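/- **Geometric data.** Let a group $\Gamma$ act by isometries on a Hadamard space $X$, and let $\mathcal V$ be the vertex set of a $\Gamma$-tree, with stabilizers $\Gamma_v$ and an equivariant family of free abelian subgroups $\Lambda_v\trianglelefteq\Gamma_v$ of rank $n$. For $g\in\Gamma$ let $\mathrm{Min}_X(g)$ be the set of points at which $x\mapsto d(gx,x)$ attains its infimum, and $\mathrm{Min}_X(\Lambda_v)=\bigcap_{\zeta\in\Lambda_v}\mathrm{Min}_X(\zeta)$. It splits as a metric product $\overline Y_v\times\mathbb E^n$ such that every $\gamma$ in the normalizer of $\Lambda_v$ acts as a product $(\overline\gamma,\gamma_{\mathbb E})$, $\Lambda_v$ acts trivially on $\overline Y_v$ and as a lattice of translations on $\mathbb E^n$, and $\gamma_{\mathbb E}$ is a translation if $\gamma$ lies in the centralizer $C_\Gamma(\Lambda_v)$. Define $\mathrm{MLS}_v:\Gamma_v\to\mathbb R_{\ge0}$ by $\mathrm{MLS}_v(\gamma)=\inf_{y\in\overline Y_v}d(\overline\gamma y,y)$. Choose, equivariantly in $v$, free generators $\zeta_{v,1},\dots,\zeta_{v,n}$ of $\Lambda_v$, and define the homomorphism $T_v:C_\Gamma(\Lambda_v)\to\mathbb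 R^n$ that maps $\gamma$ to the coordinates of the translation vector of $\gamma_{\mathbb E}$ in the basis of the translation vectors of $\zeta_{v,1},\dots,\zeta_{v,n}$. The families $(\mathrm{MLS}_v)_v$, $(T_v)_v$ are the *generalized geometric data* of the action. The data of two actions of $\Gamma$ (with the same tree, subgroups $\Lambda_v$ and generators) are *equivalent* if for each $v$ there is $\lambda(v)>0$ with $\mathrm{MLS}'_v=\lambda(v)\,\mathrm{MLS}_v$, and $T'_v=T_v$. **The spaces.** For $\varepsilon\ge0$ put $\varepsilon_2=\varepsilon_3=\varepsilon$ and $\varepsilon_0=\varepsilon_1=\varepsilon_x=0$. Let $E_x$ and $E_i^\pm$ ($i=0,1,2,3$) be the nine thickened flat tori $(\mathbb R^3/L)\times[0,\varepsilon_\bullet]$ with coordinates $(r,s,t;u)$ and lattices $L=(\sqrt2\,\mathbb Z)^3$ for $E_x$, $L=\mathbb Z^2\times\sqrt2\,\mathbb Z$ for $i=0,1$, and $L=(\tfrac1{\sqrt2}\mathbb Z)^2\times\sqrt2\,\mathbb Z$ for $i=2,3$. Let $C_x^\pm$ and $C_i^\pm$ ($i=0,1,2,3$) be ten flat cylinders $(\mathbb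 R/p\mathbb Z\times\mathbb R/\sqrt2\,\mathbb Z)\times[0,1]$ with arclength coordinates $(s,t;u)$, where $p=\sqrt2$ for $C_x^\pm$ and $C_0^\pm$, $p=1$ for $C_1^\pm$ and $C_3^\pm$, and $p=\tfrac1{\sqrt2}$ for $C_2^\pm$. Let $Y_\varepsilon$ be the quotient of the disjoint union of these pieces by the equivalence relation generated, for all $s,t\in\mathbb R$ and, in the first four lines, for both signs, by $$\begin{aligned} (\tfrac s{\sqrt2},-\tfrac s{\sqrt2},t;0)_{E_0^\pm}&\sim(s,t;0)_{C_0^\pm}, & (s,t;1)_{C_0^\pm}&\sim(\tfrac s{\sqrt2},-\tfrac s{\sqrt2},t;0)_{E_1^\pm},\\ (s,0,t;0)_{E_1^\pm}&\sim(s,t;0)_{C_1^\pm}, & (s,t;1)_{C_1^\pm}&\sim(\tfrac s{\sqrt2},\tfrac s{\sqrt2},t;0)_{E_2^\pm},\\ (0,s,t;\varepsilon)_{E_2^\pm}&\sim(s,t;0)_{C_2^\pm}, & (s,t;1)_{C_2^\pm}&\sim(0,s,t;\varepsilon)_{E_3^\pm},\\ (\tfrac s{\sqrt2},\tfrac s{\sqrt2},t;0)_{E_3^\pm}&\sim(s,t;0)_{C_3^\pm},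 & (s,t;1)_{C_3^\pm}&\sim(s,0,t;0)_{E_0^\pm},\\ (\tfrac s{\sqrt2},-\tfrac s{\sqrt2},t;0)_{E_0^-}&\sim(s,t;0)_{C_x^-}, & (s,t;1)_{C_x^-}&\sim(s,0,t;0)_{E_x},\\ (s,t,0;0)_{E_x}&\sim(s,t;0)_{C_x^+}, & (s,t;1)_{C_x^+}&\sim(-\tfrac s{\sqrt2},\tfrac s{\sqrt2},t;0)_{E_0^+}, \end{aligned}$$ endowed with the induced length metric, and let $X_\varepsilon$ be its universal cover with the lifted length metric. Let $\Gamma=\pi_1(Y_0)$, acting on $X_0$ by deck transformations. It acts on $X_\varepsilon$ by deck transformations through the isomorphism $\pi_1(Y_0)\to\pi_1(Y_\varepsilon)$ induced by the homotopy equivalence $Y_0\to Y_\varepsilon$ that maps the tori to the fibres $u=0$ and stretches the interval factors of $C_2^\pm$ by $1+2\varepsilon$ (so that they cross $E_2^\pm$, $C_2^\pm$ and $E_3^\pm$). The subspaces $V_0^\pm=E_0^\pm\cup C_0^\pm\cup E_1^\pm\cup C_x^\pm\cup E_x$ and $V_i^\pm=E_i^\pm\cup C_i^\pm\cup E_{i+1}^\pm$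 ($i=1,2,3$; $E_4^\pm=E_0^\pm$) of $Y_0$ are the vertices of a graph of groups decomposition of $\Gamma$, with vertex groups $\pi_1(V_i^\pm)$. Let $\mathcal V$ be the vertex set of its Bass–Serre tree, i.e. the disjoint union of the coset spaces $\Gamma/\pi_1(V_i^\pm)$ (where $\pi_1(V_i^\pm)$ is regarded as a subgroup of $\Gamma$ by means of any path from the base point of $Y_0$ to $V_i^\pm$), and let $\Lambda_v$ be the center of $\Gamma_v$. **Proposition 8.** The groups $\Lambda_v$ are free abelian of rank $2$ and admit equivariant choices of free generators. For every $\varepsilon>0$ and every such choice, the generalized geometric data of the $\Gamma$-actions on $X_0$ and on $X_\varepsilon$ exist and are equivalent: for every $v\in\mathcal V$ there is $\lambda(v)>0$ such that $\mathrm{MLS}_v^{X_\varepsilon}=\lambda(v)\,\mathrm{MLS}_v^{X_0}$, and $T_v^{X_\varepsilon}=T_v^{X_0}$. -/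

import Mathlib

open scoped NNReal ENNReal

noncomputable section

/-! ## Minimal displacement sets and generalized geometric data -/

section GeometricData

variable {Γ X : Type} [Group Γ] [PseudoEMetricSpace X]

/-- `Min_X(g)`: the points at which the displacement function of the isometry `g` attains its
infimum. -/
def minSet (g : X ≃ᵢ X) : Set X :=
  {x | edist (g x) x = ⨅ y, edist (g y) y}

/-- `Min_X(Λ) = ⋂_{ζ ∈ Λ} Min_X(ζ)` for an isometric action `ρ` and a subgroup `Λ`. -/
def groupMinSet (ρ : Γ →* (X ≃ᵢ X)) (Λ : Subgroup Γ) : Set X :=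
  {x | ∀ ζ ∈ Λ, x ∈ minSet (ρ ζ)}

/-- A splitting `Min_X(Λ) ≅ Ȳ × 𝔼ⁿ` as a metric (Euclidean) product, compatible with the action of
the normalizer of `Λ`: every `γ` that normalizes `Λ` acts as a product `(γ̄, γ_𝔼)`, elements of the
centralizer act on `𝔼ⁿ` by translations, and `Λ` acts trivially on `Ȳ` and on `𝔼ⁿ` by translations
along vectors that span `𝔼ⁿ`. -/
structure FlatSplitting (ρ : Γ →* (X ≃ᵢ X)) (Λ : Subgroup Γ) (n : ℕ) where
  /-- the non-Euclidean factor `Ȳ` -/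
  Ybar : Type
  [metricYbar : MetricSpace Ybar]
  [nonemptyYbar : Nonempty Ybar]
  /-- product coordinates on the minimal displacement set -/
  coord : groupMinSet ρ Λ ≃ᵢ WithLp 2 (Ybar × EuclideanSpace ℝ (Fin n))
  /-- the isometry `γ̄` -/
  bar : Subgroup.normalizer (Λ : Set Γ) → (Ybar ≃ᵢ Ybar)
  /-- the isometry `γ_𝔼` -/
  euc : Subgroup.normalizer (Λ : Set Γ) →
    (EuclideanSpace ℝ (Fin n) ≃ᵢ EuclideanSpace ℝ (Fin n))
  coord_act : ∀ (γ : Subgroup.normalizer (Λ : Set Γ)) (x y : groupMinSet ρ Λ),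
    (y : X) = ρ (γ : Γ) (x : X) →
      coord y = WithLp.toLp 2 (bar γ (coord x).fst, euc γ (coord x).snd)
  euc_centralizer : ∀ γ : Subgroup.normalizer (Λ : Set Γ),
    (γ : Γ) ∈ Subgroup.centralizer (Λ : Set Γ) → ∀ w, euc γ w = w + euc γ 0
  bar_lattice : ∀ γ : Subgroup.normalizer (Λ : Set Γ), (γ : Γ) ∈ Λ → ∀ y, bar γ y = y
  euc_lattice : ∀ γ : Subgroup.normalizer (Λ : Set Γ), (γ : Γ) ∈ Λ → ∀ w, euc γ w = w + euc γ 0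
  span_lattice : Submodule.span ℝ
    {τ | ∃ γ : Subgroup.normalizer (Λ : Set Γ), (γ : Γ) ∈ Λ ∧ euc γ 0 = τ} = ⊤

attribute [instance] FlatSplitting.metricYbar FlatSplitting.nonemptyYbar

namespace FlatSplitting

variable {ρ : Γ →* (X ≃ᵢ X)} {Λ : Subgroup Γ} {n : ℕ}

/-- The translation length `|γ̄|` of `γ̄` on the non-Euclidean factor `Ȳ`. -/
def barLength (S : FlatSplitting ρ Λ n) (γ : Subgroup.normalizer (Λ : Set Γ)) : ℝ≥0 :=
  ⨅ y : S.Ybar, nndist (S.bar γ y) y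

/-- The translation vector of `γ_𝔼`, for those `γ` for which `γ_𝔼` is a translation. -/
def vec (S : FlatSplitting ρ Λ n) (γ : Subgroup.normalizer (Λ : Set Γ)) :
    EuclideanSpace ℝ (Fin n) :=
  S.euc γ 0

end FlatSplitting

/-- The vertices of a `Γ`-tree with an equivariant family of subgroups `Λ_v` of `Γ`. The
stabilizer `Γ_v` of a vertex is `MulAction.stabilizer Γ v`. -/
structure VertexSystem (Γ : Type) [Group Γ] where
  /-- the vertices -/
  Vert : Type
  [action : MulAction Γ Vert]
  /-- the subgroup `Λ_v` -/
  Lam : Vert → Subgroup Γ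
  Lam_smul : ∀ (g : Γ) (v : Vert), Lam (g • v) = (Lam v).map (MulAut.conj g).toMonoidHom

attribute [instance] VertexSystem.action

namespace VertexSystem

variable (𝒯 : VertexSystem Γ)

theorem stabilizer_le_normalizer (v : 𝒯.Vert) :
    MulAction.stabilizer Γ v ≤ Subgroup.normalizer (𝒯.Lam v : Set Γ) := by
  intro g hg
  have h := 𝒯.Lam_smul g v
  rw [MulAction.mem_stabilizer_iff.mp hg] at h
  rw [Subgroup.mem_normalizer_iff]
  intro x
  constructor
  · intro hx
    rw [h]
    exact ⟨x, hx, rfl⟩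
  · intro hx
    rw [h] at hx
    obtain ⟨y, hy, hyx⟩ := hx
    have : y = x := by simpa using hyx
    exact this ▸ hy

theorem centralizer_le_normalizer (v : 𝒯.Vert) :
    Subgroup.centralizer (𝒯.Lam v : Set Γ) ≤ Subgroup.normalizer (𝒯.Lam v : Set Γ) := by
  intro g hg
  rw [Subgroup.mem_normalizer_iff]
  have hc : ∀ x ∈ 𝒯.Lam v, g * x * g⁻¹ = x := fun x hx => by
    rw [← Subgroup.mem_centralizer_iff.mp hg x hx, mul_inv_cancel_right]
  intro x
  constructor
  · intro hx
    exact (hc x hx).symm ▸ hx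
  · intro hx
    have h1 := hc _ hx
    have : g * x * g⁻¹ = x := by
      have h2 : g * (g * x * g⁻¹) * g⁻¹ = g * x * g⁻¹ := h1
      simpa using h2
    exact this ▸ hx

/-- `ζ_v = (ζ_{v,1}, …, ζ_{v,n})` is a family of free generators of the abelian group `Λ_v`, chosen
for all vertices `v` in an equivariant way. -/
structure IsEquivariantBasis {n : ℕ} (ζ : ∀ v : 𝒯.Vert, Fin n → 𝒯.Lam v) : Prop where
  commute : ∀ v i j, Commute (ζ v i) (ζ v j)
  bijective : ∀ v, Function.Bijective
    fun k : Fin n → ℤ => (List.ofFn fun i => ζ v i ^ k i).prod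
  smul : ∀ (g : Γ) v i, (ζ (g • v) i : Γ) = g * ζ v i * g⁻¹

end VertexSystem

theorem center_stabilizer_smul {Γ V : Type} [Group Γ] [MulAction Γ V] (g : Γ) (v : V) :
    (Subgroup.center (MulAction.stabilizer Γ (g • v))).map (MulAction.stabilizer Γ (g • v)).subtype =
      ((Subgroup.center (MulAction.stabilizer Γ v)).map
        (MulAction.stabilizer Γ v).subtype).map (MulAut.conj g).toMonoidHom := by
    have key : ∀ (g : Γ) (v : V),
        ((Subgroup.center (MulAction.stabilizer Γ v)).map
          (MulAction.stabilizer Γ v).subtype).map (MulAut.conj g).toMonoidHom ≤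
        (Subgroup.center (MulAction.stabilizer Γ (g • v))).map
          (MulAction.stabilizer Γ (g • v)).subtype := by
      rintro g v _ ⟨_, ⟨x, hx, rfl⟩, rfl⟩
      have hx' := Subgroup.mem_center_iff.mp hx
      refine ⟨⟨g * x * g⁻¹, ?_⟩, ?_, rfl⟩
      · rw [MulAction.mem_stabilizer_iff, mul_smul, mul_smul, inv_smul_smul,
          MulAction.mem_stabilizer_iff.mp x.2]
      · refine Subgroup.mem_center_iff.mpr fun y => Subtype.ext ?_
        have hy : g⁻¹ * y * g ∈ MulAction.stabilizer Γ v := by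
          rw [MulAction.mem_stabilizer_iff, mul_smul, mul_smul,
            MulAction.mem_stabilizer_iff.mp y.2, inv_smul_smul]
        have := congrArg Subtype.val (hx' ⟨_, hy⟩)
        have h2 : (g⁻¹ * y * g) * x = x * (g⁻¹ * y * g) := this
        change (y : Γ) * (g * x * g⁻¹) = (g * x * g⁻¹) * y
        calc (y : Γ) * (g * x * g⁻¹) = g * ((g⁻¹ * y * g) * x) * g⁻¹ := by group
          _ = g * (x * (g⁻¹ * y * g)) * g⁻¹ := by rw [h2]
          _ = (g * x * g⁻¹) * y := by group
    refine le_antisymm ?_ (key g v)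
    intro z hz
    have h1 := key g⁻¹ (g • v)
    rw [inv_smul_smul] at h1
    have h2 := h1 ⟨z, hz, rfl⟩
    refine ⟨_, h2, ?_⟩
    simp [mul_assoc]

/-- A pair of families `MLS_v : Γ_v → ℝ≥0` and `T_v : C_Γ(Λ_v) → ℝⁿ` (a homomorphism) indexed by
the vertices. -/
structure GeometricData (𝒯 : VertexSystem Γ) (n : ℕ) where
  /-- the functions `MLS_v` -/
  MLS : ∀ v : 𝒯.Vert, MulAction.stabilizer Γ v → ℝ≥0
  /-- the homomorphisms `T_v` -/
  T : ∀ v : 𝒯.Vert,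
    Subgroup.centralizer (𝒯.Lam v : Set Γ) →* Multiplicative (Fin n → ℝ)

/-- `D` is the generalized geometric data of the action `ρ` with respect to the equivariant choice
`ζ` of generators: `MLS_v(γ)` is the translation length of `γ̄` on the non-Euclidean factor of
`Min_X(Λ_v)`, and `T_v(γ)` is the vector of coordinates of the translation vector of `γ_𝔼` with
respect to the basis of the translation vectors of `ζ_{v,1}, …, ζ_{v,n}`. -/
def GeometricData.IsDataOf {𝒯 : VertexSystem Γ} {n : ℕ} (D : GeometricData 𝒯 n)
    (ρ : Γ →* (X ≃ᵢ X)) (ζ : ∀ v : 𝒯.Vert, Fin n → 𝒯.Lam v) : Prop :=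
  ∀ v : 𝒯.Vert, ∃ S : FlatSplitting ρ (𝒯.Lam v) n,
    (∀ γ : MulAction.stabilizer Γ v,
      D.MLS v γ = S.barLength ⟨γ, 𝒯.stabilizer_le_normalizer v γ.2⟩) ∧
    (∀ γ : Subgroup.centralizer (𝒯.Lam v : Set Γ),
      S.vec ⟨γ, 𝒯.centralizer_le_normalizer v γ.2⟩ =
        ∑ i, (Multiplicative.toAdd (D.T v γ)) i • S.vec ⟨ζ v i, Subgroup.le_normalizer (ζ v i).2⟩)

/-- Equivalence of geometric data: `MLS'_v = λ(v) MLS_v` with `λ(v) > 0`, and `T'_v = T_v`. -/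
def GeometricData.Equivalent {𝒯 : VertexSystem Γ} {n : ℕ} (D D' : GeometricData 𝒯 n) : Prop :=
  ∀ v : 𝒯.Vert, (∃ c : ℝ≥0, 0 < c ∧ ∀ γ, D'.MLS v γ = c * D.MLS v γ) ∧ D'.T v = D.T v

end GeometricData

/-! ## The universal cover of a length space -/

/-- The length of a path. -/
def pathLength {Z : Type} [PseudoEMetricSpace Z] {x y : Z} (c : Path x y) : ℝ≥0∞ :=
  eVariationOn (fun t : unitInterval => c t) Set.univ

section PathLength

variable {Z : Type} [PseudoEMetricSpace Z]

theorem pathLength_refl (x : Z) : pathLength (Path.refl x) = 0 := by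
  apply eVariationOn.constant_on
  rintro _ ⟨a, -, rfl⟩ _ ⟨b, -, rfl⟩
  rfl

theorem pathLength_symm_le {x y : Z} (c : Path x y) : pathLength c.symm ≤ pathLength c := by
  have := eVariationOn.comp_le_of_antitoneOn (fun t : unitInterval => c t) (s := Set.univ) (t := Set.univ)
    unitInterval.symm (fun a _ b _ h => by simpa using h) (fun _ _ => Set.mem_univ _)
  exact this

theorem pathLength_trans_le {x y z : Z} (c : Path x y) (d : Path y z) :
    pathLength (c.trans d) ≤ pathLength c + pathLength d := by
  let h : unitInterval := ⟨1 / 2, by norm_num, by norm_num⟩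
  have h1 : (Set.univ : Set unitInterval) = Set.Iic h ∪ Set.Ici h := by
    ext t; simp
  have hG : IsGreatest (Set.Iic h) h := isGreatest_Iic
  have hL : IsLeast (Set.Ici h) h := isLeast_Ici
  have h2 : pathLength (c.trans d) =
      eVariationOn (fun t : unitInterval => (c.trans d) t) (Set.Iic h) +
        eVariationOn (fun t : unitInterval => (c.trans d) t) (Set.Ici h) := by
    rw [pathLength, h1, eVariationOn.union _ hG hL]
  rw [h2]
  refine add_le_add ?_ ?_
  · let φ : unitInterval → unitInterval := fun t => Set.projIcc (0 : ℝ) 1 zero_le_one (2 * (t : ℝ))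
    have e : Set.EqOn (fun t : unitInterval => (c.trans d) t) ((fun t : unitInterval => c t) ∘ φ) (Set.Iic h) := by
      intro t ht
      have ht' : (t : ℝ) ≤ 1 / 2 := ht
      simp only [Path.trans_apply, dif_pos ht', Function.comp_apply]
      congr 1
      refine Subtype.ext ?_
      simp only [φ]
      rw [Set.projIcc_of_mem zero_le_one ⟨by linarith [t.2.1], by linarith⟩]
    rw [eVariationOn.congr e]
    refine (eVariationOn.comp_le_of_monotoneOn _ φ ?_ (fun _ _ => Set.mem_univ _))
    intro a _ b _ hab
    exact Set.monotone_projIcc _ (by have : (a : ℝ) ≤ b := hab; linarith)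
  · let φ : unitInterval → unitInterval := fun t => Set.projIcc (0 : ℝ) 1 zero_le_one (2 * (t : ℝ) - 1)
    have e : Set.EqOn (fun t : unitInterval => (c.trans d) t) ((fun t : unitInterval => d t) ∘ φ) (Set.Ici h) := by
      intro t ht
      have ht' : 1 / 2 ≤ (t : ℝ) := ht
      rcases ht'.lt_or_eq with hlt | heq
      · simp only [Path.trans_apply, dif_neg (not_le.mpr hlt), Function.comp_apply]
        congr 1
        refine Subtype.ext ?_
        simp only [φ]
        rw [Set.projIcc_of_mem zero_le_one ⟨by linarith, by linarith [t.2.2]⟩]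
      · have h0 : φ t = 0 := by
          simp only [φ, ← heq]
          norm_num
        simp only [Path.trans_apply, dif_pos heq.symm.le, Function.comp_apply, h0, d.source]
        have : (⟨2 * (t : ℝ), (unitInterval.mul_pos_mem_iff zero_lt_two).2 ⟨t.2.1, heq.symm.le⟩⟩ :
            unitInterval)
            = 1 := by
          refine Subtype.ext ?_
          simp [← heq]
        rw [this, c.target]
    rw [eVariationOn.congr e]
    refine (eVariationOn.comp_le_of_monotoneOn _ φ ?_ (fun _ _ => Set.mem_univ _))
    intro a _ b _ hab
    exact Set.monotone_projIcc _ (by have : (a : ℝ) ≤ b := hab; linarith)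

end PathLength

/-- The universal cover of `(Z, z₀)`, as the set of homotopy classes (relative to the endpoints) of
paths that start at `z₀`. -/
structure UniversalCover (Z : Type) [PseudoEMetricSpace Z] (z₀ : Z) where
  /-- the endpoint, i.e. the image under the covering projection -/
  pt : Z
  /-- the homotopy class -/
  cls : Path.Homotopic.Quotient z₀ pt

namespace UniversalCover

variable {Z : Type} [PseudoEMetricSpace Z] {z₀ : Z}

/-- The lifted length metric: a path in the universal cover from `[p]` to `[q]` is the lift of a path
in the class `[p]⁻¹[q]`, and has the same length. -/
instance : PseudoEMetricSpace (UniversalCover Z z₀) where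
  edist p q := ⨅ (c : Path p.pt q.pt)
    (_ : Path.Homotopic.Quotient.mk c = p.cls.symm.trans q.cls), pathLength c
  edist_self p := by
    refine le_antisymm ?_ bot_le
    refine (iInf₂_le (Path.refl p.pt) ?_).trans (pathLength_refl _).le
    let a : (⟨z₀⟩ : FundamentalGroupoid Z) ⟶ ⟨p.pt⟩ := p.cls
    change CategoryTheory.CategoryStruct.id (⟨p.pt⟩ : FundamentalGroupoid Z) =
      CategoryTheory.CategoryStruct.comp (CategoryTheory.Groupoid.inv a) a
    simp
  edist_comm := by
    have : ∀ p q : UniversalCover Z z₀,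
        (⨅ (c : Path p.pt q.pt)
          (_ : Path.Homotopic.Quotient.mk c = p.cls.symm.trans q.cls), pathLength c) ≤
        ⨅ (c : Path q.pt p.pt)
          (_ : Path.Homotopic.Quotient.mk c = q.cls.symm.trans p.cls), pathLength c := by
      intro p q
      refine le_iInf₂ fun c hc => (iInf₂_le c.symm ?_).trans (pathLength_symm_le c)
      rw [Path.Homotopic.Quotient.mk_symm, hc]
      let a : (⟨z₀⟩ : FundamentalGroupoid Z) ⟶ ⟨q.pt⟩ := q.cls
      let b : (⟨z₀⟩ : FundamentalGroupoid Z) ⟶ ⟨p.pt⟩ := p.cls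
      change CategoryTheory.Groupoid.inv (CategoryTheory.CategoryStruct.comp
        (CategoryTheory.Groupoid.inv a) b) =
        CategoryTheory.CategoryStruct.comp (CategoryTheory.Groupoid.inv b) a
      simp
    exact fun p q => le_antisymm (this p q) (this q p)
  edist_triangle p q r := by
    simp_rw [ENNReal.iInf_add, ENNReal.add_iInf]
    refine le_iInf₂ fun c hc => le_iInf₂ fun d hd =>
      (iInf₂_le (c.trans d) ?_).trans (pathLength_trans_le c d)
    rw [Path.Homotopic.Quotient.mk_trans, hc, hd]
    let a : (⟨z₀⟩ : FundamentalGroupoid Z) ⟶ ⟨p.pt⟩ := p.cls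
    let b : (⟨z₀⟩ : FundamentalGroupoid Z) ⟶ ⟨q.pt⟩ := q.cls
    let e : (⟨z₀⟩ : FundamentalGroupoid Z) ⟶ ⟨r.pt⟩ := r.cls
    change CategoryTheory.CategoryStruct.comp (CategoryTheory.CategoryStruct.comp
      (CategoryTheory.Groupoid.inv a) b) (CategoryTheory.CategoryStruct.comp
        (CategoryTheory.Groupoid.inv b) e) =
      CategoryTheory.CategoryStruct.comp (CategoryTheory.Groupoid.inv a) e
    simp

theorem edist_def (p q : UniversalCover Z z₀) :
    edist p q = ⨅ (c : Path p.pt q.pt)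
      (_ : Path.Homotopic.Quotient.mk c = p.cls.symm.trans q.cls), pathLength c := rfl

/-- A loop class acts by prepending its inverse (products in `FundamentalGroup` are
`γ * δ = δ.trans γ`, so this is a left action). -/
def deckMap (γ : FundamentalGroup Z z₀) (p : UniversalCover Z z₀) : UniversalCover Z z₀ :=
  ⟨p.pt, (FundamentalGroup.toPath γ).symm.trans p.cls⟩

theorem deckMap_one (p : UniversalCover Z z₀) :
    deckMap (1 : FundamentalGroup Z z₀) p = p := by
  obtain ⟨y, p⟩ := p
  let a : (⟨z₀⟩ : FundamentalGroupoid Z) ⟶ ⟨y⟩ := p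
  have : CategoryTheory.CategoryStruct.comp (CategoryTheory.Groupoid.inv
    (CategoryTheory.CategoryStruct.id (⟨z₀⟩ : FundamentalGroupoid Z))) a = a := by simp
  exact congrArg (UniversalCover.mk y) this

theorem deckMap_mul (γ δ : FundamentalGroup Z z₀) (p : UniversalCover Z z₀) :
    deckMap (γ * δ) p = deckMap γ (deckMap δ p) := by
  obtain ⟨y, p⟩ := p
  let a : (⟨z₀⟩ : FundamentalGroupoid Z) ⟶ ⟨y⟩ := p
  let g : (⟨z₀⟩ : FundamentalGroupoid Z) ⟶ ⟨z₀⟩ := γ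
  let d : (⟨z₀⟩ : FundamentalGroupoid Z) ⟶ ⟨z₀⟩ := δ
  have : CategoryTheory.CategoryStruct.comp (CategoryTheory.Groupoid.inv
      (CategoryTheory.CategoryStruct.comp d g)) a =
      CategoryTheory.CategoryStruct.comp (CategoryTheory.Groupoid.inv g)
        (CategoryTheory.CategoryStruct.comp (CategoryTheory.Groupoid.inv d) a) := by simp
  exact congrArg (UniversalCover.mk y) this

theorem isometry_deckMap (γ : FundamentalGroup Z z₀) :
    Isometry (deckMap γ : UniversalCover Z z₀ → UniversalCover Z z₀) := by
  intro p q
  obtain ⟨y, p⟩ := p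
  obtain ⟨z, q⟩ := q
  let a : (⟨z₀⟩ : FundamentalGroupoid Z) ⟶ ⟨y⟩ := p
  let b : (⟨z₀⟩ : FundamentalGroupoid Z) ⟶ ⟨z⟩ := q
  let g : (⟨z₀⟩ : FundamentalGroupoid Z) ⟶ ⟨z₀⟩ := γ
  have : CategoryTheory.CategoryStruct.comp (CategoryTheory.Groupoid.inv
      (CategoryTheory.CategoryStruct.comp (CategoryTheory.Groupoid.inv g) a))
      (CategoryTheory.CategoryStruct.comp (CategoryTheory.Groupoid.inv g) b) =
      CategoryTheory.CategoryStruct.comp (CategoryTheory.Groupoid.inv a) b := by simp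
  have h : ((FundamentalGroup.toPath γ).symm.trans p).symm.trans
      ((FundamentalGroup.toPath γ).symm.trans q) = p.symm.trans q := this
  rw [edist_def, edist_def]
  simp only [deckMap]
  rw [h]

/-- The action of the fundamental group on the universal cover by deck transformations. -/
def deck (Z : Type) [PseudoEMetricSpace Z] (z₀ : Z) :
    FundamentalGroup Z z₀ →* (UniversalCover Z z₀ ≃ᵢ UniversalCover Z z₀) where
  toFun γ :=
    { toFun := deckMap γ
      invFun := deckMap γ⁻¹
      left_inv := fun p => by rw [← deckMap_mul, inv_mul_cancel, deckMap_one]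
      right_inv := fun p => by rw [← deckMap_mul, mul_inv_cancel, deckMap_one]
      isometry_toFun := isometry_deckMap γ }
  map_one' := by ext p; exact deckMap_one p
  map_mul' γ δ := by ext p; exact deckMap_mul γ δ p

end UniversalCover

/-! ## The complexes `Y_ε` of nine thickened 3-tori and ten cylinders -/

namespace TorusComplex

/-- The two signs in the labels `E_i^±`, `C_i^±`, `V_i^±`. -/
inductive PM
  | plus
  | minus

/-- The nine thickened tori: `E_x` and `E_i^±`, `i = 0, 1, 2, 3`. -/
inductive Wall
  | x
  | e (σ : PM) (i : Fin 4)

/-- The ten cylinders: `C_x^±` and `C_i^±`, `i = 0, 1, 2, 3`. -/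
inductive Cyl
  | x (σ : PM)
  | c (σ : PM) (i : Fin 4)

/-- The thickness `ε_x = ε_0 = ε_1 = 0`, `ε_2 = ε_3 = ε`. -/
def thickness (ε : ℝ≥0) : Wall → ℝ≥0
  | .x => 0
  | .e _ i => ![0, 0, ε, ε] i

/-- The common period of the coordinates `r` and `s` on a 3-torus (`t` has period `√2`). -/
def Wall.period : Wall → ℝ
  | .x => √2
  | .e _ i => ![1, 1, 1 / √2, 1 / √2] i

/-- The period of the arclength coordinate `s` on the 2-torus factor of a cylinder (`t` has period
`√2`): the length of the closed geodesics in the directions along which it is glued. -/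
def Cyl.period : Cyl → ℝ
  | .x _ => √2
  | .c _ i => ![√2, 1, 1 / √2, 1] i

/-- The disjoint union of the pieces `ℝ³ × [0, ε_E]` and `ℝ² × [0, 1]`, in coordinates
`(r, s, t; u)` and `(s, t; u)`. -/
inductive Pre (ε : ℝ≥0)
  | wall (E : Wall) (r s t : ℝ) (u : Set.Icc (0 : ℝ) (thickness ε E))
  | cyl (C : Cyl) (s t : ℝ) (u : Set.Icc (0 : ℝ) 1)

/-- The coordinate `u = 0`. -/
def lo (ε : ℝ≥0) (E : Wall) : Set.Icc (0 : ℝ) (thickness ε E) :=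
  ⟨0, le_rfl, (thickness ε E).2⟩

/-- The coordinate `u = ε_E`. -/
def hi (ε : ℝ≥0) (E : Wall) : Set.Icc (0 : ℝ) (thickness ε E) :=
  ⟨thickness ε E, (thickness ε E).2, le_rfl⟩

open Pre PM in
/-- The identifications: the lattices of the flat tori and of the cylinders, and the gluing of the
boundary tori of the cylinders, all coordinates of the cylinders being arclength coordinates. -/
inductive Glue (ε : ℝ≥0) : Pre ε → Pre ε → Prop
  | wallLattice (E r s t u) (k l m : ℤ) : Glue ε (wall E r s t u)
      (wall E (r + k * E.period) (s + l * E.period) (t + m * √2) u)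
  | cylLattice (C s t u) (k l : ℤ) : Glue ε (cyl C s t u)
      (cyl C (s + k * C.period) (t + l * √2) u)
  | c0_0 (σ s t) : Glue ε (wall (.e σ 0) (s / √2) (-s / √2) t (lo ε _)) (cyl (.c σ 0) s t 0)
  | c0_1 (σ s t) : Glue ε (cyl (.c σ 0) s t 1) (wall (.e σ 1) (s / √2) (-s / √2) t (lo ε _))
  | c1_0 (σ s t) : Glue ε (wall (.e σ 1) s 0 t (lo ε _)) (cyl (.c σ 1) s t 0)
  | c1_1 (σ s t) : Glue ε (cyl (.c σ 1) s t 1) (wall (.e σ 2) (s / √2) (s / √2) t (lo ε _))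
  | c2_0 (σ s t) : Glue ε (wall (.e σ 2) 0 s t (hi ε _)) (cyl (.c σ 2) s t 0)
  | c2_1 (σ s t) : Glue ε (cyl (.c σ 2) s t 1) (wall (.e σ 3) 0 s t (hi ε _))
  | c3_0 (σ s t) : Glue ε (wall (.e σ 3) (s / √2) (s / √2) t (lo ε _)) (cyl (.c σ 3) s t 0)
  | c3_1 (σ s t) : Glue ε (cyl (.c σ 3) s t 1) (wall (.e σ 0) s 0 t (lo ε _))
  | xm_0 (s t) : Glue ε (wall (.e minus 0) (s / √2) (-s / √2) t (lo ε _)) (cyl (.x minus) s t 0)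
  | xm_1 (s t) : Glue ε (cyl (.x minus) s t 1) (wall .x s 0 t (lo ε _))
  | xp_0 (s t) : Glue ε (wall .x s t 0 (lo ε _)) (cyl (.x plus) s t 0)
  | xp_1 (s t) : Glue ε (cyl (.x plus) s t 1) (wall (.e plus 0) (-s / √2) (s / √2) t (lo ε _))

/-- The space `Y_ε`: the quotient of the pieces by the equivalence relation generated by `Glue`. -/
def Y (ε : ℝ≥0) : Type := Quot (Glue ε)

/-- The quotient map onto `Y_ε`. -/
def Y.mk {ε : ℝ≥0} (x : Pre ε) : Y ε := Quot.mk _ x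

/-- `Seg x y d`: the points `x` and `y` lie in the same piece, at Euclidean distance `d`. -/
inductive Seg {ε : ℝ≥0} : Pre ε → Pre ε → ℝ → Prop
  | wall (E r s t u r' s' t' u') : Seg (.wall E r s t u) (.wall E r' s' t' u')
      √((r - r') ^ 2 + (s - s') ^ 2 + (t - t') ^ 2 + ((u : ℝ) - u') ^ 2)
  | cyl (C s t u s' t' u') : Seg (.cyl C s t u) (.cyl C s' t' u')
      √((s - s') ^ 2 + (t - t') ^ 2 + ((u : ℝ) - u') ^ 2)

/-- `Chain a b c`: the points `a` and `b` of `Y_ε` are joined by a broken line of finitely many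
straight segments in the pieces, of total length `c`. -/
inductive Chain {ε : ℝ≥0} : Y ε → Y ε → ℝ≥0∞ → Prop
  | nil (a) : Chain a a 0
  | cons {x y d b c} : Seg x y d → Chain (Y.mk y) b c →
      Chain (Y.mk x) b (ENNReal.ofReal d + c)

theorem Seg.symm {ε : ℝ≥0} {x y : Pre ε} {d : ℝ} (h : Seg x y d) : Seg y x d := by
  cases h with
  | wall E r s t u r' s' t' u' =>
    have := Seg.wall E r' s' t' u' r s t u
    rwa [sub_sq_comm r', sub_sq_comm s', sub_sq_comm t', sub_sq_comm (u' : ℝ)] at this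
  | cyl C s t u s' t' u' =>
    have := Seg.cyl (ε := ε) C s' t' u' s t u
    rwa [sub_sq_comm s', sub_sq_comm t', sub_sq_comm (u' : ℝ)] at this

theorem Chain.trans {ε : ℝ≥0} {a b e : Y ε} {c c' : ℝ≥0∞} (h : Chain a b c) (h' : Chain b e c') :
    Chain a e (c + c') := by
  induction h with
  | nil a => simpa using h'
  | cons hs _ ih => rw [add_assoc]; exact .cons hs (ih h')

theorem Chain.symm {ε : ℝ≥0} {a b : Y ε} {c : ℝ≥0∞} (h : Chain a b c) : Chain b a c := by
  induction h with
  | nil a => exact .nil a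
  | cons hs _ ih =>
    have := ih.trans (.cons hs.symm (.nil _))
    rwa [add_zero, add_comm] at this

/-- The induced length metric on `Y_ε`: the infimum of the lengths of broken lines. -/
instance (ε : ℝ≥0) : PseudoEMetricSpace (Y ε) where
  edist a b := ⨅ (c : ℝ≥0∞) (_ : Chain a b c), c
  edist_self a := le_antisymm (iInf₂_le 0 (.nil a)) bot_le
  edist_comm a b := le_antisymm (le_iInf₂ fun c h => iInf₂_le c h.symm)
    (le_iInf₂ fun c h => iInf₂_le c h.symm)
  edist_triangle a b e := by
    simp_rw [ENNReal.iInf_add, ENNReal.add_iInf]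
    exact le_iInf₂ fun c h => le_iInf₂ fun c' h' => iInf₂_le (c + c') (h.trans h')

theorem edist_def {ε : ℝ≥0} (a b : Y ε) : edist a b = ⨅ (c : ℝ≥0∞) (_ : Chain a b c), c := rfl

theorem edist_le_of_seg {ε : ℝ≥0} {x y : Pre ε} {d : ℝ} (h : Seg x y d) :
    edist (Y.mk x) (Y.mk y) ≤ ENNReal.ofReal d := by
  have := Chain.cons h (.nil (Y.mk y))
  rw [add_zero] at this
  exact iInf₂_le _ this

/-- The base point of `Y_ε`, the origin of the torus `E_x`. -/
def base (ε : ℝ≥0) : Y ε := Y.mk (.wall .x 0 0 0 (lo ε _))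

/-! ### The homotopy equivalence `Y_0 → Y_ε` -/

theorem thickness_two (ε : ℝ≥0) (σ : PM) : thickness ε (.e σ 2) = ε := rfl
theorem thickness_three (ε : ℝ≥0) (σ : PM) : thickness ε (.e σ 3) = ε := rfl

/-- The point of `[0, ε_E]` closest to `w`. -/
def clampWall (ε : ℝ≥0) (E : Wall) (w : ℝ) : Set.Icc (0 : ℝ) (thickness ε E) :=
  Set.projIcc 0 _ (thickness ε E).2 w

/-- The point of `[0, 1]` closest to `w`. -/
def clampCyl (w : ℝ) : Set.Icc (0 : ℝ) 1 := Set.projIcc 0 1 zero_le_one w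

/-- For fixed `(s, t)`, the segment `0 ≤ w ≤ 1 + 2ε` of `Y_ε` that crosses `E_2^±` from `u = 0` to
`u = ε`, then `C_2^±`, and then `E_3^±` from `u = ε` to `u = 0`. -/
def cross (ε : ℝ≥0) (σ : PM) (s t w : ℝ) : Y ε :=
  if w ≤ ε then Y.mk (.wall (.e σ 2) 0 s t (clampWall ε _ w))
  else if w ≤ 1 + ε then Y.mk (.cyl (.c σ 2) s t (clampCyl (w - ε)))
  else Y.mk (.wall (.e σ 3) 0 s t (clampWall ε _ (1 + 2 * ε - w)))

/-- The map `Y_0 → Y_ε` on the pieces: the interval factors of the cylinders `C_2^±` are stretched by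
the factor `1 + 2ε`, the tori are mapped to the fibres `u = 0`. -/
def preMarking (ε : ℝ≥0) : Pre 0 → Y ε
  | .wall E r s t _ => Y.mk (.wall E r s t (lo ε E))
  | .cyl (.x σ) s t u => Y.mk (.cyl (.x σ) s t u)
  | .cyl (.c σ i) s t u =>
      if i = 2 then cross ε σ s t ((1 + 2 * ε) * u) else Y.mk (.cyl (.c σ i) s t u)

theorem clampWall_zero (ε : ℝ≥0) (E : Wall) : clampWall ε E 0 = lo ε E :=
  Set.projIcc_left (h := (thickness ε E).2)

theorem clampWall_hi (ε : ℝ≥0) (E : Wall) : clampWall ε E (thickness ε E) = hi ε E :=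
  Set.projIcc_right (h := (thickness ε E).2)

theorem clampCyl_zero : clampCyl 0 = 0 := Set.projIcc_left (h := zero_le_one)

theorem clampCyl_one : clampCyl 1 = 1 := Set.projIcc_right (h := zero_le_one)

theorem cross_mid {ε : ℝ≥0} (σ : PM) (s t : ℝ) {w : ℝ} (h1 : ε ≤ w) (h2 : w ≤ 1 + ε) :
    cross ε σ s t w = Y.mk (.cyl (.c σ 2) s t (clampCyl (w - ε))) := by
  rcases h1.lt_or_eq with h | h
  · simp [cross, not_le.mpr h, h2]
  · subst h
    have e : clampWall ε (.e σ 2) ε = hi ε (.e σ 2) := clampWall_hi ε (.e σ 2)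
    rw [cross, if_pos le_rfl, sub_self, clampCyl_zero, e]
    exact Quot.sound (.c2_0 σ s t)

theorem cross_top {ε : ℝ≥0} (σ : PM) (s t : ℝ) {w : ℝ} (h : 1 + ε ≤ w) :
    cross ε σ s t w = Y.mk (.wall (.e σ 3) 0 s t (clampWall ε _ (1 + 2 * ε - w))) := by
  rcases h.lt_or_eq with h | h
  · have h' : ¬ w ≤ ε := by linarith
    simp [cross, not_le.mpr h, h']
  · subst h
    have e : clampWall ε (.e σ 3) (1 + 2 * ε - (1 + ε)) = hi ε (.e σ 3) := by
      rw [← clampWall_hi]; congr 1; rw [thickness_three]; ring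
    rw [cross_mid σ s t (by linarith) le_rfl, e, add_sub_cancel_right, clampCyl_one]
    exact Quot.sound (.c2_1 σ s t)

theorem preMarking_glue (ε : ℝ≥0) (x y : Pre 0) (h : Glue 0 x y) :
    preMarking ε x = preMarking ε y := by
  cases h with
  | wallLattice E r s t u k l m => exact Quot.sound (.wallLattice E r s t _ k l m)
  | cylLattice C s t u k l =>
    cases C with
    | x σ => exact Quot.sound (.cylLattice (.x σ) s t u k l)
    | c σ i =>
      by_cases hi : i = 2
      · subst hi
        simp only [preMarking, if_true, cross]
        have hp : (Cyl.c σ 2).period = (Wall.e σ 2).period := rfl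
        have hp' : (Cyl.c σ 2).period = (Wall.e σ 3).period := rfl
        split_ifs
        · have := Glue.wallLattice (ε := ε) (.e σ 2) 0 s t
            (clampWall ε _ ((1 + 2 * ε) * u)) 0 k l
          rw [Int.cast_zero, zero_mul, add_zero, ← hp] at this
          exact Quot.sound this
        · exact Quot.sound (.cylLattice _ s t _ k l)
        · have := Glue.wallLattice (ε := ε) (.e σ 3) 0 s t
            (clampWall ε _ (1 + 2 * ε - (1 + 2 * ε) * u)) 0 k l
          rw [Int.cast_zero, zero_mul, add_zero, ← hp'] at this
          exact Quot.sound this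
      · simp only [preMarking, if_neg hi]
        exact Quot.sound (.cylLattice _ s t u k l)
  | c0_0 σ s t => exact Quot.sound (.c0_0 σ s t)
  | c0_1 σ s t => exact Quot.sound (.c0_1 σ s t)
  | c1_0 σ s t => exact Quot.sound (.c1_0 σ s t)
  | c1_1 σ s t => exact Quot.sound (.c1_1 σ s t)
  | c2_0 σ s t =>
    have : preMarking ε (.cyl (.c σ 2) s t 0) = cross ε σ s t 0 := by
      simp [preMarking]
    rw [this, cross, if_pos ε.coe_nonneg, clampWall_zero]
    rfl
  | c2_1 σ s t =>
    have : preMarking ε (.cyl (.c σ 2) s t 1) = cross ε σ s t (1 + 2 * ε) := by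
      simp [preMarking]
    rw [this, cross_top σ s t (by linarith [ε.2]), sub_self, clampWall_zero]
    rfl
  | c3_0 σ s t => exact Quot.sound (.c3_0 σ s t)
  | c3_1 σ s t => exact Quot.sound (.c3_1 σ s t)
  | xm_0 s t => exact Quot.sound (.xm_0 s t)
  | xm_1 s t => exact Quot.sound (.xm_1 s t)
  | xp_0 s t => exact Quot.sound (.xp_0 s t)
  | xp_1 s t => exact Quot.sound (.xp_1 s t)

/-- The map underlying the homotopy equivalence `Y_0 → Y_ε`. -/
def markingFun (ε : ℝ≥0) : Y 0 → Y ε := Quot.lift (preMarking ε) (preMarking_glue ε)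

theorem abs_clampWall_le (ε : ℝ≥0) (E : Wall) (w w' : ℝ) :
    |((clampWall ε E w : ℝ) - clampWall ε E w')| ≤ |w - w'| :=
  Set.abs_projIcc_sub_projIcc (thickness ε E).2

theorem abs_clampCyl_le (w w' : ℝ) : |((clampCyl w : ℝ) - clampCyl w')| ≤ |w - w'| :=
  Set.abs_projIcc_sub_projIcc zero_le_one

theorem edist_cross_vert_aux (ε : ℝ≥0) (σ : PM) (s t : ℝ) {w w' : ℝ}
    (h : (w ≤ ε ∧ w' ≤ ε) ∨ ((ε ≤ w ∧ w ≤ 1 + ε) ∧ (ε ≤ w' ∧ w' ≤ 1 + ε)) ∨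
      (1 + ε ≤ w ∧ 1 + ε ≤ w')) :
    edist (cross ε σ s t w) (cross ε σ s t w') ≤ ENNReal.ofReal |w - w'| := by
  rcases h with ⟨h, h'⟩ | ⟨⟨h1, h2⟩, h1', h2'⟩ | ⟨h, h'⟩
  · rw [cross, cross, if_pos h, if_pos h']
    refine (edist_le_of_seg (Seg.wall _ _ _ _ _ _ _ _ _)).trans (ENNReal.ofReal_le_ofReal ?_)
    simp only [sub_self, ne_eq, OfNat.ofNat_ne_zero, not_false_eq_true, zero_pow, add_zero,
      zero_add, Real.sqrt_sq_eq_abs]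
    exact abs_clampWall_le _ _ _ _
  · rw [cross_mid σ s t h1 h2, cross_mid σ s t h1' h2']
    refine (edist_le_of_seg (Seg.cyl _ _ _ _ _ _ _)).trans (ENNReal.ofReal_le_ofReal ?_)
    simp only [sub_self, ne_eq, OfNat.ofNat_ne_zero, not_false_eq_true, zero_pow, add_zero,
      zero_add, Real.sqrt_sq_eq_abs]
    refine (abs_clampCyl_le _ _).trans (le_of_eq ?_)
    congr 1; ring
  · rw [cross_top σ s t h, cross_top σ s t h']
    refine (edist_le_of_seg (Seg.wall _ _ _ _ _ _ _ _ _)).trans (ENNReal.ofReal_le_ofReal ?_)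
    simp only [sub_self, ne_eq, OfNat.ofNat_ne_zero, not_false_eq_true, zero_pow, add_zero,
      zero_add, Real.sqrt_sq_eq_abs]
    refine (abs_clampWall_le _ _ _ _).trans (le_of_eq ?_)
    rw [abs_sub_comm w w']; congr 1; ring

theorem edist_cross_vert (ε : ℝ≥0) (σ : PM) (s t w w' : ℝ) :
    edist (cross ε σ s t w) (cross ε σ s t w') ≤ ENNReal.ofReal |w - w'| := by
  wlog hw : w ≤ w' generalizing w w'
  · rw [edist_comm, abs_sub_comm]; exact this w' w (le_of_not_ge hw)
  have split : ∀ a b c : ℝ, a ≤ b → b ≤ c →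
      edist (cross ε σ s t a) (cross ε σ s t b) ≤ ENNReal.ofReal |a - b| →
      edist (cross ε σ s t b) (cross ε σ s t c) ≤ ENNReal.ofReal |b - c| →
      edist (cross ε σ s t a) (cross ε σ s t c) ≤ ENNReal.ofReal |a - c| := by
    intro a b c hab hbc h1 h2
    refine (edist_triangle _ (cross ε σ s t b) _).trans ((add_le_add h1 h2).trans ?_)
    rw [← ENNReal.ofReal_add (abs_nonneg _) (abs_nonneg _), abs_of_nonpos (by linarith),
      abs_of_nonpos (by linarith), abs_of_nonpos (by linarith)]
    exact ENNReal.ofReal_le_ofReal (by linarith)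
  have up : ∀ a b : ℝ, (ε : ℝ) ≤ a → a ≤ b →
      edist (cross ε σ s t a) (cross ε σ s t b) ≤ ENNReal.ofReal |a - b| := by
    intro a b ha hab
    rcases le_total b (1 + ε) with hb | hb
    · exact edist_cross_vert_aux ε σ s t (.inr (.inl ⟨⟨ha, hab.trans hb⟩, ha.trans hab, hb⟩))
    · rcases le_total a (1 + ε) with ha' | ha'
      · exact split a (1 + ε) b ha' hb
          (edist_cross_vert_aux ε σ s t (.inr (.inl ⟨⟨ha, ha'⟩, ha.trans ha', le_rfl⟩)))
          (edist_cross_vert_aux ε σ s t (.inr (.inr ⟨le_rfl, hb⟩)))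
      · exact edist_cross_vert_aux ε σ s t (.inr (.inr ⟨ha', hb⟩))
  rcases le_total (ε : ℝ) w with h | h
  · exact up w w' h hw
  · rcases le_total w' ε with h' | h'
    · exact edist_cross_vert_aux ε σ s t (.inl ⟨h, h'⟩)
    · exact split w ε w' h h' (edist_cross_vert_aux ε σ s t (.inl ⟨h, le_rfl⟩)) (up ε w' le_rfl h')

theorem edist_cross_horiz (ε : ℝ≥0) (σ : PM) (s t s' t' w : ℝ) :
    edist (cross ε σ s t w) (cross ε σ s' t' w) ≤
      ENNReal.ofReal √((s - s') ^ 2 + (t - t') ^ 2) := by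
  simp only [cross]
  split_ifs
  · refine (edist_le_of_seg (Seg.wall _ _ _ _ _ _ _ _ _)).trans (le_of_eq ?_)
    simp
  · refine (edist_le_of_seg (Seg.cyl _ _ _ _ _ _ _)).trans (le_of_eq ?_)
    simp
  · refine (edist_le_of_seg (Seg.wall _ _ _ _ _ _ _ _ _)).trans (le_of_eq ?_)
    simp

theorem edist_preMarking_le (ε : ℝ≥0) {x y : Pre 0} {d : ℝ} (h : Seg x y d) :
    edist (preMarking ε x) (preMarking ε y) ≤ ((2 + 2 * ε : ℝ≥0) : ℝ≥0∞) * ENNReal.ofReal d := by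
  have one : ∀ d : ℝ, ENNReal.ofReal d ≤ ((2 + 2 * ε : ℝ≥0) : ℝ≥0∞) * ENNReal.ofReal d := by
    intro d
    refine le_mul_of_one_le_left bot_le ?_
    have : (1 : ℝ≥0) ≤ 2 + 2 * ε := le_add_right one_le_two
    exact_mod_cast this
  cases h with
  | wall E r s t u r' s' t' u' =>
    refine (edist_le_of_seg (Seg.wall _ _ _ _ _ _ _ _ _)).trans (le_trans ?_ (one _))
    apply ENNReal.ofReal_le_ofReal
    apply Real.sqrt_le_sqrt
    simp only [sub_self]
    nlinarith [sq_nonneg ((u : ℝ) - u')]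
  | cyl C s t u s' t' u' =>
    cases C with
    | x σ => exact (edist_le_of_seg (Seg.cyl _ _ _ _ _ _ _)).trans (one _)
    | c σ i =>
      by_cases hi : i = 2
      · subst hi
        simp only [preMarking, if_true]
        set D := √((s - s') ^ 2 + (t - t') ^ 2 + ((u : ℝ) - u') ^ 2)
        refine (edist_triangle _ (cross ε σ s' t' ((1 + 2 * ε) * u)) _).trans ?_
        refine (add_le_add (edist_cross_horiz _ _ _ _ _ _ _)
          (edist_cross_vert _ _ _ _ _ _)).trans ?_
        have h1 : √((s - s') ^ 2 + (t - t') ^ 2) ≤ D :=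
          Real.sqrt_le_sqrt (by nlinarith [sq_nonneg ((u : ℝ) - u')])
        have h2 : |(1 + 2 * (ε : ℝ)) * u - (1 + 2 * ε) * u'| ≤ (1 + 2 * ε) * D := by
          rw [← mul_sub, abs_mul, abs_of_nonneg (by linarith [ε.2] : (0 : ℝ) ≤ 1 + 2 * ε)]
          refine mul_le_mul_of_nonneg_left ?_ (by linarith [ε.2])
          rw [← Real.sqrt_sq_eq_abs]
          exact Real.sqrt_le_sqrt (by nlinarith [sq_nonneg (s - s'), sq_nonneg (t - t')])
        rw [← ENNReal.ofReal_add (Real.sqrt_nonneg _) (abs_nonneg _), ← ENNReal.ofReal_coe_nnreal,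
          ← ENNReal.ofReal_mul (NNReal.coe_nonneg _)]
        apply ENNReal.ofReal_le_ofReal
        push_cast
        linarith
      · simp only [preMarking, if_neg hi]
        exact (edist_le_of_seg (Seg.cyl _ _ _ _ _ _ _)).trans (one _)

theorem lipschitz_markingFun (ε : ℝ≥0) : LipschitzWith (2 + 2 * ε) (markingFun ε) := by
  intro a b
  have key : ∀ {a b : Y 0} {c : ℝ≥0∞}, Chain a b c →
      edist (markingFun ε a) (markingFun ε b) ≤ ((2 + 2 * ε : ℝ≥0) : ℝ≥0∞) * c := by
    intro a b c h
    induction h with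
    | nil a => simp
    | cons hs _ ih =>
      refine (edist_triangle _ _ _).trans ((add_le_add (edist_preMarking_le ε hs) ih).trans ?_)
      rw [mul_add]
  rw [edist_def (a : Y 0) b]
  have hne : ((2 + 2 * ε : ℝ≥0) : ℝ≥0∞) ≠ ⊤ := ENNReal.coe_ne_top
  have h0 : ((2 + 2 * ε : ℝ≥0) : ℝ≥0∞) ≠ 0 := by
    simp
  simp_rw [ENNReal.mul_iInf_of_ne h0 hne]
  exact le_iInf₂ fun c h => key h

/-- The homotopy equivalence `Y_0 → Y_ε` as a continuous map. -/
def marking (ε : ℝ≥0) : C(Y 0, Y ε) := ⟨markingFun ε, (lipschitz_markingFun ε).continuous⟩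

/-! ### The group `Γ`, the spaces `X_ε` and the actions -/

/-- The group `Γ = π₁(Y_0)`. -/
abbrev Gamma : Type := FundamentalGroup (Y 0) (base 0)

/-- The space `X_ε`, the universal cover of `Y_ε`. -/
abbrev X (ε : ℝ≥0) : Type := UniversalCover (Y ε) (base ε)

/-- The isomorphism `Γ = π₁(Y_0) → π₁(Y_ε)` induced by the homotopy equivalence. -/
def markingHom (ε : ℝ≥0) : Gamma →* FundamentalGroup (Y ε) (base ε) :=
  FundamentalGroup.map (marking ε) (base 0)

/-- The action of `Γ` on `X_0` by deck transformations. -/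
def action₀ : Gamma →* (X 0 ≃ᵢ X 0) := UniversalCover.deck (Y 0) (base 0)

/-- The action of `Γ` on `X_ε` by deck transformations, through `Γ ≅ π₁(Y_ε)`. -/
def action (ε : ℝ≥0) : Gamma →* (X ε ≃ᵢ X ε) :=
  (UniversalCover.deck (Y ε) (base ε)).comp (markingHom ε)

/-! ### The graph of groups decomposition and the vertices of its Bass-Serre tree -/

/-- The eight vertices `V_i^±`. -/
abbrev GVert : Type := PM × Fin 4

/-- The tori contained in `V_i^±`: `E_i^±`, `E_{i+1}^±` (indices mod 4) and, if `i = 0`, `E_x`. -/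
def wallsIn (V : GVert) : Set Wall :=
  {E | E = .e V.1 V.2 ∨ E = .e V.1 (V.2 + 1) ∨ (V.2 = 0 ∧ E = .x)}

/-- The cylinders contained in `V_i^±`: `C_i^±` and, if `i = 0`, `C_x^±`. -/
def cylsIn (V : GVert) : Set Cyl :=
  {C | C = .c V.1 V.2 ∨ (V.2 = 0 ∧ C = .x V.1)}

/-- The subspace `V_i^±` of `Y_0`, i.e. `V_0^± = E_0^± ∪ C_0^± ∪ E_1^± ∪ C_x^± ∪ E_x` and
`V_i^± = E_i^± ∪ C_i^± ∪ E_{i+1}^±` for `i = 1, 2, 3`. -/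
def vertexSpace (V : GVert) : Set (Y 0) :=
  {a | (∃ E ∈ wallsIn V, ∃ r s t u, a = Y.mk (.wall E r s t u)) ∨
    (∃ C ∈ cylsIn V, ∃ s t u, a = Y.mk (.cyl C s t u))}

/-- The base point of `V_i^±`: the origin of the torus `u = 0` of the cylinder `C_i^±`. -/
def vertexBase (V : GVert) : Y 0 := Y.mk (.cyl (.c V.1 V.2) 0 0 0)

theorem vertexBase_mem (V : GVert) : vertexBase V ∈ vertexSpace V :=
  .inr ⟨_, .inl rfl, 0, 0, 0, rfl⟩

/-- The inclusion of `V_i^±` into `Y_0`. -/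
def vertexIncl (V : GVert) : C(vertexSpace V, Y 0) := ⟨Subtype.val, continuous_subtype_val⟩

/-- The vertex group `Γ(V)` as a subgroup of `Γ`: the image of `π₁(V)`, transported to the base point
of `Y_0` along the path `w V`. -/
def vertexGroup (w : ∀ V : GVert, Path (base 0) (vertexBase V)) (V : GVert) : Subgroup Gamma :=
  (FundamentalGroup.map (vertexIncl V) ⟨vertexBase V, vertexBase_mem V⟩).range.map
    (FundamentalGroup.fundamentalGroupMulEquivOfPath (w V)).symm.toMonoidHom

/-- The vertices of the Bass-Serre tree: the disjoint union of the coset spaces `Γ / Γ(V)`. -/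
abbrev TreeVert (w : ∀ V : GVert, Path (base 0) (vertexBase V)) : Type :=
  Σ V : GVert, Gamma ⧸ vertexGroup w V

/-- The vertices `v` of the Bass-Serre tree, with `Λ_v` the center of the stabilizer `Γ_v`. -/
def vertexSystem (w : ∀ V : GVert, Path (base 0) (vertexBase V)) : VertexSystem Gamma where
  Vert := TreeVert w
  Lam v := (Subgroup.center (MulAction.stabilizer Gamma v)).map (MulAction.stabilizer Gamma v).subtype
  Lam_smul := center_stabilizer_smul

end TorusComplex

end

/-! Thickening `E_2^±` and `E_3^±` only lengthens the passage from one vertex space to the next.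
Inside a single vertex space all cylinders meet their tori at one height: `u = ε` for `V_2^±`, `u =
0` for the others. In `X_ε` the set `Min(Λ_v)` is a lift of the thickened vertex space and splits as
`Ȳ × 𝔼²`. Collapsing its walls to the attaching height is equivariant and 1-Lipschitz on the
`Ȳ`-factors, and it works from `X_0` to `X_ε` as well as back. So `|γ̄|` does not change at all, and
`λ(v) = 1` serves for every `v`. The translation vectors agree because both are read off from the
same lattice vectors.

For the proof, the universal cover is replaced by an explicit tree of spaces `Tree ε E₀`: walls `ℝ³
× [0, ε_E]`, indexed by reduced words of crossings (`State`), joined by strips `ℝ² × [0, 1]`. The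
map `cover` to `Y_ε` lifts broken lines without changing their length and has sheets at distance at
least `1 / 2` (`isMetricCovering`); the tree of spaces is contractible, hence isometric to the
universal cover (`develop`). By uniqueness of lifts, a deck transformation permutes the walls by a
map `α` and moves each wall by a lattice vector `l` (`exists_isMotion`). The homotopy equivalence
`Y_0 → Y_ε` lifts to a map that keeps the labels of the walls, so the same `α` and `l` describe the
action for all `ε` (`exists_isModel`). In these terms `Γ_v` consists of the `γ` that keep the base
wall inside its component of the preimage of the vertex space (`exists_isModel_vertex`), and `Λ_v`
of the translations along the common plane of that component (`commute_of_isTransl`,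
`isTransl_of_commute`).

On the component, `flat` is the `𝔼²`-coordinate and `slide` changes it while keeping the other
factor; `lipschitz_slide_flat` and `dist_slide_le` are the two halves of the product formula. A
point outside the component lies behind a strip of another vertex space, whose plane is not parallel
to that of `V`. Some `ζ ∈ Λ_v` moves this strip off itself, and Pythagoras shows that the point is
moved farther than points of the component (`exists_lt_dist`, `groupMinSet_eq`). The comparison of
the `Ȳ`-factors is `barLength_flatSplitting_le`.

Since the data may come from any splitting, uniqueness is also needed. For `γ` centralizing `Λ_v`,
the infimum of the displacement on `Min(Λ_v)` is `√(|γ̄|² + |τ_γ|²)` (`groupDispl_eq`), and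
multiplication of `γ` by elements of `Λ_v` leaves `|γ̄|` unchanged. Polarization therefore recovers
the inner products with lattice vectors, hence the coordinates of `τ_γ` and `|γ̄|` (`inner_eq`,
`coeff_eq`, `barLength_eq`). The explicit splittings show that these infima are the same for `X_0`
and `X_ε`. -/

noncomputable section

/-! ### Planes and lattices in the 3-tori -/

namespace TorusComplex

/-- Euclidean 3-space, the universal cover of a flat 3-torus. -/
abbrev E3 : Type := EuclideanSpace ℝ (Fin 3)

/-- The Euclidean plane, the universal cover of a flat 2-torus. -/
abbrev E2 : Type := EuclideanSpace ℝ (Fin 2)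

/-- The torus to which an end of a cylinder is attached; `false` is the end `u = 0`. -/
def Cyl.att : Cyl → Bool → Wall
  | .x .minus, false => .e .minus 0
  | .x .minus, true => .x
  | .x .plus, false => .x
  | .x .plus, true => .e .plus 0
  | .c σ i, false => .e σ i
  | .c σ i, true => .e σ (i + 1)

/-- The vertex space that contains a cylinder. -/
def Cyl.vert : Cyl → GVert
  | .x σ => (σ, 0)
  | .c σ i => (σ, i)

/-- The direction of the first coordinate of the 2-tori of a vertex space in a 3-torus. -/
def dirA : GVert → Wall → E3
  | (.minus, _), .x => !₂[1, 0, 0]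
  | (.plus, _), .x => !₂[-1, 0, 0]
  -- Tori that do not belong to the vertex space also receive a unit vector, so that `plane` is an
  -- isometric embedding for all arguments.
  | (_, i), .e _ j =>
    if i = 0 then !₂[1 / √2, -1 / √2, 0]
    else if i = 1 then (if j = 1 then !₂[1, 0, 0] else !₂[1 / √2, 1 / √2, 0])
    else if i = 2 then !₂[0, 1, 0]
    else (if j = 3 then !₂[1 / √2, 1 / √2, 0] else !₂[1, 0, 0])

/-- The direction of the second coordinate of the 2-tori of a vertex space in a 3-torus. -/
def dirB : GVert → Wall → E3
  | (.plus, _), .x => !₂[0, 1, 0]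
  | _, _ => !₂[0, 0, 1]

/-- A lattice vector that generates the lattice of a 3-torus together with the sublattice of the
2-tori of a vertex space. -/
def trans : GVert → Wall → E3
  | (.minus, _), .x => !₂[0, √2, 0]
  | (.plus, _), .x => !₂[0, 0, √2]
  | (_, i), .e _ j =>
    if i = 0 then !₂[1, 0, 0]
    else if i = 1 then (if j = 1 then !₂[0, 1, 0] else !₂[1 / √2, 0, 0])
    else if i = 2 then !₂[1 / √2, 0, 0]
    else (if j = 3 then !₂[1 / √2, 0, 0] else !₂[0, 1, 0])

theorem sqrt_two_inv : 1 / √2 = √2 / 2 := by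
  rw [div_eq_div_iff (by positivity) two_ne_zero]
  simp

theorem neg_one_div_sqrt_two : -1 / √2 = -(√2 / 2) := by
  rw [neg_div, sqrt_two_inv]

theorem inner_E3 (x y : E3) : inner ℝ x y = x 0 * y 0 + x 1 * y 1 + x 2 * y 2 := by
  rw [PiLp.inner_apply, Fin.sum_univ_three]
  simp only [RCLike.inner_apply, conj_trivial]
  ring

theorem inner_dirA_self (V : GVert) (E : Wall) : inner ℝ (dirA V E) (dirA V E) = (1 : ℝ) := by
  obtain ⟨σ, i⟩ := V
  have h2 : √2 * √2 = 2 := by simp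
  rw [inner_E3]
  rcases E with _ | ⟨σ', j⟩
  · cases σ <;> simp [dirA]
  · simp only [dirA, sqrt_two_inv, neg_one_div_sqrt_two]
    split_ifs <;> simp <;> linarith

theorem inner_dirB_self (V : GVert) (E : Wall) : inner ℝ (dirB V E) (dirB V E) = (1 : ℝ) := by
  obtain ⟨σ, i⟩ := V
  rw [inner_E3]
  rcases E with _ | ⟨σ', j⟩ <;> cases σ <;> simp [dirB]

theorem inner_dirA_dirB (V : GVert) (E : Wall) : inner ℝ (dirA V E) (dirB V E) = (0 : ℝ) := by
  obtain ⟨σ, i⟩ := V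
  rw [inner_E3]
  rcases E with _ | ⟨σ', j⟩
  · cases σ <;> simp [dirA, dirB]
  · cases σ <;> simp only [dirA, dirB] <;> split_ifs <;> simp

/-- The isometric embedding of the universal cover of the 2-tori of `V` as a plane through the
origin of the universal cover of a 3-torus. -/
def plane (V : GVert) (E : Wall) : E2 →ₗᵢ[ℝ] E3 where
  toFun s := s 0 • dirA V E + s 1 • dirB V E
  map_add' s s' := by simp only [PiLp.add_apply]; module
  map_smul' c s := by simp only [PiLp.smul_apply, smul_eq_mul, RingHom.id_apply]; module
  norm_map' s := by
    change ‖s 0 • dirA V E + s 1 • dirB V E‖ = ‖s‖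
    rw [← sq_eq_sq₀ (norm_nonneg _) (norm_nonneg _), ← real_inner_self_eq_norm_sq,
      ← real_inner_self_eq_norm_sq]
    have := inner_dirA_dirB V E
    have h' : inner ℝ (dirB V E) (dirA V E) = (0 : ℝ) := by rw [real_inner_comm]; exact this
    simp only [inner_add_left, inner_add_right, inner_smul_left, inner_smul_right,
      inner_dirA_self, inner_dirB_self, this, h']
    rw [PiLp.inner_apply, Fin.sum_univ_two]
    simp [pow_two]

theorem plane_apply (V : GVert) (E : Wall) (s : E2) :
    plane V E s = s 0 • dirA V E + s 1 • dirB V E := rfl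

/-- The coordinates of the orthogonal projection to a plane. -/
def proj (V : GVert) (E : Wall) : E3 →L[ℝ] E2 :=
  ContinuousLinearMap.adjoint (plane V E).toContinuousLinearMap

@[simp]
theorem proj_plane (V : GVert) (E : Wall) (s : E2) : proj V E (plane V E s) = s := by
  refine ext_inner_right ℝ fun t => ?_
  rw [proj, ContinuousLinearMap.adjoint_inner_left]
  exact (plane V E).inner_map_map s t

theorem norm_sq_eq_proj (V : GVert) (E : Wall) (x : E3) :
    ‖x‖ ^ 2 = ‖proj V E x‖ ^ 2 + ‖x - plane V E (proj V E x)‖ ^ 2 := by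
  have h : inner ℝ x (plane V E (proj V E x)) = ‖proj V E x‖ ^ 2 := by
    rw [← real_inner_self_eq_norm_sq]
    exact (ContinuousLinearMap.adjoint_inner_left (plane V E).toContinuousLinearMap _ _).symm
  rw [norm_sub_sq_real, h, (plane V E).norm_map]
  ring

theorem norm_proj_le (V : GVert) (E : Wall) (x : E3) : ‖proj V E x‖ ≤ ‖x‖ := by
  have := norm_sq_eq_proj V E x
  exact (sq_le_sq₀ (norm_nonneg _) (norm_nonneg _)).1 (by nlinarith [sq_nonneg ‖x - plane V E (proj V E x)‖])

/-- The lattice of a 3-torus. -/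
def Wall.lat (E : Wall) : AddSubgroup E3 where
  carrier := {x | ∃ k l m : ℤ, x = !₂[k * E.period, l * E.period, m * √2]}
  zero_mem' := ⟨0, 0, 0, by ext i; fin_cases i <;> simp⟩
  add_mem' := by
    rintro _ _ ⟨k, l, m, rfl⟩ ⟨k', l', m', rfl⟩
    exact ⟨k + k', l + l', m + m', by ext i; fin_cases i <;> simp <;> ring⟩
  neg_mem' := by
    rintro _ ⟨k, l, m, rfl⟩
    exact ⟨-k, -l, -m, by ext i; fin_cases i <;> simp⟩

theorem Wall.mem_lat {E : Wall} {x : E3} :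
    x ∈ E.lat ↔ ∃ k l m : ℤ, x = !₂[k * E.period, l * E.period, m * √2] := Iff.rfl

/-- The period of the first coordinate of the 2-tori of a vertex space. -/
def vertPeriod (V : GVert) : ℝ := ![√2, 1, 1 / √2, 1] V.2

theorem Cyl.period_eq (C : Cyl) : C.period = vertPeriod C.vert := by
  cases C <;> rfl

/-- The lattice of the 2-tori of a vertex space. -/
def vlat (V : GVert) : AddSubgroup E2 where
  carrier := {x | ∃ k l : ℤ, x = !₂[k * vertPeriod V, l * √2]}
  zero_mem' := ⟨0, 0, by ext i; fin_cases i <;> simp⟩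
  add_mem' := by
    rintro _ _ ⟨k, l, rfl⟩ ⟨k', l', rfl⟩
    exact ⟨k + k', l + l', by ext i; fin_cases i <;> simp <;> ring⟩
  neg_mem' := by
    rintro _ ⟨k, l, rfl⟩
    exact ⟨-k, -l, by ext i; fin_cases i <;> simp⟩

theorem mem_vlat {V : GVert} {x : E2} :
    x ∈ vlat V ↔ ∃ k l : ℤ, x = !₂[k * vertPeriod V, l * √2] := Iff.rfl

theorem vertPeriod_pos (V : GVert) : 0 < vertPeriod V := by
  obtain ⟨σ, i⟩ := V
  fin_cases i <;> simp [vertPeriod]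

/-- The attaching 2-torus is primitive in the 3-torus, so one further lattice vector completes its
lattice. The integers solve the linear system in each case; for instance `(k, l) = (k + l) (1, 0) -
l (1, -1)` if the plane contains the diagonal `(1, -1)`. -/
theorem exists_of_mem_lat (C : Cyl) (b : Bool) {x : E3} (hx : x ∈ (C.att b).lat) :
    ∃ k : ℤ, ∃ s ∈ vlat C.vert,
      x = k • trans C.vert (C.att b) + plane C.vert (C.att b) s := by
  have h2 : √2 * √2 = 2 := by simp
  obtain ⟨k, l, m, rfl⟩ := hx
  have key : ∃ a b' c : ℤ, !₂[(k : ℝ) * (C.att b).period, l * (C.att b).period, m * √2] =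
      a • trans C.vert (C.att b) + plane C.vert (C.att b) !₂[b' * vertPeriod C.vert, c * √2] := by
    rcases C with σ | ⟨σ, i⟩
    · cases σ <;> cases b
      · refine ⟨m, -k, l, ?_⟩
        ext i; fin_cases i <;>
        simp [Cyl.att, Cyl.vert, Wall.period, vertPeriod, trans, plane_apply, dirA, dirB]
      · refine ⟨k + l, -l, m, ?_⟩
        ext i; fin_cases i <;>
        simp [Cyl.att, Cyl.vert, Wall.period, vertPeriod, trans, plane_apply, dirA, dirB, div_eq_mul_inv]
      · refine ⟨k + l, -l, m, ?_⟩
        ext i; fin_cases i <;>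
        simp [Cyl.att, Cyl.vert, Wall.period, vertPeriod, trans, plane_apply, dirA, dirB, div_eq_mul_inv]
      · refine ⟨l, k, m, ?_⟩
        ext i; fin_cases i <;>
        simp [Cyl.att, Cyl.vert, Wall.period, vertPeriod, trans, plane_apply, dirA, dirB]
    · fin_cases i <;> cases b
      · refine ⟨k + l, -l, m, ?_⟩
        ext i; fin_cases i <;>
        simp [Cyl.att, Cyl.vert, Wall.period, vertPeriod, trans, plane_apply, dirA, dirB, div_eq_mul_inv]
      · refine ⟨k + l, -l, m, ?_⟩
        ext i; fin_cases i <;>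
        simp [Cyl.att, Cyl.vert, Wall.period, vertPeriod, trans, plane_apply, dirA, dirB, div_eq_mul_inv]
      · refine ⟨l, k, m, ?_⟩
        ext i; fin_cases i <;>
        simp [Cyl.att, Cyl.vert, Wall.period, vertPeriod, trans, plane_apply, dirA, dirB]
      · refine ⟨k - l, l, m, ?_⟩
        ext i; fin_cases i <;>
        simp [Cyl.att, Cyl.vert, Wall.period, vertPeriod, trans, plane_apply, dirA, dirB] <;> ring
      · refine ⟨k, l, m, ?_⟩
        ext i; fin_cases i <;>
        simp [Cyl.att, Cyl.vert, Wall.period, vertPeriod, trans, plane_apply, dirA, dirB]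
      · refine ⟨k, l, m, ?_⟩
        ext i; fin_cases i <;>
        simp [Cyl.att, Cyl.vert, Wall.period, vertPeriod, trans, plane_apply, dirA, dirB]
      · refine ⟨k - l, l, m, ?_⟩
        ext i; fin_cases i <;>
        simp [Cyl.att, Cyl.vert, Wall.period, vertPeriod, trans, plane_apply, dirA, dirB] <;> ring
      · refine ⟨l, k, m, ?_⟩
        ext i; fin_cases i <;>
        simp [Cyl.att, Cyl.vert, Wall.period, vertPeriod, trans, plane_apply, dirA, dirB]
  obtain ⟨a, b', c, h⟩ := key
  exact ⟨a, _, ⟨b', c, rfl⟩, h⟩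

theorem trans_mem_lat (C : Cyl) (b : Bool) : trans C.vert (C.att b) ∈ (C.att b).lat := by
  rcases C with σ | ⟨σ, i⟩
  · cases σ <;> cases b
    · exact ⟨0, 0, 1, by simp [Cyl.att, Cyl.vert, Wall.period, trans]⟩
    · exact ⟨1, 0, 0, by simp [Cyl.att, Cyl.vert, Wall.period, trans]⟩
    · exact ⟨1, 0, 0, by simp [Cyl.att, Cyl.vert, Wall.period, trans]⟩
    · exact ⟨0, 1, 0, by simp [Cyl.att, Cyl.vert, Wall.period, trans]⟩
  · fin_cases i <;> cases b
    · exact ⟨1, 0, 0, by simp [Cyl.att, Cyl.vert, Wall.period, trans]⟩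
    · exact ⟨1, 0, 0, by simp [Cyl.att, Cyl.vert, Wall.period, trans]⟩
    · exact ⟨0, 1, 0, by simp [Cyl.att, Cyl.vert, Wall.period, trans]⟩
    · exact ⟨1, 0, 0, by simp [Cyl.att, Cyl.vert, Wall.period, trans]⟩
    · exact ⟨1, 0, 0, by simp [Cyl.att, Cyl.vert, Wall.period, trans]⟩
    · exact ⟨1, 0, 0, by simp [Cyl.att, Cyl.vert, Wall.period, trans]⟩
    · exact ⟨1, 0, 0, by simp [Cyl.att, Cyl.vert, Wall.period, trans]⟩
    · exact ⟨0, 1, 0, by simp [Cyl.att, Cyl.vert, Wall.period, trans]⟩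

theorem plane_mem_lat (C : Cyl) (b : Bool) {s : E2} (hs : s ∈ vlat C.vert) :
    plane C.vert (C.att b) s ∈ (C.att b).lat := by
  obtain ⟨k, l, rfl⟩ := hs
  have h2 : √2 * √2 = 2 := by simp
  have key : ∃ a b' c : ℤ, plane C.vert (C.att b) !₂[k * vertPeriod C.vert, l * √2] =
      !₂[(a : ℝ) * (C.att b).period, b' * (C.att b).period, c * √2] := by
    rcases C with σ | ⟨σ, i⟩
    · cases σ <;> cases b
      · refine ⟨-k, l, 0, ?_⟩
        ext i; fin_cases i <;>
        simp [Cyl.att, Cyl.vert, Wall.period, vertPeriod, plane_apply, dirA, dirB]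
      · refine ⟨k, -k, l, ?_⟩
        ext i; fin_cases i <;>
        simp [Cyl.att, Cyl.vert, Wall.period, vertPeriod, plane_apply, dirA, dirB, div_eq_mul_inv]
      · refine ⟨k, -k, l, ?_⟩
        ext i; fin_cases i <;>
        simp [Cyl.att, Cyl.vert, Wall.period, vertPeriod, plane_apply, dirA, dirB, div_eq_mul_inv]
      · refine ⟨k, 0, l, ?_⟩
        ext i; fin_cases i <;>
        simp [Cyl.att, Cyl.vert, Wall.period, vertPeriod, plane_apply, dirA, dirB]
    · fin_cases i <;> cases b
      · refine ⟨k, -k, l, ?_⟩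
        ext i; fin_cases i <;>
        simp [Cyl.att, Cyl.vert, Wall.period, vertPeriod, plane_apply, dirA, dirB, div_eq_mul_inv]
      · refine ⟨k, -k, l, ?_⟩
        ext i; fin_cases i <;>
        simp [Cyl.att, Cyl.vert, Wall.period, vertPeriod, plane_apply, dirA, dirB, div_eq_mul_inv]
      · refine ⟨k, 0, l, ?_⟩
        ext i; fin_cases i <;>
        simp [Cyl.att, Cyl.vert, Wall.period, vertPeriod, plane_apply, dirA, dirB]
      · refine ⟨k, k, l, ?_⟩
        ext i; fin_cases i <;>
        simp [Cyl.att, Cyl.vert, Wall.period, vertPeriod, plane_apply, dirA, dirB]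
      · refine ⟨0, k, l, ?_⟩
        ext i; fin_cases i <;>
        simp [Cyl.att, Cyl.vert, Wall.period, vertPeriod, plane_apply, dirA, dirB]
      · refine ⟨0, k, l, ?_⟩
        ext i; fin_cases i <;>
        simp [Cyl.att, Cyl.vert, Wall.period, vertPeriod, plane_apply, dirA, dirB]
      · refine ⟨k, k, l, ?_⟩
        ext i; fin_cases i <;>
        simp [Cyl.att, Cyl.vert, Wall.period, vertPeriod, plane_apply, dirA, dirB]
      · refine ⟨k, 0, l, ?_⟩
        ext i; fin_cases i <;>
        simp [Cyl.att, Cyl.vert, Wall.period, vertPeriod, plane_apply, dirA, dirB]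
  exact key

/-- A vector orthogonal to a plane and not orthogonal to the transverse lattice vector. -/
theorem exists_normal (C : Cyl) (b : Bool) : ∃ n : Fin 3 → ℝ,
    (∀ s, ∑ i, n i * plane C.vert (C.att b) s i = 0) ∧
      ∑ i, n i * trans C.vert (C.att b) i ≠ 0 := by
  have h2 : √2 ≠ 0 := by simp
  rcases C with σ | ⟨σ, i⟩
  · cases σ <;> cases b
    · exact ⟨![0, 0, 1], fun s => by simp [Cyl.att, Cyl.vert, plane_apply, dirA, dirB, Fin.sum_univ_three], by
        simp [Cyl.att, Cyl.vert, trans, Fin.sum_univ_three]⟩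
    · exact ⟨![1, 1, 0], fun s => by simp [Cyl.att, Cyl.vert, plane_apply, dirA, dirB, Fin.sum_univ_three]; ring, by
        simp [Cyl.att, Cyl.vert, trans, Fin.sum_univ_three]⟩
    · exact ⟨![1, 1, 0], fun s => by simp [Cyl.att, Cyl.vert, plane_apply, dirA, dirB, Fin.sum_univ_three]; ring, by
        simp [Cyl.att, Cyl.vert, trans, Fin.sum_univ_three]⟩
    · exact ⟨![0, 1, 0], fun s => by simp [Cyl.att, Cyl.vert, plane_apply, dirA, dirB, Fin.sum_univ_three], by
        simp [Cyl.att, Cyl.vert, trans, Fin.sum_univ_three]⟩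
  · fin_cases i <;> cases b
    · exact ⟨![1, 1, 0], fun s => by simp [Cyl.att, Cyl.vert, plane_apply, dirA, dirB, Fin.sum_univ_three]; ring, by
        simp [Cyl.att, Cyl.vert, trans, Fin.sum_univ_three]⟩
    · exact ⟨![1, 1, 0], fun s => by simp [Cyl.att, Cyl.vert, plane_apply, dirA, dirB, Fin.sum_univ_three]; ring, by
        simp [Cyl.att, Cyl.vert, trans, Fin.sum_univ_three]⟩
    · exact ⟨![0, 1, 0], fun s => by simp [Cyl.att, Cyl.vert, plane_apply, dirA, dirB, Fin.sum_univ_three], by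
        simp [Cyl.att, Cyl.vert, trans, Fin.sum_univ_three]⟩
    · exact ⟨![1, -1, 0], fun s => by simp [Cyl.att, Cyl.vert, plane_apply, dirA, dirB, Fin.sum_univ_three], by
        simp [Cyl.att, Cyl.vert, trans, Fin.sum_univ_three]⟩
    · exact ⟨![1, 0, 0], fun s => by simp [Cyl.att, Cyl.vert, plane_apply, dirA, dirB, Fin.sum_univ_three], by
        simp [Cyl.att, Cyl.vert, trans, Fin.sum_univ_three]⟩
    · exact ⟨![1, 0, 0], fun s => by simp [Cyl.att, Cyl.vert, plane_apply, dirA, dirB, Fin.sum_univ_three], by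
        simp [Cyl.att, Cyl.vert, trans, Fin.sum_univ_three]⟩
    · exact ⟨![1, -1, 0], fun s => by simp [Cyl.att, Cyl.vert, plane_apply, dirA, dirB, Fin.sum_univ_three], by
        simp [Cyl.att, Cyl.vert, trans, Fin.sum_univ_three]⟩
    · exact ⟨![0, 1, 0], fun s => by simp [Cyl.att, Cyl.vert, plane_apply, dirA, dirB, Fin.sum_univ_three], by
        simp [Cyl.att, Cyl.vert, trans, Fin.sum_univ_three]⟩

theorem eq_zero_of_trans_eq_plane (C : Cyl) (b : Bool) {k : ℤ} {s : E2}
    (h : k • trans C.vert (C.att b) = plane C.vert (C.att b) s) : k = 0 := by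
  obtain ⟨n, h1, h2⟩ := exists_normal C b
  have h3 := h1 s
  rw [← h] at h3
  have h4 : (k : ℝ) * ∑ i, n i * trans C.vert (C.att b) i = 0 := by
    rw [← h3, Finset.mul_sum]
    refine Finset.sum_congr rfl fun i _ => ?_
    simp; ring
  simpa [h2] using h4

theorem index_unique (C : Cyl) (b : Bool) {k k' : ℤ} {s s' : E2}
    (h : k • trans C.vert (C.att b) + plane C.vert (C.att b) s =
      k' • trans C.vert (C.att b) + plane C.vert (C.att b) s') : k = k' ∧ s = s' := by
  have h1 : (k - k') • trans C.vert (C.att b) = plane C.vert (C.att b) (s' - s) := by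
    rw [sub_smul, map_sub, sub_eq_sub_iff_add_eq_add, h, add_comm]
  have h2 := eq_zero_of_trans_eq_plane C b h1
  obtain rfl : k = k' := by omega
  exact ⟨rfl, (plane C.vert (C.att b)).injective (by simpa using h)⟩

/-- All periods are at least `1 / √2`, which exceeds `1 / 2`. The constant `1 / 2` becomes the
distance between the sheets of the covering. -/
theorem eq_zero_of_mem_lat {E : Wall} {x : E3} (hx : x ∈ E.lat) (h : ‖x‖ < 1 / 2) : x = 0 := by
  obtain ⟨k, l, m, rfl⟩ := hx
  have h2 : (1 : ℝ) ≤ √2 := by rw [Real.one_le_sqrt]; norm_num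
  have hp : 1 / 2 ≤ E.period := by
    rcases E with _ | ⟨σ, i⟩
    · simp only [Wall.period]; linarith
    · fin_cases i <;> simp only [Wall.period, sqrt_two_inv] <;> norm_num <;> linarith
  have key : ∀ (p : ℝ), 1 / 2 ≤ p → ∀ k : ℤ, |k * p| < 1 / 2 → k = 0 := by
    intro p hp k hk
    by_contra h0
    have : (1 : ℝ) ≤ |(k : ℝ)| := by exact_mod_cast Int.one_le_abs h0
    rw [abs_mul, abs_of_nonneg (by linarith : (0:ℝ) ≤ p)] at hk
    nlinarith
  have hc : ∀ i, |(!₂[(k : ℝ) * E.period, l * E.period, m * √2] : E3) i| < 1 / 2 := fun i =>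
    ((Real.norm_eq_abs _).symm.le.trans (PiLp.norm_apply_le _ i)).trans_lt h
  have hk := key _ hp k (by simpa using hc 0)
  have hl := key _ hp l (by simpa using hc 1)
  have hm := key √2 (by linarith) m (by simpa using hc 2)
  subst hk hl hm
  ext i; fin_cases i <;> simp

theorem Cyl.att_eq_x {C : Cyl} {b : Bool} (h : C.att b = .x) : C.vert = (.minus, 0) ∨ C.vert = (.plus, 0) := by
  rcases C with σ | ⟨σ, i⟩
  · cases σ <;> simp [Cyl.vert]
  · cases b <;> simp [Cyl.att] at h

theorem Cyl.att_eq_e {C : Cyl} {b : Bool} {σ : PM} {j : Fin 4} (h : C.att b = .e σ j) :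
    C.vert = (σ, j) ∨ C.vert = (σ, j - 1) := by
  rcases C with σ' | ⟨σ', i⟩
  · cases σ' <;> cases b <;> simp [Cyl.att] at h <;> simp [Cyl.vert, h.1, ← h.2]
  · cases b <;> simp [Cyl.att] at h <;> simp [Cyl.vert, h.1, ← h.2]

/-- The planes of two different vertex spaces in a common 3-torus are not parallel. -/
theorem exists_transversal {E : Wall} {C C' : Cyl} {b b' : Bool} (h : C.att b = E)
    (h' : C'.att b' = E) (hne : C'.vert ≠ C.vert) :
    ∃ s ∈ vlat C.vert, ∀ s', plane C.vert E s ≠ plane C'.vert E s' := by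
  -- The planes intersect in the line of first coordinates in `E_x` and in the line of second
  -- coordinates (the `t`-axis) in the other tori. The sum of both generators lies on neither line.
  refine ⟨_, ⟨1, 1, rfl⟩, fun s' hs => ?_⟩
  have h0 := congrArg (fun x : E3 => x 0) hs
  have h1 := congrArg (fun x : E3 => x 1) hs
  have h2 := congrArg (fun x : E3 => x 2) hs
  have h3 : √2 ≠ 0 := by simp
  clear hs
  rcases E with _ | ⟨σ, j⟩
  · rcases Cyl.att_eq_x h with e | e <;> rcases Cyl.att_eq_x h' with e' | e' <;> rw [e, e'] at hne h0 h1 h2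
    all_goals first
      | exact hne rfl
      | simp [plane_apply, dirA, dirB, vertPeriod] at h0 h1 h2
  · rcases Cyl.att_eq_e h with e | e <;> rcases Cyl.att_eq_e h' with e' | e' <;>
      rw [e, e'] at hne h0 h1 h2
    all_goals first
      | exact hne rfl
      | clear e e' h h' hne
        have m1 : (-1 : Fin 4) = 3 := rfl
        fin_cases j <;> simp [plane_apply, dirA, dirB, vertPeriod, m1] at h0 h1 h2 <;>
          first
          | linarith
          | (rw [h1] at h0; simp at h0)

end TorusComplex

end

/-! ### Reduced words of crossings and the tree of spaces -/

noncomputable section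

namespace TorusComplex

/-- A crossing of a lift of a cylinder `C`, starting from the end `b`, which is attached along the
`k`-th parallel translate of a plane. -/
structure Letter where
  /-- the cylinder -/
  C : Cyl
  /-- the end at which the crossing starts -/
  b : Bool
  /-- the index of the plane in the wall where the crossing starts -/
  k : ℤ

namespace Letter

/-- The wall where the crossing starts. -/
def src (a : Letter) : Wall := a.C.att a.b

/-- The wall where the crossing ends. -/
def tgt (a : Letter) : Wall := a.C.att (!a.b)

/-- The vertex space of the cylinder. -/
def vert (a : Letter) : GVert := a.C.vert

/-- The attaching map at the start of the crossing. -/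
def emb (a : Letter) (s : E2) : E3 := a.k • trans a.vert a.src + plane a.vert a.src s

/-- The attaching map at the end of the crossing. -/
def embT (a : Letter) (s : E2) : E3 := plane a.vert a.tgt s

/-- The projection to the attaching plane at the end of the crossing. -/
def projT (a : Letter) (x : E3) : E2 := proj a.vert a.tgt x

/-- The projection of the wall behind the crossing to the wall in front of it. -/
def back (a : Letter) (x : E3) : E3 := a.emb (a.projT x)

@[simp] theorem projT_embT (a : Letter) (s : E2) : a.projT (a.embT s) = s := proj_plane _ _ _

theorem norm_emb_sub (a : Letter) (s s' : E2) : ‖a.emb s - a.emb s'‖ = ‖s - s'‖ := by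
  rw [emb, emb, add_sub_add_left_eq_sub, ← map_sub, (plane _ _).norm_map]

theorem norm_embT_sub (a : Letter) (s s' : E2) : ‖a.embT s - a.embT s'‖ = ‖s - s'‖ := by
  rw [embT, embT, ← map_sub, (plane _ _).norm_map]

theorem norm_projT_sub_le (a : Letter) (x x' : E3) : ‖a.projT x - a.projT x'‖ ≤ ‖x - x'‖ := by
  rw [projT, projT, ← map_sub]; exact norm_proj_le _ _ _

theorem norm_back_sub_le (a : Letter) (x x' : E3) : ‖a.back x - a.back x'‖ ≤ ‖x - x'‖ := by
  rw [back, back, norm_emb_sub]; exact norm_projT_sub_le _ _ _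

/-- The reverse of a crossing that arrives at the `k`-th parallel plane. -/
def rev (a : Letter) (k : ℤ) : Letter := ⟨a.C, !a.b, k⟩

@[simp] theorem rev_src (a : Letter) (k : ℤ) : (a.rev k).src = a.tgt := rfl
@[simp] theorem rev_tgt (a : Letter) (k : ℤ) : (a.rev k).tgt = a.src := by simp [rev, src, tgt]
@[simp] theorem rev_vert (a : Letter) (k : ℤ) : (a.rev k).vert = a.vert := rfl
@[simp] theorem rev_k (a : Letter) (k : ℤ) : (a.rev k).k = k := rfl
@[simp] theorem rev_C (a : Letter) (k : ℤ) : (a.rev k).C = a.C := rfl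
@[simp] theorem rev_b (a : Letter) (k : ℤ) : (a.rev k).b = !a.b := rfl
@[simp] theorem rev_rev (a : Letter) (k k' : ℤ) : (a.rev k).rev k' = ⟨a.C, a.b, k'⟩ := by
  simp [rev]

@[simp] theorem rev_emb_zero (a : Letter) (s : E2) : (a.rev 0).emb s = a.embT s := by
  simp [emb, embT]

theorem ext' {a a' : Letter} (hC : a.C = a'.C) (hb : a.b = a'.b) (hk : a.k = a'.k) : a = a' := by
  cases a; cases a'; simp_all

end Letter

/-- The height at which the cylinders of a vertex space are attached to a thickened torus. -/
def side (ε : ℝ≥0) (V : GVert) : ℝ := if V.2 = 2 then ε else 0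

theorem side_mem (ε : ℝ≥0) (C : Cyl) (b : Bool) :
    side ε C.vert ∈ Set.Icc (0 : ℝ) (thickness ε (C.att b)) := by
  rcases C with σ | ⟨σ, i⟩
  · simp [side, Cyl.vert]
  · fin_cases i <;> cases b <;> simp [side, Cyl.vert, Cyl.att, thickness]

/-- The last wall on a sequence of crossings that starts at the wall `E₀`; the most recent crossing
is the head of the list. -/
def wordType (E₀ : Wall) : List Letter → Wall
  | [] => E₀
  | a :: _ => a.tgt

/-- The crossing `a` is possible after `l`, and is not the reverse of the last crossing. -/
def Extends (E₀ : Wall) (l : List Letter) (a : Letter) : Prop :=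
  -- Coordinates behind a crossing are normalized so that it arrives at the plane of index 0. The
  -- immediate return is thus the same cylinder from its other end with `k = 0`; the equation with
  -- `a.rev a'.k` compares cylinder and ends only.
  a.src = wordType E₀ l ∧ ∀ a' l', l = a' :: l' → ¬ (a' = a.rev a'.k ∧ a.k = 0)

/-- Reduced sequences of crossings. -/
def IsReduced (E₀ : Wall) : List Letter → Prop
  | [] => True
  | a :: l => IsReduced E₀ l ∧ Extends E₀ l a

/-- The lifts of the thickened tori to the tree of spaces with base wall `E₀`. -/
def State (E₀ : Wall) : Type := {l : List Letter // IsReduced E₀ l}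

namespace State

variable {E₀ : Wall}

/-- The base wall. -/
def nil : State E₀ := ⟨[], trivial⟩

/-- The type of a wall. -/
def typ (ω : State E₀) : Wall := wordType E₀ ω.1

/-- `a` leads from `ω` to a wall which is farther away from the base wall. -/
def Ok (ω : State E₀) (a : Letter) : Prop := Extends E₀ ω.1 a

/-- The wall behind the crossing `a`. -/
def cons (ω : State E₀) (a : Letter) (h : ω.Ok a) : State E₀ := ⟨a :: ω.1, ω.2, h⟩

/-- The number of crossings. -/
def len (ω : State E₀) : ℕ := ω.1.length

@[simp] theorem typ_nil : (nil : State E₀).typ = E₀ := rfl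
@[simp] theorem typ_cons (ω : State E₀) (a h) : (ω.cons a h).typ = a.tgt := rfl
@[simp] theorem len_nil : (nil : State E₀).len = 0 := rfl
@[simp] theorem len_cons (ω : State E₀) (a h) : (ω.cons a h).len = ω.len + 1 := rfl

theorem Ok.src {ω : State E₀} {a : Letter} (h : ω.Ok a) : a.src = ω.typ := h.1

theorem cons_ne_nil (ω : State E₀) (a h) : ω.cons a h ≠ nil := fun e => by
  have := congrArg len e
  simp at this

theorem cons_inj {ω ω' : State E₀} {a a' h h'} (e : ω.cons a h = ω'.cons a' h') :
    ω = ω' ∧ a = a' := by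
  have := congrArg Subtype.val e
  simp only [cons, List.cons.injEq] at this
  exact ⟨Subtype.ext this.2, this.1⟩

theorem cons_ne_self (ω : State E₀) (a h) : ω.cons a h ≠ ω := fun e => by
  have := congrArg len e
  simp at this

/-- Recursion on the number of crossings. -/
def recOn' {motive : State E₀ → Sort*} (nil : motive nil)
    (cons : ∀ ω a h, motive ω → motive (cons ω a h)) : ∀ ω, motive ω := fun ω =>
  go ω.1 ω.2
where
  /-- The recursion on the underlying list. -/
  go : ∀ l h, motive ⟨l, h⟩
  | [], _ => nil
  | a :: l, h => cons ⟨l, h.1⟩ a h.2 (go l h.1)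

@[simp] theorem recOn'_nil {motive : State E₀ → Sort*} (n : motive State.nil)
    (c : ∀ ω a h, motive ω → motive (State.cons ω a h)) : recOn' n c State.nil = n := rfl

@[simp] theorem recOn'_cons {motive : State E₀ → Sort*} (n : motive State.nil)
    (c : ∀ ω a h, motive ω → motive (State.cons ω a h)) (ω a h) :
    recOn' n c (State.cons ω a h) = c ω a h (recOn' n c ω) := rfl

@[elab_as_elim]
theorem induct {P : State E₀ → Prop} (ω : State E₀) (nil : P nil)
    (cons : ∀ ω a h, P ω → P (cons ω a h)) : P ω := recOn' nil cons ω

theorem eq_nil_or_cons (ω : State E₀) : ω = nil ∨ ∃ ω' a h, ω = cons ω' a h := by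
  induction ω using induct with
  | nil => exact .inl rfl
  | cons ω a h _ => exact .inr ⟨ω, a, h, rfl⟩

theorem not_ok_cons (ω : State E₀) (a h) (a' : Letter) (e : a' = a.rev 0) : ¬ (ω.cons a h).Ok a' := by
  rintro ⟨-, h2⟩
  refine h2 a ω.1 rfl ⟨?_, by rw [e]; rfl⟩
  rw [e, Letter.rev_rev]

/-- The dichotomy behind the case distinctions for strips at a wall: a strip either leads away from
the base wall, or it is the one through which the wall was reached. -/
theorem ok_or_back {ω : State E₀} {a : Letter} (h : a.src = ω.typ) :
    ω.Ok a ∨ ∃ ω' a' h', ω = cons ω' a' h' ∧ a = a'.rev 0 := by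
  rcases ω.eq_nil_or_cons with rfl | ⟨ω', a', h', rfl⟩
  · exact .inl ⟨h, fun _ _ h => by simp [nil] at h⟩
  · by_cases hb : a' = a.rev a'.k ∧ a.k = 0
    · exact .inr ⟨ω', a', h', rfl, by
        rw [hb.1]; exact Letter.ext' (by simp) (by simp) (by simpa using hb.2)⟩
    · refine .inl ⟨h, fun a'' l'' e => ?_⟩
      simp only [cons, List.cons.injEq] at e
      exact e.1 ▸ hb

/-- The wall in front of the last crossing. -/
def tail : State E₀ → State E₀ := recOn' nil fun ω _ _ _ => ω

/-- The index of the last crossing. -/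
def lastIndex : State E₀ → ℤ := recOn' 0 fun _ a _ _ => a.k

@[simp] theorem tail_cons (ω : State E₀) (a h) : (ω.cons a h).tail = ω := rfl
@[simp] theorem lastIndex_cons (ω : State E₀) (a h) : (ω.cons a h).lastIndex = a.k := rfl

open Classical in
/-- The wall reached by an arbitrary crossing. -/
def nbr (ω : State E₀) (a : Letter) : State E₀ := if h : ω.Ok a then ω.cons a h else ω.tail

open Classical in
/-- The index of the crossed strip in the wall that is reached. -/
def nbrIdx (ω : State E₀) (a : Letter) : ℤ := if ω.Ok a then 0 else ω.lastIndex

theorem nbr_ok {ω : State E₀} {a : Letter} (h : ω.Ok a) : ω.nbr a = ω.cons a h := by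
  simp [nbr, h]

theorem nbrIdx_ok {ω : State E₀} {a : Letter} (h : ω.Ok a) : ω.nbrIdx a = 0 := by
  simp [nbrIdx, h]

theorem nbr_cons_rev (ω : State E₀) (a h) : (ω.cons a h).nbr (a.rev 0) = ω := by
  rw [nbr, dif_neg (not_ok_cons ω a h _ rfl), tail_cons]

theorem nbrIdx_cons_rev (ω : State E₀) (a h) : (ω.cons a h).nbrIdx (a.rev 0) = a.k := by
  rw [nbrIdx, if_neg (not_ok_cons ω a h _ rfl), lastIndex_cons]

theorem typ_nbr {ω : State E₀} {a : Letter} (h : a.src = ω.typ) : (ω.nbr a).typ = a.tgt := by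
  rcases ok_or_back h with h' | ⟨ω', a', h', rfl, rfl⟩
  · rw [nbr_ok h', typ_cons]
  · rw [nbr_cons_rev, ← h'.src, Letter.rev_tgt]

theorem nbr_nbr {ω : State E₀} {a : Letter} (h : a.src = ω.typ) :
    (ω.nbr a).nbr (a.rev (ω.nbrIdx a)) = ω := by
  rcases ok_or_back h with h' | ⟨ω', a', h', rfl, rfl⟩
  · rw [nbr_ok h', nbrIdx_ok h', nbr_cons_rev]
  · rw [nbr_cons_rev, nbrIdx_cons_rev, Letter.rev_rev]
    exact nbr_ok h'

end State

/-! ### The tree of spaces -/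

/-- The disjoint union of the pieces of the tree of spaces. The last coordinate is only relevant
up to projection to `[0, ε_E]` and `[0, 1]`, respectively. -/
inductive TPre (E₀ : Wall)
  | wall (ω : State E₀) (x : E3) (u : ℝ)
  | strip (ω : State E₀) (a : Letter) (h : ω.Ok a) (s : E2) (v : ℝ)

/-- The identifications in the tree of spaces. -/
inductive TGlue (ε : ℝ≥0) (E₀ : Wall) : TPre E₀ → TPre E₀ → Prop
  | clampW (ω x u) : TGlue ε E₀ (.wall ω x u) (.wall ω x (clampWall ε ω.typ u))
  | clampS (ω a h s v) : TGlue ε E₀ (.strip ω a h s v) (.strip ω a h s (clampCyl v))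
  | bot (ω a h s) : TGlue ε E₀ (.strip ω a h s 0) (.wall ω (a.emb s) (side ε a.vert))
  | top (ω a h s) : TGlue ε E₀ (.strip ω a h s 1)
      (.wall (ω.cons a h) (a.embT s) (side ε a.vert))

/-- The tree of spaces. -/
def Tree (ε : ℝ≥0) (E₀ : Wall) : Type := Quot (TGlue ε E₀)

/-- Straight segments in the pieces. -/
inductive TSeg {E₀ : Wall} : TPre E₀ → TPre E₀ → ℝ → Prop
  | wall (ω x u x' u') : TSeg (.wall ω x u) (.wall ω x' u') √(‖x - x'‖ ^ 2 + (u - u') ^ 2)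
  | strip (ω a h s v s' v') : TSeg (.strip ω a h s v) (.strip ω a h s' v')
      √(‖s - s'‖ ^ 2 + (v - v') ^ 2)

theorem TSeg.symm {E₀ : Wall} {x y : TPre E₀} {d : ℝ} (h : TSeg x y d) : TSeg y x d := by
  cases h with
  | wall ω x u x' u' =>
    have := TSeg.wall ω x' u' x u
    rwa [norm_sub_rev, sub_sq_comm u'] at this
  | strip ω a h s v s' v' =>
    have := TSeg.strip ω a h s' v' s v
    rwa [norm_sub_rev, sub_sq_comm v'] at this

theorem TSeg.nonneg {E₀ : Wall} {x y : TPre E₀} {d : ℝ} (h : TSeg x y d) : 0 ≤ d := by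
  cases h <;> exact Real.sqrt_nonneg _

/-- Broken lines in the tree of spaces. -/
inductive TChain {ε : ℝ≥0} {E₀ : Wall} : Tree ε E₀ → Tree ε E₀ → ℝ → Prop
  | nil (p) : TChain p p 0
  | cons {x y d q c} : TSeg x y d → TChain (Quot.mk _ y) q c → TChain (Quot.mk _ x) q (d + c)

namespace Tree

variable {ε : ℝ≥0} {E₀ : Wall}

theorem _root_.TorusComplex.TChain.trans {p q r : Tree ε E₀} {c c' : ℝ} (h : TChain p q c)
    (h' : TChain q r c') : TChain p r (c + c') := by
  induction h with
  | nil a => simpa using h'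
  | cons hs _ ih => rw [add_assoc]; exact .cons hs (ih h')

theorem _root_.TorusComplex.TChain.symm {p q : Tree ε E₀} {c : ℝ} (h : TChain p q c) :
    TChain q p c := by
  induction h with
  | nil a => exact .nil a
  | cons hs _ ih =>
    have := ih.trans (.cons hs.symm (.nil _))
    rwa [add_zero, add_comm] at this

theorem _root_.TorusComplex.TChain.nonneg {p q : Tree ε E₀} {c : ℝ} (h : TChain p q c) :
    0 ≤ c := by
  induction h with
  | nil a => exact le_rfl
  | cons hs _ ih => exact add_nonneg hs.nonneg ih

instance : PseudoEMetricSpace (Tree ε E₀) where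
  edist p q := ⨅ (c : ℝ) (_ : TChain p q c), ENNReal.ofReal c
  edist_self p := le_antisymm ((iInf₂_le 0 (.nil p)).trans (by simp)) bot_le
  edist_comm p q := le_antisymm (le_iInf₂ fun c h => iInf₂_le c h.symm)
    (le_iInf₂ fun c h => iInf₂_le c h.symm)
  edist_triangle p q r := by
    simp_rw [ENNReal.iInf_add, ENNReal.add_iInf]
    refine le_iInf₂ fun c h => le_iInf₂ fun c' h' => (iInf₂_le (c + c') (h.trans h')).trans ?_
    rw [ENNReal.ofReal_add h.nonneg h'.nonneg]

theorem edist_def (p q : Tree ε E₀) :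
    edist p q = ⨅ (c : ℝ) (_ : TChain p q c), ENNReal.ofReal c := rfl

theorem edist_le_of_chain {p q : Tree ε E₀} {c : ℝ} (h : TChain p q c) :
    edist p q ≤ ENNReal.ofReal c := iInf₂_le c h

variable (ε) in
/-- Points of the walls. -/
def wallPt (ω : State E₀) (x : E3) (u : ℝ) : Tree ε E₀ := Quot.mk _ (.wall ω x u)

variable (ε) in
/-- Points of the strips. -/
def stripPt (ω : State E₀) (a : Letter) (h : ω.Ok a) (s : E2) (v : ℝ) : Tree ε E₀ :=
  Quot.mk _ (.strip ω a h s v)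

theorem wallPt_clamp (ω : State E₀) (x : E3) (u : ℝ) :
    wallPt ε ω x (clampWall ε ω.typ u) = wallPt ε ω x u := (Quot.sound (.clampW ω x u)).symm

theorem stripPt_clamp (ω : State E₀) (a : Letter) (h : ω.Ok a) (s : E2) (v : ℝ) :
    stripPt ε ω a h s (clampCyl v) = stripPt ε ω a h s v :=
  (Quot.sound (.clampS ω a h s v)).symm

theorem stripPt_zero (ω : State E₀) (a : Letter) (h : ω.Ok a) (s : E2) :
    stripPt ε ω a h s 0 = wallPt ε ω (a.emb s) (side ε a.vert) := Quot.sound (.bot ω a h s)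

theorem stripPt_one (ω : State E₀) (a : Letter) (h : ω.Ok a) (s : E2) :
    stripPt ε ω a h s 1 = wallPt ε (ω.cons a h) (a.embT s) (side ε a.vert) :=
  Quot.sound (.top ω a h s)

theorem clampCyl_coe {v : ℝ} (h : v ∈ Set.Icc (0 : ℝ) 1) : (clampCyl v : ℝ) = v := by
  simp only [clampCyl, Set.coe_projIcc]
  rw [min_eq_right h.2, max_eq_right h.1]

theorem clampWall_coe {E : Wall} {u : ℝ} (h : u ∈ Set.Icc (0 : ℝ) (thickness ε E)) :
    (clampWall ε E u : ℝ) = u :=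
  congrArg Subtype.val (Set.projIcc_of_mem (thickness ε E).2 h)

@[elab_as_elim]
theorem ind {P : Tree ε E₀ → Prop} (p : Tree ε E₀)
    (wall : ∀ ω x u, u ∈ Set.Icc (0 : ℝ) (thickness ε ω.typ) → P (wallPt ε ω x u))
    (strip : ∀ ω a h s v, v ∈ Set.Icc (0 : ℝ) 1 → P (stripPt ε ω a h s v)) : P p := by
  induction p using Quot.ind with
  | mk p =>
    cases p with
    | wall ω x u =>
      have := wall ω x _ (clampWall ε ω.typ u).2
      rwa [wallPt_clamp] at this
    | strip ω a h s v =>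
      have := strip ω a h s _ (clampCyl v).2
      rwa [stripPt_clamp] at this

/-- Functions on the tree of spaces. -/
def lift {Z : Type*} (gw : State E₀ → E3 → ℝ → Z) (gs : ∀ ω : State E₀, ∀ a, ω.Ok a → E2 → ℝ → Z)
    (h1 : ∀ ω x u, gw ω x (clampWall ε ω.typ u) = gw ω x u)
    (h2 : ∀ ω a h s v, gs ω a h s (clampCyl v) = gs ω a h s v)
    (h3 : ∀ ω a h s, gs ω a h s 0 = gw ω (a.emb s) (side ε a.vert))
    (h4 : ∀ ω a h s, gs ω a h s 1 = gw (ω.cons a h) (a.embT s) (side ε a.vert)) :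
    Tree ε E₀ → Z :=
  Quot.lift (fun
    | .wall ω x u => gw ω x u
    | .strip ω a h s v => gs ω a h s v) fun p q h => by
    cases h with
    | clampW ω x u => exact (h1 ω x u).symm
    | clampS ω a h s v => exact (h2 ω a h s v).symm
    | bot ω a h s => exact h3 ω a h s
    | top ω a h s => exact h4 ω a h s

@[simp] theorem lift_wallPt {Z : Type*} (gw : State E₀ → E3 → ℝ → Z) (gs h1 h2 h3 h4 ω x u) :
    lift (ε := ε) gw gs h1 h2 h3 h4 (wallPt ε ω x u) = gw ω x u := rfl

@[simp] theorem lift_stripPt {Z : Type*} (gw : State E₀ → E3 → ℝ → Z)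
    (gs h1 h2 h3 h4 ω a h s v) :
    lift (ε := ε) gw gs h1 h2 h3 h4 (stripPt ε ω a h s v) = gs ω a h s v := rfl

theorem edist_wallPt_le (ω : State E₀) (x x' : E3) (u u' : ℝ) :
    edist (wallPt ε ω x u) (wallPt ε ω x' u') ≤ ENNReal.ofReal √(‖x - x'‖ ^ 2 + (u - u') ^ 2) := by
  have := TChain.cons (TSeg.wall ω x u x' u') (.nil (wallPt ε ω x' u'))
  rw [add_zero] at this
  exact edist_le_of_chain this

theorem edist_stripPt_le (ω : State E₀) (a : Letter) (h : ω.Ok a) (s s' : E2) (v v' : ℝ) :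
    edist (stripPt ε ω a h s v) (stripPt ε ω a h s' v') ≤
      ENNReal.ofReal √(‖s - s'‖ ^ 2 + (v - v') ^ 2) := by
  have := TChain.cons (TSeg.strip ω a h s v s' v') (.nil (stripPt ε ω a h s' v'))
  rw [add_zero] at this
  exact edist_le_of_chain this

/-- Induction along broken lines, with all pieces in standard position. -/
theorem seg_cases {Φ : Tree ε E₀ → Tree ε E₀ → ℝ → Prop}
    (mono : ∀ p q c c', Φ p q c → c ≤ c' → Φ p q c')
    (wall : ∀ ω x u x' u', u ∈ Set.Icc (0 : ℝ) (thickness ε ω.typ) →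
      u' ∈ Set.Icc (0 : ℝ) (thickness ε ω.typ) →
      Φ (wallPt ε ω x u) (wallPt ε ω x' u') √(‖x - x'‖ ^ 2 + (u - u') ^ 2))
    (strip : ∀ ω a h s v s' v', v ∈ Set.Icc (0 : ℝ) 1 → v' ∈ Set.Icc (0 : ℝ) 1 →
      Φ (stripPt ε ω a h s v) (stripPt ε ω a h s' v') √(‖s - s'‖ ^ 2 + (v - v') ^ 2))
    {x y : TPre E₀} {d : ℝ} (h : TSeg x y d) : Φ (Quot.mk _ x) (Quot.mk _ y) d := by
  cases h with
  | wall ω x u x' u' =>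
    have := wall ω x _ x' _ (clampWall ε ω.typ u).2 (clampWall ε ω.typ u').2
    rw [wallPt_clamp, wallPt_clamp] at this
    refine mono _ _ _ _ this (Real.sqrt_le_sqrt ?_)
    have := sq_le_sq.2 (abs_clampWall_le ε ω.typ u u')
    linarith
  | strip ω a h s v s' v' =>
    have := strip ω a h s _ s' _ (clampCyl v).2 (clampCyl v').2
    rw [stripPt_clamp, stripPt_clamp] at this
    refine mono _ _ _ _ this (Real.sqrt_le_sqrt ?_)
    have := sq_le_sq.2 (abs_clampCyl_le v v')
    linarith

/-- Distances are infima of lengths of broken lines, so a map that does not increase distances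
within each piece does not increase any distance. All global 1-Lipschitz estimates on the tree of
spaces rest on this. -/
theorem edist_map_le {Z : Type*} [PseudoEMetricSpace Z] (g : Tree ε E₀ → Z)
    (wall : ∀ ω x u x' u', u ∈ Set.Icc (0 : ℝ) (thickness ε ω.typ) →
      u' ∈ Set.Icc (0 : ℝ) (thickness ε ω.typ) →
      edist (g (wallPt ε ω x u)) (g (wallPt ε ω x' u')) ≤
        ENNReal.ofReal √(‖x - x'‖ ^ 2 + (u - u') ^ 2))
    (strip : ∀ ω a h s v s' v', v ∈ Set.Icc (0 : ℝ) 1 → v' ∈ Set.Icc (0 : ℝ) 1 →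
      edist (g (stripPt ε ω a h s v)) (g (stripPt ε ω a h s' v')) ≤
        ENNReal.ofReal √(‖s - s'‖ ^ 2 + (v - v') ^ 2)) (p q : Tree ε E₀) :
    edist (g p) (g q) ≤ edist p q := by
  rw [edist_def]
  refine le_iInf₂ fun c h => ?_
  induction h with
  | nil p => simp
  | cons hs hc ih =>
    rw [ENNReal.ofReal_add hs.nonneg hc.nonneg]
    refine (edist_triangle _ _ _).trans (add_le_add ?_ ih)
    exact seg_cases (Φ := fun p q c => edist (g p) (g q) ≤ ENNReal.ofReal c)
      (fun p q c c' h h' => h.trans (ENNReal.ofReal_le_ofReal h')) wall strip hs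

theorem lipschitz_of_seg {Z : Type*} [PseudoEMetricSpace Z] (g : Tree ε E₀ → Z)
    (wall : ∀ ω x u x' u', u ∈ Set.Icc (0 : ℝ) (thickness ε ω.typ) →
      u' ∈ Set.Icc (0 : ℝ) (thickness ε ω.typ) →
      edist (g (wallPt ε ω x u)) (g (wallPt ε ω x' u')) ≤
        ENNReal.ofReal √(‖x - x'‖ ^ 2 + (u - u') ^ 2))
    (strip : ∀ ω a h s v s' v', v ∈ Set.Icc (0 : ℝ) 1 → v' ∈ Set.Icc (0 : ℝ) 1 →
      edist (g (stripPt ε ω a h s v)) (g (stripPt ε ω a h s' v')) ≤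
        ENNReal.ofReal √(‖s - s'‖ ^ 2 + (v - v') ^ 2)) : LipschitzWith 1 g :=
  LipschitzWith.of_edist_le fun p q => edist_map_le g wall strip p q

/-! ### Strips seen from either end -/

variable (ε) in
open Classical in
/-- The strip that is attached to the wall `ω` as prescribed by `a`, parametrized from `ω`. -/
def edgePt (ω : State E₀) (a : Letter) (s : E2) (v : ℝ) : Tree ε E₀ :=
  if h : ω.Ok a then stripPt ε ω a h s v
  else State.recOn' (motive := fun _ => Tree ε E₀) (wallPt ε .nil 0 0) (fun ω' a' h' _ => stripPt ε ω' a' h' s (1 - v)) ω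

theorem edgePt_ok {ω : State E₀} {a : Letter} (h : ω.Ok a) (s : E2) (v : ℝ) :
    edgePt ε ω a s v = stripPt ε ω a h s v := by
  rw [edgePt, dif_pos h]

theorem edgePt_cons_rev (ω : State E₀) (a h) (s : E2) (v : ℝ) :
    edgePt ε (ω.cons a h) (a.rev 0) s v = stripPt ε ω a h s (1 - v) := by
  rw [edgePt, dif_neg (State.not_ok_cons ω a h _ rfl)]
  rfl

theorem edgePt_zero {ω : State E₀} {a : Letter} (h : a.src = ω.typ) (s : E2) :
    edgePt ε ω a s 0 = wallPt ε ω (a.emb s) (side ε a.vert) := by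
  rcases State.ok_or_back h with h' | ⟨ω', a', h', rfl, rfl⟩
  · rw [edgePt_ok h', stripPt_zero]
  · rw [edgePt_cons_rev, sub_zero, stripPt_one, Letter.rev_emb_zero, Letter.rev_vert]

/-- Each strip has one description from either end. With this symmetry, arguments near a wall can
ignore which of its strips points to the base wall. -/
theorem edgePt_symm {ω : State E₀} {a : Letter} (h : a.src = ω.typ) (s : E2) (v : ℝ) :
    edgePt ε (ω.nbr a) (a.rev (ω.nbrIdx a)) s v = edgePt ε ω a s (1 - v) := by
  rcases State.ok_or_back h with h' | ⟨ω', a', h', rfl, rfl⟩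
  · rw [edgePt_ok h', State.nbr_ok h', State.nbrIdx_ok h', edgePt_cons_rev]
  · rw [edgePt_cons_rev, State.nbr_cons_rev, State.nbrIdx_cons_rev, Letter.rev_rev, sub_sub_cancel]
    exact edgePt_ok h' s v

theorem edgePt_one {ω : State E₀} {a : Letter} (h : a.src = ω.typ) (s : E2) :
    edgePt ε ω a s 1 =
      wallPt ε (ω.nbr a) ((a.rev (ω.nbrIdx a)).emb s) (side ε a.vert) := by
  have := edgePt_symm (ε := ε) h s 0
  rw [sub_zero] at this
  rw [← this, edgePt_zero, Letter.rev_vert]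
  rw [State.typ_nbr h, Letter.rev_src]

theorem clampCyl_one_sub (v : ℝ) : (clampCyl (1 - v) : ℝ) = 1 - clampCyl v := by
  simp only [clampCyl, Set.coe_projIcc]
  rcases le_total v 0 with h0 | h0
  · rw [min_eq_right (by linarith : v ≤ 1), max_eq_left h0, min_eq_left (by linarith)]
    simp
  · rcases le_total v 1 with h1 | h1
    · rw [min_eq_right h1, max_eq_right h0, min_eq_right (by linarith), max_eq_right (by linarith)]
    · rw [min_eq_left h1, max_eq_right zero_le_one, min_eq_right (by linarith),
        max_eq_left (by linarith), sub_self]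

theorem edgePt_clamp {ω : State E₀} {a : Letter} (h : a.src = ω.typ) (s : E2) (v : ℝ) :
    edgePt ε ω a s (clampCyl v) = edgePt ε ω a s v := by
  rcases State.ok_or_back h with h' | ⟨ω', a', h', rfl, rfl⟩
  · rw [edgePt_ok h', edgePt_ok h', stripPt_clamp]
  · rw [edgePt_cons_rev, edgePt_cons_rev, ← clampCyl_one_sub, stripPt_clamp]

theorem edist_edgePt_le {ω : State E₀} {a : Letter} (h : a.src = ω.typ) (s s' : E2) (v v' : ℝ) :
    edist (edgePt ε ω a s v) (edgePt ε ω a s' v') ≤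
      ENNReal.ofReal √(‖s - s'‖ ^ 2 + (v - v') ^ 2) := by
  rcases State.ok_or_back h with h' | ⟨ω', a', h', rfl, rfl⟩
  · rw [edgePt_ok h', edgePt_ok h']; exact edist_stripPt_le _ _ _ _ _ _ _
  · rw [edgePt_cons_rev, edgePt_cons_rev]
    refine (edist_stripPt_le _ _ _ _ _ _ _).trans (le_of_eq ?_)
    congr 3; ring

end Tree

end TorusComplex

end

/-! ### The covering map from the tree of spaces to the complex -/

noncomputable section

namespace TorusComplex

/-! ### The gluing of the complex in uniform notation -/

/-- The sign that relates the first coordinate of a cylinder to the coordinates in its lifts. -/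
def Cyl.sgn : Cyl → ℝ
  | .x .plus => -1
  | _ => 1

theorem Cyl.sgn_mul_self (C : Cyl) : C.sgn * C.sgn = 1 := by
  rcases C with σ | ⟨σ, i⟩
  · cases σ <;> simp [Cyl.sgn]
  · simp [Cyl.sgn]

theorem Cyl.sgn_int (C : Cyl) : ∃ z : ℤ, C.sgn = z := by
  rcases C with σ | ⟨σ, i⟩
  · cases σ
    · exact ⟨-1, by simp [Cyl.sgn]⟩
    · exact ⟨1, by simp [Cyl.sgn]⟩
  · exact ⟨1, by simp [Cyl.sgn]⟩

/-- The coordinate `u` of an end of a cylinder. -/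
def endCoord (b : Bool) : ℝ := if b then 1 else 0

/-- The points of the thickened tori in vector notation. -/
def wallMk (ε : ℝ≥0) (E : Wall) (x : E3) (u : ℝ) : Y ε :=
  Y.mk (.wall E (x 0) (x 1) (x 2) (clampWall ε E u))

/-- The points of the cylinders in vector notation. -/
def cylMk (ε : ℝ≥0) (C : Cyl) (s : E2) (v : ℝ) : Y ε :=
  Y.mk (.cyl C (C.sgn * s 0) (s 1) (clampCyl v))

/-- The twelve gluing relations become the single rule `h3`: the end `b` of `C` is attached along
`plane C.vert (C.att b)` at height `side`. Coordinates enter through equations so that each relation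
can be matched up to simplification. -/
theorem glue_invariant {ε : ℝ≥0} {Z : Type*} (F : Pre ε → Z)
    (h1 : ∀ E r s t u (k l m : ℤ), F (.wall E r s t u) =
      F (.wall E (r + k * E.period) (s + l * E.period) (t + m * √2) u))
    (h2 : ∀ C s t u (k l : ℤ), F (.cyl C s t u) = F (.cyl C (s + k * C.period) (t + l * √2) u))
    (h3 : ∀ (C : Cyl) (b : Bool) (z : E2) (r s t : ℝ)
      (u : Set.Icc (0 : ℝ) (thickness ε (C.att b))) (s' t' : ℝ) (u' : Set.Icc (0 : ℝ) 1),
      r = plane C.vert (C.att b) z 0 → s = plane C.vert (C.att b) z 1 →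
      t = plane C.vert (C.att b) z 2 → (u : ℝ) = side ε C.vert →
      s' = C.sgn * z 0 → t' = z 1 → (u' : ℝ) = endCoord b →
      F (.wall (C.att b) r s t u) = F (.cyl C s' t' u')) {x y : Pre ε} (h : Glue ε x y) :
    F x = F y := by
  cases h with
  | wallLattice E r s t u k l m => exact h1 E r s t u k l m
  | cylLattice C s t u k l => exact h2 C s t u k l
  | c0_0 σ s t =>
    refine h3 (.c σ 0) false !₂[s, t] _ _ _ _ _ _ _ ?_ ?_ ?_ ?_ ?_ ?_ ?_ <;>
      simp [plane_apply, Cyl.vert, Cyl.att, dirA, dirB, div_eq_mul_inv, side, lo, thickness,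
        Cyl.sgn, endCoord]
  | c0_1 σ s t =>
    refine (h3 (.c σ 0) true !₂[s, t] _ _ _ _ _ _ _ ?_ ?_ ?_ ?_ ?_ ?_ ?_).symm <;>
      simp [plane_apply, Cyl.vert, Cyl.att, dirA, dirB, div_eq_mul_inv, side, lo, thickness,
        Cyl.sgn, endCoord]
  | c1_0 σ s t =>
    refine h3 (.c σ 1) false !₂[s, t] _ _ _ _ _ _ _ ?_ ?_ ?_ ?_ ?_ ?_ ?_ <;>
      simp [plane_apply, Cyl.vert, Cyl.att, dirA, dirB, side, lo, thickness,
        Cyl.sgn, endCoord]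
  | c1_1 σ s t =>
    refine (h3 (.c σ 1) true !₂[s, t] _ _ _ _ _ _ _ ?_ ?_ ?_ ?_ ?_ ?_ ?_).symm <;>
      simp [plane_apply, Cyl.vert, Cyl.att, dirA, dirB, div_eq_mul_inv, side, lo, thickness,
        Cyl.sgn, endCoord]
  | c2_0 σ s t =>
    refine h3 (.c σ 2) false !₂[s, t] _ _ _ _ _ _ _ ?_ ?_ ?_ ?_ ?_ ?_ ?_ <;>
      simp [plane_apply, Cyl.vert, Cyl.att, dirA, dirB, side, hi, thickness,
        Cyl.sgn, endCoord]
  | c2_1 σ s t =>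
    refine (h3 (.c σ 2) true !₂[s, t] _ _ _ _ _ _ _ ?_ ?_ ?_ ?_ ?_ ?_ ?_).symm <;>
      simp [plane_apply, Cyl.vert, Cyl.att, dirA, dirB, side, hi, thickness,
        Cyl.sgn, endCoord]
  | c3_0 σ s t =>
    refine h3 (.c σ 3) false !₂[s, t] _ _ _ _ _ _ _ ?_ ?_ ?_ ?_ ?_ ?_ ?_ <;>
      simp [plane_apply, Cyl.vert, Cyl.att, dirA, dirB, div_eq_mul_inv, side, lo, thickness,
        Cyl.sgn, endCoord]
  | c3_1 σ s t =>
    refine (h3 (.c σ 3) true !₂[s, t] _ _ _ _ _ _ _ ?_ ?_ ?_ ?_ ?_ ?_ ?_).symm <;>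
      simp [plane_apply, Cyl.vert, Cyl.att, dirA, dirB, side, lo, thickness,
        Cyl.sgn, endCoord]
  | xm_0 s t =>
    refine h3 (.x .minus) false !₂[s, t] _ _ _ _ _ _ _ ?_ ?_ ?_ ?_ ?_ ?_ ?_ <;>
      simp [plane_apply, Cyl.vert, Cyl.att, dirA, dirB, div_eq_mul_inv, side, lo, thickness,
        Cyl.sgn, endCoord]
  | xm_1 s t =>
    refine (h3 (.x .minus) true !₂[s, t] _ _ _ _ _ _ _ ?_ ?_ ?_ ?_ ?_ ?_ ?_).symm <;>
      simp [plane_apply, Cyl.vert, Cyl.att, dirA, dirB, side, lo, thickness,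
        Cyl.sgn, endCoord]
  -- The first coordinate of `C_x^+` is reversed (`Cyl.sgn`). This is what allows one `plane` per
  -- vertex space and torus: `C_x^+` meets `E_0^+` in the same plane as `C_0^+`, but in the opposite
  -- direction.
  | xp_0 s t =>
    refine h3 (.x .plus) false !₂[-s, t] _ _ _ _ _ _ _ ?_ ?_ ?_ ?_ ?_ ?_ ?_ <;>
      simp [plane_apply, Cyl.vert, Cyl.att, dirA, dirB, side, lo, thickness,
        Cyl.sgn, endCoord]
  | xp_1 s t =>
    refine (h3 (.x .plus) true !₂[-s, t] _ _ _ _ _ _ _ ?_ ?_ ?_ ?_ ?_ ?_ ?_).symm <;>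
      simp [plane_apply, Cyl.vert, Cyl.att, dirA, dirB, div_eq_mul_inv, side, lo, thickness,
        Cyl.sgn, endCoord]

theorem wallMk_add (ε : ℝ≥0) {E : Wall} (x : E3) {l : E3} (hl : l ∈ E.lat) (u : ℝ) :
    wallMk ε E (x + l) u = wallMk ε E x u := by
  obtain ⟨k, l, m, rfl⟩ := hl
  exact (Quot.sound (.wallLattice E (x 0) (x 1) (x 2) (clampWall ε E u) k l m)).symm

theorem sgn_mul_vlat (C : Cyl) {z : E2} (hz : z ∈ vlat C.vert) : ∃ k l : ℤ,
    C.sgn * z 0 = k * C.period ∧ z 1 = l * √2 := by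
  obtain ⟨k, l, rfl⟩ := hz
  obtain ⟨n, hn⟩ := C.sgn_int
  exact ⟨n * k, l, by simp [hn, C.period_eq, mul_assoc], by simp⟩

theorem cylMk_add (ε : ℝ≥0) {C : Cyl} (s : E2) {z : E2} (hz : z ∈ vlat C.vert) (v : ℝ) :
    cylMk ε C (s + z) v = cylMk ε C s v := by
  obtain ⟨k, l, h0, h1⟩ := sgn_mul_vlat C hz
  have := Quot.sound (.cylLattice C (C.sgn * s 0) (s 1) (clampCyl v) k l : Glue ε _ _)
  rw [← h0, ← h1, ← mul_add] at this
  exact this.symm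

theorem wallMk_plane (ε : ℝ≥0) (C : Cyl) (b : Bool) (s : E2) :
    wallMk ε (C.att b) (plane C.vert (C.att b) s) (side ε C.vert) = cylMk ε C s (endCoord b) := by
  have e0 : (0 : Set.Icc (0 : ℝ) 1) = clampCyl 0 := clampCyl_zero.symm
  have e1 : (1 : Set.Icc (0 : ℝ) 1) = clampCyl 1 := clampCyl_one.symm
  have elo : ∀ E, lo ε E = clampWall ε E 0 := fun E => (clampWall_zero ε E).symm
  have ehi : ∀ E, hi ε E = clampWall ε E (thickness ε E) := fun E => (clampWall_hi ε E).symm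
  have key : ∀ {x y : Pre ε} {p q : Y ε}, Glue ε x y → p = Y.mk x → q = Y.mk y → p = q :=
    fun h hp hq => hp.trans ((Quot.sound h).trans hq.symm)
  rcases C with σ | ⟨σ, i⟩
  · cases σ <;> cases b
    · refine key (.xp_0 (-s 0) (s 1)) ?_ ?_ <;>
        simp [wallMk, cylMk, plane_apply, Cyl.vert, Cyl.att, dirA, dirB, side, elo, e0, endCoord, Cyl.sgn]
    · refine (key (.xp_1 (-s 0) (s 1)) ?_ ?_).symm <;>
        simp [wallMk, cylMk, plane_apply, Cyl.vert, Cyl.att, dirA, dirB, side, elo, e1, endCoord, Cyl.sgn, div_eq_mul_inv]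
    · refine key (.xm_0 (s 0) (s 1)) ?_ ?_ <;>
        simp [wallMk, cylMk, plane_apply, Cyl.vert, Cyl.att, dirA, dirB, side, elo, e0, endCoord, Cyl.sgn, div_eq_mul_inv]
    · refine (key (.xm_1 (s 0) (s 1)) ?_ ?_).symm <;>
        simp [wallMk, cylMk, plane_apply, Cyl.vert, Cyl.att, dirA, dirB, side, elo, e1, endCoord, Cyl.sgn]
  · fin_cases i <;> cases b
    · refine key (.c0_0 σ (s 0) (s 1)) ?_ ?_ <;>
        simp [wallMk, cylMk, plane_apply, Cyl.vert, Cyl.att, dirA, dirB, side, elo, e0, endCoord, Cyl.sgn, div_eq_mul_inv]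
    · refine (key (.c0_1 σ (s 0) (s 1)) ?_ ?_).symm <;>
        simp [wallMk, cylMk, plane_apply, Cyl.vert, Cyl.att, dirA, dirB, side, elo, e1, endCoord, Cyl.sgn, div_eq_mul_inv]
    · refine key (.c1_0 σ (s 0) (s 1)) ?_ ?_ <;>
        simp [wallMk, cylMk, plane_apply, Cyl.vert, Cyl.att, dirA, dirB, side, elo, e0, endCoord, Cyl.sgn]
    · refine (key (.c1_1 σ (s 0) (s 1)) ?_ ?_).symm <;>
        simp [wallMk, cylMk, plane_apply, Cyl.vert, Cyl.att, dirA, dirB, side, elo, e1, endCoord, Cyl.sgn, div_eq_mul_inv]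
    · refine key (.c2_0 σ (s 0) (s 1)) ?_ ?_ <;>
        simp [wallMk, cylMk, plane_apply, Cyl.vert, Cyl.att, dirA, dirB, side, ehi, e0, endCoord, Cyl.sgn, thickness]
    · refine (key (.c2_1 σ (s 0) (s 1)) ?_ ?_).symm <;>
        simp [wallMk, cylMk, plane_apply, Cyl.vert, Cyl.att, dirA, dirB, side, ehi, e1, endCoord, Cyl.sgn, thickness]
    · refine key (.c3_0 σ (s 0) (s 1)) ?_ ?_ <;>
        simp [wallMk, cylMk, plane_apply, Cyl.vert, Cyl.att, dirA, dirB, side, elo, e0, endCoord, Cyl.sgn, div_eq_mul_inv]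
    · refine (key (.c3_1 σ (s 0) (s 1)) ?_ ?_).symm <;>
        simp [wallMk, cylMk, plane_apply, Cyl.vert, Cyl.att, dirA, dirB, side, elo, e1, endCoord, Cyl.sgn]

theorem trans_smul_mem_lat (C : Cyl) (b : Bool) (k : ℤ) :
    k • trans C.vert (C.att b) ∈ (C.att b).lat :=
  AddSubgroup.zsmul_mem _ (trans_mem_lat C b) k

theorem wallMk_emb (ε : ℝ≥0) (a : Letter) (s : E2) :
    wallMk ε a.src (a.emb s) (side ε a.vert) = cylMk ε a.C s (endCoord a.b) := by
  rw [Letter.emb, add_comm]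
  exact (wallMk_add ε _ (trans_smul_mem_lat a.C a.b a.k) _).trans (wallMk_plane ε a.C a.b s)

theorem wallMk_embT (ε : ℝ≥0) (a : Letter) (s : E2) :
    wallMk ε a.tgt (a.embT s) (side ε a.vert) = cylMk ε a.C s (endCoord (!a.b)) :=
  wallMk_plane ε a.C (!a.b) s

theorem edist_wallMk_le (ε : ℝ≥0) (E : Wall) (x x' : E3) (u u' : ℝ) :
    edist (wallMk ε E x u) (wallMk ε E x' u') ≤ ENNReal.ofReal √(‖x - x'‖ ^ 2 + (u - u') ^ 2) := by
  refine (edist_le_of_seg (Seg.wall _ _ _ _ _ _ _ _ _)).trans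
    (ENNReal.ofReal_le_ofReal (Real.sqrt_le_sqrt ?_))
  have h := sq_le_sq.2 (abs_clampWall_le ε E u u')
  rw [EuclideanSpace.real_norm_sq_eq, Fin.sum_univ_three]
  simp only [PiLp.sub_apply]
  linarith

theorem edist_cylMk_le (ε : ℝ≥0) (C : Cyl) (s s' : E2) (v v' : ℝ) :
    edist (cylMk ε C s v) (cylMk ε C s' v') ≤ ENNReal.ofReal √(‖s - s'‖ ^ 2 + (v - v') ^ 2) := by
  refine (edist_le_of_seg (Seg.cyl _ _ _ _ _ _ _)).trans
    (ENNReal.ofReal_le_ofReal (Real.sqrt_le_sqrt ?_))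
  have h := sq_le_sq.2 (abs_clampCyl_le v v')
  rw [EuclideanSpace.real_norm_sq_eq, Fin.sum_univ_two]
  simp only [PiLp.sub_apply]
  rw [← mul_sub, mul_pow, pow_two C.sgn, C.sgn_mul_self, one_mul]
  linarith

/-! ### The covering map from the tree of spaces -/

namespace Tree

variable {ε : ℝ≥0} {E₀ : Wall}

/-- The coordinate along a cylinder, measured from the end `false`. -/
def orient (b : Bool) (v : ℝ) : ℝ := if b then 1 - v else v

theorem orient_zero (b : Bool) : orient b 0 = endCoord b := by cases b <;> simp [orient, endCoord]
theorem orient_one (b : Bool) : orient b 1 = endCoord !b := by cases b <;> simp [orient, endCoord]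
theorem orient_orient (b : Bool) (v : ℝ) : orient b (orient b v) = v := by cases b <;> simp [orient]
theorem orient_not (b : Bool) (v : ℝ) : orient (!b) v = orient b (1 - v) := by
  cases b <;> simp [orient]

theorem clampCyl_orient (b : Bool) (v : ℝ) : (clampCyl (orient b v) : ℝ) = orient b (clampCyl v) := by
  cases b
  · simp [orient]
  · simp only [orient, if_true]; exact clampCyl_one_sub v

theorem cylMk_clamp (C : Cyl) (s : E2) (v : ℝ) : cylMk ε C s (clampCyl v) = cylMk ε C s v := by
  rw [cylMk, cylMk]
  congr 2
  exact Subtype.ext (clampCyl_coe (clampCyl v).2)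

theorem wallMk_clamp (E : Wall) (x : E3) (u : ℝ) :
    wallMk ε E x (clampWall ε E u) = wallMk ε E x u := by
  rw [wallMk, wallMk]
  congr 2
  exact Subtype.ext (clampWall_coe (clampWall ε E u).2)

variable (ε E₀) in
/-- The covering map. -/
def cover : Tree ε E₀ → Y ε :=
  lift (fun ω x u => wallMk ε ω.typ x u) (fun _ a _ s v => cylMk ε a.C s (orient a.b v))
    (fun ω x u => wallMk_clamp ω.typ x u)
    (fun ω a h s v => by rw [← cylMk_clamp, ← cylMk_clamp _ _ (orient a.b v), ← clampCyl_orient,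
      clampCyl_coe (clampCyl _).2])
    (fun ω a h s => by rw [orient_zero, ← h.src, wallMk_emb])
    (fun ω a h s => by rw [orient_one, State.typ_cons, wallMk_embT])

@[simp] theorem cover_wallPt (ω : State E₀) (x : E3) (u : ℝ) :
    cover ε E₀ (wallPt ε ω x u) = wallMk ε ω.typ x u := rfl

@[simp] theorem cover_stripPt (ω : State E₀) (a h) (s : E2) (v : ℝ) :
    cover ε E₀ (stripPt ε ω a h s v) = cylMk ε a.C s (orient a.b v) := rfl

theorem cover_edgePt {ω : State E₀} {a : Letter} (h : a.src = ω.typ) (s : E2) (v : ℝ) :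
    cover ε E₀ (edgePt ε ω a s v) = cylMk ε a.C s (orient a.b v) := by
  rcases State.ok_or_back h with h' | ⟨ω', a', h', rfl, rfl⟩
  · rw [edgePt_ok h', cover_stripPt]
  · rw [edgePt_cons_rev, cover_stripPt, Letter.rev_b, Letter.rev_C, orient_not]

/-- The fibers of the covering map. -/
def fib (E₀ : Wall) : Pre ε → Set (Tree ε E₀)
  | .wall E r s t u => {p | ∃ ω : State E₀, ω.typ = E ∧ ∃ l ∈ E.lat,
      p = wallPt ε ω (!₂[r, s, t] + l) u}
  | .cyl C s t u => {p | ∃ ω a, a.src = ω.typ ∧ a.C = C ∧ ∃ z ∈ vlat C.vert,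
      p = edgePt ε ω a (!₂[C.sgn * s, t] + z) (orient a.b u)}

/-- At an end of a cylinder, a lattice translate of a point of the attaching plane splits into an
index `k`, which selects the strip attached along a parallel plane, and a vector of `vlat`, which is
the ambiguity of coordinates on that strip. The two descriptions of the fiber thereby match. If the
strip is listed from its other end, `edgePt_one` is used instead of `edgePt_zero`. -/
theorem fib_glue {x y : Pre ε} (h : Glue ε x y) : fib E₀ x = fib E₀ y := by
  refine glue_invariant (fib E₀) ?_ ?_ ?_ h
  · intro E r s t u k l m
    set d : E3 := !₂[k * E.period, l * E.period, m * √2]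
    have hd : d ∈ E.lat := ⟨k, l, m, rfl⟩
    have e : (!₂[r + k * E.period, s + l * E.period, t + m * √2] : E3) = !₂[r, s, t] + d := by
      ext i; fin_cases i <;> simp [d]
    ext p
    simp only [fib, e, Set.mem_ofPred_eq]
    constructor
    · rintro ⟨ω, hω, z, hz, rfl⟩
      exact ⟨ω, hω, z - d, sub_mem hz hd, by congr 1; abel⟩
    · rintro ⟨ω, hω, z, hz, rfl⟩
      exact ⟨ω, hω, d + z, add_mem hd hz, by congr 1; abel⟩
  · intro C s t u k l
    set d : E2 := !₂[C.sgn * (k * C.period), l * √2]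
    have hd : d ∈ vlat C.vert := by
      obtain ⟨n, hn⟩ := C.sgn_int
      exact ⟨n * k, l, by simp [d, hn, C.period_eq, mul_assoc]⟩
    have e : (!₂[C.sgn * (s + k * C.period), t + l * √2] : E2) = !₂[C.sgn * s, t] + d := by
      ext i; fin_cases i <;> simp [d, mul_add]
    ext p
    simp only [fib, e, Set.mem_ofPred_eq]
    constructor
    · rintro ⟨ω, a, h, hC, z, hz, rfl⟩
      exact ⟨ω, a, h, hC, z - d, sub_mem hz hd, by congr 1; abel⟩
    · rintro ⟨ω, a, h, hC, z, hz, rfl⟩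
      exact ⟨ω, a, h, hC, d + z, add_mem hd hz, by congr 1; abel⟩
  · intro C b z r s t u s' t' u' hr hs ht hu hs' ht' hu'
    have e : (!₂[r, s, t] : E3) = plane C.vert (C.att b) z := by
      ext i; fin_cases i <;> simp [hr, hs, ht]
    have e' : (!₂[C.sgn * s', t'] : E2) = z := by
      ext i; fin_cases i
      · simp [hs', ← mul_assoc, C.sgn_mul_self]
      · simp [ht']
    ext p
    simp only [fib, e, e', Set.mem_ofPred_eq, hu, hu']
    constructor
    · rintro ⟨ω, hω, l, hl, rfl⟩
      obtain ⟨k, w, hw, rfl⟩ := exists_of_mem_lat C b hl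
      refine ⟨ω, ⟨C, b, k⟩, hω.symm, rfl, w, hw, ?_⟩
      have : orient b (endCoord b) = 0 := by cases b <;> simp [orient, endCoord]
      rw [this, edgePt_zero (a := ⟨C, b, k⟩) hω.symm, Letter.emb, map_add]
      congr 1
      simp only [Letter.vert, Letter.src]; abel
    · rintro ⟨ω, a, h, rfl, w, hw, rfl⟩
      by_cases hb : a.b = b
      · subst hb
        have : orient a.b (endCoord a.b) = 0 := by cases a.b <;> simp [orient, endCoord]
        rw [this, edgePt_zero h]
        refine ⟨ω, h.symm, a.k • trans a.vert a.src + plane a.vert a.src w,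
          add_mem (trans_smul_mem_lat a.C a.b a.k) (plane_mem_lat a.C a.b hw), ?_⟩
        rw [Letter.emb, map_add]
        congr 1
        simp only [Letter.vert, Letter.src]; abel
      · obtain rfl : b = !a.b := by cases b <;> cases h : a.b <;> simp_all
        have : orient a.b (endCoord !a.b) = 1 := by cases a.b <;> simp [orient, endCoord]
        rw [this, edgePt_one h]
        refine ⟨_, State.typ_nbr h, (ω.nbrIdx a) • trans a.vert a.tgt + plane a.vert a.tgt w,
          add_mem (trans_smul_mem_lat a.C (!a.b) _) (plane_mem_lat a.C (!a.b) hw), ?_⟩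
        rw [Letter.emb, map_add]
        congr 1
        simp only [Letter.vert, Letter.src, Letter.rev, Letter.tgt]; abel

/-- By `fib_glue` the candidate fibers are well defined on `Y ε`, so it suffices to find `p` in the
fiber over the representative that defines `cover`. -/
theorem mem_fib {p : Tree ε E₀} {x : Pre ε} (h : cover ε E₀ p = Y.mk x) : p ∈ fib E₀ x := by
  let F : Y ε → Set (Tree ε E₀) := Quot.lift (fib E₀) fun _ _ h => fib_glue h
  change p ∈ F (Y.mk x)
  rw [← h]
  induction p using ind with
  | wall ω x u hu =>
    refine ⟨ω, rfl, 0, zero_mem _, ?_⟩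
    rw [add_zero, wallPt_clamp]
    congr 1
    ext i; fin_cases i <;> rfl
  | strip ω a ha s v hv =>
    refine ⟨ω, a, ha.src, rfl, 0, zero_mem _, ?_⟩
    rw [add_zero, edgePt_ok ha, clampCyl_orient, orient_orient, stripPt_clamp]
    congr 1
    ext i; fin_cases i
    · simp [← mul_assoc, a.C.sgn_mul_self]
    · simp

theorem exists_of_cover_eq_wallMk {p : Tree ε E₀} {E : Wall} {x : E3} {u : ℝ}
    (h : cover ε E₀ p = wallMk ε E x u) :
    ∃ ω : State E₀, ω.typ = E ∧ ∃ l ∈ E.lat, p = wallPt ε ω (x + l) u := by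
  obtain ⟨ω, hω, l, hl, rfl⟩ := mem_fib h
  refine ⟨ω, hω, l, hl, ?_⟩
  subst hω
  rw [wallPt_clamp]
  congr 2
  ext i; fin_cases i <;> rfl

theorem exists_of_cover_eq_cylMk {p : Tree ε E₀} {C : Cyl} {s : E2} {v : ℝ}
    (h : cover ε E₀ p = cylMk ε C s v) :
    ∃ (ω : State E₀) (a : Letter), a.src = ω.typ ∧ a.C = C ∧ ∃ z ∈ vlat C.vert,
      p = edgePt ε ω a (s + z) (orient a.b v) := by
  obtain ⟨ω, a, ha, hC, z, hz, rfl⟩ := mem_fib h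
  refine ⟨ω, a, ha, hC, z, hz, ?_⟩
  rw [← clampCyl_orient, edgePt_clamp ha]
  congr 2
  ext i; fin_cases i
  · simp [← mul_assoc, C.sgn_mul_self]
  · simp

theorem edist_cover_le (p q : Tree ε E₀) : edist (cover ε E₀ p) (cover ε E₀ q) ≤ edist p q := by
  refine edist_map_le _ (fun ω x u x' u' _ _ => edist_wallMk_le _ _ _ _ _ _)
    (fun ω a h s v s' v' _ _ => ?_) p q
  refine (edist_cylMk_le _ _ _ _ _ _).trans (le_of_eq ?_)
  have h1 : (orient a.b v - orient a.b v') ^ 2 = (v - v') ^ 2 := by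
    cases a.b <;> simp [orient]; ring
  rw [h1]

theorem exists_lift_seg {p : Tree ε E₀} {x y : Pre ε} {d : ℝ} (h : Seg x y d)
    (hp : cover ε E₀ p = Y.mk x) : ∃ q, cover ε E₀ q = Y.mk y ∧ edist p q ≤ ENNReal.ofReal d := by
  cases h with
  | wall E r s t u r' s' t' u' =>
    have e : ∀ r s t u, Y.mk (.wall E r s t u) = wallMk ε E !₂[r, s, t] u := fun r s t u => by
      have : clampWall ε E u = u := Subtype.ext (clampWall_coe u.2)
      rw [wallMk, this]; rfl
    rw [e] at hp
    obtain ⟨ω, rfl, l, hl, rfl⟩ := exists_of_cover_eq_wallMk hp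
    refine ⟨wallPt ε ω (!₂[r', s', t'] + l) u', ?_, ?_⟩
    · rw [e, cover_wallPt, wallMk_add ε _ hl]
    · refine (edist_wallPt_le _ _ _ _ _).trans (le_of_eq ?_)
      rw [add_sub_add_right_eq_sub, EuclideanSpace.real_norm_sq_eq, Fin.sum_univ_three]
      rfl
  | cyl C s t u s' t' u' =>
    have e : ∀ s t u, Y.mk (.cyl C s t u) = cylMk ε C !₂[C.sgn * s, t] u := fun s t u => by
      have : clampCyl u = u := Subtype.ext (clampCyl_coe u.2)
      rw [cylMk, this]; simp [← mul_assoc, C.sgn_mul_self]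
    rw [e] at hp
    obtain ⟨ω, a, ha, hC, z, hz, rfl⟩ := exists_of_cover_eq_cylMk hp
    refine ⟨edgePt ε ω a (!₂[C.sgn * s', t'] + z) (orient a.b u'), ?_, ?_⟩
    · rw [e, cover_edgePt ha, orient_orient, hC, cylMk_add ε _ hz]
    · refine (edist_edgePt_le ha _ _ _ _).trans (le_of_eq ?_)
      have h1 : (orient a.b u - orient a.b u') ^ 2 = ((u : ℝ) - u') ^ 2 := by
        cases a.b <;> simp [orient]; ring
      rw [add_sub_add_right_eq_sub, EuclideanSpace.real_norm_sq_eq, Fin.sum_univ_two, h1]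
      simp only [PiLp.sub_apply, Matrix.cons_val_zero, Matrix.cons_val_one]
      rw [← mul_sub, mul_pow, pow_two C.sgn, C.sgn_mul_self, one_mul]

/-- A broken line in `Y ε` lifts segment by segment from any prescribed starting point, and each
lifted segment joins points whose distance is at most the length of the segment. -/
theorem exists_lift_of_edist_lt {p : Tree ε E₀} {b : Y ε} {r : ℝ≥0∞}
    (h : edist (cover ε E₀ p) b < r) : ∃ q, cover ε E₀ q = b ∧ edist p q < r := by
  obtain ⟨c, hc⟩ := iInf_lt_iff.1 h
  obtain ⟨hch, hc⟩ := iInf_lt_iff.1 hc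
  suffices H : ∀ {a b : Y ε} {c : ℝ≥0∞}, Chain a b c → ∀ p, cover ε E₀ p = a →
      ∃ q, cover ε E₀ q = b ∧ edist p q ≤ c by
    obtain ⟨q, hq, hpq⟩ := H hch p rfl
    exact ⟨q, hq, hpq.trans_lt hc⟩
  intro a b c hch
  induction hch with
  | nil a => exact fun p hp => ⟨p, hp, by simp⟩
  | cons hs _ ih =>
    intro p hp
    obtain ⟨q, hq, hpq⟩ := exists_lift_seg hs hp
    obtain ⟨q', hq', hqq'⟩ := ih q hq
    exact ⟨q', hq', (edist_triangle _ q _).trans (add_le_add hpq hqq')⟩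

end Tree

end TorusComplex

end

/-! ### Separation of sheets and the metric on the tree of spaces -/

noncomputable section

namespace TorusComplex

/-- Excludes that two lifts of a cylinder point, both measured from the same end of the cylinder,
belong to neighbouring walls; needed in `eq_of_cover_eq`. -/
theorem Cyl.att_ne_att_not (C : Cyl) (b : Bool) : C.att b ≠ C.att (!b) := by
  rcases C with σ | ⟨σ, i⟩
  · cases σ <;> cases b <;> simp [Cyl.att]
  · fin_cases i <;> cases b <;> simp [Cyl.att]

namespace Letter

theorem emb_injective (a : Letter) : Function.Injective a.emb := fun s s' h => by
  have := norm_emb_sub a s s'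
  rw [h, sub_self, norm_zero] at this
  exact sub_eq_zero.1 (norm_eq_zero.1 this.symm)

end Letter

theorem State.nbr_injOn {E₀ : Wall} {ω : State E₀} {a a' : Letter} (h : a.src = ω.typ)
    (h' : a'.src = ω.typ) (e : ω.nbr a = ω.nbr a') : a = a' := by
  rcases State.ok_or_back h with hk | ⟨ω₁, a₁, h₁, rfl, rfl⟩
  · rcases State.ok_or_back h' with hk' | ⟨ω₂, a₂, h₂, rfl, rfl⟩
    · rw [nbr_ok hk, nbr_ok hk'] at e
      exact (cons_inj e).2
    · rw [nbr_ok hk, nbr_cons_rev] at e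
      have := congrArg len e
      simp only [len_cons] at this
      omega
  · rcases State.ok_or_back h' with hk' | ⟨ω₂, a₂, h₂, e₂, rfl⟩
    · rw [nbr_ok hk', nbr_cons_rev] at e
      have := congrArg len e
      simp only [len_cons] at this
      omega
    · rw [(cons_inj e₂).2]

namespace Tree

variable {ε : ℝ≥0} {E₀ : Wall}

/-! ### The metric near a wall -/

/-- The five-dimensional Euclidean space used to measure distances near a wall. -/
abbrev StarSpace : Type := WithLp 2 (E3 × E2)

/-- Points of `StarSpace`. -/
def starPt (x : E3) (u d : ℝ) : StarSpace := WithLp.toLp 2 (x, !₂[u, d])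

theorem dist_starPt (x x' : E3) (u u' d d' : ℝ) : dist (starPt x u d) (starPt x' u' d') =
    √(‖x - x'‖ ^ 2 + (u - u') ^ 2 + (d - d') ^ 2) := by
  rw [WithLp.prod_dist_eq_of_L2]
  congr 1
  have : dist (starPt x u d).snd (starPt x' u' d').snd ^ 2 = (u - u') ^ 2 + (d - d') ^ 2 := by
    rw [EuclideanSpace.dist_eq, Real.sq_sqrt (by positivity), Fin.sum_univ_two]
    simp [starPt, Real.dist_eq, sq_abs]
  rw [this, ← add_assoc]
  congr 2

theorem abs_le_dist_starPt (x x' : E3) (u u' d d' : ℝ) :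
    |d - d'| ≤ dist (starPt x u d) (starPt x' u' d') := by
  rw [dist_starPt, ← Real.sqrt_sq_eq_abs]
  exact Real.sqrt_le_sqrt (by nlinarith [sq_nonneg ‖x - x'‖, sq_nonneg (u - u')])

theorem norm_le_dist_starPt (x x' : E3) (u u' d d' : ℝ) :
    ‖x - x'‖ ≤ dist (starPt x u d) (starPt x' u' d') := by
  rw [dist_starPt]
  exact Real.le_sqrt_of_sq_le (by nlinarith [sq_nonneg (d - d'), sq_nonneg (u - u')])

theorem starPt_inj {x x' : E3} {u u' d d' : ℝ} (h : dist (starPt x u d) (starPt x' u' d') = 0) :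
    x = x' ∧ u = u' ∧ d = d' := by
  rw [dist_starPt, Real.sqrt_eq_zero (by positivity)] at h
  have h1 := sq_nonneg ‖x - x'‖
  have h2 := sq_nonneg (u - u')
  have h3 := sq_nonneg (d - d')
  refine ⟨?_, ?_, ?_⟩
  · exact sub_eq_zero.1 (norm_eq_zero.1 (pow_eq_zero_iff two_ne_zero |>.1 (by linarith)))
  · exact sub_eq_zero.1 (pow_eq_zero_iff two_ne_zero |>.1 (by linarith))
  · exact sub_eq_zero.1 (pow_eq_zero_iff two_ne_zero |>.1 (by linarith))

theorem abs_min_sub_min_le (P Q R : StarSpace) :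
    |min (1 / 2) (dist Q P) - min (1 / 2) (dist R P)| ≤ dist Q R := by
  refine (abs_min_sub_min_le_max _ _ _ _).trans ?_
  rw [sub_self, abs_zero]
  exact max_le dist_nonneg (abs_dist_sub_le _ _ _)

/-- The signs of the strips at a wall, and the condition on the reference point, that are needed
to define the truncated distance. -/
structure StarData (E₀ : Wall) where
  /-- the wall -/
  ω₀ : State E₀
  /-- the sign of the strip that leads to a neighbour -/
  χ : State E₀ → ℝ
  /-- coordinates of the reference point -/
  x : E3
  /-- coordinates of the reference point -/
  u : ℝ
  /-- coordinates of the reference point -/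
  d : ℝ
  sign : ∀ ω, |χ ω| = 1
  far : ∀ ω, 1 / 2 ≤ |χ ω - d|

namespace StarData

variable (D : StarData E₀)

/-- The distance to the reference point, truncated at `1 / 2`. -/
def trunc (x : E3) (u d : ℝ) : ℝ := min (1 / 2) (dist (starPt x u d) (starPt D.x D.u D.d))

/-- At the far ends of the strips the truncated distance has already reached its maximum. It can
therefore be continued by the constant `1 / 2` to all other walls and strips. -/
theorem trunc_far (x : E3) (u : ℝ) (ω : State E₀) : D.trunc x u (D.χ ω) = 1 / 2 :=
  min_eq_left ((D.far ω).trans (abs_le_dist_starPt _ _ _ _ _ _))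

theorem trunc_sub_le (x x' : E3) (u u' d d' : ℝ) : |D.trunc x u d - D.trunc x' u' d'| ≤
    √(‖x - x'‖ ^ 2 + (u - u') ^ 2 + (d - d') ^ 2) := by
  rw [← dist_starPt]; exact abs_min_sub_min_le _ _ _

open Classical in
variable (ε) in
/-- The truncated distance on the tree of spaces. -/
def fn : Tree ε E₀ → ℝ :=
  lift (fun ω x u => if ω = D.ω₀ then D.trunc x (clampWall ε ω.typ u) 0 else 1 / 2)
    (fun ω a h s v => if ω.cons a h = D.ω₀ then
        D.trunc (a.embT s) (side ε a.vert) (D.χ ω * (1 - clampCyl v))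
      else if ω = D.ω₀ then D.trunc (a.emb s) (side ε a.vert) (D.χ (ω.cons a h) * clampCyl v)
      else 1 / 2)
    (fun ω x u => by rw [clampWall_coe (clampWall _ _ _).2])
    (fun ω a h s v => by rw [clampCyl_coe (clampCyl _).2])
    (fun ω a h s => by
      simp only [clampCyl_zero, Set.Icc.coe_zero, sub_zero, mul_one, mul_zero, trunc_far]
      have hs : side ε a.vert ∈ Set.Icc (0 : ℝ) (thickness ε ω.typ) := h.src ▸ side_mem ε a.C a.b
      rw [clampWall_coe hs]
      by_cases h1 : ω.cons a h = D.ω₀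
      · have : ω ≠ D.ω₀ := fun e => State.cons_ne_self ω a h (h1.trans e.symm)
        simp [h1, this]
      · simp [h1])
    (fun ω a h s => by
      simp only [clampCyl_one, Set.Icc.coe_one, sub_self, mul_one, mul_zero, trunc_far]
      have hs : side ε a.vert ∈ Set.Icc (0 : ℝ) (thickness ε (ω.cons a h).typ) :=
        side_mem ε a.C (!a.b)
      rw [clampWall_coe hs]
      by_cases h1 : ω.cons a h = D.ω₀ <;> simp [h1])

theorem fn_wallPt {ω : State E₀} (hω : ω = D.ω₀) (x : E3) {u : ℝ}
    (hu : u ∈ Set.Icc (0 : ℝ) (thickness ε ω.typ)) :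
    D.fn ε (wallPt ε ω x u) = D.trunc x u 0 := by
  subst hω
  rw [fn, lift_wallPt, if_pos rfl, clampWall_coe hu]

theorem fn_wallPt_ne {ω : State E₀} (h : ω ≠ D.ω₀) (x : E3) (u : ℝ) :
    D.fn ε (wallPt ε ω x u) = 1 / 2 := by
  rw [fn, lift_wallPt, if_neg h]

theorem fn_edgePt {ω : State E₀} (hω : ω = D.ω₀) {a : Letter} (h : a.src = ω.typ) (s : E2) {v : ℝ}
    (hv : v ∈ Set.Icc (0 : ℝ) 1) :
    D.fn ε (edgePt ε ω a s v) =
      D.trunc (a.emb s) (side ε a.vert) (D.χ (ω.nbr a) * v) := by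
  obtain ⟨ω₀, χ, x₀, u₀, d₀, h1, h2⟩ := D
  simp only at hω
  subst hω
  rcases State.ok_or_back h with h' | ⟨ω', a', h', rfl, rfl⟩
  · rw [edgePt_ok h', fn, lift_stripPt, State.nbr_ok h', if_neg (State.cons_ne_self _ _ _),
      if_pos rfl, clampCyl_coe hv]
  · have hv' : 1 - v ∈ Set.Icc (0 : ℝ) 1 := ⟨by linarith [hv.2], by linarith [hv.1]⟩
    simp only
    rw [edgePt_cons_rev, fn, lift_stripPt, State.nbr_cons_rev, if_pos rfl,
      clampCyl_coe hv', sub_sub_cancel, Letter.rev_emb_zero, Letter.rev_vert]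

theorem fn_edgePt_ne {ω : State E₀} {a : Letter} (h : a.src = ω.typ) (h1 : ω ≠ D.ω₀)
    (h2 : ω.nbr a ≠ D.ω₀) (s : E2) (v : ℝ) : D.fn ε (edgePt ε ω a s v) = 1 / 2 := by
  rcases State.ok_or_back h with h' | ⟨ω', a', h', rfl, rfl⟩
  · rw [State.nbr_ok h'] at h2
    rw [edgePt_ok h', fn, lift_stripPt, if_neg h2, if_neg h1]
  · rw [State.nbr_cons_rev] at h2
    rw [edgePt_cons_rev, fn, lift_stripPt, if_neg h1, if_neg h2]

/-- The wall and its strips unfold isometrically, piece by piece, into the Euclidean space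
`StarSpace`, where the truncated distance to a point is 1-Lipschitz. So `fn` bounds distances in the
tree of spaces from below. -/
theorem edist_fn_le (p q : Tree ε E₀) : edist (D.fn ε p) (D.fn ε q) ≤ edist p q := by
  refine edist_map_le _ (fun ω x u x' u' hu hu' => ?_) (fun ω a h s v s' v' hv hv' => ?_) p q
  · rw [edist_dist, Real.dist_eq]
    refine ENNReal.ofReal_le_ofReal ?_
    by_cases h : ω = D.ω₀
    · subst h
      rw [fn_wallPt _ rfl _ hu, fn_wallPt _ rfl _ hu']
      refine (D.trunc_sub_le _ _ _ _ _ _).trans (le_of_eq ?_)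
      simp
    · rw [fn_wallPt_ne _ h, fn_wallPt_ne _ h, sub_self, abs_zero]; exact Real.sqrt_nonneg _
  · rw [edist_dist, Real.dist_eq]
    refine ENNReal.ofReal_le_ofReal ?_
    rw [fn, lift_stripPt, lift_stripPt, clampCyl_coe hv, clampCyl_coe hv']
    have hs : ∀ ω (v v' : ℝ), (D.χ ω * v - D.χ ω * v') ^ 2 = (v - v') ^ 2 := fun ω v v' => by
      rw [← mul_sub, mul_pow, ← sq_abs (D.χ ω), D.sign]; ring
    split_ifs
    · refine (D.trunc_sub_le _ _ _ _ _ _).trans (le_of_eq ?_)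
      rw [hs, Letter.norm_embT_sub]
      congr 1; ring
    · refine (D.trunc_sub_le _ _ _ _ _ _).trans (le_of_eq ?_)
      rw [hs, Letter.norm_emb_sub]
      congr 1; ring
    · rw [sub_self, abs_zero]; exact Real.sqrt_nonneg _

theorem fn_lt {p q : Tree ε E₀} (hp : D.fn ε p = 0) (h : edist p q < ENNReal.ofReal (1 / 2)) :
    D.fn ε q < 1 / 2 := by
  have := (D.edist_fn_le p q).trans_lt h
  rw [hp, edist_dist, Real.dist_eq, zero_sub, abs_neg] at this
  exact (le_abs_self _).trans_lt ((ENNReal.ofReal_lt_ofReal_iff (by norm_num)).1 this)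

theorem fn_eq_zero {p q : Tree ε E₀} (hp : D.fn ε p = 0) (h : edist p q = 0) :
    D.fn ε q = 0 := by
  have := (D.edist_fn_le p q).trans h.le
  rw [hp] at this
  exact (edist_eq_zero.1 (le_antisymm this bot_le)).symm

theorem trunc_lt {x : E3} {u d : ℝ} (h : D.trunc x u d < 1 / 2) :
    D.trunc x u d = dist (starPt x u d) (starPt D.x D.u D.d) :=
  min_eq_right (by_contra fun h' => absurd h (by rw [trunc, min_eq_left (le_of_not_ge h')]; exact lt_irrefl _))

theorem trunc_self : D.trunc D.x D.u D.d = 0 := by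
  rw [trunc, dist_self]; norm_num

theorem exists_of_fn_lt {q : Tree ε E₀} (h : D.fn ε q < 1 / 2) :
    (∃ x, ∃ u ∈ Set.Icc (0 : ℝ) (thickness ε D.ω₀.typ), q = wallPt ε D.ω₀ x u) ∨
    (∃ a s, ∃ v ∈ Set.Icc (0 : ℝ) 1, a.src = D.ω₀.typ ∧ q = edgePt ε D.ω₀ a s v) := by
  induction q using ind with
  | wall ω x u hu =>
    by_cases hω : ω = D.ω₀
    · subst hω; exact .inl ⟨x, u, hu, rfl⟩
    · rw [fn_wallPt_ne _ hω] at h; exact absurd h (lt_irrefl _)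
  | strip ω a ha s v hv =>
    by_cases h1 : ω = D.ω₀
    · subst h1; exact .inr ⟨a, s, v, hv, ha.src, (edgePt_ok ha s v).symm⟩
    · by_cases h2 : ω.cons a ha = D.ω₀
      · refine .inr ⟨a.rev 0, s, 1 - v, ⟨by linarith [hv.2], by linarith [hv.1]⟩, by
          rw [← h2]; simp, ?_⟩
        rw [← h2, edgePt_cons_rev, sub_sub_cancel]
      · rw [← edgePt_ok ha, fn_edgePt_ne _ ha.src h1 (by rwa [State.nbr_ok ha])] at h
        exact absurd h (lt_irrefl _)

end StarData

/-- The distances to points of a wall. -/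
def wallStar (ω : State E₀) (x : E3) (u : ℝ) : StarData E₀ where
  ω₀ := ω
  χ _ := 1
  x := x
  u := u
  d := 0
  sign _ := abs_one
  far _ := by norm_num

open Classical in
/-- The distances to points of a strip. -/
def edgeStar (ε : ℝ≥0) (ω : State E₀) (a : Letter) (s : E2) (v : ℝ) (h0 : 0 ≤ v)
    (h1 : v ≤ 1 / 2) : StarData E₀ where
  ω₀ := ω
  -- The strip of the reference point occupies the positive half-axis and all other strips are
  -- folded onto the negative one. Points of other strips can then have distance zero from the
  -- reference point only on the wall itself.
  χ ω' := if ω' = ω.nbr a then 1 else -1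
  x := a.emb s
  u := side ε a.vert
  d := v
  sign _ := by split_ifs <;> simp
  far _ := by
    split_ifs
    · exact le_abs.2 (.inl (by linarith))
    · exact le_abs.2 (.inr (by linarith))

theorem wallStar_self (ω : State E₀) (x : E3) {u : ℝ}
    (hu : u ∈ Set.Icc (0 : ℝ) (thickness ε ω.typ)) :
    (wallStar ω x u).fn ε (wallPt ε ω x u) = 0 := by
  rw [StarData.fn_wallPt (ω := ω) (wallStar ω x u) rfl x hu]
  exact StarData.trunc_self _

theorem edgeStar_self {ω : State E₀} {a : Letter} (h : a.src = ω.typ) (s : E2) {v : ℝ}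
    (h0 : 0 ≤ v) (h1 : v ≤ 1 / 2) :
    (edgeStar ε ω a s v h0 h1).fn ε (edgePt ε ω a s v) = 0 := by
  rw [StarData.fn_edgePt (ω := ω) (edgeStar ε ω a s v h0 h1) rfl h s ⟨h0, by linarith⟩]
  have : (edgeStar ε ω a s v h0 h1).χ (ω.nbr a) * v = v := by simp [edgeStar]
  exact (congrArg _ this).trans (StarData.trunc_self _)

/-- Every point lies in a wall or in the half of a strip that is close to a wall. -/
theorem half_cases {P : Tree ε E₀ → Prop} (p : Tree ε E₀)
    (wall : ∀ ω x u, u ∈ Set.Icc (0 : ℝ) (thickness ε ω.typ) → P (wallPt ε ω x u))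
    (edge : ∀ ω a s v, a.src = State.typ ω → 0 ≤ v → v ≤ 1 / 2 → P (edgePt ε ω a s v)) : P p := by
  induction p using ind with
  | wall ω x u hu => exact wall ω x u hu
  | strip ω a h s v hv =>
    rcases le_total v (1 / 2) with h1 | h1
    · rw [← edgePt_ok h]; exact edge _ _ _ _ h.src hv.1 h1
    · have := edge (ω.cons a h) (a.rev 0) s (1 - v) (by simp) (by linarith [hv.2]) (by linarith)
      rwa [edgePt_cons_rev, sub_sub_cancel] at this

theorem exists_of_cover_eq_cylMk' {p : Tree ε E₀} {C : Cyl} (b : Bool) {s : E2} {v : ℝ}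
    (h : cover ε E₀ p = cylMk ε C s (orient b v)) :
    ∃ (ω : State E₀) (k : ℤ), C.att b = ω.typ ∧ ∃ z ∈ vlat C.vert,
      p = edgePt ε ω ⟨C, b, k⟩ (s + z) v := by
  obtain ⟨ω, a, ha, rfl, z, hz, rfl⟩ := exists_of_cover_eq_cylMk h
  by_cases hb : a.b = b
  · subst hb
    exact ⟨ω, a.k, ha, z, hz, by rw [orient_orient]⟩
  · obtain rfl : b = !a.b := by cases b <;> cases h : a.b <;> simp_all
    refine ⟨ω.nbr a, ω.nbrIdx a, ?_, z, hz, ?_⟩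
    · rw [State.typ_nbr ha]; rfl
    · rw [orient_not, orient_orient]
      exact (edgePt_symm ha _ _).symm

/-- With the truncated distance to `p`, a point `q` closer than `1 / 2` must lie at the same wall.
There the coordinates of `p` and `q` differ by a lattice vector shorter than `1 / 2`, which is zero.
For points of strips, both are measured from the wall at the nearer end, and `index_unique` shows
that the strips coincide. -/
theorem eq_of_cover_eq {p q : Tree ε E₀} (h : cover ε E₀ p = cover ε E₀ q)
    (hd : edist p q < ENNReal.ofReal (1 / 2)) : p = q := by
  revert h hd
  refine half_cases (P := fun p => cover ε E₀ p = cover ε E₀ q →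
    edist p q < ENNReal.ofReal (1 / 2) → p = q) p (fun ω x u hu h hd => ?_)
    (fun ω a s v ha h0 h1 h hd => ?_)
  · obtain ⟨ω', hω', l, hl, rfl⟩ := exists_of_cover_eq_wallMk h.symm
    have hlt := (wallStar ω x u).fn_lt (wallStar_self ω x hu) hd
    by_cases e : ω' = ω
    · subst e
      rw [StarData.fn_wallPt (ω := ω') (wallStar ω' x u) rfl _ hu] at hlt
      rw [StarData.trunc_lt _ hlt] at hlt
      have h2 := (norm_le_dist_starPt _ _ _ _ _ _).trans_lt hlt
      have : l = 0 := eq_zero_of_mem_lat hl (by simpa [wallStar] using h2)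
      rw [this, add_zero]
    · rw [StarData.fn_wallPt_ne (wallStar ω x u) e] at hlt
      exact absurd hlt (lt_irrefl _)
  · rw [cover_edgePt ha] at h
    obtain ⟨ω', k, hω', z, hz, rfl⟩ := exists_of_cover_eq_cylMk' a.b h.symm
    have hlt := (edgeStar ε ω a s v h0 h1).fn_lt (edgeStar_self ha s h0 h1) hd
    by_cases e : ω' = ω
    · subst e
      rw [StarData.fn_edgePt (ω := ω') (edgeStar ε ω' a s v h0 h1) rfl (a := ⟨a.C, a.b, k⟩) ha _
        ⟨h0, by linarith⟩] at hlt
      rw [StarData.trunc_lt _ hlt] at hlt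
      have h2 := (norm_le_dist_starPt _ _ _ _ _ _).trans_lt hlt
      have e2 : Letter.emb ⟨a.C, a.b, k⟩ (s + z) - a.emb s =
          (k - a.k) • trans a.C.vert (a.C.att a.b) + plane a.C.vert (a.C.att a.b) z := by
        simp only [Letter.emb, Letter.vert, Letter.src, map_add, sub_smul]; abel
      have h3 : (k - a.k) • trans a.C.vert (a.C.att a.b) + plane a.C.vert (a.C.att a.b) z = 0 := by
        refine eq_zero_of_mem_lat (add_mem (trans_smul_mem_lat a.C a.b _) (plane_mem_lat a.C a.b hz)) ?_
        rw [← e2]; exact h2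
      have h4 := index_unique a.C a.b (k := k - a.k) (k' := 0) (s := z) (s' := 0)
        (by rw [h3]; simp)
      have h5 : k = a.k := by omega
      rw [h4.2, add_zero, h5]
    · rw [StarData.fn_edgePt_ne (edgeStar ε ω a s v h0 h1) (a := ⟨a.C, a.b, k⟩) hω' e] at hlt
      · exact absurd hlt (lt_irrefl _)
      · intro e'
        have := State.typ_nbr (a := ⟨a.C, a.b, k⟩) hω'
        rw [e'] at this
        exact a.C.att_ne_att_not a.b (ha.trans this)

theorem eq_of_edist_eq_zero' {p q : Tree ε E₀} (hd : edist p q = 0) : p = q := by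
  revert hd
  refine half_cases (P := fun p => edist p q = 0 → p = q) p (fun ω x u hu hd => ?_)
    (fun ω a s v ha h0 h1 hd => ?_)
  · have hz := (wallStar ω x u).fn_eq_zero (wallStar_self ω x hu) hd
    have hlt : (wallStar ω x u).fn ε q < 1 / 2 := by rw [hz]; norm_num
    rcases (wallStar ω x u).exists_of_fn_lt hlt with ⟨x', u', hu', rfl⟩ | ⟨a, s, v, hv, ha, rfl⟩
    · rw [StarData.fn_wallPt _ rfl _ hu'] at hz hlt
      rw [StarData.trunc_lt _ hlt] at hz
      obtain ⟨e1, e2, -⟩ := starPt_inj hz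
      rw [e1, e2]; rfl
    · rw [StarData.fn_edgePt _ rfl ha _ hv] at hz hlt
      rw [StarData.trunc_lt _ hlt] at hz
      obtain ⟨e1, e2, e3⟩ := starPt_inj hz
      have e3' : v = 0 := by simpa [wallStar] using e3
      subst e3'
      change wallPt ε ω x u = edgePt ε ω a s 0
      rw [edgePt_zero (ω := ω) ha, e1, e2]; rfl
  · have hz := (edgeStar ε ω a s v h0 h1).fn_eq_zero (edgeStar_self ha s h0 h1) hd
    have hlt : (edgeStar ε ω a s v h0 h1).fn ε q < 1 / 2 := by rw [hz]; norm_num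
    rcases (edgeStar ε ω a s v h0 h1).exists_of_fn_lt hlt with
      ⟨x', u', hu', rfl⟩ | ⟨a', s', v', hv', ha', rfl⟩
    · rw [StarData.fn_wallPt _ rfl _ hu'] at hz hlt
      rw [StarData.trunc_lt _ hlt] at hz
      obtain ⟨e1, e2, e3⟩ := starPt_inj hz
      have e3' : v = 0 := e3.symm
      change edgePt ε ω a s v = wallPt ε ω x' u'
      rw [e3', edgePt_zero ha, e1, e2]; rfl
    · rw [StarData.fn_edgePt _ rfl ha' _ hv'] at hz hlt
      rw [StarData.trunc_lt _ hlt] at hz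
      obtain ⟨e1, e2, e3⟩ := starPt_inj hz
      have e1' : a'.emb s' = a.emb s := e1
      have e2' : side ε a'.vert = side ε a.vert := e2
      change edgePt ε ω a s v = edgePt ε ω a' s' v'
      change (edgeStar ε ω a s v h0 h1).χ (ω.nbr a') * v' = v at e3
      by_cases hn : ω.nbr a' = ω.nbr a
      · have e3' : 1 * v' = v := by simpa [edgeStar, hn] using e3
        obtain rfl := State.nbr_injOn ha' ha hn
        rw [a'.emb_injective e1', ← e3', one_mul]
      · have e3' : -1 * v' = v := by simpa [edgeStar, hn] using e3
        have hv0 : v = 0 := by linarith [hv'.1]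
        have hv0' : v' = 0 := by linarith
        rw [hv0, hv0', edgePt_zero ha, edgePt_zero (ω := ω) ha', e1', e2']

variable (ε E₀) in
/-- The base point. -/
def origin : Tree ε E₀ := wallPt ε .nil 0 0

theorem edist_origin_lt_top (p : Tree ε E₀) : edist (origin ε E₀) p < ⊤ := by
  have key : ∀ (ω : State E₀) (x : E3) (u : ℝ), edist (origin ε E₀) (wallPt ε ω x u) < ⊤ := by
    intro ω
    induction ω using State.induct with
    | nil => exact fun x u => (edist_wallPt_le _ _ _ _ _).trans_lt ENNReal.ofReal_lt_top
    | cons ω a h ih =>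
      intro x u
      refine (edist_triangle _ (wallPt ε ω (a.emb 0) (side ε a.vert)) _).trans_lt
        (ENNReal.add_lt_top.2 ⟨ih _ _, ?_⟩)
      rw [← stripPt_zero ω a h]
      refine (edist_triangle _ (stripPt ε ω a h 0 1) _).trans_lt
        (ENNReal.add_lt_top.2 ⟨(edist_stripPt_le _ _ _ _ _ _ _).trans_lt ENNReal.ofReal_lt_top, ?_⟩)
      rw [stripPt_one]
      exact (edist_wallPt_le _ _ _ _ _).trans_lt ENNReal.ofReal_lt_top
  induction p using ind with
  | wall ω x u hu => exact key ω x u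
  | strip ω a h s v hv =>
    refine (edist_triangle _ (wallPt ε ω (a.emb s) (side ε a.vert)) _).trans_lt
        (ENNReal.add_lt_top.2 ⟨key _ _ _, ?_⟩)
    rw [← stripPt_zero ω a h]
    exact (edist_stripPt_le _ _ _ _ _ _ _).trans_lt ENNReal.ofReal_lt_top

instance : EMetricSpace (Tree ε E₀) where
  eq_of_edist_eq_zero := eq_of_edist_eq_zero'

instance : MetricSpace (Tree ε E₀) :=
  EMetricSpace.toMetricSpace fun p q => by
    refine ((edist_triangle p (origin ε E₀) q).trans_lt ?_).ne
    rw [edist_comm p]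
    exact ENNReal.add_lt_top.2 ⟨edist_origin_lt_top p, edist_origin_lt_top q⟩

end Tree

end TorusComplex

end

/-! ### Metric coverings of length spaces -/

noncomputable section

/-- Maps of length spaces that are covering maps with sheets separated by `δ`. -/
structure IsMetricCovering {M Z : Type} [PseudoEMetricSpace M] [PseudoEMetricSpace Z] (f : M → Z)
    (δ : ℝ≥0∞) : Prop where
  pos : 0 < δ
  edist_le : ∀ p q, edist (f p) (f q) ≤ edist p q
  exists_lift : ∀ {p b r}, edist (f p) b < r → ∃ q, f q = b ∧ edist p q < r
  separated : ∀ {p q}, f p = f q → edist p q < δ → p = q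

namespace IsMetricCovering

variable {M Z : Type} [PseudoEMetricSpace M] [PseudoEMetricSpace Z] {f : M → Z} {δ : ℝ≥0∞}

theorem continuous (h : IsMetricCovering f δ) : Continuous f :=
  (LipschitzWith.of_edist_le h.edist_le).continuous

/-- If the images were closer, a lift of the shorter distance would end at another point of the
fiber of `f q`, less than `δ` away from `q`. -/
theorem edist_eq (h : IsMetricCovering f δ) {p q : M} (hd : edist p q < δ / 2) :
    edist (f p) (f q) = edist p q := by
  refine le_antisymm (h.edist_le p q) (le_of_not_gt fun hlt => ?_)
  obtain ⟨q', hq', hd'⟩ := h.exists_lift hlt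
  have : q' = q := h.separated hq' <| calc
    edist q' q ≤ edist p q' + edist p q := by rw [edist_comm p q']; exact edist_triangle _ _ _
    _ < δ / 2 + δ / 2 := ENNReal.add_lt_add (hd'.trans hd) hd
    _ = δ := ENNReal.add_halves δ
  exact lt_irrefl _ (this ▸ hd')

theorem isOpenMap (h : IsMetricCovering f δ) : IsOpenMap f := by
  intro U hU
  rw [EMetric.isOpen_iff]
  rintro _ ⟨p, hp, rfl⟩
  obtain ⟨r, hr, hb⟩ := EMetric.isOpen_iff.1 hU p hp
  refine ⟨r, hr, fun b hb' => ?_⟩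
  obtain ⟨q, hq, hd⟩ := h.exists_lift (p := p) (b := b) (r := r) (by rw [edist_comm]; exact hb')
  exact ⟨q, hb (by rw [Metric.mem_eball, edist_comm]; exact hd), hq⟩

/-- The sheets over the ball of radius `δ / 4` about `x` are the balls of that radius about the
points of the fiber: lifting makes them surject and cover the preimage, and separation makes them
injective and disjoint. If the fiber is empty, lifting shows that the whole ball has empty preimage.
-/
theorem isCoveringMap (h : IsMetricCovering f δ) : IsCoveringMap f := by
  intro x
  have hδ4 : 0 < δ / 4 := ENNReal.div_pos h.pos.ne' (by norm_num)
  have h4 : δ / 4 + δ / 4 ≤ δ := by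
    have : δ / 4 + δ / 4 = δ / 2 := by
      rw [← ENNReal.add_div, ← two_mul, ENNReal.div_eq_div_iff (by norm_num) (by norm_num)
        (by norm_num) (by norm_num)]
      ring
    rw [this]; exact ENNReal.half_le_self
  by_cases hx : Nonempty (f ⁻¹' {x})
  · let _ : TopologicalSpace (f ⁻¹' {x}) := ⊥
    have : DiscreteTopology (f ⁻¹' {x}) := ⟨rfl⟩
    have : Nonempty (Z → M) := ⟨fun _ => hx.some.1⟩
    have surj : ∀ i : f ⁻¹' {x}, (Metric.eball (i : M) (δ / 4)).SurjOn f (Metric.eball x (δ / 4)) := by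
      rintro ⟨i, rfl⟩ b hb
      rw [Metric.mem_eball, edist_comm] at hb
      obtain ⟨q, hq, hd⟩ := h.exists_lift hb
      exact ⟨q, by rw [Metric.mem_eball, edist_comm]; exact hd, hq⟩
    refine (IsEvenlyCovered.of_trivialization (I := f ⁻¹' {x})
      (t := Metric.isOpen_eball.trivializationDiscrete (f := f)
        (fun i : f ⁻¹' {x} => Metric.eball (i : M) (δ / 4)) (Metric.eball x (δ / 4))
        ?_ ?_ surj ?_ ?_) ?_).to_isEvenlyCovered_preimage
    · intro i W hW
      refine ⟨fun hW' => (hW'.preimage h.continuous).inter Metric.isOpen_eball, fun hW' => ?_⟩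
      have : W = f '' (f ⁻¹' W ∩ Metric.eball (i : M) (δ / 4)) := by
        ext w
        constructor
        · intro hw
          obtain ⟨q, hq, rfl⟩ := surj i (hW hw)
          exact ⟨q, ⟨hw, hq⟩, rfl⟩
        · rintro ⟨q, ⟨hq, -⟩, rfl⟩
          exact hq
      rw [this]
      exact h.isOpenMap _ hW'
    · intro i p hp q hq hpq
      refine h.separated hpq ((edist_triangle_right p q i).trans_lt ?_)
      exact (ENNReal.add_lt_add hp hq).trans_le h4
    · intro i j hij
      refine Set.disjoint_left.2 fun p hp hq => hij (Subtype.ext (h.separated ?_ ?_))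
      · rw [i.2, j.2]
      · refine (edist_triangle_left (i : M) j p).trans_lt ?_
        exact (ENNReal.add_lt_add hp hq).trans_le h4
    · intro p hp
      obtain ⟨q, hq, hd⟩ := h.exists_lift (p := p) (b := x) hp
      exact Set.mem_iUnion.2 ⟨⟨q, hq⟩, hd⟩
    · exact Metric.mem_eball_self hδ4
  · have : IsEmpty (f ⁻¹' {x}) := not_nonempty_iff.1 hx
    refine (IsEvenlyCovered.of_preimage_eq_empty (I := f ⁻¹' {x}) (U := Metric.eball x (δ / 4))
      (Metric.eball_mem_nhds x hδ4) ?_)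
    refine Set.eq_empty_of_forall_notMem fun p hp => hx ?_
    obtain ⟨q, hq, -⟩ := h.exists_lift (p := p) (b := x) hp
    exact ⟨⟨q, hq⟩⟩

/-- Subdivide the path so finely that consecutive points are less than `δ / 2` apart. On such pairs
`f` preserves distances, so the distance upstairs is bounded by a sum that occurs in the variation
downstairs. -/
theorem edist_le_pathLength (h : IsMetricCovering f δ) {p q : M} (c : Path p q) :
    edist p q ≤ eVariationOn (fun t : unitInterval => f (c t)) Set.univ := by
  have hδ4 : 0 < δ / 4 := ENNReal.div_pos h.pos.ne' (by norm_num)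
  obtain ⟨t, t0, tm, ⟨n, tn⟩, ht⟩ := exists_monotone_Icc_subset_open_cover_unitInterval
    (c := fun s : unitInterval => c ⁻¹' Metric.eball (c s) (δ / 4))
    (fun s => Metric.isOpen_eball.preimage c.continuous)
    (fun s _ => Set.mem_iUnion.2 ⟨s, Metric.mem_eball_self hδ4⟩)
  have hstep : ∀ i, edist (c (t i)) (c (t (i + 1))) = edist (f (c (t i))) (f (c (t (i + 1)))) := by
    intro i
    obtain ⟨s, hs⟩ := ht i
    refine (h.edist_eq ?_).symm
    have h1 : c (t i) ∈ Metric.eball (c s) (δ / 4) := hs ⟨le_rfl, tm i.le_succ⟩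
    have h2 : c (t (i + 1)) ∈ Metric.eball (c s) (δ / 4) := hs ⟨tm i.le_succ, le_rfl⟩
    refine (edist_triangle_right _ _ (c s)).trans_lt ((ENNReal.add_lt_add h1 h2).trans_le ?_)
    rw [← ENNReal.add_div, ← two_mul]
    refine le_of_eq ((ENNReal.div_eq_div_iff (by norm_num) (by norm_num)
        (by norm_num) (by norm_num)).2 ?_)
    ring
  have h1 := edist_le_range_sum_edist (fun i => c (t i)) n
  simp only [t0, tn n le_rfl, c.source, c.target] at h1
  refine h1.trans ?_
  rw [Finset.sum_congr rfl fun i _ => hstep i]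
  have := eVariationOn.sum_le (f := fun t : unitInterval => f (c t)) (s := Set.univ) (n := n) tm
    (fun _ => Set.mem_univ _)
  refine le_trans (le_of_eq (Finset.sum_congr rfl fun i _ => edist_comm _ _)) this

end IsMetricCovering

end

/-! ### Simply connected coverings and the universal cover -/

noncomputable section

namespace UniversalCover

variable {Z : Type} [PseudoEMetricSpace Z] {z₀ : Z}

/-- The point of the universal cover represented by a path. -/
def ofPath {y : Z} (p : Path z₀ y) : UniversalCover Z z₀ := ⟨y, .mk p⟩

theorem ofPath_congr {y y' : Z} {p : Path z₀ y} {p' : Path z₀ y'} (h : ∀ t, p t = p' t) :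
    ofPath p = ofPath p' := by
  obtain rfl : y = y' := by rw [← p.target, ← p'.target, h]
  obtain rfl : p = p' := Path.ext (funext h)
  rfl

theorem ofPath_eq {y : Z} {p p' : Path z₀ y}
    (h : Path.Homotopic.Quotient.mk p = Path.Homotopic.Quotient.mk p') : ofPath p = ofPath p' :=
  congrArg (UniversalCover.mk y) h

theorem exists_ofPath (a : UniversalCover Z z₀) : ∃ p : Path z₀ a.pt, a = ofPath p := by
  obtain ⟨y, c⟩ := a
  obtain ⟨p, rfl⟩ := Path.Homotopic.Quotient.mk_surjective c
  exact ⟨p, rfl⟩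

theorem mk_symm_trans_trans {x y z : Z} (p : Path x y) (q : Path x z) :
    Path.Homotopic.Quotient.mk (p.trans (p.symm.trans q)) = Path.Homotopic.Quotient.mk q := by
  rw [Path.Homotopic.Quotient.mk_trans, Path.Homotopic.Quotient.mk_trans,
    Path.Homotopic.Quotient.mk_symm]
  let a : (⟨x⟩ : FundamentalGroupoid Z) ⟶ ⟨y⟩ := Path.Homotopic.Quotient.mk p
  let b : (⟨x⟩ : FundamentalGroupoid Z) ⟶ ⟨z⟩ := Path.Homotopic.Quotient.mk q
  change CategoryTheory.CategoryStruct.comp a (CategoryTheory.CategoryStruct.comp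
    (CategoryTheory.Groupoid.inv a) b) = b
  simp

theorem deckMap_injective {γ : FundamentalGroup Z z₀} {a : UniversalCover Z z₀}
    (h : deckMap γ a = a) : γ = 1 := by
  obtain ⟨y, p⟩ := a
  let a : (⟨z₀⟩ : FundamentalGroupoid Z) ⟶ ⟨y⟩ := p
  let g : (⟨z₀⟩ : FundamentalGroupoid Z) ⟶ ⟨z₀⟩ := γ
  have h' : CategoryTheory.CategoryStruct.comp (CategoryTheory.Groupoid.inv g) a = a := by
    have := h
    rw [deckMap] at this
    injection this with _ h2
  have : g = CategoryTheory.CategoryStruct.id _ := by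
    have h3 := congrArg (fun b => CategoryTheory.CategoryStruct.comp g
      (CategoryTheory.CategoryStruct.comp b (CategoryTheory.Groupoid.inv a))) h'
    simpa using h3.symm
  exact this

theorem exists_deckMap_eq {a b : UniversalCover Z z₀} (h : a.pt = b.pt) :
    ∃ γ : FundamentalGroup Z z₀, deckMap γ a = b := by
  obtain ⟨y, p⟩ := a
  obtain ⟨y', q⟩ := b
  obtain rfl : y = y' := h
  let a : (⟨z₀⟩ : FundamentalGroupoid Z) ⟶ ⟨y⟩ := p
  let b : (⟨z₀⟩ : FundamentalGroupoid Z) ⟶ ⟨y⟩ := q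
  refine ⟨CategoryTheory.CategoryStruct.comp a (CategoryTheory.Groupoid.inv b), ?_⟩
  have : CategoryTheory.CategoryStruct.comp (CategoryTheory.Groupoid.inv
    (CategoryTheory.CategoryStruct.comp a (CategoryTheory.Groupoid.inv b))) a = b := by simp
  exact congrArg (UniversalCover.mk y) this

theorem deckMap_mk_ofPath {y : Z} (l : Path z₀ z₀) (p : Path z₀ y) :
    deckMap (FundamentalGroup.fromPath (.mk l)) (ofPath p) = ofPath (l.symm.trans p) := rfl

/-- The map of universal covers induced by a continuous map. -/
def map {Z' : Type} [PseudoEMetricSpace Z'] (g : C(Z, Z')) (a : UniversalCover Z z₀) :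
    UniversalCover Z' (g z₀) := ⟨g a.pt, a.cls.map g⟩

theorem map_ofPath {Z' : Type} [PseudoEMetricSpace Z'] (g : C(Z, Z')) {y : Z} (p : Path z₀ y) :
    map g (ofPath p) = ofPath (p.map g.continuous) := rfl

theorem map_deckMap {Z' : Type} [PseudoEMetricSpace Z'] (g : C(Z, Z')) (γ : FundamentalGroup Z z₀)
    (a : UniversalCover Z z₀) :
    map g (deckMap γ a) = deckMap (FundamentalGroup.map g z₀ γ) (map g a) := by
  obtain ⟨p, ha⟩ := exists_ofPath a
  rw [ha]
  obtain ⟨l, hl⟩ := Path.Homotopic.Quotient.mk_surjective (FundamentalGroup.toPath γ)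
  obtain rfl : γ = FundamentalGroup.fromPath (.mk l) := hl.symm
  have : FundamentalGroup.map g z₀ (FundamentalGroup.fromPath (.mk l)) =
    FundamentalGroup.fromPath (.mk (l.map g.continuous)) := rfl
  rw [this, map_ofPath, deckMap_mk_ofPath, deckMap_mk_ofPath, map_ofPath, Path.map_trans,
    Path.map_symm]

theorem edist_ofPath_trans {y z w : Z} (p : Path z₀ y) (q : Path y z) (r : Path z w) :
    edist (ofPath (p.trans q)) (ofPath (p.trans (q.trans r))) =
      ⨅ (c : Path z w) (_ : Path.Homotopic.Quotient.mk c = Path.Homotopic.Quotient.mk r),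
        pathLength c := by
  have : (Path.Homotopic.Quotient.mk (p.trans q)).symm.trans
      (Path.Homotopic.Quotient.mk (p.trans (q.trans r))) = Path.Homotopic.Quotient.mk r := by
    simp only [Path.Homotopic.Quotient.mk_trans]
    let a : (⟨z₀⟩ : FundamentalGroupoid Z) ⟶ ⟨y⟩ := Path.Homotopic.Quotient.mk p
    let b : (⟨y⟩ : FundamentalGroupoid Z) ⟶ ⟨z⟩ := Path.Homotopic.Quotient.mk q
    let c : (⟨z⟩ : FundamentalGroupoid Z) ⟶ ⟨w⟩ := Path.Homotopic.Quotient.mk r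
    change CategoryTheory.CategoryStruct.comp (CategoryTheory.Groupoid.inv
      (CategoryTheory.CategoryStruct.comp a b)) (CategoryTheory.CategoryStruct.comp a
        (CategoryTheory.CategoryStruct.comp b c)) = c
    simp
  rw [edist_def]
  simp only [ofPath]
  rw [this]

end UniversalCover

namespace IsMetricCovering

open UniversalCover

variable {M Z : Type} [PseudoEMetricSpace M] [PseudoEMetricSpace Z] [SimplyConnectedSpace M]
  {f : M → Z} {δ : ℝ≥0∞} (h : IsMetricCovering f δ) {z₀ : Z} {o : M} (P₀ : Path z₀ (f o))

/-- The map from a simply connected covering space to the universal cover. -/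
def toUniversalCover (m : M) : UniversalCover Z z₀ :=
  ofPath (P₀.trans ((PathConnectedSpace.somePath o m).map h.continuous))

theorem toUniversalCover_eq {m : M} (q : Path o m) :
    h.toUniversalCover P₀ m = ofPath (P₀.trans (q.map h.continuous)) := by
  refine ofPath_eq ?_
  have := SimplyConnectedSpace.paths_homotopic (PathConnectedSpace.somePath o m) q
  rw [Path.Homotopic.Quotient.mk_trans, Path.Homotopic.Quotient.mk_trans]
  congr 1
  exact Path.Homotopic.Quotient.eq.2 (this.map ⟨f, h.continuous⟩)

theorem toUniversalCover_base : h.toUniversalCover P₀ o = ofPath P₀ := by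
  rw [h.toUniversalCover_eq P₀ (Path.refl o)]
  refine ofPath_eq ?_
  rw [Path.Homotopic.Quotient.mk_trans]
  exact (Path.Homotopic.Quotient.mk_trans _ _).symm.trans
    (Path.Homotopic.Quotient.eq.2 ⟨Path.Homotopy.transRefl P₀⟩)

/-- A class represented by `p` is the image of the endpoint of the lift of `P₀⁻¹ p` that starts at
`o`. -/
theorem toUniversalCover_surjective : Function.Surjective (h.toUniversalCover P₀) := by
  intro a
  obtain ⟨p, ha⟩ := exists_ofPath a
  obtain ⟨Γ, hΓ, h0⟩ := h.isCoveringMap.exists_path_lifts ((P₀.symm.trans p : Path _ _) : C(_, Z)) o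
    (Path.source _)
  have hΓ' : ∀ t, f (Γ t) = (P₀.symm.trans p) t := fun t => congrFun hΓ t
  refine ⟨Γ 1, ?_⟩
  refine (h.toUniversalCover_eq P₀ (m := Γ 1) ⟨Γ, h0, rfl⟩).trans ?_
  rw [ha]
  have e1 : f (Γ 1) = a.pt := (hΓ' 1).trans (Path.target _)
  have : ofPath (P₀.trans (P₀.symm.trans p)) = ofPath p := ofPath_eq (mk_symm_trans_trans P₀ p)
  rw [← this]
  refine ofPath_congr fun t => ?_
  rw [Path.trans_apply, Path.trans_apply]
  split_ifs
  · rfl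
  · exact hΓ' _

/-- For `≤`, short paths upstairs project to paths in the required homotopy class, by simple
connectedness. For `≥`, a path in that class lifts to one from `m` to `m'` by homotopy lifting, and
`edist_le_pathLength` applies. -/
theorem edist_toUniversalCover (hlen : ∀ (p q : M) (r : ℝ≥0∞), edist p q < r →
    ∃ c : Path p q, pathLength c ≤ r) (m m' : M) :
    edist (h.toUniversalCover P₀ m) (h.toUniversalCover P₀ m') = edist m m' := by
  let q := PathConnectedSpace.somePath o m
  let r := PathConnectedSpace.somePath m m'
  rw [h.toUniversalCover_eq P₀ q, h.toUniversalCover_eq P₀ (q.trans r), Path.map_trans,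
    edist_ofPath_trans]
  refine le_antisymm ?_ (le_iInf₂ fun c hc => ?_)
  · refine le_of_forall_gt fun s hs => ?_
    obtain ⟨s', hs', hs''⟩ := exists_between hs
    obtain ⟨c, hc⟩ := hlen m m' s' hs'
    refine (iInf₂_le (c.map h.continuous) ?_).trans_lt (lt_of_le_of_lt ?_ hs'')
    · exact Path.Homotopic.Quotient.eq.2
        ((SimplyConnectedSpace.paths_homotopic c r).map ⟨f, h.continuous⟩)
    · refine le_trans ?_ hc
      refine (LipschitzOnWith.comp_eVariationOn_le (f := f) (C := 1) (t := Set.univ)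
        (fun p _ q _ => by simpa using h.edist_le p q) (g := fun t : unitInterval => c t)
        (s := Set.univ) (fun _ _ => Set.mem_univ _)).trans (by simp [pathLength])
  · obtain ⟨Γ, hΓ, h0⟩ := h.isCoveringMap.exists_path_lifts (c : C(_, Z)) m (Path.source _)
    have e1 : Γ 1 = m' := by
      have h1 := (h.isCoveringMap.eq_liftPath_iff' (γ := (c : C(_, Z))) (e := m)
        (Path.source _)).2 ⟨hΓ, h0⟩
      have h2 := (h.isCoveringMap.eq_liftPath_iff' (γ := (r.map h.continuous : C(_, Z))) (e := m)
        (Path.source _) (Γ := r)).2 ⟨rfl, r.source⟩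
      have h3 := h.isCoveringMap.liftPath_apply_one_eq_of_homotopicRel
        (Path.Homotopic.Quotient.eq.1 hc) m (Path.source _) (Path.source _)
      exact (congrArg (fun g : C(_, M) => g 1) h1).trans (h3.trans
        ((congrArg (fun g : C(_, M) => g 1) h2).symm.trans r.target))
    subst e1
    refine (h.edist_le_pathLength ⟨Γ, h0, rfl⟩).trans (le_of_eq ?_)
    rw [pathLength]
    congr 1

/-- A simply connected covering space is isometric to the universal cover. -/
def isometryEquiv (hlen : ∀ (p q : M) (r : ℝ≥0∞), edist p q < r →
    ∃ c : Path p q, pathLength c ≤ r) (hz : ∀ p q : M, edist p q = 0 → p = q) :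
    M ≃ᵢ UniversalCover Z z₀ where
  toEquiv := Equiv.ofBijective (h.toUniversalCover P₀)
    ⟨fun p q hpq => hz p q (by rw [← h.edist_toUniversalCover P₀ hlen, hpq, edist_self]),
      h.toUniversalCover_surjective P₀⟩
  isometry_toFun := h.edist_toUniversalCover P₀ hlen

end IsMetricCovering

end

/-! ### Contractibility and length structure of the tree of spaces -/

noncomputable section

namespace TorusComplex

namespace Tree

variable {ε : ℝ≥0} {E₀ : Wall}

theorem isMetricCovering (ε : ℝ≥0) (E₀ : Wall) :
    IsMetricCovering (cover ε E₀) (ENNReal.ofReal (1 / 2)) where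
  pos := ENNReal.ofReal_pos.2 (by norm_num)
  edist_le := edist_cover_le
  exists_lift := exists_lift_of_edist_lt
  separated := eq_of_cover_eq

/-! ### Functions on the tree of walls -/

/-- The affine extension of a function on the walls to the strips. -/
def height (g : State E₀ → ℝ) : Tree ε E₀ → ℝ :=
  lift (fun ω _ _ => g ω)
    (fun ω a h _ v => (1 - clampCyl v) * g ω + clampCyl v * g (ω.cons a h))
    (fun _ _ _ => rfl)
    (fun ω a h s v => by rw [clampCyl_coe (clampCyl v).2])
    (fun ω a h s => by simp [clampCyl_zero])
    (fun ω a h s => by simp [clampCyl_one])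

@[simp] theorem height_wallPt (g : State E₀ → ℝ) (ω : State E₀) (x : E3) (u : ℝ) :
    height g (wallPt ε ω x u) = g ω := rfl

theorem height_stripPt (g : State E₀ → ℝ) (ω : State E₀) (a h) (s : E2) {v : ℝ}
    (hv : v ∈ Set.Icc (0 : ℝ) 1) :
    height g (stripPt ε ω a h s v) = (1 - v) * g ω + v * g (ω.cons a h) := by
  rw [height, lift_stripPt, clampCyl_coe hv]

theorem height_edgePt (g : State E₀ → ℝ) {ω : State E₀} {a : Letter} (h : a.src = ω.typ) (s : E2)
    {v : ℝ} (hv : v ∈ Set.Icc (0 : ℝ) 1) :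
    height g (edgePt ε ω a s v) = (1 - v) * g ω + v * g (ω.nbr a) := by
  rcases State.ok_or_back h with h' | ⟨ω', a', h', rfl, rfl⟩
  · rw [edgePt_ok h', height_stripPt _ _ _ _ _ hv, State.nbr_ok h']
  · rw [edgePt_cons_rev, height_stripPt _ _ _ _ _ ⟨by linarith [hv.2], by linarith [hv.1]⟩,
      State.nbr_cons_rev]
    ring

theorem sq_height_stripPt_sub_le {g : State E₀ → ℝ} (hg : ∀ ω a h, |g (ω.cons a h) - g ω| ≤ 1)
    (ω : State E₀) (a h) (s s' : E2) {v v' : ℝ}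
    (hv : v ∈ Set.Icc (0 : ℝ) 1) (hv' : v' ∈ Set.Icc (0 : ℝ) 1) :
    (height g (stripPt ε ω a h s v) - height g (stripPt ε ω a h s' v')) ^ 2 ≤ (v - v') ^ 2 := by
  rw [height_stripPt _ _ _ _ _ hv, height_stripPt _ _ _ _ _ hv']
  have h1 : (1 - v) * g ω + v * g (ω.cons a h) - ((1 - v') * g ω + v' * g (ω.cons a h)) =
    (v - v') * (g (ω.cons a h) - g ω) := by ring
  rw [h1, mul_pow]
  exact mul_le_of_le_one_right (sq_nonneg _) ((sq_le_one_iff_abs_le_one _).2 (hg ω a h))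

theorem lipschitz_height {g : State E₀ → ℝ} (hg : ∀ ω a h, |g (ω.cons a h) - g ω| ≤ 1) :
    LipschitzWith 1 (height g : Tree ε E₀ → ℝ) := by
  refine lipschitz_of_seg _ (fun ω x u x' u' _ _ => by simp) (fun ω a h s v s' v' hv hv' => ?_)
  rw [edist_dist, Real.dist_eq]
  refine ENNReal.ofReal_le_ofReal (Real.le_sqrt_of_sq_le ?_)
  rw [sq_abs]
  exact (sq_height_stripPt_sub_le hg ω a h s s' hv hv').trans (by nlinarith [sq_nonneg ‖s - s'‖])

/-! ### The contraction to the base point -/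

/-- Interpolation between two points, with time clamped to the unit interval. -/
def ramp {W : Type*} [AddCommGroup W] [Module ℝ W] (θ : ℝ) (x y : W) : W :=
  (1 - (clampCyl θ : ℝ)) • x + (clampCyl θ : ℝ) • y

theorem continuous_clampCyl : Continuous fun θ : ℝ => (clampCyl θ : ℝ) :=
  continuous_subtype_val.comp (continuous_projIcc (h := zero_le_one))

theorem continuous_ramp {W : Type*} [NormedAddCommGroup W] [NormedSpace ℝ W] (x y : W) :
    Continuous fun θ : ℝ => ramp θ x y := by
  unfold ramp
  exact ((continuous_const.sub continuous_clampCyl).smul continuous_const).add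
    (continuous_clampCyl.smul continuous_const)

theorem ramp_of_nonpos {W : Type*} [AddCommGroup W] [Module ℝ W] {θ : ℝ} (h : θ ≤ 0) (x y : W) :
    ramp θ x y = x := by
  have : (clampCyl θ : ℝ) = 0 := congrArg Subtype.val (Set.projIcc_of_le_left zero_le_one h)
  simp [ramp, this]

theorem ramp_of_one_le {W : Type*} [AddCommGroup W] [Module ℝ W] {θ : ℝ} (h : 1 ≤ θ) (x y : W) :
    ramp θ x y = y := by
  have : (clampCyl θ : ℝ) = 1 := congrArg Subtype.val (Set.projIcc_of_right_le zero_le_one h)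
  simp [ramp, this]

theorem norm_ramp_sub_le {W : Type*} [NormedAddCommGroup W] [NormedSpace ℝ W] (θ : ℝ)
    {x y x' y' : W} {d : ℝ} (hx : ‖x - x'‖ ≤ d) (hy : ‖y - y'‖ ≤ d) :
    ‖ramp θ x y - ramp θ x' y'‖ ≤ d := by
  obtain ⟨h0, h1⟩ := (clampCyl θ).2
  have e : ramp θ x y - ramp θ x' y' =
      (1 - (clampCyl θ : ℝ)) • (x - x') + (clampCyl θ : ℝ) • (y - y') := by
    simp only [ramp, smul_sub]; abel
  rw [e]
  refine (norm_add_le _ _).trans ?_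
  rw [norm_smul, norm_smul, Real.norm_of_nonneg h0, Real.norm_of_nonneg (sub_nonneg.2 h1)]
  nlinarith [sub_nonneg.2 h1]

@[simp] theorem ramp_self {W : Type*} [AddCommGroup W] [Module ℝ W] (θ : ℝ) (x : W) :
    ramp θ x x = x := by
  rw [ramp, ← add_smul, sub_add_cancel, one_smul]

variable (ε) in
/-- The contraction on the walls: time `θ` is the distance from the base wall up to which the tree of
walls is kept, each wall and each strip being traversed in unit time. -/
def shrink : State E₀ → ℝ → E3 → ℝ → Tree ε E₀ :=
  State.recOn' (motive := fun _ => ℝ → E3 → ℝ → Tree ε E₀)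
    (fun θ x u => wallPt ε .nil (ramp θ 0 x) (ramp θ 0 (clampWall ε E₀ u : ℝ)))
    (fun ω a h ih θ x u =>
      -- A wall at depth `n` is filled during `[2n, 2n + 1]` and the strips leading away from it
      -- during `[2n + 1, 2n + 2]`. Until its turn comes, a point is replaced by its projection to
      -- the part of the tree of spaces that is already present.
      if θ ≤ 2 * ω.len + 1 then ih θ (a.back x) (side ε a.vert)
      else if θ ≤ 2 * ω.len + 2 then stripPt ε ω a h (a.projT x) (θ - (2 * ω.len + 1))
      else wallPt ε (ω.cons a h) (ramp (θ - (2 * ω.len + 2)) (a.embT (a.projT x)) x)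
        (ramp (θ - (2 * ω.len + 2)) (side ε a.vert) (clampWall ε a.tgt u : ℝ)))

theorem shrink_nil (θ : ℝ) (x : E3) (u : ℝ) : shrink ε (.nil : State E₀) θ x u =
    wallPt ε .nil (ramp θ 0 x) (ramp θ 0 (clampWall ε E₀ u : ℝ)) := rfl

theorem shrink_cons (ω : State E₀) (a : Letter) (h : ω.Ok a) (θ : ℝ) (x : E3) (u : ℝ) :
    shrink ε (ω.cons a h) θ x u =
      if θ ≤ 2 * ω.len + 1 then shrink ε ω θ (a.back x) (side ε a.vert)
      else if θ ≤ 2 * ω.len + 2 then stripPt ε ω a h (a.projT x) (θ - (2 * ω.len + 1))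
      else wallPt ε (ω.cons a h) (ramp (θ - (2 * ω.len + 2)) (a.embT (a.projT x)) x)
        (ramp (θ - (2 * ω.len + 2)) (side ε a.vert) (clampWall ε a.tgt u : ℝ)) := rfl

theorem shrink_clamp (ω : State E₀) (θ : ℝ) (x : E3) (u : ℝ) :
    shrink ε ω θ x (clampWall ε ω.typ u) = shrink ε ω θ x u := by
  rcases ω.eq_nil_or_cons with rfl | ⟨ω, a, h, rfl⟩
  · rw [shrink_nil, shrink_nil, State.typ_nil, clampWall_coe (clampWall ε E₀ u).2]
  · rw [shrink_cons, shrink_cons, State.typ_cons, clampWall_coe (clampWall ε a.tgt u).2]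

theorem shrink_of_le (ω : State E₀) {θ : ℝ} (hθ : 2 * ω.len + 1 ≤ θ) (x : E3) (u : ℝ) :
    shrink ε ω θ x u = wallPt ε ω x u := by
  rcases ω.eq_nil_or_cons with rfl | ⟨ω, a, h, rfl⟩
  · simp only [State.len_nil, Nat.cast_zero, mul_zero, zero_add] at hθ
    rw [shrink_nil, ramp_of_one_le hθ, ramp_of_one_le hθ]
    exact wallPt_clamp .nil x u
  · simp only [State.len_cons, Nat.cast_add, Nat.cast_one] at hθ
    rw [shrink_cons, if_neg (by linarith), if_neg (by linarith),
      ramp_of_one_le (by linarith), ramp_of_one_le (by linarith)]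
    exact wallPt_clamp (ω.cons a h) x u

theorem edist_shrink_le (ω : State E₀) (θ : ℝ) (x x' : E3) (u u' : ℝ) :
    edist (shrink ε ω θ x u) (shrink ε ω θ x' u') ≤ ENNReal.ofReal √(‖x - x'‖ ^ 2 + (u - u') ^ 2) := by
  induction ω using State.induct generalizing x x' u u' with
  | nil =>
    rw [shrink_nil, shrink_nil]
    refine (edist_wallPt_le _ _ _ _ _).trans (ENNReal.ofReal_le_ofReal (Real.sqrt_le_sqrt ?_))
    have h1 := norm_ramp_sub_le θ (x := (0 : E3)) (x' := 0) (by simp) (le_refl ‖x - x'‖)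
    have h2 := norm_ramp_sub_le θ (x := (0 : ℝ)) (x' := 0) (by simp) (abs_clampWall_le ε E₀ u u')
    exact add_le_add (pow_le_pow_left₀ (norm_nonneg _) h1 2) (sq_le_sq.2 h2)
  | cons ω a h ih =>
    rw [shrink_cons, shrink_cons]
    split_ifs
    · refine (ih _ _ _ _).trans (ENNReal.ofReal_le_ofReal (Real.sqrt_le_sqrt ?_))
      have := pow_le_pow_left₀ (norm_nonneg _) (a.norm_back_sub_le x x') 2
      nlinarith [sq_nonneg (u - u')]
    · refine (edist_stripPt_le _ _ _ _ _ _ _).trans (ENNReal.ofReal_le_ofReal (Real.sqrt_le_sqrt ?_))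
      have := pow_le_pow_left₀ (norm_nonneg _) (a.norm_projT_sub_le x x') 2
      nlinarith [sq_nonneg (u - u')]
    · refine (edist_wallPt_le _ _ _ _ _).trans (ENNReal.ofReal_le_ofReal (Real.sqrt_le_sqrt ?_))
      have h1 := norm_ramp_sub_le (θ - (2 * ω.len + 2))
        (by rw [a.norm_embT_sub]; exact a.norm_projT_sub_le x x') (le_refl ‖x - x'‖)
      have h2 := norm_ramp_sub_le (θ - (2 * ω.len + 2)) (x := side ε a.vert) (x' := side ε a.vert)
        (by simp) (abs_clampWall_le ε a.tgt u u')
      exact add_le_add (pow_le_pow_left₀ (norm_nonneg _) h1 2) (sq_le_sq.2 h2)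

theorem ofReal_sqrt_le_two_mul_edist {W : Type*} [NormedAddCommGroup W] (p q : W × ℝ) :
    ENNReal.ofReal √(‖p.1 - q.1‖ ^ 2 + (p.2 - q.2) ^ 2) ≤ ((2 : ℝ≥0) : ℝ≥0∞) * edist p q := by
  have e : ((2 : ℝ≥0) : ℝ≥0∞) = ENNReal.ofReal 2 := by simp
  rw [edist_dist, e, ← ENNReal.ofReal_mul zero_le_two]
  refine ENNReal.ofReal_le_ofReal ((Real.sqrt_le_left (by positivity)).2 ?_)
  have h1 : ‖p.1 - q.1‖ ≤ dist p q := by rw [← dist_eq_norm]; exact le_max_left _ _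
  have h2 : |p.2 - q.2| ≤ dist p q := by rw [← Real.dist_eq]; exact le_max_right _ _
  have h3 := pow_le_pow_left₀ (abs_nonneg _) h2 2
  have h4 := pow_le_pow_left₀ (norm_nonneg _) h1 2
  rw [sq_abs] at h3
  nlinarith [sq_nonneg (dist p q)]

theorem continuous_wallPt (ω : State E₀) : Continuous fun p : E3 × ℝ => wallPt ε ω p.1 p.2 := by
  have : LipschitzWith 2 fun p : E3 × ℝ => wallPt ε ω p.1 p.2 := fun p q => by
    refine (edist_wallPt_le _ _ _ _ _).trans ?_
    exact ofReal_sqrt_le_two_mul_edist p q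
  exact this.continuous

theorem continuous_edgePt {ω : State E₀} {a : Letter} (h : a.src = ω.typ) :
    Continuous fun p : E2 × ℝ => edgePt ε ω a p.1 p.2 := by
  have : LipschitzWith 2 fun p : E2 × ℝ => edgePt ε ω a p.1 p.2 := fun p q => by
    refine (edist_edgePt_le h _ _ _ _).trans ?_
    exact ofReal_sqrt_le_two_mul_edist p q
  exact this.continuous

theorem continuous_stripPt (ω : State E₀) (a : Letter) (h : ω.Ok a) :
    Continuous fun p : E2 × ℝ => stripPt ε ω a h p.1 p.2 := by
  have := continuous_edgePt (ε := ε) h.src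
  simpa only [edgePt_ok h] using this

theorem continuous_shrink (ω : State E₀) (x : E3) (u : ℝ) :
    Continuous fun θ => shrink ε ω θ x u := by
  induction ω using State.induct generalizing x u with
  | nil => exact (continuous_wallPt _).comp ((continuous_ramp _ _).prodMk (continuous_ramp _ _))
  | cons ω a h ih =>
    simp only [shrink_cons]
    refine Continuous.if_le (ih _ _) (Continuous.if_le ?_ ?_ continuous_id continuous_const ?_)
      continuous_id continuous_const ?_
    · exact (continuous_stripPt ω a h).comp (continuous_const.prodMk (continuous_id.sub continuous_const))
    · refine (continuous_wallPt _).comp (Continuous.prodMk ?_ ?_)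
      · exact (continuous_ramp _ _).comp (continuous_id.sub continuous_const)
      · exact (continuous_ramp _ _).comp (continuous_id.sub continuous_const)
    · rintro θ (rfl : θ = _)
      rw [sub_self, ramp_of_nonpos le_rfl, ramp_of_nonpos le_rfl, ← stripPt_one]
      congr 1; ring
    · rintro θ (rfl : θ = _)
      rw [if_pos (by linarith), shrink_of_le _ le_rfl, sub_self, stripPt_zero]
      rfl

/-- The contraction. -/
def contract (θ : ℝ) : Tree ε E₀ → Tree ε E₀ :=
  lift (fun ω x u => shrink ε ω θ x u)
    (fun ω a h s v => if θ ≤ 2 * ω.len + 1 then shrink ε ω θ (a.emb s) (side ε a.vert)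
      else stripPt ε ω a h s (min (clampCyl v) (θ - (2 * ω.len + 1))))
    (fun ω x u => shrink_clamp ω θ x u)
    (fun ω a h s v => by rw [clampCyl_coe (clampCyl v).2])
    (fun ω a h s => by
      split_ifs with hθ
      · rfl
      · rw [clampCyl_zero, Set.Icc.coe_zero, min_eq_left (by linarith), stripPt_zero,
          shrink_of_le _ (by linarith)])
    (fun ω a h s => by
      rw [shrink_cons, clampCyl_one, Set.Icc.coe_one, Letter.back, Letter.projT_embT]
      split_ifs with h1 h2
      · rfl
      · rw [min_eq_right (by linarith)]
      · have hs : side ε a.vert ∈ Set.Icc (0 : ℝ) (thickness ε a.tgt) := side_mem ε a.C (!a.b)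
        rw [min_eq_left (by linarith), stripPt_one, clampWall_coe hs, ramp_self, ramp_self])

theorem lipschitz_contract (θ : ℝ) : LipschitzWith 1 (contract θ : Tree ε E₀ → Tree ε E₀) := by
  refine lipschitz_of_seg _ (fun ω x u x' u' _ _ => edist_shrink_le ω θ x x' u u')
    (fun ω a h s v s' v' hv hv' => ?_)
  simp only [contract, lift_stripPt, clampCyl_coe hv, clampCyl_coe hv']
  split_ifs
  · refine (edist_shrink_le _ _ _ _ _ _).trans (ENNReal.ofReal_le_ofReal (Real.sqrt_le_sqrt ?_))
    rw [a.norm_emb_sub, sub_self]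
    nlinarith [sq_nonneg (v - v')]
  · refine (edist_stripPt_le _ _ _ _ _ _ _).trans (ENNReal.ofReal_le_ofReal (Real.sqrt_le_sqrt ?_))
    have := abs_min_sub_min_le_max v (θ - (2 * ω.len + 1)) v' (θ - (2 * ω.len + 1))
    rw [sub_self, abs_zero, max_eq_left (abs_nonneg _)] at this
    have := sq_le_sq.2 this
    linarith

theorem continuous_contract (p : Tree ε E₀) : Continuous fun θ => contract θ p := by
  induction p using ind with
  | wall ω x u hu => exact continuous_shrink ω x u
  | strip ω a h s v hv =>
    simp only [contract, lift_stripPt, clampCyl_coe hv]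
    refine Continuous.if_le (continuous_shrink _ _ _) ?_ continuous_id continuous_const ?_
    · exact (continuous_stripPt ω a h).comp (continuous_const.prodMk
        (continuous_const.min (continuous_id.sub continuous_const)))
    · rintro θ (rfl : θ = _)
      rw [shrink_of_le _ le_rfl, sub_self, min_eq_right hv.1, stripPt_zero]

theorem contract_of_nonpos {θ : ℝ} (hθ : θ ≤ 0) (p : Tree ε E₀) : contract θ p = origin ε E₀ := by
  have key : ∀ (ω : State E₀) (x : E3) (u : ℝ), shrink ε ω θ x u = origin ε E₀ := by
    intro ω
    induction ω using State.induct with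
    | nil => intro x u; rw [shrink_nil, ramp_of_nonpos hθ, ramp_of_nonpos hθ]; rfl
    | cons ω a h ih =>
      intro x u
      rw [shrink_cons, if_pos (by have : (0 : ℝ) ≤ ω.len := Nat.cast_nonneg _; linarith), ih]
  induction p using ind with
  | wall ω x u hu => exact key ω x u
  | strip ω a h s v hv =>
    rw [contract, lift_stripPt, if_pos (by have : (0 : ℝ) ≤ ω.len := Nat.cast_nonneg _; linarith),
      key]

theorem contract_of_le {θ : ℝ} (p : Tree ε E₀) (hθ : 2 * height (fun ω => (ω.len : ℝ)) p + 1 ≤ θ) :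
    contract θ p = p := by
  induction p using ind with
  | wall ω x u hu => exact shrink_of_le ω hθ x u
  | strip ω a h s v hv =>
    rw [height_stripPt _ _ _ _ _ hv, State.len_cons] at hθ
    push_cast at hθ
    rw [contract, lift_stripPt]
    split_ifs with h1
    · obtain rfl : v = 0 := by nlinarith [hv.1]
      rw [stripPt_zero, shrink_of_le _ (by linarith)]
    · rw [clampCyl_coe hv, min_eq_left (by linarith [hv.1])]

/-- Joint continuity comes for free from continuity in the time together with a Lipschitz constant
in the point that does not depend on the time. -/
theorem continuous_contract_uncurry :
    Continuous fun p : ℝ × Tree ε E₀ => contract p.1 p.2 :=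
  continuous_prod_of_continuous_lipschitzWith' _ 1 (fun θ => lipschitz_contract θ)
    (fun p => continuous_contract p)

instance : ContractibleSpace (Tree ε E₀) := by
  have hl : LipschitzWith 1 (height (fun ω => (ω.len : ℝ)) : Tree ε E₀ → ℝ) :=
    lipschitz_height fun ω a h => by simp
  rw [contractible_iff_id_nullhomotopic]
  -- There is no time at which the contraction is finished everywhere, so time runs at a speed
  -- depending on the point: by time `2 * height + 1` the point `p` is in its place
  -- (`contract_of_le`).
  refine ⟨origin ε E₀, ⟨ContinuousMap.Homotopy.symm ⟨⟨fun p => contract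
    ((p.1 : ℝ) * (2 * height (fun ω => (ω.len : ℝ)) p.2 + 1)) p.2, ?_⟩, fun p => ?_, fun p => ?_⟩⟩⟩
  · refine continuous_contract_uncurry.comp (Continuous.prodMk ?_ continuous_snd)
    exact (continuous_subtype_val.comp continuous_fst).mul
      ((continuous_const.mul (hl.continuous.comp continuous_snd)).add continuous_const)
  · exact contract_of_nonpos (by simp) p
  · exact contract_of_le p (by simp)

/-! ### The length structure -/

theorem exists_path_of_affine {Z : Type} [PseudoEMetricSpace Z] (c : unitInterval → Z) {d : ℝ≥0∞}
    (hd : d ≠ ⊤) (h : ∀ t t' : unitInterval, edist (c t) (c t') ≤ ENNReal.ofReal |(t : ℝ) - t'| * d) :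
    ∃ q : Path (c 0) (c 1), pathLength q ≤ d := by
  have hL : LipschitzWith d.toNNReal c := fun t t' => by
    rw [ENNReal.coe_toNNReal hd, mul_comm, edist_dist, Subtype.dist_eq, Real.dist_eq]
    exact h t t'
  refine ⟨⟨⟨c, hL.continuous⟩, rfl, rfl⟩, ?_⟩
  refine (LipschitzOnWith.comp_eVariationOn_le (hL.lipschitzOnWith (s := Set.univ))
    (g := id) (s := Set.univ) (fun _ _ => Set.mem_univ _)).trans ?_
  rw [ENNReal.coe_toNNReal hd]
  refine mul_le_of_le_one_right bot_le ?_
  have := (Monotone.monotoneOn (fun a b (h : a ≤ b) => h : Monotone (fun t : unitInterval => (t : ℝ)))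
    (Set.univ : Set unitInterval)).eVariationOn_eq (Set.mem_univ 0) (Set.mem_univ 1)
  simp only [Set.Icc.coe_zero, Set.Icc.coe_one, sub_zero, ENNReal.ofReal_one] at this
  have hI : (Set.univ : Set unitInterval) ∩ Set.Icc 0 1 = Set.univ :=
    Set.eq_univ_of_forall fun t => ⟨trivial, t.2.1, t.2.2⟩
  rw [hI] at this
  exact this.le

theorem exists_path_of_seg (ε : ℝ≥0) {x y : TPre E₀} {d : ℝ} (h : TSeg x y d) :
    ∃ q : Path (X := Tree ε E₀) (Quot.mk _ x) (Quot.mk _ y),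
      pathLength q ≤ ENNReal.ofReal d := by
  have aux : ∀ (A B t t' : ℝ), √((t - t') ^ 2 * A + (t - t') ^ 2 * B) = |t - t'| * √(A + B) := by
    intro A B t t'
    rw [← mul_add, Real.sqrt_mul (sq_nonneg _), Real.sqrt_sq_eq_abs]
  cases h with
  | wall ω x u x' u' =>
    obtain ⟨q, hq⟩ := exists_path_of_affine (fun t : unitInterval =>
      wallPt ε ω (x + (t : ℝ) • (x' - x)) (u + t * (u' - u)))
      (d := ENNReal.ofReal √(‖x - x'‖ ^ 2 + (u - u') ^ 2)) ENNReal.ofReal_ne_top (fun t t' => by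
        refine (edist_wallPt_le _ _ _ _ _).trans (le_of_eq ?_)
        rw [← ENNReal.ofReal_mul (abs_nonneg _), ← aux]
        have e1 : x + (t : ℝ) • (x' - x) - (x + (t' : ℝ) • (x' - x)) = ((t : ℝ) - t') • (x' - x) := by
          module
        rw [e1, norm_smul, mul_pow, Real.norm_eq_abs, sq_abs, norm_sub_rev x']
        congr 3; ring)
    refine ⟨q.cast ?_ ?_, hq⟩
    · simp [wallPt]; rfl
    · simp [wallPt]; rfl
  | strip ω a h s v s' v' =>
    obtain ⟨q, hq⟩ := exists_path_of_affine (fun t : unitInterval =>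
      stripPt ε ω a h (s + (t : ℝ) • (s' - s)) (v + t * (v' - v)))
      (d := ENNReal.ofReal √(‖s - s'‖ ^ 2 + (v - v') ^ 2)) ENNReal.ofReal_ne_top (fun t t' => by
        refine (edist_stripPt_le _ _ _ _ _ _ _).trans (le_of_eq ?_)
        rw [← ENNReal.ofReal_mul (abs_nonneg _), ← aux]
        have e1 : s + (t : ℝ) • (s' - s) - (s + (t' : ℝ) • (s' - s)) = ((t : ℝ) - t') • (s' - s) := by
          module
        rw [e1, norm_smul, mul_pow, Real.norm_eq_abs, sq_abs, norm_sub_rev s']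
        congr 3; ring)
    refine ⟨q.cast ?_ ?_, hq⟩
    · simp [stripPt]; rfl
    · simp [stripPt]; rfl

theorem exists_path_of_edist_lt (p q : Tree ε E₀) (r : ℝ≥0∞) (h : edist p q < r) :
    ∃ c : Path p q, pathLength c ≤ r := by
  obtain ⟨c, hc⟩ := iInf_lt_iff.1 h
  obtain ⟨hch, hc⟩ := iInf_lt_iff.1 hc
  suffices H : ∀ {p q : Tree ε E₀} {c : ℝ}, TChain p q c →
      ∃ q : Path p q, pathLength q ≤ ENNReal.ofReal c from
    (H hch).imp fun _ h => h.trans hc.le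
  intro p q c hch
  induction hch with
  | nil p => exact ⟨Path.refl p, (pathLength_refl p).le.trans bot_le⟩
  | cons hs hc ih =>
    obtain ⟨q, hq⟩ := ih
    obtain ⟨q', hq'⟩ := exists_path_of_seg ε hs
    refine ⟨q'.trans q, (pathLength_trans_le _ _).trans ?_⟩
    rw [ENNReal.ofReal_add hs.nonneg hc.nonneg]
    exact add_le_add hq' hq

/-- The tree of spaces as the universal cover. -/
def develop {z₀ : Y ε} (P₀ : Path z₀ (cover ε E₀ (origin ε E₀))) :
    Tree ε E₀ ≃ᵢ UniversalCover (Y ε) z₀ :=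
  (isMetricCovering ε E₀).isometryEquiv P₀ exists_path_of_edist_lt
    fun _ _ h => eq_of_edist_eq_zero' h

end Tree

end TorusComplex

end

/-! ### Deck transformations and the lift of the homotopy equivalence -/

noncomputable section

namespace TorusComplex

/-! ### Coordinates of lattice vectors -/

open Classical in
/-- The coordinates of a lattice vector with respect to a plane and a transverse lattice vector. -/
def latCoord (C : Cyl) (b : Bool) (x : E3) : ℤ × E2 :=
  if h : x ∈ (C.att b).lat then
    ⟨(exists_of_mem_lat C b h).choose, (exists_of_mem_lat C b h).choose_spec.choose⟩
  else 0

theorem latCoord_spec (C : Cyl) (b : Bool) {x : E3} (h : x ∈ (C.att b).lat) :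
    (latCoord C b x).2 ∈ vlat C.vert ∧
      x = (latCoord C b x).1 • trans C.vert (C.att b) + plane C.vert (C.att b) (latCoord C b x).2 := by
  rw [latCoord, dif_pos h]
  exact (exists_of_mem_lat C b h).choose_spec.choose_spec

theorem latCoord_eq (C : Cyl) (b : Bool) {k : ℤ} {z : E2} (hz : z ∈ vlat C.vert) :
    latCoord C b (k • trans C.vert (C.att b) + plane C.vert (C.att b) z) = (k, z) := by
  have h := latCoord_spec C b (add_mem (trans_smul_mem_lat C b k) (plane_mem_lat C b hz))
  obtain ⟨h1, h2⟩ := index_unique C b h.2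
  exact Prod.ext h1.symm h2.symm

namespace Letter

/-- The crossing obtained by translation of the wall where it starts. -/
def shift (a : Letter) (x : E3) : Letter := ⟨a.C, a.b, a.k + (latCoord a.C a.b x).1⟩

/-- The coordinates along a strip of the translation of a wall. -/
def off (a : Letter) (x : E3) : E2 := (latCoord a.C a.b x).2

@[simp] theorem shift_src (a : Letter) (x : E3) : (a.shift x).src = a.src := rfl
@[simp] theorem shift_vert (a : Letter) (x : E3) : (a.shift x).vert = a.vert := rfl
@[simp] theorem shift_C (a : Letter) (x : E3) : (a.shift x).C = a.C := rfl
@[simp] theorem shift_b (a : Letter) (x : E3) : (a.shift x).b = a.b := rfl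
@[simp] theorem shift_projT (a : Letter) (x y : E3) : (a.shift x).projT y = a.projT y := rfl

theorem off_mem (a : Letter) {x : E3} (h : x ∈ a.src.lat) : a.off x ∈ vlat a.vert :=
  (latCoord_spec a.C a.b h).1

theorem emb_add (a : Letter) (s z : E2) : a.emb (s + z) = a.emb s + plane a.vert a.src z := by
  rw [emb, emb, map_add, add_assoc]

theorem embT_add (a : Letter) (s z : E2) : a.embT (s + z) = a.embT s + plane a.vert a.tgt z := by
  rw [embT, embT, map_add]

theorem emb_add_eq (a : Letter) {x : E3} (h : x ∈ a.src.lat) (s : E2) :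
    a.emb s + x = (a.shift x).emb (s + a.off x) := by
  have h1 : x = (latCoord a.C a.b x).1 • trans a.vert a.src + plane a.vert a.src (a.off x) :=
    (latCoord_spec a.C a.b h).2
  rw [emb_add]
  conv_lhs => rw [h1]
  simp only [emb, shift_vert, shift_src]
  rw [show (a.shift x).k = a.k + (latCoord a.C a.b x).1 from rfl, add_smul]
  abel

theorem shift_add_plane (a : Letter) (k : ℤ) {z : E2} (hz : z ∈ vlat a.vert) :
    a.shift (k • trans a.vert a.src + plane a.vert a.src z) = ⟨a.C, a.b, a.k + k⟩ := by
  rw [shift]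
  exact congrArg (fun p : ℤ × E2 => (⟨a.C, a.b, a.k + p.1⟩ : Letter)) (latCoord_eq a.C a.b hz)

theorem off_add_plane (a : Letter) (k : ℤ) {z : E2} (hz : z ∈ vlat a.vert) :
    a.off (k • trans a.vert a.src + plane a.vert a.src z) = z :=
  congrArg Prod.snd (latCoord_eq a.C a.b hz)

end Letter

namespace Tree

variable {ε : ℝ≥0} {E₀ : Wall}

theorem wallPt_inj {ω ω' : State E₀} {x x' : E3} {u u' : ℝ}
    (hu : u ∈ Set.Icc (0 : ℝ) (thickness ε ω.typ)) (hu' : u' ∈ Set.Icc (0 : ℝ) (thickness ε ω'.typ))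
    (h : wallPt ε ω x u = wallPt ε ω' x' u') : ω = ω' ∧ x = x' ∧ u = u' := by
  have h1 := wallStar_self ω x hu
  rw [h] at h1
  by_cases e : ω' = ω
  · subst e
    rw [StarData.fn_wallPt (ω := ω') (wallStar ω' x u) rfl _ hu'] at h1
    rw [StarData.trunc_lt _ (by rw [h1]; norm_num)] at h1
    obtain ⟨e1, e2, -⟩ := starPt_inj h1
    exact ⟨rfl, e1.symm, e2.symm⟩
  · rw [StarData.fn_wallPt_ne (wallStar ω x u) e] at h1
    norm_num at h1

theorem zero_mem_thickness (ε : ℝ≥0) (E : Wall) : (0 : ℝ) ∈ Set.Icc (0 : ℝ) (thickness ε E) :=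
  ⟨le_rfl, (thickness ε E).2⟩

/-! ### Deck transformations -/

/-- `T` maps walls to walls and strips to strips, as described by a map of the set of walls and by
translation vectors. -/
structure IsMotion (α : State E₀ → State E₀) (l : State E₀ → E3) (T : Tree ε E₀ → Tree ε E₀) :
    Prop where
  typ : ∀ ω, (α ω).typ = ω.typ
  mem : ∀ ω, l ω ∈ ω.typ.lat
  wall : ∀ ω x u, T (wallPt ε ω x u) = wallPt ε (α ω) (x + l ω) u
  edge : ∀ ω (a : Letter) s v, a.src = ω.typ →
    T (edgePt ε ω a s v) = edgePt ε (α ω) (a.shift (l ω)) (s + a.off (l ω)) v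

theorem eq_of_cover_comp_eq {A : Type*} [TopologicalSpace A] [PreconnectedSpace A]
    {g₁ g₂ : A → Tree ε E₀} (h₁ : Continuous g₁) (h₂ : Continuous g₂)
    (h : ∀ a, cover ε E₀ (g₁ a) = cover ε E₀ (g₂ a)) (a : A) (ha : g₁ a = g₂ a) (a' : A) :
    g₁ a' = g₂ a' :=
  congrFun ((isMetricCovering ε E₀).isCoveringMap.eq_of_comp_eq h₁ h₂ (funext h) a ha) a'

/-- The image of the origin of a wall lies over the same point of the torus, which fixes the target
wall and a lattice vector. Since the wall is connected, uniqueness of lifts determines `T` on all of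
it. The same argument applies to each strip, starting from its attaching plane. -/
theorem exists_isMotion {T : Tree ε E₀ → Tree ε E₀} (hT : Continuous T)
    (h : ∀ p, cover ε E₀ (T p) = cover ε E₀ p) : ∃ α l, IsMotion α l T := by
  have hw : ∀ ω : State E₀, ∃ ω' : State E₀, ∃ x : E3, ω'.typ = ω.typ ∧ x ∈ ω.typ.lat ∧
      T (wallPt ε ω 0 0) = wallPt ε ω' x 0 := fun ω => by
    obtain ⟨ω', hω', x, hx, e⟩ := exists_of_cover_eq_wallMk (h (wallPt ε ω 0 0))
    exact ⟨ω', x, hω', hx, by rw [e, zero_add]⟩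
  choose α l typ mem hαl using hw
  have wall : ∀ ω x u, T (wallPt ε ω x u) = wallPt ε (α ω) (x + l ω) u := fun ω x u => by
    refine eq_of_cover_comp_eq (g₁ := fun p : E3 × ℝ => T (wallPt ε ω p.1 p.2))
      (g₂ := fun p : E3 × ℝ => wallPt ε (α ω) (p.1 + l ω) p.2)
      (hT.comp (continuous_wallPt ω))
      ((continuous_wallPt (α ω)).comp ((continuous_fst.add continuous_const).prodMk continuous_snd))
      (fun p => ?_) (0, 0) ?_ (x, u)
    · rw [h, cover_wallPt, cover_wallPt, typ, wallMk_add ε _ (mem ω)]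
    · rw [hαl, zero_add]
  refine ⟨α, l, typ, mem, wall, fun ω a s v ha => ?_⟩
  have ha' : (a.shift (l ω)).src = (α ω).typ := by rw [typ, ← ha]; rfl
  have hm : l ω ∈ a.src.lat := by rw [ha]; exact mem ω
  refine eq_of_cover_comp_eq (g₁ := fun p : E2 × ℝ => T (edgePt ε ω a p.1 p.2))
    (g₂ := fun p : E2 × ℝ => edgePt ε (α ω) (a.shift (l ω)) (p.1 + a.off (l ω)) p.2)
    (hT.comp (continuous_edgePt ha))
    ((continuous_edgePt ha').comp ((continuous_fst.add continuous_const).prodMk continuous_snd))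
    (fun p => ?_) (0, 0) ?_ (s, v)
  · rw [h, cover_edgePt ha, cover_edgePt ha', Letter.shift_C, Letter.shift_b,
      cylMk_add ε _ (a.off_mem hm)]
  · rw [edgePt_zero ha, wall, edgePt_zero ha', a.emb_add_eq hm, Letter.shift_vert]

namespace IsMotion

variable {α : State E₀ → State E₀} {l : State E₀ → E3} {T : Tree ε E₀ → Tree ε E₀}

theorem mem_src (h : IsMotion α l T) {ω : State E₀} {a : Letter} (ha : a.src = ω.typ) :
    l ω ∈ a.src.lat := by rw [ha]; exact h.mem ω

theorem shift_src (h : IsMotion α l T) {ω : State E₀} {a : Letter} (ha : a.src = ω.typ) :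
    (a.shift (l ω)).src = (α ω).typ := by rw [h.typ, ← ha, Letter.shift_src]

/-- Comparison of two expressions for the image of the far end of a strip. It propagates `α` and `l`
from a wall to its neighbours. -/
theorem nbr (h : IsMotion α l T) {ω : State E₀} {a : Letter} (ha : a.src = ω.typ) (s : E2) :
    α (ω.nbr a) = (α ω).nbr (a.shift (l ω)) ∧
      (a.rev (ω.nbrIdx a)).emb s + l (ω.nbr a) =
        ((a.shift (l ω)).rev ((α ω).nbrIdx (a.shift (l ω)))).emb (s + a.off (l ω)) := by
  have e := h.edge ω a s 1 ha
  rw [edgePt_one ha, h.wall, edgePt_one (h.shift_src ha)] at e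
  have hs : side ε a.vert ∈ Set.Icc (0 : ℝ) (thickness ε a.tgt) := side_mem ε a.C (!a.b)
  obtain ⟨e1, e2, -⟩ := wallPt_inj (by rw [h.typ, State.typ_nbr ha]; exact hs)
    (by rw [State.typ_nbr (h.shift_src ha)]; exact hs) e
  exact ⟨e1, e2⟩

end IsMotion

/-! ### The lift of the homotopy equivalence -/

theorem edist_map_le_mul {Z : Type*} [PseudoEMetricSpace Z] (g : Tree ε E₀ → Z) {K : ℝ≥0} (hK : K ≠ 0)
    (wall : ∀ ω x u x' u', u ∈ Set.Icc (0 : ℝ) (thickness ε ω.typ) →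
      u' ∈ Set.Icc (0 : ℝ) (thickness ε ω.typ) →
      edist (g (wallPt ε ω x u)) (g (wallPt ε ω x' u')) ≤
        K * ENNReal.ofReal √(‖x - x'‖ ^ 2 + (u - u') ^ 2))
    (strip : ∀ ω a h s v s' v', v ∈ Set.Icc (0 : ℝ) 1 → v' ∈ Set.Icc (0 : ℝ) 1 →
      edist (g (stripPt ε ω a h s v)) (g (stripPt ε ω a h s' v')) ≤
        K * ENNReal.ofReal √(‖s - s'‖ ^ 2 + (v - v') ^ 2)) : LipschitzWith K g := by
  intro p q
  rw [edist_def p q]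
  simp_rw [ENNReal.mul_iInf_of_ne (ENNReal.coe_ne_zero.2 hK) ENNReal.coe_ne_top]
  refine le_iInf₂ fun c h => ?_
  induction h with
  | nil p => simp
  | cons hs hc ih =>
    rw [ENNReal.ofReal_add hs.nonneg hc.nonneg, mul_add]
    refine (edist_triangle _ _ _).trans (add_le_add ?_ ih)
    exact seg_cases (Φ := fun p q c => edist (g p) (g q) ≤ K * ENNReal.ofReal c)
      (fun p q c c' h h' => h.trans (mul_le_mul_right (ENNReal.ofReal_le_ofReal h') _)) wall strip hs

theorem _root_.LipschitzWith.ite_le {Z : Type*} [PseudoEMetricSpace Z] {f g : ℝ → Z}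
    (hf : LipschitzWith 1 f) (hg : LipschitzWith 1 g) {a : ℝ} (h : f a = g a) :
    LipschitzWith 1 fun w => if w ≤ a then f w else g w := by
  have key : ∀ w w', w ≤ a → a < w' → edist (f w) (g w') ≤ edist w w' := fun w w' hw hw' => by
    refine (edist_triangle _ (f a) _).trans ?_
    have h1 := hf w a
    have h2 := hg a w'
    rw [← h] at h2
    simp only [ENNReal.coe_one, one_mul] at h1 h2
    refine (add_le_add h1 h2).trans (le_of_eq ?_)
    rw [edist_dist, edist_dist, edist_dist, ← ENNReal.ofReal_add dist_nonneg dist_nonneg,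
      Real.dist_eq, Real.dist_eq, Real.dist_eq, abs_of_nonpos (by linarith),
      abs_of_neg (by linarith), abs_of_neg (by linarith)]
    congr 1; ring
  intro w w'
  simp only [ENNReal.coe_one, one_mul]
  split_ifs with h1 h2 h2
  · simpa using hf w w'
  · exact key w w' h1 (not_le.1 h2)
  · rw [edist_comm, edist_comm w]; exact key w' w h2 (not_le.1 h1)
  · simpa using hg w w'

/-- The segment that crosses a strip and the two thickened walls at its ends. -/
def crossing (ε : ℝ≥0) (ω : State E₀) (a : Letter) (h : ω.Ok a) (s : E2) (w : ℝ) : Tree ε E₀ :=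
  if w ≤ side ε a.vert then wallPt ε ω (a.emb s) w
  else if w ≤ 1 + side ε a.vert then stripPt ε ω a h s (w - side ε a.vert)
  else wallPt ε (ω.cons a h) (a.embT s) (1 + 2 * side ε a.vert - w)

theorem lipschitz_crossing (ω : State E₀) (a : Letter) (h : ω.Ok a) (s : E2) :
    LipschitzWith 1 (crossing ε ω a h s) := by
  have e : ∀ w w' : ℝ, √(0 ^ 2 + (w - w') ^ 2) = dist w w' := fun w w' => by
    rw [Real.dist_eq]; simp [Real.sqrt_sq_eq_abs]
  refine LipschitzWith.ite_le (LipschitzWith.of_edist_le fun w w' => ?_)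
    (LipschitzWith.ite_le (LipschitzWith.of_edist_le fun w w' => ?_)
      (LipschitzWith.of_edist_le fun w w' => ?_) ?_) ?_
  · refine (edist_wallPt_le _ _ _ _ _).trans (le_of_eq ?_)
    rw [sub_self, norm_zero, e, edist_dist]
  · refine (edist_stripPt_le _ _ _ _ _ _ _).trans (le_of_eq ?_)
    rw [sub_self, norm_zero, e, dist_sub_right, edist_dist]
  · refine (edist_wallPt_le _ _ _ _ _).trans (le_of_eq ?_)
    rw [sub_self, norm_zero, e, dist_sub_left, edist_dist]
  · rw [add_sub_cancel_right, stripPt_one]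
    congr 1; ring
  · have hs : (0 : ℝ) ≤ side ε a.vert := (side_mem ε a.C a.b).1
    rw [if_pos (by linarith), sub_self, stripPt_zero]

theorem edist_crossing_le (ω : State E₀) (a : Letter) (h : ω.Ok a) (s s' : E2) (w : ℝ) :
    edist (crossing ε ω a h s w) (crossing ε ω a h s' w) ≤ ENNReal.ofReal ‖s - s'‖ := by
  have e : ∀ x : ℝ, 0 ≤ x → √(x ^ 2 + 0 ^ 2) = x := fun x hx => by simp [Real.sqrt_sq hx]
  unfold crossing
  split_ifs
  · refine (edist_wallPt_le _ _ _ _ _).trans (le_of_eq ?_)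
    rw [sub_self, a.norm_emb_sub, e _ (norm_nonneg _)]
  · refine (edist_stripPt_le _ _ _ _ _ _ _).trans (le_of_eq ?_)
    rw [sub_self, e _ (norm_nonneg _)]
  · refine (edist_wallPt_le _ _ _ _ _).trans (le_of_eq ?_)
    rw [sub_self, a.norm_embT_sub, e _ (norm_nonneg _)]

theorem side_nonneg (ε : ℝ≥0) (V : GVert) : 0 ≤ side ε V := by
  rw [side]; split_ifs <;> simp

theorem side_le (ε : ℝ≥0) (V : GVert) : side ε V ≤ ε := by
  rw [side]; split_ifs <;> simp

variable (ε E₀) in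
/-- The lift of the homotopy equivalence `Y_0 → Y_ε`. -/
def markingLift : Tree 0 E₀ → Tree ε E₀ :=
  lift (fun ω x _ => wallPt ε ω x 0)
    (fun ω a h s v => crossing ε ω a h s ((1 + 2 * side ε a.vert) * clampCyl v))
    (fun _ _ _ => rfl)
    (fun ω a h s v => by rw [clampCyl_coe (clampCyl v).2])
    (fun ω a h s => by
      rw [clampCyl_zero, Set.Icc.coe_zero, mul_zero, crossing, if_pos (side_nonneg _ _)])
    (fun ω a h s => by
      rw [clampCyl_one, Set.Icc.coe_one, mul_one, crossing]
      have := side_nonneg ε a.vert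
      split_ifs with h1 h2
      · linarith
      · have h0 : side ε a.vert = 0 := by linarith
        rw [h0, mul_zero, add_zero, sub_zero, stripPt_one, h0]
      · rw [sub_self])

@[simp] theorem markingLift_wallPt (ω : State E₀) (x : E3) (u : ℝ) :
    markingLift ε E₀ (wallPt 0 ω x u) = wallPt ε ω x 0 := rfl

theorem lipschitz_markingLift : LipschitzWith (2 + 2 * ε) (markingLift ε E₀) := by
  refine edist_map_le_mul _ (by simp) (fun ω x u x' u' _ _ => ?_)
    (fun ω a h s v s' v' hv hv' => ?_)
  · rw [markingLift_wallPt, markingLift_wallPt]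
    refine (edist_wallPt_le _ _ _ _ _).trans (le_trans (ENNReal.ofReal_le_ofReal
      (Real.sqrt_le_sqrt ?_)) (le_mul_of_one_le_left bot_le ?_))
    · rw [sub_self]; nlinarith [sq_nonneg (u - u')]
    · have : (1 : ℝ≥0) ≤ 2 + 2 * ε := le_add_right one_le_two
      exact_mod_cast this
  · simp only [markingLift, lift_stripPt, clampCyl_coe hv, clampCyl_coe hv']
    refine (edist_triangle _ (crossing ε ω a h s' ((1 + 2 * side ε a.vert) * v)) _).trans ?_
    have h1 := edist_crossing_le (ε := ε) ω a h s s' ((1 + 2 * side ε a.vert) * v)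
    have h2 := lipschitz_crossing (ε := ε) ω a h s' ((1 + 2 * side ε a.vert) * v)
      ((1 + 2 * side ε a.vert) * v')
    rw [ENNReal.coe_one, one_mul, edist_dist ((1 + 2 * side ε a.vert) * v), Real.dist_eq, ← mul_sub, abs_mul,
      abs_of_nonneg (by linarith [side_nonneg ε a.vert])] at h2
    refine (add_le_add h1 h2).trans ?_
    rw [← ENNReal.ofReal_add (norm_nonneg _)
      (mul_nonneg (by linarith [side_nonneg ε a.vert]) (abs_nonneg _)),
      ← ENNReal.ofReal_coe_nnreal, ← ENNReal.ofReal_mul (NNReal.coe_nonneg _)]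
    refine ENNReal.ofReal_le_ofReal ?_
    have h3 : ‖s - s'‖ ≤ √(‖s - s'‖ ^ 2 + (v - v') ^ 2) :=
      Real.le_sqrt_of_sq_le (by nlinarith [sq_nonneg (v - v')])
    have h4 : |v - v'| ≤ √(‖s - s'‖ ^ 2 + (v - v') ^ 2) :=
      Real.le_sqrt_of_sq_le (by rw [sq_abs]; nlinarith [sq_nonneg ‖s - s'‖])
    push_cast
    nlinarith [side_nonneg ε a.vert, side_le ε a.vert, abs_nonneg (v - v'), NNReal.coe_nonneg ε]

theorem marking_wallMk (E : Wall) (x : E3) (u : ℝ) :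
    marking ε (wallMk 0 E x u) = wallMk ε E x 0 := by
  rw [wallMk, wallMk, clampWall_zero]
  rfl

theorem crossing_of_side_eq_zero (ω : State E₀) (a : Letter) (h : ω.Ok a) (s : E2) {v : ℝ}
    (hv : v ∈ Set.Icc (0 : ℝ) 1) (h0 : side ε a.vert = 0) :
    crossing ε ω a h s ((1 + 2 * side ε a.vert) * v) = stripPt ε ω a h s v := by
  rw [h0, mul_zero, add_zero, one_mul, crossing, h0, add_zero, sub_zero]
  split_ifs with h1 h2
  · obtain rfl : v = 0 := le_antisymm h1 hv.1
    rw [stripPt_zero, h0]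
  · rfl
  · exact absurd hv.2 h2

theorem cover_crossing (ω : State E₀) (a : Letter) (h : ω.Ok a) (s : E2) (w : ℝ) :
    cover ε E₀ (crossing ε ω a h s w) =
      if w ≤ side ε a.vert then wallMk ε a.src (plane a.vert a.src s) w
      else if w ≤ 1 + side ε a.vert then cylMk ε a.C s (orient a.b (w - side ε a.vert))
      else wallMk ε a.tgt (plane a.vert a.tgt s) (1 + 2 * side ε a.vert - w) := by
  unfold crossing
  split_ifs
  · rw [cover_wallPt, ← h.src, Letter.emb, add_comm]
    exact wallMk_add ε _ (trans_smul_mem_lat a.C a.b a.k) _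
  · rfl
  · rfl

/-- Only the strips over `C_2^±` are stretched: for every other vertex space `side` is zero and
`crossing` is the strip itself. -/
theorem cover_markingLift (p : Tree 0 E₀) :
    cover ε E₀ (markingLift ε E₀ p) = marking ε (cover 0 E₀ p) := by
  induction p using ind with
  | wall ω x u hu => rw [markingLift_wallPt, cover_wallPt, cover_wallPt, marking_wallMk]
  | strip ω a h s v hv =>
    simp only [markingLift, lift_stripPt, clampCyl_coe hv, cover_stripPt]
    have hx : a.vert.2 ≠ 2 → cover ε E₀ (crossing ε ω a h s ((1 + 2 * side ε a.vert) * v)) =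
        cylMk ε a.C s (orient a.b v) := fun h2 => by
      rw [crossing_of_side_eq_zero ω a h s hv (by simp [side, h2]), cover_stripPt]
    obtain ⟨C, b, k⟩ := a
    rcases C with σ | ⟨σ, i⟩
    · exact hx (by simp [Letter.vert, Cyl.vert])
    · by_cases hi : i = 2
      · subst hi
        have hside : side ε (Letter.vert ⟨.c σ 2, b, k⟩) = ε := by simp [side, Letter.vert, Cyl.vert]
        have hm : marking ε (cylMk 0 (.c σ 2) s (orient b v)) =
            cross ε σ (s 0) (s 1) ((1 + 2 * ε) * orient b v) := by
          have hb : orient b v ∈ Set.Icc (0 : ℝ) 1 := by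
            cases b
            · simpa [orient] using hv
            · simpa [orient] using hv.symm
          change preMarking ε (.cyl (.c σ 2) _ _ _) = _
          simp only [preMarking, if_true, clampCyl_coe hb, Cyl.sgn, one_mul]
        rw [cover_crossing, hside, hm]
        have hp2 : plane (σ, 2) (.e σ 2) s = !₂[0, s 0, s 1] := by
          ext i; fin_cases i <;> simp [plane_apply, dirA, dirB]
        have hp3 : plane (σ, 2) (.e σ 3) s = !₂[0, s 0, s 1] := by
          ext i; fin_cases i <;> simp [plane_apply, dirA, dirB]
        have h3 : (2 + 1 : Fin 4) = 3 := rfl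
        cases b
        · simp only [orient, Letter.src, Letter.tgt, Letter.vert, Cyl.vert, Cyl.att, Bool.not_false,
            h3, hp2, hp3, wallMk, cylMk, Cyl.sgn, cross]
          simp
          rfl
        · simp only [orient, Letter.src, Letter.tgt, Letter.vert, Cyl.vert, Cyl.att, Bool.not_true,
            h3, hp2, hp3, wallMk, cylMk, Cyl.sgn, if_true]
          -- The strip starts at the end `u = 1`, so time `w` of `crossing` is time `1 + 2ε - w` of
          -- `cross`, and the two pieces in the thickened walls are exchanged.
          split_ifs with h1 h2
          · rw [cross_top σ _ _ (by linarith)]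
            simp only [Matrix.cons_val]
            congr 3; ring
          · rw [cross_mid σ _ _ (by linarith) (by linarith), one_mul]
            congr 3; ring
          · rw [cross, if_pos (by linarith)]
            simp only [Matrix.cons_val]
            congr 3; ring
      · refine (hx hi).trans ?_
        change _ = preMarking ε (.cyl (.c σ i) _ _ _)
        rw [preMarking, if_neg hi]
        rfl

end Tree

end TorusComplex

end

/-! ### Vertex spaces, vertex groups and the action on walls -/

noncomputable section

namespace TorusComplex

/-! ### Vertex spaces in the tree of spaces -/

theorem Cyl.att_mem_wallsIn (C : Cyl) (b : Bool) : C.att b ∈ wallsIn C.vert := by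
  rcases C with σ | ⟨σ, i⟩
  · cases σ <;> cases b <;> simp [Cyl.att, Cyl.vert, wallsIn]
  · cases b <;> simp [Cyl.att, Cyl.vert, wallsIn]

theorem mem_cylsIn {C : Cyl} {V : GVert} : C ∈ cylsIn V ↔ C.vert = V := by
  obtain ⟨τ, j⟩ := V
  rcases C with σ | ⟨σ, i⟩ <;> simp [Cyl.vert, cylsIn, and_comm, eq_comm]

/-- The wall that contains the base point of a vertex space. -/
abbrev baseWall (V : GVert) : Wall := .e V.1 V.2

namespace State

variable {E₀ : Wall}

/-- The walls that are reached through strips of the vertex space `V` only. -/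
def InV (V : GVert) (ω : State E₀) : Prop := ∀ a ∈ ω.1, a.vert = V

theorem inV_nil (V : GVert) : InV V (nil : State E₀) := fun _ h => by simp [nil] at h

theorem inV_cons {V : GVert} {ω : State E₀} {a : Letter} {h : ω.Ok a} :
    InV V (ω.cons a h) ↔ InV V ω ∧ a.vert = V := by
  simp [InV, cons, and_comm]

theorem InV.nbr {V : GVert} {ω : State E₀} {a : Letter} (hω : InV V ω) (h : a.src = ω.typ)
    (ha : a.vert = V) : InV V (ω.nbr a) := by
  rcases ok_or_back h with h' | ⟨ω', a', h', rfl, rfl⟩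
  · rw [nbr_ok h']; exact inV_cons.2 ⟨hω, ha⟩
  · rw [nbr_cons_rev]; exact (inV_cons.1 hω).1

theorem InV.typ_mem {V : GVert} {ω : State (baseWall V)} (h : InV V ω) : ω.typ ∈ wallsIn V := by
  rcases ω.eq_nil_or_cons with rfl | ⟨ω', a, h', rfl⟩
  · exact .inl rfl
  · obtain ⟨-, rfl⟩ := inV_cons.1 h
    exact a.C.att_mem_wallsIn _

end State

namespace Tree

open Classical in
/-- The function that vanishes exactly on the component of the preimage of the vertex space `V` that
contains the base wall. -/
def outside (ε : ℝ≥0) {E₀ : Wall} (V : GVert) : Tree ε E₀ → ℝ :=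
  height fun ω => if ω.InV V then 0 else 1

variable {ε : ℝ≥0} {E₀ : Wall} {V : GVert}

theorem outside_wallPt_eq_zero {ω : State E₀} {x : E3} {u : ℝ} :
    outside ε V (wallPt ε ω x u) = 0 ↔ ω.InV V := by
  simp [outside]

theorem lipschitz_outside : LipschitzWith 1 (outside ε V : Tree ε E₀ → ℝ) :=
  lipschitz_height fun ω a h => by split_ifs <;> simp

theorem outside_edgePt {ω : State E₀} {a : Letter} (h : a.src = ω.typ) (ha : a.vert = V) (s : E2)
    {v : ℝ} (hv : v ∈ Set.Icc (0 : ℝ) 1) :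
    outside ε V (edgePt ε ω a s v) = 0 ∧ ω.InV V ∨
      outside ε V (edgePt ε ω a s v) = 1 ∧ ¬ ω.InV V := by
  rw [outside, height_edgePt _ h _ hv]
  by_cases hω : ω.InV V
  · simp [hω, hω.nbr h ha]
  · have : ¬ (ω.nbr a).InV V := fun h' => hω <| by
      have := h'.nbr (a := a.rev (ω.nbrIdx a)) (by rw [State.typ_nbr h, Letter.rev_src]) (by simpa using ha)
      rwa [State.nbr_nbr h] at this
    simp [hω, this]

/-- Walls have the value 0 or 1 by definition. A strip over a cylinder of `V` has both ends inside
or both ends outside the component, so no intermediate value occurs on it. -/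
theorem outside_of_cover_mem {p : Tree 0 E₀} (h : cover 0 E₀ p ∈ vertexSpace V) :
    outside 0 V p = 0 ∨ outside 0 V p = 1 := by
  rcases h with ⟨E, -, r, s, t, u, h⟩ | ⟨C, hC, s, t, u, h⟩
  · obtain ⟨ω, -, l, -, rfl⟩ := mem_fib h
    rw [outside, height_wallPt]
    split_ifs <;> simp
  · obtain ⟨ω, a, ha, hC', z, -, rfl⟩ := mem_fib h
    have hu : orient a.b u ∈ Set.Icc (0 : ℝ) 1 := by
      rw [orient]
      split_ifs
      · exact ⟨by linarith [u.2.2], by linarith [u.2.1]⟩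
      · exact u.2
    have ha' : a.vert = V := by rw [← mem_cylsIn.1 hC, ← hC']; rfl
    exact (outside_edgePt ha ha' _ hu).imp And.left And.left

/-- A path that stays over the vertex space cannot leave the component of the base wall: `outside`
would have to pass through `1 / 2`. -/
theorem outside_eq_zero_of_path {m : Tree 0 E₀} (c : Path (origin 0 E₀) m)
    (h : ∀ t, cover 0 E₀ (c t) ∈ vertexSpace V) : outside 0 V m = 0 := by
  rcases outside_of_cover_mem (h 1) with h1 | h1
  · rwa [c.target] at h1
  · have h0 : outside 0 V (c 0) = 0 := by
      rw [c.source]; exact outside_wallPt_eq_zero.2 (State.inV_nil V)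
    obtain ⟨t, ht⟩ := mem_range_of_exists_le_of_exists_ge (c := (1 / 2 : ℝ))
      (lipschitz_outside.continuous.comp c.continuous)
      ⟨0, by simp only [Function.comp_apply]; rw [h0]; norm_num⟩
      ⟨1, by simp only [Function.comp_apply]; rw [h1]; norm_num⟩
    simp only [Function.comp_apply] at ht
    rcases outside_of_cover_mem (h t) with h2 | h2 <;> rw [ht] at h2 <;> norm_num at h2

theorem joinedIn_wall {ω : State (baseWall V)} (h : ω.InV V) (x x' : E3) (u u' : ℝ) :
    JoinedIn {p | cover 0 (baseWall V) p ∈ vertexSpace V} (wallPt 0 ω x u) (wallPt 0 ω x' u') :=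
  ⟨(PathConnectedSpace.somePath (x, u) (x', u')).map (continuous_wallPt ω), fun _ =>
    .inl ⟨_, h.typ_mem, _, _, _, _, rfl⟩⟩

theorem joinedIn_strip {ω : State E₀} {a : Letter} (h : ω.Ok a) (ha : a.vert = V) (s s' : E2)
    (v v' : ℝ) : JoinedIn {p | cover 0 E₀ p ∈ vertexSpace V} (stripPt 0 ω a h s v)
      (stripPt 0 ω a h s' v') :=
  ⟨(PathConnectedSpace.somePath (s, v) (s', v')).map (continuous_stripPt ω a h), fun _ =>
    .inr ⟨_, mem_cylsIn.2 ha, _, _, _, rfl⟩⟩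

theorem joinedIn_origin {ω : State (baseWall V)} (h : ω.InV V) (x : E3) (u : ℝ) :
    JoinedIn {p | cover 0 (baseWall V) p ∈ vertexSpace V} (origin 0 _) (wallPt 0 ω x u) := by
  induction ω using State.induct generalizing x u with
  | nil => exact joinedIn_wall h _ _ _ _
  | cons ω a ha ih =>
    obtain ⟨h1, h2⟩ := State.inV_cons.1 h
    have h3 := joinedIn_strip ha h2 0 0 0 1
    rw [stripPt_zero, stripPt_one] at h3
    exact (ih h1 _ _).trans (h3.trans (joinedIn_wall h _ _ _ _))

end Tree

/-! ### Vertex groups -/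

theorem deckMap_conj {Z : Type} [PseudoEMetricSpace Z] {z y : Z} (w : Path z y) (κ : Path y y) :
    UniversalCover.deckMap ((FundamentalGroup.fundamentalGroupMulEquivOfPath w).symm
      (FundamentalGroup.fromPath (.mk κ))) (UniversalCover.ofPath w) =
      UniversalCover.ofPath (w.trans κ.symm) := by
  let a : (⟨z⟩ : FundamentalGroupoid Z) ⟶ ⟨y⟩ := Path.Homotopic.Quotient.mk w
  let k : (⟨y⟩ : FundamentalGroupoid Z) ⟶ ⟨y⟩ := Path.Homotopic.Quotient.mk κ
  have : CategoryTheory.CategoryStruct.comp (CategoryTheory.Groupoid.inv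
      (CategoryTheory.CategoryStruct.comp (CategoryTheory.CategoryStruct.comp a k)
        (CategoryTheory.Groupoid.inv a))) a =
      CategoryTheory.CategoryStruct.comp a (CategoryTheory.Groupoid.inv k) := by simp
  have h2 : (FundamentalGroup.fundamentalGroupMulEquivOfPath w).symm
      (FundamentalGroup.fromPath (.mk κ)) = CategoryTheory.CategoryStruct.comp
        (CategoryTheory.CategoryStruct.comp a k) (CategoryTheory.Groupoid.inv a) := by
    rw [CategoryTheory.Category.assoc]
    change CategoryTheory.CategoryStruct.comp a (CategoryTheory.CategoryStruct.comp k
      (CategoryTheory.Groupoid.inv a)) = _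
    rfl
  rw [h2]
  exact congrArg (UniversalCover.mk y) this

/-- `deckMap` prepends the inverse of a loop, so the conjugate of a loop of `V` by `w V` acts on the
class of `w V` by appending the inverse loop. The converse direction uses that deck transformations
act freely. -/
theorem mem_vertexGroup_iff (w : ∀ V : GVert, Path (base 0) (vertexBase V)) (V : GVert) (x : Gamma) :
    x ∈ vertexGroup w V ↔ ∃ κ : Path (vertexBase V) (vertexBase V), (∀ t, κ t ∈ vertexSpace V) ∧
      UniversalCover.deckMap x (UniversalCover.ofPath (w V)) =
        UniversalCover.ofPath ((w V).trans κ) := by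
  constructor
  · rintro ⟨_, ⟨k, rfl⟩, rfl⟩
    obtain ⟨κ, rfl⟩ := Path.Homotopic.Quotient.mk_surjective k
    refine ⟨(κ.map (vertexIncl V).continuous).symm, fun t => (κ (unitInterval.symm t)).2, ?_⟩
    exact deckMap_conj (w V) (κ.map (vertexIncl V).continuous)
  · rintro ⟨κ, hκ, h⟩
    let κ' : Path (⟨vertexBase V, vertexBase_mem V⟩ : vertexSpace V) ⟨vertexBase V, vertexBase_mem V⟩ :=
      ⟨⟨fun t => ⟨κ t, hκ t⟩, κ.continuous.subtype_mk _⟩, Subtype.ext κ.source, Subtype.ext κ.target⟩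
    have h2 := (deckMap_conj (w V) (κ'.symm.map (vertexIncl V).continuous)).trans
      ((UniversalCover.ofPath_congr (p' := (w V).trans κ) fun t => by
        simp only [Path.trans_apply]
        split_ifs
        · rfl
        · change κ (unitInterval.symm (unitInterval.symm _)) = κ _
          rw [unitInterval.symm_symm]).trans h.symm)
    have h4 : ∀ {y z : Gamma}, UniversalCover.deckMap y (UniversalCover.ofPath (w V)) =
        UniversalCover.deckMap z (UniversalCover.ofPath (w V)) → y = z := fun {y z} e => by
      have : UniversalCover.deckMap (z⁻¹ * y) (UniversalCover.ofPath (w V)) =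
          UniversalCover.ofPath (w V) := by
        rw [UniversalCover.deckMap_mul, e, ← UniversalCover.deckMap_mul, inv_mul_cancel,
          UniversalCover.deckMap_one]
      exact (inv_mul_eq_one.1 (UniversalCover.deckMap_injective this)).symm
    rw [← h4 h2]
    exact ⟨_, ⟨FundamentalGroup.fromPath (.mk κ'.symm), rfl⟩, rfl⟩

/-! ### The action on the tree of spaces -/

/-- `A` is a free isometric action on the tree of spaces that permutes the walls by `α` with
translation vectors `l`, and it is transitive on the walls of the type of the base wall, with all
lattice vectors as translation vectors. -/
structure IsModel {Γ : Type} [Group Γ] {ε : ℝ≥0} {E₀ : Wall} (A : Γ →* (Tree ε E₀ ≃ᵢ Tree ε E₀))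
    (α : Γ → State E₀ → State E₀) (l : Γ → State E₀ → E3) : Prop where
  motion : ∀ γ, Tree.IsMotion (α γ) (l γ) (A γ)
  free : ∀ γ, α γ .nil = .nil → l γ .nil = 0 → γ = 1
  transitive : ∀ ω x, ω.typ = E₀ → x ∈ E₀.lat → ∃ γ, α γ .nil = ω ∧ l γ .nil = x

/-- Conjugation of an action by an isometry. -/
def conjAct {Γ M N : Type} [Group Γ] [PseudoEMetricSpace M] [PseudoEMetricSpace N] (D : M ≃ᵢ N)
    (ρ : Γ →* (N ≃ᵢ N)) : Γ →* (M ≃ᵢ M) where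
  toFun γ := (D.trans (ρ γ)).trans D.symm
  map_one' := by ext p; simp
  map_mul' γ δ := by ext p; simp

theorem apply_conjAct {Γ M N : Type} [Group Γ] [PseudoEMetricSpace M] [PseudoEMetricSpace N]
    (D : M ≃ᵢ N) (ρ : Γ →* (N ≃ᵢ N)) (γ : Γ) (p : M) : D (conjAct D ρ γ p) = ρ γ (D p) := by
  simp [conjAct]

namespace Tree

variable {ε : ℝ≥0} {E₀ : Wall}

theorem develop_pt {z₀ : Y ε} (P₀ : Path z₀ (cover ε E₀ (origin ε E₀))) (p : Tree ε E₀) :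
    (develop P₀ p).pt = cover ε E₀ p := rfl

theorem develop_eq {z₀ : Y ε} (P₀ : Path z₀ (cover ε E₀ (origin ε E₀))) {p : Tree ε E₀}
    (q : Path (origin ε E₀) p) : develop P₀ p =
      UniversalCover.ofPath (P₀.trans (q.map (isMetricCovering ε E₀).continuous)) :=
  (isMetricCovering ε E₀).toUniversalCover_eq P₀ q

theorem develop_origin {z₀ : Y ε} (P₀ : Path z₀ (cover ε E₀ (origin ε E₀))) :
    develop P₀ (origin ε E₀) = UniversalCover.ofPath P₀ :=
  (isMetricCovering ε E₀).toUniversalCover_base P₀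

theorem cover_conjAct {z₀ : Y ε} (P₀ : Path z₀ (cover ε E₀ (origin ε E₀)))
    (ρ : Gamma →* (UniversalCover (Y ε) z₀ ≃ᵢ UniversalCover (Y ε) z₀))
    (hρ : ∀ γ a, (ρ γ a).pt = a.pt) (γ : Gamma) (p : Tree ε E₀) :
    cover ε E₀ (conjAct (develop P₀) ρ γ p) = cover ε E₀ p := by
  rw [← develop_pt P₀, apply_conjAct, hρ, develop_pt]

/-- The image of a base path under the homotopy equivalence. -/
def markPath (ε : ℝ≥0) (P₀ : Path (base 0) (cover 0 E₀ (origin 0 E₀))) :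
    Path (base ε) (cover ε E₀ (origin ε E₀)) :=
  (P₀.map (marking ε).continuous).cast rfl
    ((cover_markingLift (ε := ε) (origin 0 E₀)).trans rfl)

theorem develop_markingLift (P₀ : Path (base 0) (cover 0 E₀ (origin 0 E₀))) (p : Tree 0 E₀) :
    develop (markPath ε P₀) (markingLift ε E₀ p) =
      UniversalCover.map (marking ε) (develop P₀ p) := by
  let q := PathConnectedSpace.somePath (origin 0 E₀) p
  rw [develop_eq P₀ q, develop_eq (p := markingLift ε E₀ p) (markPath ε P₀)
    ((q.map lipschitz_markingLift.continuous).cast rfl rfl), UniversalCover.map_ofPath]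
  refine UniversalCover.ofPath_congr fun t => ?_
  rw [Path.map_trans]
  refine (Path.trans_apply _ _ _).trans (Eq.trans ?_ (Path.trans_apply _ _ _).symm)
  split_ifs
  · rfl
  · exact cover_markingLift _

theorem markingLift_conjAct (P₀ : Path (base 0) (cover 0 E₀ (origin 0 E₀))) (γ : Gamma)
    (p : Tree 0 E₀) : conjAct (develop (markPath ε P₀)) (action ε) γ (markingLift ε E₀ p) =
      markingLift ε E₀ (conjAct (develop P₀) action₀ γ p) := by
  apply (develop (markPath ε P₀)).injective
  rw [apply_conjAct, develop_markingLift, develop_markingLift, apply_conjAct]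
  exact (UniversalCover.map_deckMap (marking ε) γ _).symm

/-- The actions on the trees of spaces permute the walls in the same way for all thicknesses. -/
theorem exists_isModel (P₀ : Path (base 0) (cover 0 E₀ (origin 0 E₀))) :
    ∃ α l, IsModel (conjAct (develop P₀) action₀) α l ∧
      ∀ ε, IsModel (conjAct (develop (markPath ε P₀)) (action ε)) α l := by
  have h0 : ∀ γ, ∃ α l, IsMotion α l (conjAct (develop P₀) action₀ γ) := fun γ =>
    exists_isMotion (IsometryEquiv.continuous _) (cover_conjAct P₀ _ (fun _ _ => rfl) γ)
  choose α l h using h0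
  have free : ∀ γ, α γ .nil = .nil → l γ .nil = 0 → γ = 1 := fun γ h1 h2 => by
    have h3 := (h γ).wall .nil 0 0
    rw [h1, h2, add_zero] at h3
    have h4 := apply_conjAct (develop P₀) action₀ γ (wallPt 0 .nil 0 0)
    rw [h3] at h4
    exact UniversalCover.deckMap_injective h4.symm
  have transitive : ∀ ω x, ω.typ = E₀ → x ∈ E₀.lat → ∃ γ, α γ .nil = ω ∧ l γ .nil = x := by
    intro ω x hω hx
    have hc : cover 0 E₀ (wallPt 0 .nil 0 0) = cover 0 E₀ (wallPt 0 ω x 0) := by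
      rw [cover_wallPt, cover_wallPt, hω, State.typ_nil]
      conv_rhs => rw [← zero_add x]
      exact (wallMk_add 0 _ hx _).symm
    obtain ⟨γ, hγ⟩ := UniversalCover.exists_deckMap_eq (a := develop P₀ (wallPt 0 .nil 0 0))
      (b := develop P₀ (wallPt 0 ω x 0)) hc
    refine ⟨γ, ?_⟩
    have h3 : conjAct (develop P₀) action₀ γ (wallPt 0 .nil 0 0) = wallPt 0 ω x 0 := by
      apply (develop P₀).injective
      rw [apply_conjAct]
      exact hγ
    rw [(h γ).wall, zero_add] at h3
    obtain ⟨h4, h5, -⟩ := wallPt_inj (zero_mem_thickness _ _) (zero_mem_thickness _ _) h3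
    exact ⟨h4, h5⟩
  refine ⟨α, l, ⟨h, free, transitive⟩, fun ε => ⟨fun γ => ?_, free, transitive⟩⟩
  obtain ⟨α', l', h'⟩ := exists_isMotion (T := conjAct (develop (markPath ε P₀)) (action ε) γ)
    (IsometryEquiv.continuous _) (cover_conjAct _ _ (fun _ _ => rfl) γ)
  -- `markingLift` is equivariant and sends the origin of a wall to the origin of the wall with the
  -- same label. So the label and translation vector of the image can be compared between thickness
  -- 0 and `ε`.
  have key : ∀ ω, α' ω = α γ ω ∧ l' ω = l γ ω := fun ω => by
    have e := markingLift_conjAct (ε := ε) P₀ γ (wallPt 0 ω 0 0)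
    rw [markingLift_wallPt, h'.wall, (h γ).wall, markingLift_wallPt, zero_add, zero_add] at e
    obtain ⟨h4, h5, -⟩ := wallPt_inj (zero_mem_thickness _ _) (zero_mem_thickness _ _) e
    exact ⟨h4, h5⟩
  rwa [show α' = α γ from funext fun ω => (key ω).1, show l' = l γ from funext fun ω => (key ω).2]
    at h'

theorem cover_origin_baseWall (V : GVert) :
    cover 0 (baseWall V) (origin 0 (baseWall V)) = vertexBase V := by
  have h : cover 0 (baseWall V) (origin 0 (baseWall V)) = Y.mk (.wall (baseWall V) 0 0 0 (lo 0 _)) := by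
    rw [origin, cover_wallPt, wallMk, clampWall_zero]
    rfl
  rw [h]
  obtain ⟨σ, i⟩ := V
  fin_cases i
  · have := Glue.c0_0 (ε := 0) σ 0 0
    rw [neg_zero, zero_div] at this
    exact Quot.sound this
  · exact Quot.sound (Glue.c1_0 (ε := 0) σ 0 0)
  · exact Quot.sound (Glue.c2_0 (ε := 0) σ 0 0)
  · have := Glue.c3_0 (ε := 0) σ 0 0
    rw [zero_div] at this
    exact Quot.sound this

theorem exists_path_stabilizer (w : ∀ V : GVert, Path (base 0) (vertexBase V)) (v : TreeVert w) :
    ∃ P₀ : Path (base 0) (cover 0 (baseWall v.1) (origin 0 (baseWall v.1))),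
      ∀ γ : Gamma, γ ∈ MulAction.stabilizer Gamma v ↔ ∃ κ : Path (vertexBase v.1) (vertexBase v.1),
        (∀ t, κ t ∈ vertexSpace v.1) ∧ UniversalCover.deckMap γ (UniversalCover.ofPath P₀) =
          UniversalCover.ofPath ((P₀.cast rfl (cover_origin_baseWall v.1).symm).trans κ) := by
  obtain ⟨V, q⟩ := v
  obtain ⟨g, rfl⟩ := QuotientGroup.mk_surjective q
  obtain ⟨l, hl⟩ := Path.Homotopic.Quotient.mk_surjective (FundamentalGroup.toPath g)
  obtain rfl : g = FundamentalGroup.fromPath (.mk l) := hl.symm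
  set g : Gamma := FundamentalGroup.fromPath (.mk l) with hg
  -- The stabilizer of the coset `g Γ(V)` is `g Γ(V) g⁻¹`. The conjugation by `g` is absorbed into
  -- the base path, so that every vertex is seen from the base wall of its own tree of spaces.
  refine ⟨(l.symm.trans (w V)).cast rfl (cover_origin_baseWall V), fun γ => ?_⟩
  have h1 : γ ∈ MulAction.stabilizer Gamma (⟨V, (g : Gamma ⧸ vertexGroup w V)⟩ : TreeVert w) ↔
      g⁻¹ * γ * g ∈ vertexGroup w V := by
    rw [MulAction.mem_stabilizer_iff, eq_comm]
    have : γ • (⟨V, (g : Gamma ⧸ vertexGroup w V)⟩ : TreeVert w) =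
      ⟨V, ((γ * g : Gamma) : Gamma ⧸ vertexGroup w V)⟩ := rfl
    rw [this, Sigma.mk.injEq, mul_assoc]
    simp [QuotientGroup.eq]
  rw [h1, mem_vertexGroup_iff]
  refine exists_congr fun κ => and_congr_right fun _ => ?_
  have h2 : UniversalCover.ofPath ((l.symm.trans (w V)).cast rfl (cover_origin_baseWall V)) =
      UniversalCover.deckMap g (UniversalCover.ofPath (w V)) :=
    UniversalCover.ofPath_congr fun _ => rfl
  have h3 : UniversalCover.ofPath ((((l.symm.trans (w V)).cast rfl (cover_origin_baseWall V)).cast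
      rfl (cover_origin_baseWall V).symm).trans κ) =
      UniversalCover.deckMap g (UniversalCover.ofPath ((w V).trans κ)) := by
    refine (UniversalCover.ofPath_congr (p' := (l.symm.trans (w V)).trans κ) fun _ => rfl).trans ?_
    rw [hg, UniversalCover.deckMap_mk_ofPath]
    exact UniversalCover.ofPath_eq
      (Path.Homotopic.Quotient.eq.2 ⟨Path.Homotopy.transAssoc _ _ _⟩)
  rw [h2, h3, ← UniversalCover.deckMap_mul]
  have h4 : γ * g = g * (g⁻¹ * γ * g) := by group
  rw [h4, UniversalCover.deckMap_mul g]
  exact ((UniversalCover.deck _ _ g).injective.eq_iff).symm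

/-- A loop in the vertex space lifts to a path that remains in the component of the base wall.
Conversely, that component is path connected over the vertex space (`joinedIn_origin`), and a path
to the translate of the base point projects to a suitable loop. -/
theorem exists_loop_iff {V : GVert}
    {P₀ : Path (base 0) (cover 0 (baseWall V) (origin 0 (baseWall V)))} {α l}
    (h : IsModel (conjAct (develop P₀) action₀) α l) (γ : Gamma) :
    (∃ κ : Path (vertexBase V) (vertexBase V),
        (∀ t, κ t ∈ vertexSpace V) ∧ UniversalCover.deckMap γ (UniversalCover.ofPath P₀) =
          UniversalCover.ofPath ((P₀.cast rfl (cover_origin_baseWall V).symm).trans κ)) ↔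
      (α γ .nil).InV V := by
  have hA : conjAct (develop P₀) action₀ γ (origin 0 _) = wallPt 0 (α γ .nil) (l γ .nil) 0 := by
    rw [origin, (h.motion γ).wall, zero_add]
  have hd := apply_conjAct (develop P₀) action₀ γ (origin 0 _)
  rw [develop_origin] at hd
  rw [← outside_wallPt_eq_zero (ε := 0) (x := l γ .nil) (u := 0)]
  constructor
  · rintro ⟨κ, hκ, e⟩
    obtain ⟨c, hc, hc0⟩ := (isMetricCovering 0 (baseWall V)).isCoveringMap.exists_path_lifts
      (κ : C(_, Y 0)) (origin 0 (baseWall V)) (κ.source.trans (cover_origin_baseWall V).symm)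
    have hc' : ∀ t, cover 0 (baseWall V) (c t) = κ t := fun t => congrFun hc t
    let c' : Path (origin 0 (baseWall V)) (c 1) := ⟨c, hc0, rfl⟩
    have e1 : conjAct (develop P₀) action₀ γ (origin 0 _) = c 1 := by
      apply (develop P₀).injective
      rw [hd, develop_eq P₀ c']
      refine Eq.trans e (UniversalCover.ofPath_congr fun t => ?_)
      refine (Path.trans_apply _ _ _).trans (Eq.trans ?_ (Path.trans_apply _ _ _).symm)
      split_ifs
      · rfl
      · exact (hc' _).symm
    rw [← hA, e1]
    exact outside_eq_zero_of_path c' fun t => by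
      have : cover 0 (baseWall V) (c' t) = κ t := hc' t
      rw [this]; exact hκ t
  · intro h0
    rw [outside_wallPt_eq_zero] at h0
    obtain ⟨c, hc⟩ := joinedIn_origin h0 (l γ .nil) 0
    have e0 := cover_origin_baseWall V
    have e1 : cover 0 (baseWall V) (wallPt 0 (α γ .nil) (l γ .nil) 0) = vertexBase V := by
      rw [← hA, cover_conjAct P₀ _ (fun _ _ => rfl), e0]
    refine ⟨(c.map (isMetricCovering 0 (baseWall V)).continuous).cast e0.symm e1.symm, hc, ?_⟩
    rw [hA, develop_eq P₀ c] at hd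
    refine Eq.trans hd.symm (UniversalCover.ofPath_congr fun t => ?_)
    refine (Path.trans_apply _ _ _).trans (Eq.trans ?_ (Path.trans_apply _ _ _).symm)
    rfl

/-- A vertex of the Bass-Serre tree, seen in the tree of spaces. -/
theorem exists_isModel_vertex (w : ∀ V : GVert, Path (base 0) (vertexBase V)) (v : TreeVert w) :
    ∃ (P₀ : Path (base 0) (cover 0 (baseWall v.1) (origin 0 (baseWall v.1))))
      (α : Gamma → State (baseWall v.1) → State (baseWall v.1))
      (l : Gamma → State (baseWall v.1) → E3),
      IsModel (conjAct (develop P₀) action₀) α l ∧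
      (∀ ε, IsModel (conjAct (develop (markPath ε P₀)) (action ε)) α l) ∧
      ∀ γ, γ ∈ MulAction.stabilizer Gamma v ↔ (α γ .nil).InV v.1 := by
  obtain ⟨P₀, hP⟩ := exists_path_stabilizer w v
  obtain ⟨α, l, h, h'⟩ := exists_isModel P₀
  exact ⟨P₀, α, l, h, h', fun γ => (hP γ).trans (exists_loop_iff h γ)⟩

end Tree

end TorusComplex

end

/-! ### Flat coordinates of a vertex space -/

noncomputable section

namespace TorusComplex

theorem dist_toLp_two {M N : Type*} [PseudoMetricSpace M] [PseudoMetricSpace N] (x x' : M) (y y' : N) :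
    dist (WithLp.toLp 2 (x, y)) (WithLp.toLp 2 (x', y')) = √(dist x x' ^ 2 + dist y y' ^ 2) := by
  refine (WithLp.prod_dist_eq_add (by norm_num) _ _).trans ?_
  simp [Real.sqrt_eq_rpow]

/-! ### The flat factor of a vertex space -/

theorem Letter.projT_add (a : Letter) (x y : E3) : a.projT (x + y) = a.projT x + a.projT y :=
  map_add _ _ _

namespace State

variable {E₀ : Wall}

/-- The flat coordinates of the points of a wall with respect to a vertex space: on the walls of the
vertex space that contains the base wall they are given by the orthogonal projection to the
parallel planes, up to a translation, and other walls are projected there. -/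
def flat (V : GVert) (ω : State E₀) : E3 → E2 :=
  recOn' (motive := fun _ => E3 → E2) (fun x => proj V E₀ x) (fun _ a _ ih x => ih (a.back x)) ω

@[simp] theorem flat_nil (V : GVert) (x : E3) : (nil : State E₀).flat V x = proj V E₀ x := rfl

theorem flat_cons (V : GVert) (ω : State E₀) (a h) (x : E3) :
    (ω.cons a h).flat V x = ω.flat V (a.back x) := rfl

theorem flat_cons_embT (V : GVert) (ω : State E₀) (a h) (s : E2) :
    (ω.cons a h).flat V (a.embT s) = ω.flat V (a.emb s) := by
  rw [flat_cons, Letter.back, Letter.projT_embT]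

theorem norm_flat_sub_le (V : GVert) (ω : State E₀) (x x' : E3) :
    ‖ω.flat V x - ω.flat V x'‖ ≤ ‖x - x'‖ := by
  induction ω using induct generalizing x x' with
  | nil => rw [flat_nil, flat_nil, ← map_sub]; exact norm_proj_le _ _ _
  | cons ω a h ih => exact (ih _ _).trans (a.norm_back_sub_le _ _)

/-- Crossing a strip of `V` identifies two copies of the same plane, so the linear part of the flat
coordinate remains the orthogonal projection on every wall of the component. -/
theorem InV.flat_add {V : GVert} {ω : State E₀} (hω : ω.InV V) (x y : E3) :
    ω.flat V (x + y) = ω.flat V x + proj V ω.typ y := by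
  induction ω using induct generalizing x y with
  | nil => simp
  | cons ω a h ih =>
    obtain ⟨h1, rfl⟩ := inV_cons.1 hω
    rw [flat_cons, flat_cons, Letter.back, Letter.back, Letter.projT, Letter.projT, map_add,
      Letter.emb_add, ih h1, h.src, proj_plane, typ_cons]

theorem InV.flat_sub {V : GVert} {ω : State E₀} (hω : ω.InV V) (x x' : E3) :
    ω.flat V x - ω.flat V x' = proj V ω.typ (x - x') := by
  rw [← add_sub_cancel x' x, hω.flat_add, add_sub_cancel, add_sub_cancel_left]

theorem InV.flat_add_plane {V : GVert} {ω : State E₀} (hω : ω.InV V) (x : E3) (z : E2) :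
    ω.flat V (x + plane V ω.typ z) = ω.flat V x + z := by
  rw [hω.flat_add, proj_plane]

theorem InV.flat_emb_add {V : GVert} {ω : State E₀} (hω : ω.InV V) {a : Letter} (h : a.src = ω.typ)
    (ha : a.vert = V) (s z : E2) : ω.flat V (a.emb (s + z)) = ω.flat V (a.emb s) + z := by
  rw [a.emb_add, h, ha, hω.flat_add_plane]

theorem flat_nbr (V : GVert) {ω : State E₀} {a : Letter} (h : a.src = ω.typ) (s : E2) :
    (ω.nbr a).flat V ((a.rev (ω.nbrIdx a)).emb s) = ω.flat V (a.emb s) := by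
  rcases ok_or_back h with h' | ⟨ω', a', h', rfl, rfl⟩
  · rw [nbr_ok h', nbrIdx_ok h', Letter.rev_emb_zero, flat_cons_embT]
  · rw [nbr_cons_rev, nbrIdx_cons_rev, Letter.rev_rev, Letter.rev_emb_zero, flat_cons_embT]

end State

namespace Tree

variable {ε ε' : ℝ≥0} {E₀ : Wall} {V : GVert}

/-- The projection of the tree of spaces to the flat factor of a vertex space. -/
def flat (V : GVert) : Tree ε E₀ → E2 :=
  lift (fun ω x _ => ω.flat V x) (fun ω a _ s _ => ω.flat V (a.emb s)) (fun _ _ _ => rfl)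
    (fun _ _ _ _ _ => rfl) (fun _ _ _ _ => rfl) (fun ω a h s => (ω.flat_cons_embT V a h s).symm)

@[simp] theorem flat_wallPt (ω : State E₀) (x : E3) (u : ℝ) :
    flat V (wallPt ε ω x u) = ω.flat V x := rfl

@[simp] theorem flat_stripPt (ω : State E₀) (a h) (s : E2) (v : ℝ) :
    flat V (stripPt ε ω a h s v) = ω.flat V (a.emb s) := rfl

theorem flat_edgePt {ω : State E₀} {a : Letter} (h : a.src = ω.typ) (s : E2) (v : ℝ) :
    flat V (edgePt ε ω a s v) = ω.flat V (a.emb s) := by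
  rcases State.ok_or_back h with h' | ⟨ω', a', h', rfl, rfl⟩
  · rw [edgePt_ok h', flat_stripPt]
  · rw [edgePt_cons_rev, flat_stripPt, Letter.rev_emb_zero, State.flat_cons_embT]

theorem dist_wallPt_le (ω : State E₀) (x x' : E3) (u u' : ℝ) :
    dist (wallPt ε ω x u) (wallPt ε ω x' u') ≤ √(‖x - x'‖ ^ 2 + (u - u') ^ 2) :=
  (edist_le_ofReal (Real.sqrt_nonneg _)).1 (edist_wallPt_le ω x x' u u')

theorem dist_stripPt_le (ω : State E₀) (a h) (s s' : E2) (v v' : ℝ) :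
    dist (stripPt ε ω a h s v) (stripPt ε ω a h s' v') ≤ √(‖s - s'‖ ^ 2 + (v - v') ^ 2) :=
  (edist_le_ofReal (Real.sqrt_nonneg _)).1 (edist_stripPt_le ω a h s s' v v')

theorem lipschitz_of_dist {Z : Type*} [PseudoMetricSpace Z] (g : Tree ε E₀ → Z)
    (wall : ∀ ω x u x' u', u ∈ Set.Icc (0 : ℝ) (thickness ε ω.typ) →
      u' ∈ Set.Icc (0 : ℝ) (thickness ε ω.typ) →
      dist (g (wallPt ε ω x u)) (g (wallPt ε ω x' u')) ≤ √(‖x - x'‖ ^ 2 + (u - u') ^ 2))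
    (strip : ∀ ω a h s v s' v', v ∈ Set.Icc (0 : ℝ) 1 → v' ∈ Set.Icc (0 : ℝ) 1 →
      dist (g (stripPt ε ω a h s v)) (g (stripPt ε ω a h s' v')) ≤
        √(‖s - s'‖ ^ 2 + (v - v') ^ 2)) : LipschitzWith 1 g :=
  lipschitz_of_seg g
    (fun ω x u x' u' hu hu' => (edist_le_ofReal (Real.sqrt_nonneg _)).2 (wall ω x u x' u' hu hu'))
    (fun ω a h s v s' v' hv hv' =>
      (edist_le_ofReal (Real.sqrt_nonneg _)).2 (strip ω a h s v s' v' hv hv'))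

/-- On a wall only `flat` varies. On a strip `flat` depends on `s` and `height` on the orthogonal
coordinate `v`. Hence the pair is 1-Lipschitz for the Euclidean product metric, which is stronger
than the two separate bounds and yields the strict inequality in `exists_lt_dist`. -/
theorem lipschitz_flat_height {g : State E₀ → ℝ} (hg : ∀ ω a h, |g (ω.cons a h) - g ω| ≤ 1) :
    LipschitzWith 1 fun p : Tree ε E₀ => WithLp.toLp 2 (flat V p, height g p) := by
  refine lipschitz_of_dist _ (fun ω x u x' u' _ _ => ?_) (fun ω a h s v s' v' hv hv' => ?_)
  · rw [dist_toLp_two, dist_eq_norm, height_wallPt, height_wallPt, dist_self]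
    refine Real.sqrt_le_sqrt (add_le_add ?_ ?_)
    · exact pow_le_pow_left₀ (norm_nonneg _) (ω.norm_flat_sub_le V x x') 2
    · rw [zero_pow two_ne_zero]; exact sq_nonneg _
  · rw [dist_toLp_two, dist_eq_norm, Real.dist_eq, sq_abs]
    refine Real.sqrt_le_sqrt (add_le_add ?_ (sq_height_stripPt_sub_le hg ω a h s s' hv hv'))
    refine pow_le_pow_left₀ (norm_nonneg _) ?_ 2
    exact (ω.norm_flat_sub_le V _ _).trans (a.norm_emb_sub s s').le

theorem sq_flat_add_sq_height_le {g : State E₀ → ℝ} (hg : ∀ ω a h, |g (ω.cons a h) - g ω| ≤ 1)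
    (p q : Tree ε E₀) :
    ‖flat V p - flat V q‖ ^ 2 + (height g p - height g q) ^ 2 ≤ dist p q ^ 2 := by
  have h := (lipschitz_flat_height (V := V) hg).dist_le_mul p q
  rw [dist_toLp_two, NNReal.coe_one, one_mul] at h
  have := (Real.sqrt_le_left dist_nonneg).1 h
  rwa [dist_eq_norm, Real.dist_eq, sq_abs] at this

theorem norm_flat_sub_le (p q : Tree ε E₀) : ‖flat V p - flat V q‖ ≤ dist p q := by
  have := sq_flat_add_sq_height_le (V := V) (g := fun _ => 0) (by simp) p q
  exact (sq_le_sq₀ (norm_nonneg _) dist_nonneg).1 (le_trans (le_add_of_nonneg_right (sq_nonneg _)) this)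

end Tree

/-! ### Motions that preserve a vertex space -/

section IsModel

variable {Γ : Type} [Group Γ] {ε : ℝ≥0} {E₀ : Wall} {A : Γ →* (Tree ε E₀ ≃ᵢ Tree ε E₀)}
  {α : Γ → State E₀ → State E₀} {l : Γ → State E₀ → E3}

namespace IsModel

open TorusComplex.Tree

theorem mul_apply (M : IsModel A α l) (γ δ : Γ) (ω : State E₀) :
    α (γ * δ) ω = α γ (α δ ω) ∧ l (γ * δ) ω = l δ ω + l γ (α δ ω) := by
  have h : A (γ * δ) (wallPt ε ω 0 0) = A γ (A δ (wallPt ε ω 0 0)) := by rw [map_mul]; rfl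
  rw [(M.motion _).wall, (M.motion δ).wall, (M.motion γ).wall, zero_add, zero_add] at h
  obtain ⟨h1, h2, -⟩ := wallPt_inj (zero_mem_thickness _ _) (zero_mem_thickness _ _) h
  exact ⟨h1, h2⟩

theorem one_apply (M : IsModel A α l) (ω : State E₀) : α 1 ω = ω ∧ l 1 ω = 0 := by
  have h : A 1 (wallPt ε ω 0 0) = wallPt ε ω 0 0 := by rw [map_one]; rfl
  rw [(M.motion _).wall, zero_add] at h
  obtain ⟨h1, h2, -⟩ := wallPt_inj (zero_mem_thickness _ _) (zero_mem_thickness _ _) h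
  exact ⟨h1, h2⟩

theorem inv_apply_apply (M : IsModel A α l) (γ : Γ) (ω : State E₀) : α γ⁻¹ (α γ ω) = ω := by
  rw [← (M.mul_apply _ _ _).1, inv_mul_cancel, (M.one_apply ω).1]

theorem injective (M : IsModel A α l) (γ : Γ) : Function.Injective (α γ) :=
  Function.LeftInverse.injective (M.inv_apply_apply γ)

/-- By freeness, an element is determined by its effect on the base wall. Identities in `Γ` can thus
be checked on `α` and `l` there. -/
theorem ext (M : IsModel A α l) {γ δ : Γ} (h1 : α γ .nil = α δ .nil) (h2 : l γ .nil = l δ .nil) :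
    γ = δ := by
  have h3 := M.mul_apply δ⁻¹ γ .nil
  have h4 := M.mul_apply δ⁻¹ δ .nil
  rw [inv_mul_cancel, (M.one_apply _).1, (M.one_apply _).2] at h4
  rw [h1, h2, ← h4.1, ← h4.2] at h3
  exact (inv_mul_eq_one.1 (M.free _ h3.1 h3.2)).symm

/-- The walls outside an invariant set of walls are moved along with their predecessors. -/
theorem apply_cons (M : IsModel A α l) {γ : Γ} {D : State E₀ → Prop} (hD : D .nil)
    (hD' : ∀ ω a h, D (ω.cons a h) → D ω) (hα : ∀ ω, D (α γ ω) ↔ D ω) (ω : State E₀) (a h)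
    (hω : ¬ D (ω.cons a h)) :
    ∃ h', α γ (ω.cons a h) = (α γ ω).cons (a.shift (l γ ω)) h' := by
  induction ω using State.induct generalizing a with
  | nil => exact aux M γ hD' hα .nil a h hω (fun h0 => absurd hD h0)
  | cons ω₀ a₀ h₀ ih =>
    -- If the image of the new wall were not an extension, it would be the predecessor of the image
    -- of `ω`. By induction that predecessor is the image of `ω₀`, so injectivity would identify two
    -- words whose lengths differ by 2. When `ω` lies in `D`, invariance and closure under
    -- predecessors exclude this instead.
    exact aux M γ hD' hα _ a h hω fun h0 ω₁ a₁ h₁ e => by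
      obtain ⟨h', e'⟩ := ih a₀ h₀ h0
      obtain ⟨rfl, -⟩ := State.cons_inj (e.symm.trans e')
      intro e2
      have := congrArg State.len (M.injective γ e2)
      simp at this
      omega
where
  aux (M : IsModel A α l) (γ : Γ) {D : State E₀ → Prop} 
      (hD' : ∀ ω a h, D (ω.cons a h) → D ω) (hα : ∀ ω, D (α γ ω) ↔ D ω) (ω : State E₀) (a h)
      (hω : ¬ D (ω.cons a h))
      (hback : ¬ D ω → ∀ ω₁ a₁ h₁, α γ ω = State.cons ω₁ a₁ h₁ → α γ (ω.cons a h) ≠ ω₁) :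
      ∃ h', α γ (ω.cons a h) = (α γ ω).cons (a.shift (l γ ω)) h' := by
    have h1 := ((M.motion γ).nbr h.src 0).1
    rw [State.nbr_ok h] at h1
    rcases State.ok_or_back ((M.motion γ).shift_src h.src) with h' | ⟨ω₁, a₁, h₁, e1, e2⟩
    · exact ⟨h', by rw [h1, State.nbr_ok h']⟩
    · have h3 : α γ (ω.cons a h) = ω₁ := by rw [h1, e1, e2, State.nbr_cons_rev]
      by_cases hDω : D ω
      · have h4 := (hα ω).2 hDω
        rw [e1] at h4
        exact absurd ((hα _).1 (by rw [h3]; exact hD' _ _ _ h4)) hω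
      · exact absurd h3 (hback hDω ω₁ a₁ h₁ e1)

variable {V : GVert}

theorem inV_apply (M : IsModel A α l) {γ : Γ} (hγ : (α γ .nil).InV V) {ω : State E₀}
    (hω : ω.InV V) : (α γ ω).InV V := by
  induction ω using State.induct with
  | nil => exact hγ
  | cons ω a h ih =>
    obtain ⟨h1, h2⟩ := State.inV_cons.1 hω
    have h3 := ((M.motion γ).nbr h.src 0).1
    rw [State.nbr_ok h] at h3
    rw [h3]
    exact (ih h1).nbr ((M.motion γ).shift_src h.src) h2

theorem inV_nil_of_apply (M : IsModel A α l) {γ : Γ} {ω : State E₀}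
    (hω : ω.InV V) (h : (α γ ω).InV V) : (α γ .nil).InV V := by
  induction ω using State.induct with
  | nil => exact h
  | cons ω a h' ih =>
    obtain ⟨h1, h2⟩ := State.inV_cons.1 hω
    refine ih h1 ?_
    have h3 := ((M.motion γ).nbr (ω := ω.cons a h') (a := a.rev 0) rfl 0).1
    rw [State.nbr_cons_rev] at h3
    rw [h3]
    exact h.nbr ((M.motion γ).shift_src rfl) h2

theorem inV_inv (M : IsModel A α l) {γ : Γ} (hγ : (α γ .nil).InV V) : (α γ⁻¹ .nil).InV V :=
  M.inV_nil_of_apply hγ (by rw [M.inv_apply_apply]; exact State.inV_nil V)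

theorem inV_apply_iff (M : IsModel A α l) {γ : Γ} (hγ : (α γ .nil).InV V) (ω : State E₀) :
    (α γ ω).InV V ↔ ω.InV V := by
  refine ⟨fun h => ?_, M.inV_apply hγ⟩
  have := M.inV_apply (M.inV_inv hγ) h
  rwa [M.inv_apply_apply] at this

theorem apply_cons_of_not_inV (M : IsModel A α l) {γ : Γ} (hγ : (α γ .nil).InV V) (ω : State E₀) (a h)
    (hω : ¬ (ω.cons a h).InV V) :
    ∃ h', α γ (ω.cons a h) = (α γ ω).cons (a.shift (l γ ω)) h' :=
  M.apply_cons (D := fun ω => ω.InV V) (State.inV_nil V) (fun _ _ _ h => (State.inV_cons.1 h).1)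
    (M.inV_apply_iff hγ) ω a h hω

/-- The translation of the flat factor. -/
def _root_.TorusComplex.transl (V : GVert) (α : Γ → State E₀ → State E₀) (l : Γ → State E₀ → E3)
    (γ : Γ) : E2 :=
  (α γ .nil).flat V (l γ .nil)

theorem flat_apply_emb (M : IsModel A α l) {γ : Γ} {ω : State E₀} {a : Letter}
    (h : a.src = ω.typ) (hω : ∀ x, (α γ ω).flat V (x + l γ ω) = ω.flat V x + transl V α l γ) (s : E2) :
    (α γ ω).flat V ((a.shift (l γ ω)).emb (s + a.off (l γ ω))) =
      ω.flat V (a.emb s) + transl V α l γ := by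
  rw [← a.emb_add_eq ((M.motion γ).mem_src h), hω]

/-- The translation vector found at the base wall propagates across strips. On walls of the
component it is enough to check one point, as both sides have the same linear part; on the other
walls `flat` factors through the plane of the last crossing. -/
theorem flat_apply (M : IsModel A α l) {γ : Γ} (hγ : (α γ .nil).InV V) (ω : State E₀) (x : E3) :
    (α γ ω).flat V (x + l γ ω) = ω.flat V x + transl V α l γ := by
  induction ω using State.induct generalizing x with
  | nil => rw [add_comm x, hγ.flat_add, (M.motion γ).typ, add_comm]; rfl
  | cons ω a h ih =>
    have h1 := (M.motion γ).nbr h.src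
    simp only [State.nbr_ok h, State.nbrIdx_ok h, Letter.rev_emb_zero] at h1
    have key : ∀ s, (α γ (ω.cons a h)).flat V (a.embT s + l γ (ω.cons a h)) =
        (ω.cons a h).flat V (a.embT s) + transl V α l γ := fun s => by
      rw [(h1 s).2, (h1 s).1, State.flat_nbr V ((M.motion γ).shift_src h.src),
        M.flat_apply_emb h.src ih, State.flat_cons_embT]
    by_cases hV : (ω.cons a h).InV V
    · have h2 := key 0
      rw [← sub_eq_iff_eq_add'] at h2
      rw [← sub_eq_iff_eq_add', ← h2, sub_eq_sub_iff_sub_eq_sub, (M.inV_apply hγ hV).flat_sub, hV.flat_sub,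
        (M.motion γ).typ, add_sub_add_right_eq_sub]
    · obtain ⟨h', e⟩ := M.apply_cons_of_not_inV hγ ω a h hV
      have hp : ∀ y, (α γ (ω.cons a h)).flat V y =
          (α γ (ω.cons a h)).flat V (a.embT (a.projT y)) := fun y => by
        rw [e, State.flat_cons, State.flat_cons, Letter.back, Letter.back, Letter.shift_projT,
          Letter.shift_projT, Letter.projT_embT]
      rw [hp, show a.projT (x + l γ (ω.cons a h)) = a.projT (a.embT (a.projT x) + l γ (ω.cons a h)) by
          rw [Letter.projT_add, Letter.projT_add, Letter.projT_embT], ← hp, key, State.flat_cons_embT, State.flat_cons, Letter.back]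

end IsModel

end IsModel

end TorusComplex

end

/-! ### Sliding along the flat factor -/

noncomputable section

namespace TorusComplex

theorem norm_sq_add_plane_sub (V : GVert) (E : Wall) (x : E3) (z : E2) :
    ‖x + plane V E (z - proj V E x)‖ ^ 2 = ‖x‖ ^ 2 - ‖proj V E x‖ ^ 2 + ‖z‖ ^ 2 := by
  rw [norm_sq_eq_proj V E (x + plane V E (z - proj V E x)), norm_sq_eq_proj V E x, map_add,
    proj_plane, add_sub_cancel, map_sub]
  have : x + (plane V E z - plane V E (proj V E x)) - plane V E z =
    x - plane V E (proj V E x) := by abel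
  rw [this]
  ring

/-! ### Projections along the flat factor -/

/-- A change of the thickness coordinate that is compatible with the strips of the vertex space
`V`. -/
structure Rescaling (ε ε' : ℝ≥0) (V : GVert) where
  /-- the new thickness coordinate -/
  toFun : ℝ → ℝ
  lipschitz : ∀ u u', (toFun u - toFun u') ^ 2 ≤ (u - u') ^ 2
  map_side : toFun (side ε V) = side ε' V

/-- The identity. -/
def Rescaling.refl (ε : ℝ≥0) (V : GVert) : Rescaling ε ε V := ⟨fun u => u, fun _ _ => le_rfl, rfl⟩

/-- The constant function. -/
def Rescaling.const (ε ε' : ℝ≥0) (V : GVert) : Rescaling ε ε' V :=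
  ⟨fun _ => side ε' V, fun u u' => by rw [sub_self]; nlinarith [sq_nonneg (u - u')], rfl⟩

namespace Tree

variable {ε ε' : ℝ≥0} {E₀ : Wall} {V : GVert}

open Classical in
/-- The point with flat coordinates `z` that has the same projection to the vertex space as a given
point of a wall, up to a translation along the flat factor. -/
def slideWall (r : Rescaling ε ε' V) (ω : State E₀) : E3 → ℝ → E2 → Tree ε' E₀ :=
  State.recOn' (motive := fun _ => E3 → ℝ → E2 → Tree ε' E₀)
    (fun x u z => wallPt ε' .nil (x + plane V E₀ (z - (State.nil (E₀ := E₀)).flat V x)) (r.toFun u))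
    (fun ω a h ih x u z => if (ω.cons a h).InV V then
        wallPt ε' (ω.cons a h) (x + plane V a.tgt (z - (ω.cons a h).flat V x)) (r.toFun u)
      else ih (a.back x) (side ε a.vert) z) ω

theorem slideWall_of_inV (r : Rescaling ε ε' V) {ω : State E₀} (hω : ω.InV V) (x : E3) (u : ℝ) (z : E2) :
    slideWall r ω x u z = wallPt ε' ω (x + plane V ω.typ (z - ω.flat V x)) (r.toFun u) := by
  rcases ω.eq_nil_or_cons with rfl | ⟨ω, a, h, rfl⟩
  · rfl
  · simp only [slideWall, State.recOn'_cons]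
    rw [if_pos hω, State.typ_cons]

theorem slideWall_of_not_inV (r : Rescaling ε ε' V) {ω : State E₀} {a : Letter} {h : ω.Ok a}
    (hω : ¬ (ω.cons a h).InV V) (x : E3) (u : ℝ) (z : E2) :
    slideWall r (ω.cons a h) x u z = slideWall r ω (a.back x) (side ε a.vert) z := by
  simp only [slideWall, State.recOn'_cons]
  rw [if_neg hω]

/-- On walls of the component the displacement along the plane is replaced by `z - z'`, while the
orthogonal part, of squared norm `‖x - x'‖² - ‖flat x - flat x'‖²`, is kept. Other walls are
projected back, which does not increase distances and preserves `flat`. -/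
theorem dist_slideWall_le (r : Rescaling ε ε' V) (ω : State E₀) (x x' : E3) (u u' : ℝ) (z z' : E2) :
    dist (slideWall r ω x u z) (slideWall r ω x' u' z') ≤
      √(‖x - x'‖ ^ 2 - ‖ω.flat V x - ω.flat V x'‖ ^ 2 + (u - u') ^ 2 + ‖z - z'‖ ^ 2) := by
  induction ω using State.induct generalizing x x' u u' with
  | nil => exact aux r (State.inV_nil V) x x' u u' z z'
  | cons ω a h ih =>
    by_cases hV : (ω.cons a h).InV V
    · exact aux r hV x x' u u' z z'
    · rw [slideWall_of_not_inV r hV, slideWall_of_not_inV r hV]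
      refine (ih _ _ _ _).trans (Real.sqrt_le_sqrt ?_)
      have h1 := pow_le_pow_left₀ (norm_nonneg _) (a.norm_back_sub_le x x') 2
      rw [sub_self, State.flat_cons, State.flat_cons]
      nlinarith [sq_nonneg (u - u')]
where
  aux (r : Rescaling ε ε' V) {ω : State E₀} (hω : ω.InV V) (x x' : E3) (u u' : ℝ) (z z' : E2) :
      dist (slideWall r ω x u z) (slideWall r ω x' u' z') ≤
        √(‖x - x'‖ ^ 2 - ‖ω.flat V x - ω.flat V x'‖ ^ 2 + (u - u') ^ 2 + ‖z - z'‖ ^ 2) := by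
    rw [slideWall_of_inV r hω, slideWall_of_inV r hω]
    refine (dist_wallPt_le _ _ _ _ _).trans (Real.sqrt_le_sqrt ?_)
    have h1 : x + plane V ω.typ (z - ω.flat V x) - (x' + plane V ω.typ (z' - ω.flat V x')) =
        (x - x') + plane V ω.typ ((z - z') - proj V ω.typ (x - x')) := by
      rw [← hω.flat_sub x x', add_sub_add_comm, ← map_sub]
      congr 2; abel
    rw [h1, norm_sq_add_plane_sub, ← hω.flat_sub]
    linarith [r.lipschitz u u']

open Classical in
/-- The point with flat coordinates `z` that has the same projection to the vertex space as a given
point, up to a translation along the flat factor. -/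
def slide (r : Rescaling ε ε' V) : Tree ε E₀ → E2 → Tree ε' E₀ :=
  lift (fun ω x u => slideWall r ω x (clampWall ε ω.typ u))
    (fun ω a h s v => if ω.InV V ∧ a.vert = V then
        fun z => stripPt ε' ω a h (s + (z - ω.flat V (a.emb s))) v
      else slideWall r ω (a.emb s) (side ε a.vert))
    (fun ω x u => by rw [clampWall_coe (clampWall ε ω.typ u).2])
    (fun ω a h s v => by simp only [stripPt_clamp])
    (fun ω a h s => by
      have hs : side ε a.vert ∈ Set.Icc (0 : ℝ) (thickness ε ω.typ) := by
        rw [← h.src]; exact side_mem ε a.C a.b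
      rw [clampWall_coe hs]
      split_ifs with hV
      · obtain ⟨h1, rfl⟩ := hV
        ext z
        rw [slideWall_of_inV r h1, stripPt_zero, r.map_side, a.emb_add, h.src]
      · rfl)
    (fun ω a h s => by
      have hs : side ε a.vert ∈ Set.Icc (0 : ℝ) (thickness ε (ω.cons a h).typ) :=
        side_mem ε a.C (!a.b)
      rw [clampWall_coe hs]
      split_ifs with hV
      · obtain ⟨h1, rfl⟩ := hV
        ext z
        rw [slideWall_of_inV r (State.inV_cons.2 ⟨h1, rfl⟩), stripPt_one, r.map_side, a.embT_add,
          State.flat_cons_embT, State.typ_cons]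
      · ext z
        rw [slideWall_of_not_inV r (mt State.inV_cons.1 hV), Letter.back, Letter.projT_embT])

theorem slide_wallPt' (r : Rescaling ε ε' V) (ω : State E₀) (x : E3) (u : ℝ) (z : E2) :
    slide r (wallPt ε ω x u) z = slideWall r ω x (clampWall ε ω.typ u) z := rfl

theorem slide_wallPt (r : Rescaling ε ε' V) {ω : State E₀} (hω : ω.InV V) (x : E3) {u : ℝ}
    (hu : u ∈ Set.Icc (0 : ℝ) (thickness ε ω.typ)) (z : E2) :
    slide r (wallPt ε ω x u) z =
      wallPt ε' ω (x + plane V ω.typ (z - ω.flat V x)) (r.toFun u) := by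
  rw [slide_wallPt', slideWall_of_inV r hω, clampWall_coe hu]

theorem slide_stripPt (r : Rescaling ε ε' V) {ω : State E₀} (hω : ω.InV V) {a : Letter} (h : ω.Ok a)
    (ha : a.vert = V) (s : E2) (v : ℝ) (z : E2) : slide r (stripPt ε ω a h s v) z =
      stripPt ε' ω a h (s + (z - ω.flat V (a.emb s))) v := by
  rw [slide, lift_stripPt, if_pos ⟨hω, ha⟩]

theorem slide_stripPt_of_not (r : Rescaling ε ε' V) {ω : State E₀} {a : Letter} (h : ω.Ok a)
    (ha : ¬ (ω.cons a h).InV V) (s : E2) (v : ℝ) (z : E2) : slide r (stripPt ε ω a h s v) z =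
      slideWall r ω (a.emb s) (side ε a.vert) z := by
  rw [slide, lift_stripPt, if_neg (mt State.inV_cons.2 ha)]

theorem slide_edgePt (r : Rescaling ε ε' V) {ω : State E₀} (hω : ω.InV V) {a : Letter}
    (h : a.src = ω.typ) (ha : a.vert = V) (s : E2) (v : ℝ) (z : E2) :
    slide r (edgePt ε ω a s v) z = edgePt ε' ω a (s + (z - ω.flat V (a.emb s))) v := by
  rcases State.ok_or_back h with h' | ⟨ω', a', h', rfl, rfl⟩
  · rw [edgePt_ok h', edgePt_ok h', slide_stripPt r hω h' ha]
  · obtain ⟨h1, h2⟩ := State.inV_cons.1 hω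
    rw [edgePt_cons_rev, edgePt_cons_rev, slide_stripPt r h1 h' h2, Letter.rev_emb_zero,
      State.flat_cons_embT]

theorem dist_slide_wallPt_le (r : Rescaling ε ε' V) (ω : State E₀) (x x' : E3) {u u' : ℝ}
    (hu : u ∈ Set.Icc (0 : ℝ) (thickness ε ω.typ)) (hu' : u' ∈ Set.Icc (0 : ℝ) (thickness ε ω.typ))
    (z z' : E2) : dist (slide r (wallPt ε ω x u) z) (slide r (wallPt ε ω x' u') z') ≤
      √(‖x - x'‖ ^ 2 + (u - u') ^ 2 -
        ‖flat V (wallPt ε ω x u) - flat V (wallPt ε ω x' u')‖ ^ 2 + ‖z - z'‖ ^ 2) := by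
  rw [slide_wallPt', slide_wallPt', clampWall_coe hu, clampWall_coe hu']
  refine (dist_slideWall_le r ω x x' u u' z z').trans (le_of_eq ?_)
  rw [flat_wallPt, flat_wallPt]
  congr 1; ring

theorem dist_slide_stripPt_le (r : Rescaling ε ε' V) (ω : State E₀) (a h) (s s' : E2) (v v' : ℝ)
    (z z' : E2) : dist (slide r (stripPt ε ω a h s v) z) (slide r (stripPt ε ω a h s' v') z') ≤
      √(‖s - s'‖ ^ 2 + (v - v') ^ 2 -
        ‖flat V (stripPt ε ω a h s v) - flat V (stripPt ε ω a h s' v')‖ ^ 2 + ‖z - z'‖ ^ 2) := by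
  rw [flat_stripPt, flat_stripPt]
  by_cases hV : (ω.cons a h).InV V
  · obtain ⟨h1, h2⟩ := State.inV_cons.1 hV
    rw [slide_stripPt r h1 h h2, slide_stripPt r h1 h h2]
    refine (dist_stripPt_le _ _ _ _ _ _ _).trans (Real.sqrt_le_sqrt ?_)
    have h3 : ω.flat V (a.emb s) - ω.flat V (a.emb s') = s - s' := by
      rw [h1.flat_sub, ← h.src, ← h2, Letter.emb, Letter.emb, add_sub_add_left_eq_sub, ← map_sub,
        proj_plane]
    have h4 : s + (z - ω.flat V (a.emb s)) - (s' + (z' - ω.flat V (a.emb s'))) = z - z' := by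
      have : s + (z - ω.flat V (a.emb s)) - (s' + (z' - ω.flat V (a.emb s'))) =
        (s - s') - (ω.flat V (a.emb s) - ω.flat V (a.emb s')) + (z - z') := by abel
      rw [this, h3, sub_self, zero_add]
    rw [h3, h4]
    linarith
  · rw [slide_stripPt_of_not r h hV, slide_stripPt_of_not r h hV]
    refine (dist_slideWall_le r _ _ _ _ _ z z').trans (Real.sqrt_le_sqrt ?_)
    rw [a.norm_emb_sub, sub_self]
    nlinarith [sq_nonneg (v - v')]

/-- The first half of the product formula: on each piece the part of the squared length that is lost
by sliding to flat coordinate 0 is the part measured by `flat`. -/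
theorem lipschitz_slide_flat (r : Rescaling ε ε' V) :
    LipschitzWith 1 fun p : Tree ε E₀ => WithLp.toLp 2 (slide r p 0, flat V p) := by
  have key : ∀ {D d f : ℝ}, D ≤ √(d - f ^ 2 + ‖(0 : E2) - 0‖ ^ 2) → 0 ≤ D → f ^ 2 ≤ d →
      √(D ^ 2 + f ^ 2) ≤ √d := fun {D d f} h1 h0 h2 => by
    refine Real.sqrt_le_sqrt ?_
    have := (Real.le_sqrt h0 (by simpa using h2)).1 h1
    simp at this
    linarith
  refine lipschitz_of_dist _ (fun ω x u x' u' hu hu' => ?_) (fun ω a h s v s' v' hv hv' => ?_)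
  · rw [dist_toLp_two, dist_eq_norm (flat V _)]
    refine key (dist_slide_wallPt_le r ω x x' hu hu' 0 0) dist_nonneg ?_
    have := pow_le_pow_left₀ (norm_nonneg _) (ω.norm_flat_sub_le V x x') 2
    rw [flat_wallPt, flat_wallPt]
    linarith [sq_nonneg (u - u')]
  · rw [dist_toLp_two, dist_eq_norm (flat V _)]
    refine key (dist_slide_stripPt_le r ω a h s s' v v' 0 0) dist_nonneg ?_
    have := pow_le_pow_left₀ (norm_nonneg _)
      ((ω.norm_flat_sub_le V _ _).trans (a.norm_emb_sub s s').le) 2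
    rw [flat_stripPt, flat_stripPt]
    linarith [sq_nonneg (v - v')]

/-- The equality case of Minkowski's inequality: dividing `Z` in the ratio of `d` to `c` makes the
two plane vectors parallel. -/
theorem sqrt_add_sqrt_le {d c Z : ℝ} (hd : 0 ≤ d) (hc : 0 ≤ c) :
    √(d ^ 2 + (d / (d + c) * Z) ^ 2) + √(c ^ 2 + ((1 - d / (d + c)) * Z) ^ 2) ≤
      √((d + c) ^ 2 + Z ^ 2) := by
  rcases (add_nonneg hd hc).eq_or_lt with h | h
  · obtain rfl : d = 0 := by linarith
    obtain rfl : c = 0 := by linarith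
    simp
  · have h1 : ∀ x, 0 ≤ x → √(x ^ 2 + (x / (d + c) * Z) ^ 2) = x / (d + c) * √((d + c) ^ 2 + Z ^ 2) :=
      fun x hx => by
        rw [show x ^ 2 + (x / (d + c) * Z) ^ 2 = (x / (d + c)) ^ 2 * ((d + c) ^ 2 + Z ^ 2) by
          field_simp, Real.sqrt_mul (sq_nonneg _), Real.sqrt_sq (by positivity)]
    have h2 : 1 - d / (d + c) = c / (d + c) := by field_simp; ring
    rw [h2, h1 d hd, h1 c hc, ← add_mul, ← add_div, div_self h.ne', one_mul]

theorem dist_slide_slide_le (r : Rescaling ε ε' V) (p : Tree ε E₀) (z z' : E2) :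
    dist (slide r p z) (slide r p z') ≤ ‖z - z'‖ := by
  induction p using ind with
  | wall ω x u hu =>
    refine (dist_slide_wallPt_le r ω x x hu hu z z').trans (le_of_eq ?_)
    simp
  | strip ω a h s v hv =>
    refine (dist_slide_stripPt_le r ω a h s s v v z z').trans (le_of_eq ?_)
    simp

/-- While the broken line is followed, the flat coordinate moves from `z` to `z'` at a rate
proportional to the length already covered; `sqrt_add_sqrt_le` adds up the pieces. -/
theorem dist_slide_le_of_chain (r : Rescaling ε ε' V) {p q : Tree ε E₀} {c : ℝ} (h : TChain p q c)
    (z z' : E2) : dist (slide r p z) (slide r q z') ≤ √(c ^ 2 + ‖z - z'‖ ^ 2) := by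
  induction h generalizing z with
  | nil p =>
    refine (dist_slide_slide_le r p z z').trans (le_of_eq ?_)
    simp
  | @cons x y d q c hs hc ih =>
    have h0 : ∀ w w' : E2, dist (slide r (Quot.mk _ x : Tree ε E₀) w) (slide r (Quot.mk _ y) w') ≤
        √(d ^ 2 + ‖w - w'‖ ^ 2) := fun w w' => by
      refine (seg_cases (Φ := fun p q c => 0 ≤ c ∧
        dist (slide r p w) (slide r q w') ≤ √(c ^ 2 + ‖w - w'‖ ^ 2))
        (fun p q c c' h hcc => ⟨h.1.trans hcc, h.2.trans (Real.sqrt_le_sqrt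
          (add_le_add (pow_le_pow_left₀ h.1 hcc 2) le_rfl))⟩) (fun ω x u x' u' hu hu' => ?_)
        (fun ω a h s v s' v' hv hv' => ?_) hs).2
      · refine ⟨Real.sqrt_nonneg _, ?_⟩
        refine (dist_slide_wallPt_le r ω x x' hu hu' w w').trans (Real.sqrt_le_sqrt ?_)
        rw [Real.sq_sqrt (by positivity)]
        linarith [sq_nonneg ‖flat V (wallPt ε ω x u) - flat V (wallPt ε ω x' u')‖]
      · refine ⟨Real.sqrt_nonneg _, ?_⟩
        refine (dist_slide_stripPt_le r ω a h s s' v v' w w').trans (Real.sqrt_le_sqrt ?_)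
        rw [Real.sq_sqrt (by positivity)]
        linarith [sq_nonneg ‖flat V (stripPt ε ω a h s v) - flat V (stripPt ε ω a h s' v')‖]
    have hd := hs.nonneg
    have hc' := hc.nonneg
    refine (dist_triangle _ (slide r (Quot.mk _ y) (z + (d / (d + c)) • (z' - z))) _).trans ?_
    refine le_trans (add_le_add (h0 _ _) (ih _)) ?_
    have e1 : ‖z - (z + (d / (d + c)) • (z' - z))‖ = d / (d + c) * ‖z - z'‖ := by
      rw [sub_add_cancel_left, norm_neg, norm_smul, Real.norm_eq_abs, abs_of_nonneg (by positivity),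
        norm_sub_rev]
    have e2 : ‖z + (d / (d + c)) • (z' - z) - z'‖ = |1 - d / (d + c)| * ‖z - z'‖ := by
      rw [← Real.norm_eq_abs, ← norm_smul]
      congr 1; module
    rw [e1, e2, mul_pow |1 - d / (d + c)|, sq_abs, ← mul_pow]
    exact sqrt_add_sqrt_le hd hc'

/-- The second half of the product formula. The bound for broken lines is solved for their length,
so that the infimum defining the distance can be taken. -/
theorem dist_slide_le (r : Rescaling ε ε' V) (p q : Tree ε E₀) (z z' : E2) :
    dist (slide r p z) (slide r q z') ≤ √(dist p q ^ 2 + ‖z - z'‖ ^ 2) := by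
  set D := dist (slide r p z) (slide r q z')
  have h1 : ENNReal.ofReal √(D ^ 2 - ‖z - z'‖ ^ 2) ≤ edist p q := by
    rw [edist_def p q]
    refine le_iInf₂ fun c h => ENNReal.ofReal_le_ofReal (Real.sqrt_le_iff.2 ⟨h.nonneg, ?_⟩)
    have := (Real.le_sqrt dist_nonneg (by positivity)).1 (dist_slide_le_of_chain r h z z')
    linarith
  rw [edist_dist p q, ENNReal.ofReal_le_ofReal_iff dist_nonneg] at h1
  have := (Real.sqrt_le_iff.1 h1).2
  exact Real.le_sqrt_of_sq_le (by linarith)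

end Tree

end TorusComplex

end

/-! ### Equivariance of sliding, and translations of a vertex space -/

noncomputable section

namespace TorusComplex

namespace Tree

variable {ε ε' : ℝ≥0} {E₀ : Wall} {V : GVert}

theorem outside_stripPt_eq_zero {ω : State E₀} {a : Letter} {h : ω.Ok a} (hV : (ω.cons a h).InV V)
    (s : E2) {v : ℝ} (hv : v ∈ Set.Icc (0 : ℝ) 1) : outside ε V (stripPt ε ω a h s v) = 0 := by
  rw [outside, height_stripPt _ _ _ _ _ hv, if_pos hV, if_pos (State.inV_cons.1 hV).1]
  ring

@[elab_as_elim]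
theorem outside_ind {P : Tree ε E₀ → Prop} {p : Tree ε E₀} (hp : outside ε V p = 0)
    (wall : ∀ ω x u, u ∈ Set.Icc (0 : ℝ) (thickness ε ω.typ) → ω.InV V → P (wallPt ε ω x u))
    (strip : ∀ ω a h s v, v ∈ Set.Icc (0 : ℝ) 1 → (ω.cons a h).InV V → P (stripPt ε ω a h s v)) :
    P p := by
  induction p using ind with
  | wall ω x u hu => exact wall ω x u hu (outside_wallPt_eq_zero.1 hp)
  | strip ω a h s v hv =>
    by_cases hV : (ω.cons a h).InV V
    · exact strip ω a h s v hv hV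
    · rw [outside, height_stripPt _ _ _ _ _ hv, if_neg hV] at hp
      by_cases hω : ω.InV V
      · rw [if_pos hω] at hp
        obtain rfl : v = 0 := by linarith
        rw [stripPt_zero]
        exact wall _ _ _ (by rw [← h.src]; exact side_mem ε a.C a.b) hω
      · rw [if_neg hω] at hp
        linarith

theorem outside_slideWall (r : Rescaling ε ε' V) (ω : State E₀) (x : E3) (u : ℝ) (z : E2) :
    outside ε' V (slideWall r ω x u z) = 0 := by
  induction ω using State.induct generalizing x u with
  | nil =>
    rw [slideWall_of_inV r (State.inV_nil V), outside_wallPt_eq_zero]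
    exact State.inV_nil V
  | cons ω a h ih =>
    by_cases hV : (ω.cons a h).InV V
    · rw [slideWall_of_inV r hV, outside_wallPt_eq_zero]
      exact hV
    · rw [slideWall_of_not_inV r hV]
      exact ih _ _

theorem outside_slide (r : Rescaling ε ε' V) (p : Tree ε E₀) (z : E2) :
    outside ε' V (slide r p z) = 0 := by
  induction p using ind with
  | wall ω x u hu => exact outside_slideWall r ω x _ z
  | strip ω a h s v hv =>
    by_cases hV : (ω.cons a h).InV V
    · obtain ⟨h1, h2⟩ := State.inV_cons.1 hV
      rw [slide_stripPt r h1 h h2]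
      exact outside_stripPt_eq_zero hV _ hv
    · rw [slide_stripPt_of_not r h hV]
      exact outside_slideWall r _ _ _ z

theorem flat_slideWall (r : Rescaling ε ε' V) (ω : State E₀) (x : E3) (u : ℝ) (z : E2) :
    flat V (slideWall r ω x u z) = z := by
  have key : ∀ {ω : State E₀}, ω.InV V → ∀ x u, flat V (slideWall r ω x u z) = z := fun h x u => by
    rw [slideWall_of_inV r h, flat_wallPt, h.flat_add_plane, add_sub_cancel]
  induction ω using State.induct generalizing x u with
  | nil => exact key (State.inV_nil V) x u
  | cons ω a h ih =>
    by_cases hV : (ω.cons a h).InV V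
    · exact key hV x u
    · rw [slideWall_of_not_inV r hV]
      exact ih _ _

theorem flat_slide (r : Rescaling ε ε' V) (p : Tree ε E₀) (z : E2) : flat V (slide r p z) = z := by
  induction p using ind with
  | wall ω x u hu => exact flat_slideWall r ω x _ z
  | strip ω a h s v hv =>
    by_cases hV : (ω.cons a h).InV V
    · obtain ⟨h1, h2⟩ := State.inV_cons.1 hV
      rw [slide_stripPt r h1 h h2, flat_stripPt, h1.flat_emb_add h.src h2, add_sub_cancel]
    · rw [slide_stripPt_of_not r h hV]
      exact flat_slideWall r _ _ _ z

theorem slide_flat {p : Tree ε E₀} (hp : outside ε V p = 0) :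
    slide (.refl ε V) p (flat V p) = p := by
  refine outside_ind hp (fun ω x u hu hω => ?_) (fun ω a h s v hv hω => ?_)
  · rw [slide_wallPt _ hω _ hu, flat_wallPt, sub_self, map_zero, add_zero]
    rfl
  · obtain ⟨h1, h2⟩ := State.inV_cons.1 hω
    rw [slide_stripPt _ h1 h h2, flat_stripPt, sub_self, add_zero]

theorem slide_refl_slide (r : Rescaling ε ε' V) {p : Tree ε E₀} (hp : outside ε V p = 0) (z z' : E2) :
    slide (.refl ε' V) (slide r p z) z' = slide r p z' := by
  have e : ∀ f : E2, z - f + (z' - (f + (z - f))) = z' - f := fun f => by abel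
  refine outside_ind hp (fun ω x u hu hω => ?_) (fun ω a h s v hv hω => ?_)
  · rw [slide_wallPt r hω _ hu, slide_wallPt r hω _ hu, slide_wallPt', slideWall_of_inV _ hω,
      hω.flat_add_plane, add_assoc, ← map_add, e]
    exact wallPt_clamp _ _ _
  · obtain ⟨h1, h2⟩ := State.inV_cons.1 hω
    rw [slide_stripPt _ h1 h h2, slide_stripPt _ h1 h h2, slide_stripPt _ h1 h h2,
      h1.flat_emb_add h.src h2, add_assoc, e]

theorem slide_slide_refl (r : Rescaling ε ε' V) {p : Tree ε E₀} (hp : outside ε V p = 0) (z z' : E2) :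
    slide r (slide (.refl ε V) p z) z' = slide r p z' := by
  have e : ∀ f : E2, z - f + (z' - (f + (z - f))) = z' - f := fun f => by abel
  refine outside_ind hp (fun ω x u hu hω => ?_) (fun ω a h s v hv hω => ?_)
  · rw [slide_wallPt r hω _ hu, slide_wallPt _ hω _ hu, slide_wallPt r hω, hω.flat_add_plane,
      add_assoc, ← map_add, e]
    · rfl
    · exact hu
  · obtain ⟨h1, h2⟩ := State.inV_cons.1 hω
    rw [slide_stripPt _ h1 h h2, slide_stripPt _ h1 h h2, slide_stripPt _ h1 h h2,
      h1.flat_emb_add h.src h2, add_assoc, e]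

end Tree

section Transl

variable {Γ : Type} {E₀ : Wall} {α : Γ → State E₀ → State E₀} {l : Γ → State E₀ → E3} {V : GVert}

/-- The elements that translate all the walls of a vertex space along the flat factor. -/
def IsTransl (V : GVert) (α : Γ → State E₀ → State E₀) (l : Γ → State E₀ → E3) (ζ : Γ) :
    Prop :=
  α ζ .nil = .nil ∧ ∃ z ∈ vlat V, l ζ .nil = plane V E₀ z

theorem IsTransl.inV {ζ : Γ} (hζ : IsTransl V α l ζ) : (α ζ .nil).InV V := by
  rw [hζ.1]; exact State.inV_nil V

theorem transl_eq {ζ : Γ} {z : E2} (h1 : α ζ .nil = .nil) (h2 : l ζ .nil = plane V E₀ z) :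
    transl V α l ζ = z := by
  rw [transl, h1, h2, State.flat_nil, proj_plane]

theorem Letter.shift_plane (a : Letter) {z : E2} (hz : z ∈ vlat a.vert) :
    a.shift (plane a.vert a.src z) = a ∧ a.off (plane a.vert a.src z) = z := by
  have h1 := a.shift_add_plane 0 hz
  have h2 := a.off_add_plane 0 hz
  rw [zero_smul, zero_add] at h1 h2
  exact ⟨by rw [h1, add_zero], h2⟩

end Transl

section IsModel

variable {Γ : Type} [Group Γ] {ε ε' : ℝ≥0} {E₀ : Wall} {A : Γ →* (Tree ε E₀ ≃ᵢ Tree ε E₀)}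
  {A' : Γ →* (Tree ε' E₀ ≃ᵢ Tree ε' E₀)} {α : Γ → State E₀ → State E₀} {l : Γ → State E₀ → E3}
  {V : GVert}

namespace IsModel

open TorusComplex.Tree

theorem apply_stripPt (M : IsModel A α l) (γ : Γ) (ω : State E₀) (a h) (s : E2) (v : ℝ) :
    A γ (stripPt ε ω a h s v) =
      edgePt ε (α γ ω) (a.shift (l γ ω)) (s + a.off (l γ ω)) v := by
  rw [← edgePt_ok h, (M.motion γ).edge _ _ _ _ h.src]

theorem flat_act (M : IsModel A α l) {γ : Γ} (hγ : (α γ .nil).InV V) (p : Tree ε E₀) :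
    flat V (A γ p) = flat V p + transl V α l γ := by
  induction p using ind with
  | wall ω x u hu => rw [(M.motion γ).wall, flat_wallPt, flat_wallPt, M.flat_apply hγ]
  | strip ω a h s v hv =>
    rw [M.apply_stripPt, flat_edgePt ((M.motion γ).shift_src h.src), flat_stripPt,
      M.flat_apply_emb h.src (M.flat_apply hγ ω)]

theorem height_act (M : IsModel A α l) (γ : Γ) (g : State E₀ → ℝ) (p : Tree ε E₀) :
    height g (A γ p) = height (fun ω => g (α γ ω)) p := by
  induction p using ind with
  | wall ω x u hu => rw [(M.motion γ).wall, height_wallPt, height_wallPt]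
  | strip ω a h s v hv =>
    rw [M.apply_stripPt, height_edgePt _ ((M.motion γ).shift_src h.src) _ hv, height_stripPt _ _ _ _ _ hv,
      ← ((M.motion γ).nbr h.src 0).1, State.nbr_ok h]

open Classical in
theorem outside_act (M : IsModel A α l) {γ : Γ} (hγ : (α γ .nil).InV V) (p : Tree ε E₀) :
    outside ε V (A γ p) = outside ε V p := by
  rw [outside, M.height_act]
  exact congrArg (fun g => height g p) 
    (funext fun ω => if_congr (M.inV_apply_iff hγ ω) rfl rfl)

theorem inV_of_outside_act (M : IsModel A α l) {γ : Γ}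
    (h : ∀ p, outside ε V p = 0 → outside ε V (A γ p) = 0) : (α γ .nil).InV V := by
  have := h (wallPt ε .nil 0 0) (outside_wallPt_eq_zero.2 (State.inV_nil V))
  rw [(M.motion γ).wall] at this
  exact outside_wallPt_eq_zero.1 this

/-- Sliding uses only the labels of walls and strips and the flat coordinates, and both actions
change these by the same `α` and `l`. Hence it intertwines the two actions, even for different
thicknesses. -/
theorem slide_act (M : IsModel A α l) (M' : IsModel A' α l) (r : Rescaling ε ε' V) {γ : Γ}
    (hγ : (α γ .nil).InV V) {p : Tree ε E₀} (hp : outside ε V p = 0) (z : E2) :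
    slide r (A γ p) (z + transl V α l γ) = A' γ (slide r p z) := by
  refine outside_ind hp (fun ω x u hu hω => ?_) (fun ω a h s v hv hω => ?_)
  · rw [(M.motion γ).wall, slide_wallPt r (M.inV_apply hγ hω) _ (by rwa [(M.motion γ).typ]),
      slide_wallPt r hω _ hu, (M'.motion γ).wall, M.flat_apply hγ, add_sub_add_right_eq_sub,
      (M.motion γ).typ, add_right_comm]
  · obtain ⟨h1, h2⟩ := State.inV_cons.1 hω
    rw [M.apply_stripPt, slide_edgePt r (M.inV_apply hγ h1) ((M.motion γ).shift_src h.src) h2,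
      slide_stripPt r h1 h h2, M'.apply_stripPt, M.flat_apply_emb h.src (M.flat_apply hγ ω),
      add_sub_add_right_eq_sub, add_right_comm]

theorem transl_mul (M : IsModel A α l) {γ δ : Γ} (hγ : (α γ .nil).InV V) :
    transl V α l (γ * δ) = transl V α l γ + transl V α l δ := by
  rw [transl, (M.mul_apply _ _ _).1, (M.mul_apply _ _ _).2, M.flat_apply hγ, add_comm]
  rfl

/-- A lattice vector of the plane does not change the index of any strip of `V`. So a translation of
the base wall along its plane fixes the strips at that wall, and crossing them shows that it acts by
the same vector on every wall of the component. -/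
theorem isTransl_apply (M : IsModel A α l) {ζ : Γ} (hζ : IsTransl V α l ζ) {ω : State E₀}
    (hω : ω.InV V) : α ζ ω = ω ∧ l ζ ω = plane V ω.typ (transl V α l ζ) := by
  obtain ⟨hα, z, hz, hl⟩ := hζ
  rw [transl_eq hα hl]
  induction ω using State.induct with
  | nil => exact ⟨hα, hl⟩
  | cons ω a h ih =>
    obtain ⟨h1, rfl⟩ := State.inV_cons.1 hω
    obtain ⟨i1, i2⟩ := ih h1
    obtain ⟨hs, ho⟩ := a.shift_plane hz
    rw [h.src, ← i2] at hs ho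
    have h2 := (M.motion ζ).nbr h.src 0
    rw [hs, ho, i1, State.nbr_ok h, State.nbrIdx_ok h, Letter.rev_emb_zero, Letter.rev_emb_zero,
      a.embT_add, add_right_inj] at h2
    exact h2

theorem isTransl_act (M : IsModel A α l) {ζ : Γ} (hζ : IsTransl V α l ζ) {p : Tree ε E₀}
    (hp : outside ε V p = 0) : A ζ p = slide (.refl ε V) p (flat V p + transl V α l ζ) := by
  refine outside_ind hp (fun ω x u hu hω => ?_) (fun ω a h s v hv hω => ?_)
  · obtain ⟨h1, h2⟩ := M.isTransl_apply hζ hω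
    rw [(M.motion ζ).wall, slide_wallPt _ hω _ hu, flat_wallPt, add_sub_cancel_left, h1, h2]
    rfl
  · obtain ⟨h1, h2⟩ := State.inV_cons.1 hω
    obtain ⟨h3, h4⟩ := M.isTransl_apply hζ h1
    have hz : transl V α l ζ ∈ vlat V := by
      obtain ⟨h5, z, hz, h6⟩ := hζ
      rwa [transl_eq h5 h6]
    subst h2
    obtain ⟨hs, ho⟩ := a.shift_plane hz
    rw [h.src, ← h4] at hs ho
    rw [M.apply_stripPt, h3, hs, ho, edgePt_ok h, slide_stripPt _ h1 h rfl, flat_stripPt, add_sub_cancel_left]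

end IsModel

end IsModel

end TorusComplex

end

/-! ### Centers of vertex groups and their minimal displacement sets -/

noncomputable section

namespace TorusComplex

/-- Singles out the first crossing that leaves the component. The latest crossing comes first in a
word, so `<:+` compares the initial parts of the routes. -/
theorem State.exists_exit {E₀ : Wall} {V : GVert} {ω : State E₀} (hω : ¬ ω.InV V) :
    ∃ (ω₀ : State E₀) (a : Letter) (h : ω₀.Ok a), ω₀.InV V ∧ a.vert ≠ V ∧
      (ω₀.cons a h).1 <:+ ω.1 := by
  induction ω using State.induct with
  | nil => exact absurd (State.inV_nil V) hω
  | cons ω a h ih =>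
    by_cases h1 : ω.InV V
    · exact ⟨ω, a, h, h1, fun h2 => hω (State.inV_cons.2 ⟨h1, h2⟩), List.suffix_rfl⟩
    · obtain ⟨ω₀, a₀, h₀, h2, h3, h4⟩ := ih h1
      exact ⟨ω₀, a₀, h₀, h2, h3, h4.trans (List.suffix_cons _ _)⟩

theorem State.InV.exists_cyl {V : GVert} {ω : State (baseWall V)} (hω : ω.InV V) :
    ∃ C b, Cyl.att C b = ω.typ ∧ C.vert = V := by
  rcases ω.eq_nil_or_cons with rfl | ⟨ω, a, h, rfl⟩
  · exact ⟨.c V.1 V.2, false, rfl, rfl⟩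
  · exact ⟨a.C, !a.b, rfl, (State.inV_cons.1 hω).2⟩

theorem plane_mem_baseWall_lat (V : GVert) {z : E2} (hz : z ∈ vlat V) :
    plane V (baseWall V) z ∈ (baseWall V).lat :=
  plane_mem_lat (.c V.1 V.2) false hz

theorem trans_mem_baseWall_lat (V : GVert) : trans V (baseWall V) ∈ (baseWall V).lat :=
  trans_mem_lat (.c V.1 V.2) false

section IsModel

variable {Γ : Type} [Group Γ] {ε : ℝ≥0} {V : GVert}
  {A : Γ →* (Tree ε (baseWall V) ≃ᵢ Tree ε (baseWall V))}
  {α : Γ → State (baseWall V) → State (baseWall V)} {l : Γ → State (baseWall V) → E3}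

namespace IsModel

open TorusComplex.Tree

/-! ### The center of a vertex group -/

theorem exists_isTransl (M : IsModel A α l) {z : E2} (hz : z ∈ vlat V) :
    ∃ ζ, IsTransl V α l ζ ∧ transl V α l ζ = z := by
  obtain ⟨ζ, h1, h2⟩ := M.transitive .nil _ rfl (plane_mem_baseWall_lat V hz)
  exact ⟨ζ, ⟨h1, z, hz, h2⟩, transl_eq h1 h2⟩

theorem commute_of_isTransl (M : IsModel A α l) {ζ γ : Γ} (hζ : IsTransl V α l ζ)
    (hγ : (α γ .nil).InV V) : ζ * γ = γ * ζ := by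
  obtain ⟨h1, h2⟩ := M.isTransl_apply hζ hγ
  obtain ⟨h3, h4⟩ := M.isTransl_apply hζ (State.inV_nil V)
  refine M.ext ?_ ?_
  · rw [(M.mul_apply _ _ _).1, (M.mul_apply _ _ _).1, h1, h3]
  · rw [(M.mul_apply _ _ _).2, (M.mul_apply _ _ _).2, h2, h3, h4, (M.motion γ).typ, add_comm]

/-- An element that moves the base wall transversally to the planes shifts the indices of all strips
of `V` at that wall by `k`. So it moves all parts of the component behind those strips. -/
theorem apply_ne_self (M : IsModel A α l) {γ : Γ} {k : ℤ} (hk : k ≠ 0) {z : E2} (hz : z ∈ vlat V)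
    (h1 : α γ .nil = .nil) (h2 : l γ .nil = k • trans V (baseWall V) + plane V (baseWall V) z)
    {ω : State (baseWall V)} (hω : ω.InV V) (hne : ω ≠ .nil) : α γ ω ≠ ω := by
  induction ω using State.induct with
  | nil => exact absurd rfl hne
  | cons ω a h ih =>
    obtain ⟨h3, h4⟩ := State.inV_cons.1 hω
    obtain ⟨h', e⟩ := M.apply_cons (γ := γ) (D := fun ω => ω = .nil) rfl
      (fun _ _ _ h => absurd h (State.cons_ne_nil _ _ _))
      (fun ω => by
        constructor
        · intro h
          rw [← h1] at h
          exact M.injective γ h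
        · rintro rfl
          exact h1) ω a h (State.cons_ne_nil _ _ _)
    rw [e]
    intro e2
    obtain ⟨e3, e4⟩ := State.cons_inj e2
    by_cases h0 : ω = .nil
    · subst h0
      have hs : a.src = baseWall V := h.src
      have h5 : l γ .nil = k • trans a.vert a.src + plane a.vert a.src z := by rw [h2, h4, hs]
      rw [h5, a.shift_add_plane k (by rwa [h4])] at e4
      have := congrArg Letter.k e4
      simp at this
      exact hk this
    · exact ih h3 h0 e3

/-- Inside the component, the transverse translation `τ` fixes only the base wall; as `γ` commutes
with `τ`, it preserves this wall. If `γ` had a transverse part, the base wall would be the only wall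
of the component fixed by `γ`, but `γ` also fixes its images under the vertex group. -/
theorem isTransl_of_commute (M : IsModel A α l) {γ : Γ} (hγ : (α γ .nil).InV V)
    (h : ∀ δ, (α δ .nil).InV V → γ * δ = δ * γ) : IsTransl V α l γ := by
  have key : ∀ δ, (α δ .nil).InV V → α γ (α δ .nil) = α δ (α γ .nil) := fun δ hδ => by
    rw [← (M.mul_apply _ _ _).1, ← (M.mul_apply _ _ _).1, h δ hδ]
  have h0 : α γ .nil = .nil := by
    obtain ⟨τ, h1, h2⟩ := M.transitive .nil _ rfl (trans_mem_baseWall_lat V)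
    have h3 := key τ (by rw [h1]; exact State.inV_nil V)
    rw [h1] at h3
    by_contra hne
    refine M.apply_ne_self (k := 1) one_ne_zero (zero_mem (vlat V)) h1 ?_ hγ hne h3.symm
    rw [h2, one_smul, map_zero, add_zero]
  obtain ⟨k, z, hz, hl⟩ := exists_of_mem_lat (.c V.1 V.2) false ((M.motion γ).mem .nil)
  refine ⟨h0, z, hz, ?_⟩
  by_cases hk : k = 0
  · rw [hl, hk, zero_smul, zero_add]
    rfl
  exfalso
  -- A second wall of the type of the base wall is needed: cross `C_i^±` and come back along another
  -- strip. The index 1 prevents the second crossing from undoing the first.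
  let a₁ : Letter := ⟨.c V.1 V.2, false, 0⟩
  let a₂ : Letter := ⟨.c V.1 V.2, true, 1⟩
  have ok₁ : (State.nil (E₀ := baseWall V)).Ok a₁ := ⟨rfl, fun _ _ h => by simp [State.nil] at h⟩
  have ok₂ : (State.nil.cons a₁ ok₁).Ok a₂ := ⟨rfl, fun _ _ _ h => by simp [a₂] at h⟩
  have hV : ((State.nil.cons a₁ ok₁).cons a₂ ok₂).InV V :=
    State.inV_cons.2 ⟨State.inV_cons.2 ⟨State.inV_nil V, rfl⟩, rfl⟩
  obtain ⟨δ, h1, -⟩ := M.transitive ((State.nil.cons a₁ ok₁).cons a₂ ok₂) 0 rfl (zero_mem _)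
  have h2 := key δ (by rw [h1]; exact hV)
  rw [h0, h1] at h2
  exact M.apply_ne_self hk hz h0 hl hV (State.cons_ne_nil _ _ _) h2

/-! ### Minimal displacement -/

theorem dist_act_of_isTransl (M : IsModel A α l) {ζ : Γ} (hζ : IsTransl V α l ζ)
    {p : Tree ε (baseWall V)} (hp : outside ε V p = 0) : dist (A ζ p) p = ‖transl V α l ζ‖ := by
  refine le_antisymm ?_ ?_
  · have h1 := dist_slide_slide_le (.refl ε V) p (flat V p + transl V α l ζ) (flat V p)
    rwa [slide_flat hp, ← M.isTransl_act hζ hp, add_sub_cancel_left] at h1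
  · have h1 := norm_flat_sub_le (V := V) (A ζ p) p
    rwa [M.flat_act hζ.inV, add_sub_cancel_left] at h1

/-- Everything behind an exit strip is carried along with the wall directly behind it. -/
theorem suffix_apply (M : IsModel A α l) {γ : Γ} (hγ : (α γ .nil).InV V) {ω₀ : State (baseWall V)}
    {a : Letter} (h : ω₀.Ok a) (ha : a.vert ≠ V) {ω : State (baseWall V)}
    (hω : (ω₀.cons a h).1 <:+ ω.1) : (α γ (ω₀.cons a h)).1 <:+ (α γ ω).1 := by
  induction ω using State.induct with
  | nil =>
    have := List.eq_nil_of_suffix_nil hω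
    simp [State.cons] at this
  | cons ω a' h' ih =>
    rcases List.suffix_cons_iff.1 hω with h1 | h1
    · rw [show ω₀.cons a h = ω.cons a' h' from Subtype.ext h1]
    · obtain ⟨h2, e⟩ := M.apply_cons_of_not_inV hγ ω a' h' fun h3 =>
        ha (h3 a (List.mem_cons_of_mem _ (h1.subset List.mem_cons_self)))
      rw [e]
      exact (ih h1).trans (List.suffix_cons _ _)

/-- Choose a translation `z` of `V` that is not parallel to the plane of the exit strip. If the
parts behind the strip and behind its image met, their words would share an initial part of that
length, so the indices would agree and the translation vector of the wall would lie in the plane of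
the strip. -/
theorem exists_separating (M : IsModel A α l) {ω₀ : State (baseWall V)} (hω₀ : ω₀.InV V)
    {a : Letter} (h : ω₀.Ok a) (ha : a.vert ≠ V) :
    ∃ ζ, IsTransl V α l ζ ∧ ∀ ω, (ω₀.cons a h).1 <:+ ω.1 → ¬ (ω₀.cons a h).1 <:+ (α ζ ω).1 := by
  obtain ⟨C, b, hC, rfl⟩ := hω₀.exists_cyl
  obtain ⟨z, hz, hz'⟩ := exists_transversal hC h.src ha
  obtain ⟨ζ, hζ, ht⟩ := M.exists_isTransl hz
  refine ⟨ζ, hζ, fun ω h1 h2 => ?_⟩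
  have h3 := M.suffix_apply hζ.inV h ha h1
  obtain ⟨h', e⟩ := M.apply_cons_of_not_inV hζ.inV ω₀ a h (fun h4 => ha (State.inV_cons.1 h4).2)
  obtain ⟨h5, h6⟩ := M.isTransl_apply hζ hω₀
  have h7 : (ω₀.cons a h).1.length = (α ζ (ω₀.cons a h)).1.length := by
    rw [e]
    simp [State.cons, h5]
  have h8 : (ω₀.cons a h).1 = (α ζ (ω₀.cons a h)).1 := by
    rcases List.suffix_or_suffix_of_suffix h2 h3 with h9 | h9
    · exact h9.eq_of_length h7
    · exact (h9.eq_of_length h7.symm).symm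
  have h9 := State.cons_inj ((Subtype.ext h8).trans e)
  have h10 := congrArg Letter.k h9.2
  have hm := (M.motion ζ).mem_src h.src
  have h11 := (latCoord_spec a.C a.b hm).2
  have h12 : (latCoord a.C a.b (l ζ ω₀)).1 = 0 := by simpa [Letter.shift] using h10
  rw [h12, zero_smul, zero_add, h6, ht] at h11
  exact hz' _ (h11.trans (by rw [← h.src]; rfl))

/-- Take the indicator of the part behind the exit strip through which `p` is reached, extended
affinely along strips. The separating `ζ` strictly decreases its value at `p`. Together with the
shift of `flat` by the full translation vector, `sq_flat_add_sq_height_le` makes the displacement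
strictly larger than that vector. -/
theorem exists_lt_dist (M : IsModel A α l) {p : Tree ε (baseWall V)} (hp : outside ε V p ≠ 0) :
    ∃ ζ, IsTransl V α l ζ ∧ ‖transl V α l ζ‖ < dist (A ζ p) p := by
  classical
  have key : ∀ {ω₀ : State (baseWall V)} (_ : ω₀.InV V) {a : Letter} (h : ω₀.Ok a) (_ : a.vert ≠ V),
      (∀ β : State (baseWall V) → State (baseWall V), β ω₀ = ω₀ →
        (∀ ω, (ω₀.cons a h).1 <:+ ω.1 → ¬ (ω₀.cons a h).1 <:+ (β ω).1) →
        height (fun ω => if (ω₀.cons a h).1 <:+ (β ω).1 then (1 : ℝ) else 0) p <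
          height (fun ω => if (ω₀.cons a h).1 <:+ ω.1 then (1 : ℝ) else 0) p) →
      ∃ ζ, IsTransl V α l ζ ∧ ‖transl V α l ζ‖ < dist (A ζ p) p := by
    intro ω₀ hω₀ a h ha hlt
    obtain ⟨ζ, hζ, h1⟩ := M.exists_separating hω₀ h ha
    refine ⟨ζ, hζ, ?_⟩
    have h2 := hlt (α ζ) (M.isTransl_apply hζ hω₀).1 h1
    have h3 := sq_flat_add_sq_height_le (V := V)
      (g := fun ω : State (baseWall V) => if (ω₀.cons a h).1 <:+ ω.1 then (1 : ℝ) else 0)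
      (fun ω a h => by split_ifs <;> simp) (A ζ p) p
    rw [M.height_act, M.flat_act hζ.inV, add_sub_cancel_left] at h3
    refine lt_of_pow_lt_pow_left₀ 2 dist_nonneg (lt_of_lt_of_le ?_ h3)
    have := sq_pos_of_neg (sub_neg.2 h2)
    linarith
  induction p using ind with
  | wall ω x u hu =>
    obtain ⟨ω₀, a, h, h1, h2, h3⟩ := State.exists_exit (mt outside_wallPt_eq_zero.2 hp)
    refine key h1 h h2 fun β _ hβ => ?_
    rw [height_wallPt, height_wallPt, if_pos h3, if_neg (hβ _ h3)]
    exact one_pos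
  | strip ω a h s v hv =>
    by_cases hω : ω.InV V
    · have h2 : a.vert ≠ V := fun h2 =>
        hp (outside_stripPt_eq_zero (State.inV_cons.2 ⟨hω, h2⟩) s hv)
      refine key hω h h2 fun β h3 hβ => ?_
      have h4 : ¬ (ω.cons a h).1 <:+ ω.1 := fun h4 => by
        have := h4.length_le
        simp [State.cons] at this
      rw [height_stripPt _ _ _ _ _ hv, height_stripPt _ _ _ _ _ hv]
      rw [if_neg (hβ _ List.suffix_rfl), h3, if_neg h4, if_pos List.suffix_rfl]
      have h5 : v ≠ 0 := fun h5 => hp (by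
        rw [h5, stripPt_zero]; exact outside_wallPt_eq_zero.2 hω)
      have := hv.1.lt_of_ne' h5
      linarith
    · obtain ⟨ω₀, a₀, h₀, h1, h2, h3⟩ := State.exists_exit hω
      refine key h1 h₀ h2 fun β _ hβ => ?_
      have h4 : (ω₀.cons a₀ h₀).1 <:+ (ω.cons a h).1 := h3.trans (List.suffix_cons _ _)
      rw [height_stripPt _ _ _ _ _ hv, height_stripPt _ _ _ _ _ hv, if_pos h3, if_pos h4,
        if_neg (hβ _ h3), if_neg (hβ _ h4)]
      linarith

/-- As `flat` is 1-Lipschitz, `ζ` moves every point by at least the length of its translation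
vector. Equality holds on the component, so this length is the infimum; off the component some `ζ`
exceeds it. -/
theorem groupMinSet_eq (M : IsModel A α l) {Λ : Subgroup Γ} (hΛ : ∀ ζ, ζ ∈ Λ ↔ IsTransl V α l ζ) :
    groupMinSet A Λ = {p | outside ε V p = 0} := by
  have h0 : ∀ ζ, IsTransl V α l ζ → ∀ p, ENNReal.ofReal ‖transl V α l ζ‖ ≤ edist (A ζ p) p :=
    fun ζ hζ p => by
      rw [edist_dist]
      refine ENNReal.ofReal_le_ofReal ?_
      have h1 := norm_flat_sub_le (V := V) (A ζ p) p
      rwa [M.flat_act hζ.inV, add_sub_cancel_left] at h1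
  have h1 : ∀ ζ, IsTransl V α l ζ → ∀ p, outside ε V p = 0 →
      edist (A ζ p) p = ENNReal.ofReal ‖transl V α l ζ‖ := fun ζ hζ p hp => by
    rw [edist_dist, M.dist_act_of_isTransl hζ hp]
  have ho : outside ε V (wallPt ε (State.nil (E₀ := baseWall V)) 0 0) = 0 :=
    outside_wallPt_eq_zero.2 (State.inV_nil V)
  ext p
  refine ⟨fun hp => ?_, fun hp ζ hζ => ?_⟩
  · by_contra hne
    obtain ⟨ζ, hζ, hlt⟩ := M.exists_lt_dist hne
    have h2 : edist (A ζ p) p ≤ edist (A ζ _) _ := (hp ζ ((hΛ ζ).2 hζ)).le.trans (iInf_le _ (wallPt ε .nil 0 0))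
    rw [h1 ζ hζ _ ho, edist_dist, ENNReal.ofReal_le_ofReal_iff (norm_nonneg _)] at h2
    exact absurd h2 (not_le.2 hlt)
  · have hζ' := (hΛ ζ).1 hζ
    refine le_antisymm (le_iInf fun q => ?_) (iInf_le _ p)
    rw [h1 ζ hζ' p hp]
    exact h0 ζ hζ' q

end IsModel

end IsModel

end TorusComplex

end

/-! ### The product splitting of the minimal displacement set -/

noncomputable section

theorem mem_groupMinSet_of_mem_normalizer {Γ X : Type} [Group Γ] [PseudoEMetricSpace X]
    {ρ : Γ →* (X ≃ᵢ X)} {Λ : Subgroup Γ} {γ : Γ} (hγ : γ ∈ Subgroup.normalizer (Λ : Set Γ)) {x : X}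
    (hx : x ∈ groupMinSet ρ Λ) : ρ γ x ∈ groupMinSet ρ Λ := by
  intro ζ hζ
  have h1 : γ⁻¹ * ζ * γ ∈ Λ := by
    have := (Subgroup.mem_normalizer_iff.1 hγ (γ⁻¹ * ζ * γ)).2
    refine this ?_
    rwa [show γ * (γ⁻¹ * ζ * γ) * γ⁻¹ = ζ by group]
  have h2 : ∀ y, edist (ρ ζ (ρ γ y)) (ρ γ y) = edist (ρ (γ⁻¹ * ζ * γ) y) y := fun y => by
    rw [← (ρ γ).isometry.edist_eq (ρ (γ⁻¹ * ζ * γ) y) y]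
    congr 1
    change (ρ ζ * ρ γ) y = (ρ γ * ρ (γ⁻¹ * ζ * γ)) y
    rw [← map_mul, ← map_mul]
    congr 2
    group
  have h3 : edist (ρ (γ⁻¹ * ζ * γ) x) x = ⨅ y, edist (ρ (γ⁻¹ * ζ * γ) y) y := hx _ h1
  change edist (ρ ζ (ρ γ x)) (ρ γ x) = ⨅ y, edist (ρ ζ y) y
  rw [h2, h3]
  exact (iInf_congr fun y => (h2 y).symm).trans
    ((ρ γ).surjective.iInf_comp fun y => edist (ρ ζ y) y)

namespace TorusComplex

open TorusComplex.Tree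

theorem span_vlat (V : GVert) : Submodule.span ℝ (vlat V : Set E2) = ⊤ := by
  rw [eq_top_iff]
  intro s _
  have hp := (vertPeriod_pos V).ne'
  have h2 : √2 ≠ 0 := by simp
  have : s = (s 0 / vertPeriod V) • !₂[vertPeriod V, 0] + (s 1 / √2) • !₂[0, √2] := by
    ext i
    fin_cases i <;> simp [hp]
  rw [this]
  exact add_mem (Submodule.smul_mem _ _ (Submodule.subset_span ⟨1, 0, by simp⟩))
    (Submodule.smul_mem _ _ (Submodule.subset_span ⟨0, 1, by simp⟩))

/-- The non-Euclidean factor of a vertex space. -/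
abbrev Core (ε : ℝ≥0) (V : GVert) : Type :=
  {p : Tree ε (baseWall V) // outside ε V p = 0 ∧ flat V p = 0}

variable {ε ε' : ℝ≥0} {V : GVert}

/-- The projection to the non-Euclidean factor. -/
def toCore (r : Rescaling ε ε' V) (p : Tree ε (baseWall V)) : Core ε' V :=
  ⟨slide r p 0, outside_slide r p 0, flat_slide r p 0⟩

theorem dist_toCore_le (r : Rescaling ε ε' V) (p q : Tree ε (baseWall V)) :
    dist (toCore r p) (toCore r q) ≤ dist p q := by
  have := dist_slide_le r p q 0 0
  rwa [sub_self, norm_zero, zero_pow two_ne_zero, add_zero, Real.sqrt_sq dist_nonneg] at this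

theorem toCore_coe (y : Core ε V) : toCore (.refl ε V) (y : Tree ε (baseWall V)) = y := by
  refine Subtype.ext ?_
  have := slide_flat y.2.1
  rwa [y.2.2] at this

instance : Nonempty (Core ε V) := ⟨toCore (.refl ε V) (wallPt ε .nil 0 0)⟩

variable {Γ : Type} [Group Γ] {A : Γ →* (Tree ε (baseWall V) ≃ᵢ Tree ε (baseWall V))}
  {A' : Γ →* (Tree ε' (baseWall V) ≃ᵢ Tree ε' (baseWall V))}
  {α : Γ → State (baseWall V) → State (baseWall V)} {l : Γ → State (baseWall V) → E3}
  {Λ : Subgroup Γ}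

namespace IsModel

theorem slide_act_slide (M : IsModel A α l) {γ : Γ} (hγ : (α γ .nil).InV V) {p : Tree ε (baseWall V)}
    (hp : outside ε V p = 0) (z z' : E2) :
    slide (.refl ε V) (A γ (slide (.refl ε V) p z)) z' = slide (.refl ε V) (A γ p) z' := by
  rw [← M.slide_act M _ hγ hp, slide_refl_slide]
  rwa [M.outside_act hγ]

theorem toCore_act_toCore (M : IsModel A α l) {γ : Γ} (hγ : (α γ .nil).InV V)
    {p : Tree ε (baseWall V)} (hp : outside ε V p = 0) :
    toCore (.refl ε V) (A γ (toCore (.refl ε V) p : Core ε V)) = toCore (.refl ε V) (A γ p) :=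
  Subtype.ext (M.slide_act_slide hγ hp 0 0)

theorem toCore_inv_act (M : IsModel A α l) {γ : Γ} (hγ : (α γ .nil).InV V) (y : Core ε V) :
    toCore (.refl ε V) (A γ⁻¹ (toCore (.refl ε V) (A γ y) : Core ε V)) = y := by
  rw [M.toCore_act_toCore (M.inV_inv hγ) (by rw [M.outside_act hγ, y.2.1]), map_inv]
  exact (congrArg (toCore _) ((A γ).symm_apply_apply _)).trans (toCore_coe y)

/-- The action on the non-Euclidean factor. -/
def bar (M : IsModel A α l) {γ : Γ} (hγ : (α γ .nil).InV V) : Core ε V ≃ᵢ Core ε V where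
  toFun y := toCore (.refl ε V) (A γ y)
  invFun y := toCore (.refl ε V) (A γ⁻¹ y)
  left_inv y := M.toCore_inv_act hγ y
  right_inv y := by
    have := M.toCore_inv_act (M.inV_inv hγ) y
    rwa [inv_inv] at this
  -- The maps induced by `γ` and `γ⁻¹` are inverse to each other and neither increases distances.
  isometry_toFun := by
    have h : ∀ δ, ∀ y y' : Core ε V,
        dist (toCore (.refl ε V) (A δ y)) (toCore (.refl ε V) (A δ y')) ≤ dist y y' :=
      fun δ y y' => (dist_toCore_le _ _ _).trans ((A δ).dist_eq _ _).le
    refine Isometry.of_dist_eq fun y y' => le_antisymm (h γ y y') ?_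
    have := h γ⁻¹ (toCore (.refl ε V) (A γ y)) (toCore (.refl ε V) (A γ y'))
    rwa [M.toCore_inv_act hγ, M.toCore_inv_act hγ] at this

theorem mem_groupMinSet (M : IsModel A α l) (hΛ : ∀ ζ, ζ ∈ Λ ↔ IsTransl V α l ζ)
    {p : Tree ε (baseWall V)} : p ∈ groupMinSet A Λ ↔ outside ε V p = 0 := by
  rw [M.groupMinSet_eq hΛ]
  rfl

/-- The normalizer preserves the minimal displacement set, which is the component of the base wall.
All statements about motions of the component thus apply to the normalizer. -/
theorem inV_of_mem_normalizer (M : IsModel A α l) (hΛ : ∀ ζ, ζ ∈ Λ ↔ IsTransl V α l ζ) {γ : Γ}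
    (hγ : γ ∈ Subgroup.normalizer (Λ : Set Γ)) : (α γ .nil).InV V := by
  refine M.inV_of_outside_act fun p hp => ?_
  rw [← M.mem_groupMinSet hΛ] at hp ⊢
  exact mem_groupMinSet_of_mem_normalizer hγ hp

/-- Product coordinates on a vertex space. -/
def coord (M : IsModel A α l) (hΛ : ∀ ζ, ζ ∈ Λ ↔ IsTransl V α l ζ) :
    groupMinSet A Λ ≃ᵢ WithLp 2 (Core ε V × E2) where
  toFun p := WithLp.toLp 2 (toCore (.refl ε V) (p : Tree ε (baseWall V)), flat V (p : Tree ε (baseWall V)))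
  invFun q := ⟨slide (.refl ε V) (q.fst : Tree ε (baseWall V)) q.snd,
    (M.mem_groupMinSet hΛ).2 (outside_slide _ _ _)⟩
  left_inv p := Subtype.ext <| (slide_refl_slide _ ((M.mem_groupMinSet hΛ).1 p.2) _ _).trans
    (slide_flat ((M.mem_groupMinSet hΛ).1 p.2))
  right_inv q := by
    refine congrArg (WithLp.toLp 2) (Prod.ext (Subtype.ext ?_) (flat_slide _ _ _))
    exact (slide_refl_slide _ q.fst.2.1 _ _).trans (congrArg Subtype.val (toCore_coe q.fst))
  isometry_toFun := by
    -- Sliding to flat coordinate 0 together with `flat` is 1-Lipschitz; the opposite inequality is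
    -- `dist_slide_le` for sliding back.
    refine Isometry.of_dist_eq fun p q => le_antisymm ?_ ?_
    · have := (lipschitz_slide_flat (.refl ε V)).dist_le_mul (p : Tree ε (baseWall V)) q
      rw [NNReal.coe_one, one_mul] at this
      rw [dist_toLp_two] at this ⊢
      exact this
    · have hp := (M.mem_groupMinSet hΛ).1 p.2
      have hq := (M.mem_groupMinSet hΛ).1 q.2
      have := dist_slide_le (.refl ε V) (slide (.refl ε V) (p : Tree ε (baseWall V)) 0)
        (slide (.refl ε V) (q : Tree ε (baseWall V)) 0) (flat V (p : Tree ε (baseWall V)))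
        (flat V (q : Tree ε (baseWall V)))
      rw [slide_refl_slide _ hp, slide_refl_slide _ hq, slide_flat hp, slide_flat hq] at this
      rw [dist_toLp_two, dist_eq_norm (flat V _)]
      exact this

/-- The splitting of the minimal displacement set of the center of a vertex group. -/
def flatSplitting (M : IsModel A α l) (hΛ : ∀ ζ, ζ ∈ Λ ↔ IsTransl V α l ζ) :
    FlatSplitting A Λ 2 where
  Ybar := Core ε V
  coord := M.coord hΛ
  bar γ := M.bar (M.inV_of_mem_normalizer hΛ γ.2)
  -- Not only the centralizer but every normalizing element acts on the flat factor by a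
  -- translation, by `flat_act`.
  euc γ := IsometryEquiv.addRight (transl V α l γ)
  coord_act γ x y h := by
    have hγ := M.inV_of_mem_normalizer hΛ γ.2
    have hx := (M.mem_groupMinSet hΛ).1 x.2
    refine congrArg (WithLp.toLp 2) (Prod.ext ?_ ?_)
    · rw [h]
      exact (M.toCore_act_toCore hγ hx).symm
    · rw [h]
      exact M.flat_act hγ _
  euc_centralizer γ _ w := by simp
  bar_lattice γ hγ y := by
    refine Subtype.ext ?_
    change slide (.refl ε V) (A γ y) 0 = y
    rw [M.isTransl_act ((hΛ γ).1 hγ) y.2.1, slide_refl_slide _ y.2.1]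
    exact congrArg Subtype.val (toCore_coe y)
  euc_lattice γ _ w := by simp
  span_lattice := by
    rw [eq_top_iff, ← span_vlat V]
    refine Submodule.span_mono fun z hz => ?_
    obtain ⟨ζ, hζ, ht⟩ := M.exists_isTransl hz
    exact ⟨⟨ζ, Subgroup.le_normalizer ((hΛ ζ).2 hζ)⟩, (hΛ ζ).2 hζ, by simp [ht]⟩

theorem vec_flatSplitting (M : IsModel A α l) (hΛ : ∀ ζ, ζ ∈ Λ ↔ IsTransl V α l ζ)
    (γ : Subgroup.normalizer (Λ : Set Γ)) : (M.flatSplitting hΛ).vec γ = transl V α l γ := by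
  simp [FlatSplitting.vec, flatSplitting]

theorem toCore_const_act (M : IsModel A α l) (M' : IsModel A' α l) (r : Rescaling ε ε' V) {γ : Γ}
    (hγ : (α γ .nil).InV V) (y : Core ε V) :
    M'.bar hγ (toCore r y) = toCore r (M.bar hγ y : Core ε V) := by
  refine Subtype.ext ?_
  change slide (.refl ε' V) (A' γ (slide r y 0)) 0 = slide r (slide (.refl ε V) (A γ y) 0) 0
  have h : outside ε V (A γ y) = 0 := by rw [M.outside_act hγ, y.2.1]
  rw [slide_slide_refl r h, ← M.slide_act M' r hγ y.2.1, slide_refl_slide r h]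

/-- Collapsing the thickness of the walls to the attaching height, `Rescaling.const`, gives an
equivariant 1-Lipschitz map between the non-Euclidean factors for `ε` and `ε'`, so translation
lengths cannot grow. Exchanging the two thicknesses turns this into equality. -/
theorem barLength_flatSplitting_le (M : IsModel A α l) (M' : IsModel A' α l)
    (hΛ : ∀ ζ, ζ ∈ Λ ↔ IsTransl V α l ζ) (γ : Subgroup.normalizer (Λ : Set Γ)) :
    (M'.flatSplitting hΛ).barLength γ ≤ (M.flatSplitting hΛ).barLength γ := by
  refine le_ciInf fun y : Core ε V => ?_
  refine (ciInf_le (OrderBot.bddBelow _) (toCore (.const ε ε' V) y : Core ε' V)).trans ?_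
  have hγ := M.inV_of_mem_normalizer hΛ γ.2
  change nndist (M'.bar hγ _) _ ≤ nndist (M.bar hγ y) y
  rw [M.toCore_const_act M' _ hγ]
  exact dist_toCore_le _ _ _

end IsModel

end TorusComplex

end

/-! ### Rigidity of flat splittings -/

noncomputable section

/-! ### Rigidity of flat splittings -/

section

variable {Γ X X' : Type} [Group Γ] [PseudoEMetricSpace X] [PseudoEMetricSpace X']
  {ρ : Γ →* (X ≃ᵢ X)} {ρ' : Γ →* (X' ≃ᵢ X')} {Λ : Subgroup Γ} {n : ℕ}

/-- The infimum of the displacement of `γ` on the minimal displacement set of `Λ`. -/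
def groupDispl (ρ : Γ →* (X ≃ᵢ X)) (Λ : Subgroup Γ) (γ : Γ) : ℝ≥0∞ :=
  ⨅ x : groupMinSet ρ Λ, edist (ρ γ x) x

namespace FlatSplitting

open Subgroup

theorem coord_map (S : FlatSplitting ρ Λ n) (γ : normalizer (Λ : Set Γ)) (x : groupMinSet ρ Λ) :
    S.coord ⟨ρ γ x, mem_groupMinSet_of_mem_normalizer γ.2 x.2⟩ =
      WithLp.toLp 2 (S.bar γ (S.coord x).fst, S.euc γ (S.coord x).snd) :=
  S.coord_act γ x _ rfl

/-- Multiplicativity is not part of the structure. It follows because the coordinates are bijective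
and the factors are determined by the action on pairs. -/
theorem bar_mul_euc_mul (S : FlatSplitting ρ Λ n) (γ δ : normalizer (Λ : Set Γ)) (y : S.Ybar)
    (w : EuclideanSpace ℝ (Fin n)) :
    S.bar (γ * δ) y = S.bar γ (S.bar δ y) ∧ S.euc (γ * δ) w = S.euc γ (S.euc δ w) := by
  obtain ⟨x, hx⟩ := S.coord.surjective (WithLp.toLp 2 (y, w))
  have h1 := S.coord_map (γ * δ) x
  have h2 := S.coord_map γ ⟨ρ δ x, mem_groupMinSet_of_mem_normalizer δ.2 x.2⟩
  rw [S.coord_map δ x, hx] at h2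
  rw [hx] at h1
  have h3 : ρ (γ * δ : Γ) x = ρ γ (ρ δ x) := by rw [map_mul]; rfl
  have h4 := h1.symm.trans ((congrArg S.coord (Subtype.ext h3)).trans h2)
  exact ⟨congrArg (fun q => q.fst) h4, congrArg (fun q => q.snd) h4⟩

theorem edist_act (S : FlatSplitting ρ Λ n) {γ : normalizer (Λ : Set Γ)}
    (hγ : (γ : Γ) ∈ centralizer (Λ : Set Γ)) (x : groupMinSet ρ Λ) :
    edist (ρ γ x) x = ENNReal.ofReal
      √(dist (S.bar γ (S.coord x).fst) (S.coord x).fst ^ 2 + ‖S.vec γ‖ ^ 2) := by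
  have h1 : edist (ρ γ x) (x : X) =
      edist (⟨ρ γ x, mem_groupMinSet_of_mem_normalizer γ.2 x.2⟩ : groupMinSet ρ Λ) x := rfl
  have h2 : S.coord x = WithLp.toLp 2 ((S.coord x).fst, (S.coord x).snd) := rfl
  rw [h1, ← S.coord.isometry.edist_eq, S.coord_map]
  conv_lhs => rw [h2]
  rw [edist_dist]
  refine congrArg ENNReal.ofReal ((TorusComplex.dist_toLp_two _ _ _ _).trans ?_)
  change √(_ ^ 2 + dist (S.euc γ (S.coord x).snd) (S.coord x).snd ^ 2) = _
  rw [S.euc_centralizer γ hγ, dist_self_add_left]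
  rfl

/-- Pythagoras with a constant displacement on the flat factor. Since the left side refers to the
action only, this is the invariant through which different splittings are compared. -/
theorem groupDispl_eq (S : FlatSplitting ρ Λ n) {γ : normalizer (Λ : Set Γ)}
    (hγ : (γ : Γ) ∈ centralizer (Λ : Set Γ)) :
    groupDispl ρ Λ γ = ENNReal.ofReal √((S.barLength γ : ℝ) ^ 2 + ‖S.vec γ‖ ^ 2) := by
  refine le_antisymm ?_ (le_iInf fun x => ?_)
  · obtain ⟨y₀⟩ := S.nonemptyYbar
    have h1 : ∀ y, groupDispl ρ Λ γ ≤
        ENNReal.ofReal √(dist (S.bar γ y) y ^ 2 + ‖S.vec γ‖ ^ 2) := fun y => by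
      refine (iInf_le _ (S.coord.symm (WithLp.toLp 2 (y, 0)))).trans (le_of_eq ?_)
      rw [S.edist_act hγ, IsometryEquiv.apply_symm_apply]
      rfl
    have hne : groupDispl ρ Λ γ ≠ ⊤ := ((h1 y₀).trans_lt ENNReal.ofReal_lt_top).ne
    set I := (groupDispl ρ Λ γ).toReal
    -- The bound is solved for the displacement on `Ȳ`, so that the infimum over the points of `Ȳ`
    -- can be taken.
    have h2 : Real.toNNReal √(I ^ 2 - ‖S.vec γ‖ ^ 2) ≤ S.barLength γ := by
      refine le_ciInf fun y => ?_
      rw [Real.toNNReal_le_iff_le_coe, coe_nndist, Real.sqrt_le_iff]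
      refine ⟨dist_nonneg, ?_⟩
      have h3 := ENNReal.toReal_le_of_le_ofReal (Real.sqrt_nonneg _) (h1 y)
      have := (Real.le_sqrt ENNReal.toReal_nonneg (by positivity)).1 h3
      linarith
    rw [Real.toNNReal_le_iff_le_coe, Real.sqrt_le_iff] at h2
    rw [← ENNReal.ofReal_toReal hne]
    exact ENNReal.ofReal_le_ofReal (Real.le_sqrt_of_sq_le (by linarith [h2.2]))
  · rw [S.edist_act hγ]
    refine ENNReal.ofReal_le_ofReal (Real.sqrt_le_sqrt (add_le_add_left ?_ _))
    refine pow_le_pow_left₀ (NNReal.coe_nonneg _) ?_ 2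
    exact ciInf_le (f := fun y => nndist (S.bar γ y) y) (OrderBot.bddBelow _) (S.coord x).fst

theorem vec_mul (S : FlatSplitting ρ Λ n) {γ δ : normalizer (Λ : Set Γ)}
    (hγ : (γ : Γ) ∈ centralizer (Λ : Set Γ)) : S.vec (γ * δ) = S.vec γ + S.vec δ := by
  obtain ⟨y⟩ := S.nonemptyYbar
  rw [vec, (S.bar_mul_euc_mul γ δ y 0).2, S.euc_centralizer γ hγ, add_comm]
  rfl

theorem barLength_mul_lattice (S : FlatSplitting ρ Λ n) {γ ζ : normalizer (Λ : Set Γ)}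
    (hζ : (ζ : Γ) ∈ Λ) : S.barLength (γ * ζ) = S.barLength γ := by
  refine iInf_congr fun y => ?_
  rw [(S.bar_mul_euc_mul γ ζ y 0).1, S.bar_lattice ζ hζ]

theorem barLength_lattice (S : FlatSplitting ρ Λ n) {ζ : normalizer (Λ : Set Γ)}
    (hζ : (ζ : Γ) ∈ Λ) : S.barLength ζ = 0 := by
  obtain ⟨y⟩ := S.nonemptyYbar
  refine le_antisymm ((ciInf_le (OrderBot.bddBelow _) y).trans ?_) bot_le
  rw [S.bar_lattice ζ hζ, nndist_self]

theorem sq_add_sq_eq (S : FlatSplitting ρ Λ n) (S' : FlatSplitting ρ' Λ n)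
    {γ : normalizer (Λ : Set Γ)} (hγ : (γ : Γ) ∈ centralizer (Λ : Set Γ))
    (h : groupDispl ρ Λ γ = groupDispl ρ' Λ γ) :
    (S.barLength γ : ℝ) ^ 2 + ‖S.vec γ‖ ^ 2 = (S'.barLength γ : ℝ) ^ 2 + ‖S'.vec γ‖ ^ 2 := by
  rw [S.groupDispl_eq hγ, S'.groupDispl_eq hγ,
    ENNReal.ofReal_eq_ofReal_iff (Real.sqrt_nonneg _) (Real.sqrt_nonneg _),
    Real.sqrt_inj (by positivity) (by positivity)] at h
  exact h

/-- Polarization of `|γ̄|² + ‖vec γ‖²`: passing from `γ` to `γ * ζ` leaves the first term unchanged,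
and the first term vanishes for `ζ` itself, so only the mixed inner product remains. -/
theorem inner_eq (S : FlatSplitting ρ Λ n) (S' : FlatSplitting ρ' Λ n)
    (hΛ : Λ ≤ centralizer (Λ : Set Γ))
    (h : ∀ γ ∈ centralizer (Λ : Set Γ), groupDispl ρ Λ γ = groupDispl ρ' Λ γ)
    {γ ζ : normalizer (Λ : Set Γ)} (hγ : (γ : Γ) ∈ centralizer (Λ : Set Γ)) (hζ : (ζ : Γ) ∈ Λ) :
    inner ℝ (S.vec γ) (S.vec ζ) = inner ℝ (S'.vec γ) (S'.vec ζ) := by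
  have h1 := S.sq_add_sq_eq S' hγ (h _ hγ)
  have h2 := S.sq_add_sq_eq S' (hΛ hζ) (h _ (hΛ hζ))
  have h3 := S.sq_add_sq_eq S' (γ := γ * ζ) (mul_mem hγ (hΛ hζ)) (h _ (mul_mem hγ (hΛ hζ)))
  rw [S.barLength_mul_lattice hζ, S'.barLength_mul_lattice hζ, S.vec_mul hγ, S'.vec_mul hγ,
    norm_add_sq_real, norm_add_sq_real] at h3
  rw [S.barLength_lattice hζ, S'.barLength_lattice hζ] at h2
  linarith

/-- The translation vectors of generators of `Λ` span the flat factor. -/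
theorem span_vec (S : FlatSplitting ρ Λ n) (hΛ : Λ ≤ centralizer (Λ : Set Γ)) (ζ : Fin n → Λ)
    (hζ : Function.Surjective fun k : Fin n → ℤ => (List.ofFn fun i => ζ i ^ k i).prod) :
    Submodule.span ℝ (Set.range fun i => S.vec ⟨ζ i, le_normalizer (ζ i).2⟩) = ⊤ := by
  let φ : Λ →* Multiplicative (EuclideanSpace ℝ (Fin n)) := MonoidHom.mk'
    (fun γ => Multiplicative.ofAdd (S.vec ⟨γ, le_normalizer γ.2⟩))
    fun γ δ => congrArg Multiplicative.ofAdd (S.vec_mul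
      (γ := ⟨γ, le_normalizer γ.2⟩) (δ := ⟨δ, le_normalizer δ.2⟩) (hΛ γ.2))
  let W : Subgroup Λ := ((Submodule.span ℝ
    (Set.range fun i => S.vec ⟨ζ i, le_normalizer (ζ i).2⟩)).toAddSubgroup.toSubgroup).comap φ
  have hW : ∀ γ, γ ∈ W := fun γ => by
    obtain ⟨k, rfl⟩ := hζ γ
    refine list_prod_mem fun x hx => ?_
    obtain ⟨i, rfl⟩ := (List.mem_ofFn' _ _).1 hx
    exact zpow_mem (show ζ i ∈ W from Submodule.subset_span ⟨i, rfl⟩) _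
  rw [eq_top_iff, ← S.span_lattice, Submodule.span_le]
  rintro _ ⟨γ, hγ, rfl⟩
  exact hW ⟨γ, hγ⟩

theorem linearIndependent_vec (S : FlatSplitting ρ Λ n) {ζ : Fin n → Λ}
    (hS : Submodule.span ℝ (Set.range fun i => S.vec ⟨ζ i, le_normalizer (ζ i).2⟩) = ⊤) :
    LinearIndependent ℝ fun i => S.vec ⟨ζ i, le_normalizer (ζ i).2⟩ :=
  linearIndependent_of_top_le_span_of_card_eq_finrank hS.ge (by simp)

/-- The combination of the lattice vectors of `S` with coefficients `c - c'` is orthogonal to every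
lattice vector, because both splittings have the same inner products with these vectors. As the
lattice vectors form a basis, all coefficients vanish. -/
theorem coeff_eq (S : FlatSplitting ρ Λ n) (S' : FlatSplitting ρ' Λ n)
    (hΛ : Λ ≤ centralizer (Λ : Set Γ))
    (h : ∀ γ ∈ centralizer (Λ : Set Γ), groupDispl ρ Λ γ = groupDispl ρ' Λ γ) {ζ : Fin n → Λ}
    (hS : Submodule.span ℝ (Set.range fun i => S.vec ⟨ζ i, le_normalizer (ζ i).2⟩) = ⊤)
    {γ : normalizer (Λ : Set Γ)} (hγ : (γ : Γ) ∈ centralizer (Λ : Set Γ)) {c c' : Fin n → ℝ}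
    (hc : S.vec γ = ∑ i, c i • S.vec ⟨ζ i, le_normalizer (ζ i).2⟩)
    (hc' : S'.vec γ = ∑ i, c' i • S'.vec ⟨ζ i, le_normalizer (ζ i).2⟩) : c = c' := by
  set v := fun i => S.vec ⟨ζ i, le_normalizer (ζ i).2⟩
  have h1 : ∀ j, inner ℝ (∑ i, (c i - c' i) • v i) (v j) = (0 : ℝ) := fun j => by
    have h2 := S.inner_eq S' hΛ h (ζ := ⟨ζ j, le_normalizer (ζ j).2⟩) hγ (ζ j).2
    rw [hc'] at h2
    simp only [sub_smul, Finset.sum_sub_distrib, inner_sub_left]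
    rw [← hc, h2, sum_inner, sum_inner, ← Finset.sum_sub_distrib]
    refine Finset.sum_eq_zero fun i _ => ?_
    rw [real_inner_smul_left, real_inner_smul_left,
      S.inner_eq S' hΛ h (γ := ⟨ζ i, le_normalizer (ζ i).2⟩) (ζ := ⟨ζ j, le_normalizer (ζ j).2⟩)
        (hΛ (ζ i).2) (ζ j).2, sub_self]
  have h2 : ∑ i, (c i - c' i) • v i = 0 := by
    rw [← inner_self_eq_zero (𝕜 := ℝ)]
    conv_lhs => rw [inner_sum]
    refine Finset.sum_eq_zero fun j _ => ?_
    rw [real_inner_smul_right, h1, mul_zero]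
  ext i
  exact sub_eq_zero.1 (Fintype.linearIndependent_iff.1 (S.linearIndependent_vec hS) _ h2 i)

theorem exists_coeff (S : FlatSplitting ρ Λ n) {ζ : Fin n → Λ}
    (hS : Submodule.span ℝ (Set.range fun i => S.vec ⟨ζ i, le_normalizer (ζ i).2⟩) = ⊤)
    (x : EuclideanSpace ℝ (Fin n)) :
    ∃ c : Fin n → ℝ, x = ∑ i, c i • S.vec ⟨ζ i, le_normalizer (ζ i).2⟩ := by
  have hx : x ∈ Submodule.span ℝ (Set.range fun i => S.vec ⟨ζ i, le_normalizer (ζ i).2⟩) := by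
    rw [hS]; trivial
  obtain ⟨c, hc⟩ := (Submodule.mem_span_range_iff_exists_fun ℝ).1 hx
  exact ⟨c, hc.symm⟩

/-- Equal coefficients and equal inner products give translation vectors of equal length. The
remaining term of the Pythagorean formula must then agree too. -/
theorem barLength_eq (S : FlatSplitting ρ Λ n) (S' : FlatSplitting ρ' Λ n)
    (hΛ : Λ ≤ centralizer (Λ : Set Γ))
    (h : ∀ γ ∈ centralizer (Λ : Set Γ), groupDispl ρ Λ γ = groupDispl ρ' Λ γ) {ζ : Fin n → Λ}
    (hζ : Function.Surjective fun k : Fin n → ℤ => (List.ofFn fun i => ζ i ^ k i).prod)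
    {γ : normalizer (Λ : Set Γ)} (hγ : (γ : Γ) ∈ centralizer (Λ : Set Γ)) :
    S.barLength γ = S'.barLength γ := by
  have hS := S.span_vec hΛ ζ hζ
  obtain ⟨c, hc⟩ := S.exists_coeff hS (S.vec γ)
  obtain ⟨c', hc'⟩ := S'.exists_coeff (S'.span_vec hΛ ζ hζ) (S'.vec γ)
  obtain rfl := S.coeff_eq S' hΛ h hS hγ hc hc'
  have h1 : ‖S.vec γ‖ ^ 2 = ‖S'.vec γ‖ ^ 2 := by
    rw [← real_inner_self_eq_norm_sq, ← real_inner_self_eq_norm_sq]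
    nth_rewrite 2 [hc]
    nth_rewrite 2 [hc']
    rw [inner_sum, inner_sum]
    refine Finset.sum_congr rfl fun i _ => ?_
    rw [real_inner_smul_right, real_inner_smul_right,
      S.inner_eq S' hΛ h (ζ := ⟨ζ i, le_normalizer (ζ i).2⟩) hγ (ζ i).2]
  have h2 := S.sq_add_sq_eq S' hγ (h _ hγ)
  rw [h1, add_left_inj] at h2
  exact NNReal.coe_injective ((sq_eq_sq₀ (NNReal.coe_nonneg _) (NNReal.coe_nonneg _)).1 h2)

end FlatSplitting

end

namespace TorusComplex

variable {Γ M N : Type} [Group Γ] [PseudoEMetricSpace M] [PseudoEMetricSpace N] {Λ : Subgroup Γ}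
  {n : ℕ}

theorem mem_groupMinSet_conjAct (D : M ≃ᵢ N) (ρ : Γ →* (N ≃ᵢ N)) {p : M} :
    p ∈ groupMinSet (conjAct D ρ) Λ ↔ D p ∈ groupMinSet ρ Λ := by
  refine forall₂_congr fun ζ _ => ?_
  have h : ∀ p, edist (conjAct D ρ ζ p) p = edist (ρ ζ (D p)) (D p) := fun p => by
    rw [← apply_conjAct, D.isometry.edist_eq]
  change edist _ _ = _ ↔ edist _ _ = _
  rw [h, iInf_congr h, D.surjective.iInf_comp fun y => edist (ρ ζ y) y]

/-- Transport of the minimal displacement set along an isometry. -/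
def groupMinSetConj (D : M ≃ᵢ N) (ρ : Γ →* (N ≃ᵢ N)) :
    groupMinSet ρ Λ ≃ᵢ groupMinSet (conjAct D ρ) Λ where
  toFun x := ⟨D.symm x, (mem_groupMinSet_conjAct D ρ).2 (by rw [D.apply_symm_apply]; exact x.2)⟩
  invFun p := ⟨D p, (mem_groupMinSet_conjAct D ρ).1 p.2⟩
  left_inv x := Subtype.ext (D.apply_symm_apply _)
  right_inv p := Subtype.ext (D.symm_apply_apply _)
  isometry_toFun x y := D.symm.isometry.edist_eq x y

/-- Transport of a flat splitting along an isometry. -/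
def _root_.FlatSplitting.ofConj (D : M ≃ᵢ N) {ρ : Γ →* (N ≃ᵢ N)}
    (S : FlatSplitting (conjAct D ρ) Λ n) : FlatSplitting ρ Λ n where
  Ybar := S.Ybar
  coord := (groupMinSetConj D ρ).trans S.coord
  bar := S.bar
  euc := S.euc
  coord_act γ x y h := by
    refine S.coord_act γ _ _ ?_
    change D.symm y = D.symm (ρ γ (D (D.symm x)))
    rw [D.apply_symm_apply, h]
  euc_centralizer := S.euc_centralizer
  bar_lattice := S.bar_lattice
  euc_lattice := S.euc_lattice
  span_lattice := S.span_lattice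

end TorusComplex

end

/-! ### Equivariant generators, existence and comparison of the data -/

noncomputable section

section

variable {Γ X X' : Type} [Group Γ] [PseudoEMetricSpace X] [PseudoEMetricSpace X']
  {𝒯 : VertexSystem Γ} {n : ℕ}

namespace VertexSystem

theorem exists_conjEquiv (𝒯 : VertexSystem Γ) {g : Γ} {u v : 𝒯.Vert} (h : g • u = v) :
    ∃ e : 𝒯.Lam u ≃* 𝒯.Lam v, ∀ x, (e x : Γ) = g * x * g⁻¹ := by
  subst h
  exact ⟨((MulAut.conj g).subgroupMap (𝒯.Lam u)).trans
    (MulEquiv.subgroupCongr (𝒯.Lam_smul g u).symm), fun x => rfl⟩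

/-- Free generators of the groups `Λ_v` for representatives `v` of the orbits extend to an
equivariant choice, if `Λ_v` is central in the stabilizer of `v`. -/
theorem exists_isEquivariantBasis (𝒯 : VertexSystem Γ)
    (hc : ∀ v, MulAction.stabilizer Γ v ≤ Subgroup.centralizer (𝒯.Lam v : Set Γ))
    (hb : ∀ v, ∃ ζ : Fin n → 𝒯.Lam v, (∀ i j, Commute (ζ i) (ζ j)) ∧
      Function.Bijective fun k : Fin n → ℤ => (List.ofFn fun i => ζ i ^ k i).prod) :
    ∃ ζ : ∀ v, Fin n → 𝒯.Lam v, 𝒯.IsEquivariantBasis ζ := by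
  choose ζ₀ hcomm hbij using hb
  let r : 𝒯.Vert → 𝒯.Vert := fun v => (Quotient.mk (MulAction.orbitRel Γ 𝒯.Vert) v).out
  have hr : ∀ v, ∃ g : Γ, g • r v = v := fun v => by
    obtain ⟨g, hg⟩ := (MulAction.orbitRel_apply (G := Γ)).1
      (Quotient.mk_out (s := MulAction.orbitRel Γ 𝒯.Vert) v)
    exact ⟨g⁻¹, by rw [inv_smul_eq_iff]; exact hg.symm⟩
  choose g hg using hr
  have he := fun v => 𝒯.exists_conjEquiv (hg v)
  choose e he using he
  refine ⟨fun v i => e v (ζ₀ (r v) i), ⟨fun v i j => (hcomm (r v) i j).map (e v), fun v => ?_,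
    fun h v i => ?_⟩⟩
  · have : (fun k : Fin n → ℤ => (List.ofFn fun i => (e v (ζ₀ (r v) i)) ^ k i).prod) =
        e v ∘ fun k : Fin n → ℤ => (List.ofFn fun i => ζ₀ (r v) i ^ k i).prod := by
      ext1 k
      rw [Function.comp_apply, map_list_prod, List.map_ofFn]
      congr 2
      ext1 i
      simp
    rw [this]
    exact (e v).bijective.comp (hbij (r v))
  · rw [he, he]
    have hrv : r (h • v) = r v := congrArg Quotient.out (Quotient.sound
      ((MulAction.orbitRel_apply (G := Γ)).2 ⟨h, rfl⟩))
    let F : 𝒯.Vert → Γ := fun u => ζ₀ u i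
    change g (h • v) * F (r (h • v)) * (g (h • v))⁻¹ = h * (g v * F (r v) * (g v)⁻¹) * h⁻¹
    rw [hrv]
    -- Two elements that carry the representative to the same vertex differ by an element of its
    -- stabilizer, which commutes with `Λ_v`. The conjugated generators thus do not depend on the
    -- choice.
    have hs : (h * g v)⁻¹ * g (h • v) ∈ MulAction.stabilizer Γ (r v) := by
      have h1 := hg (h • v)
      rw [hrv] at h1
      rw [MulAction.mem_stabilizer_iff, mul_smul, h1, inv_smul_eq_iff, mul_smul, hg]
    have h2 := Subgroup.mem_centralizer_iff.1 (hc _ hs) (F (r v)) (ζ₀ (r v) i).2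
    set s := (h * g v)⁻¹ * g (h • v)
    have h3 : g (h • v) = h * g v * s := (mul_inv_cancel_left _ _).symm
    rw [h3]
    calc h * g v * s * F (r v) * (h * g v * s)⁻¹ = h * g v * (s * F (r v)) * s⁻¹ * (h * g v)⁻¹ := by
          group
      _ = h * (g v * F (r v) * (g v)⁻¹) * h⁻¹ := by rw [← h2]; group

end VertexSystem

namespace GeometricData

theorem exists_isDataOf {ρ : Γ →* (X ≃ᵢ X)} {ζ : ∀ v, Fin n → 𝒯.Lam v}
    (hζ : 𝒯.IsEquivariantBasis ζ) (hc : ∀ v, 𝒯.Lam v ≤ Subgroup.centralizer (𝒯.Lam v : Set Γ))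
    (hS : ∀ v, Nonempty (FlatSplitting ρ (𝒯.Lam v) n)) :
    ∃ D : GeometricData 𝒯 n, D.IsDataOf ρ ζ := by
  let S : ∀ v, FlatSplitting ρ (𝒯.Lam v) n := fun v => (hS v).some
  let b := fun v => Module.Basis.mk
    ((S v).linearIndependent_vec ((S v).span_vec (hc v) (ζ v) (hζ.bijective v).2))
    ((S v).span_vec (hc v) (ζ v) (hζ.bijective v).2).ge
  refine ⟨⟨fun v γ => (S v).barLength ⟨γ, 𝒯.stabilizer_le_normalizer v γ.2⟩, fun v =>
    MonoidHom.mk' (fun γ => Multiplicative.ofAdd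
      ⇑((b v).repr ((S v).vec ⟨γ, 𝒯.centralizer_le_normalizer v γ.2⟩)))
      fun γ δ => congrArg Multiplicative.ofAdd ?_⟩, fun v => ⟨S v, fun _ => rfl, fun γ => ?_⟩⟩
  · have := (S v).vec_mul (γ := ⟨γ, 𝒯.centralizer_le_normalizer v γ.2⟩)
      (δ := ⟨δ, 𝒯.centralizer_le_normalizer v δ.2⟩) γ.2
    exact (congrArg (fun x => ⇑((b v).repr x)) this).trans (by rw [map_add]; rfl)
  · exact ((b v).sum_repr ((S v).vec ⟨γ, 𝒯.centralizer_le_normalizer v γ.2⟩)).symm.trans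
      (Finset.sum_congr rfl fun i _ => by rw [Module.Basis.mk_apply]; rfl)

/-- The data of any two splittings are determined by the displacement infima, so equal infima give
equal data and the scaling factor can be taken to be 1. This applies to `MLS` because the stabilizer
lies in the centralizer of `Λ_v`. -/
theorem equivalent_of_groupDispl_eq {ρ : Γ →* (X ≃ᵢ X)} {ρ' : Γ →* (X' ≃ᵢ X')}
    {ζ : ∀ v, Fin n → 𝒯.Lam v} (hζ : 𝒯.IsEquivariantBasis ζ)
    (hc : ∀ v, MulAction.stabilizer Γ v ≤ Subgroup.centralizer (𝒯.Lam v : Set Γ))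
    (hc' : ∀ v, 𝒯.Lam v ≤ Subgroup.centralizer (𝒯.Lam v : Set Γ))
    (h : ∀ v, ∀ γ ∈ Subgroup.centralizer (𝒯.Lam v : Set Γ),
      groupDispl ρ (𝒯.Lam v) γ = groupDispl ρ' (𝒯.Lam v) γ)
    {D D' : GeometricData 𝒯 n} (hD : D.IsDataOf ρ ζ) (hD' : D'.IsDataOf ρ' ζ) :
    D.Equivalent D' := by
  intro v
  obtain ⟨S, h1, h2⟩ := hD v
  obtain ⟨S', h1', h2'⟩ := hD' v
  have hspan := S.span_vec (hc' v) (ζ v) (hζ.bijective v).2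
  refine ⟨⟨1, one_pos, fun γ => ?_⟩, MonoidHom.ext fun γ => ?_⟩
  · rw [h1, h1', one_mul]
    exact (S.barLength_eq S' (hc' v) (h v) (hζ.bijective v).2 (hc v γ.2)).symm
  · exact congrArg Multiplicative.ofAdd
      (S.coeff_eq S' (hc' v) (h v) hspan γ.2 (h2 γ) (h2' γ)).symm

end GeometricData

end

namespace TorusComplex

namespace IsModel

open TorusComplex.Tree

variable {Γ : Type} [Group Γ] {ε : ℝ≥0} {V : GVert}
  {A : Γ →* (Tree ε (baseWall V) ≃ᵢ Tree ε (baseWall V))}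
  {α : Γ → State (baseWall V) → State (baseWall V)} {l : Γ → State (baseWall V) → E3}
  {Λ : Subgroup Γ}

/-- The translation vector embeds `Λ` in the plane with image `vlat V`, a lattice with an obvious
basis. -/
theorem exists_basis (M : IsModel A α l) (hΛ : ∀ ζ, ζ ∈ Λ ↔ IsTransl V α l ζ) :
    ∃ ζ : Fin 2 → Λ, (∀ i j, Commute (ζ i) (ζ j)) ∧
      Function.Bijective fun k : Fin 2 → ℤ => (List.ofFn fun i => ζ i ^ k i).prod := by
  obtain ⟨ζ₀, h0, t0⟩ := M.exists_isTransl (V := V) (z := !₂[vertPeriod V, 0]) ⟨1, 0, by simp⟩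
  obtain ⟨ζ₁, h1, t1⟩ := M.exists_isTransl (V := V) (z := !₂[0, √2]) ⟨0, 1, by simp⟩
  let φ : Λ →* Multiplicative E2 := MonoidHom.mk'
    (fun γ => Multiplicative.ofAdd (transl V α l γ))
    fun γ δ => congrArg Multiplicative.ofAdd (M.transl_mul ((hΛ γ).1 γ.2).inV)
  have hφ : Function.Injective φ := fun γ δ h => by
    obtain ⟨e1, z, -, e2⟩ := (hΛ γ).1 γ.2
    obtain ⟨e1', z', -, e2'⟩ := (hΛ δ).1 δ.2
    have h' : transl V α l γ = transl V α l δ := h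
    rw [transl_eq e1 e2, transl_eq e1' e2'] at h'
    exact Subtype.ext (M.ext (e1.trans e1'.symm) (by rw [e2, e2', h']))
  have hp := (vertPeriod_pos V).ne'
  let ζ : Fin 2 → Λ := ![⟨ζ₀, (hΛ ζ₀).2 h0⟩, ⟨ζ₁, (hΛ ζ₁).2 h1⟩]
  have hprod : ∀ k : Fin 2 → ℤ, φ (List.ofFn fun i => ζ i ^ k i).prod =
      Multiplicative.ofAdd !₂[k 0 * vertPeriod V, k 1 * √2] := fun k => by
    have e0 : φ (ζ 0) = Multiplicative.ofAdd !₂[vertPeriod V, 0] := congrArg Multiplicative.ofAdd t0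
    have e1 : φ (ζ 1) = Multiplicative.ofAdd !₂[0, √2] := congrArg Multiplicative.ofAdd t1
    simp only [List.ofFn_succ, List.ofFn_zero, List.prod_cons, List.prod_nil, mul_one, map_mul,
      map_zpow]
    change φ (ζ 0) ^ k 0 * φ (ζ 1) ^ k 1 = _
    rw [e0, e1, ← ofAdd_zsmul, ← ofAdd_zsmul, ← ofAdd_add]
    congr 1
    ext i
    fin_cases i <;> simp
  refine ⟨ζ, fun i j => Subtype.ext (M.commute_of_isTransl ((hΛ _).1 (ζ i).2)
    ((hΛ _).1 (ζ j).2).inV), fun k k' h => ?_, fun γ => ?_⟩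
  · have h2 := congrArg φ h
    simp only [hprod] at h2
    have h3 := Multiplicative.ofAdd.injective h2
    have h4 := congrArg (fun x : E2 => x 0) h3
    have h5 := congrArg (fun x : E2 => x 1) h3
    simp [hp] at h4 h5
    ext i
    fin_cases i
    · exact h4
    · exact h5
  · obtain ⟨e1, z, ⟨k, m, hz⟩, e2⟩ := (hΛ γ).1 γ.2
    refine ⟨![k, m], hφ ?_⟩
    simp only [hprod]
    exact congrArg Multiplicative.ofAdd (by rw [transl_eq e1 e2, hz]; simp)

end IsModel

theorem mem_Lam_iff {w : ∀ V : GVert, Path (base 0) (vertexBase V)} {v : TreeVert w} {γ : Gamma} :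
    γ ∈ (vertexSystem w).Lam v ↔ γ ∈ MulAction.stabilizer Gamma v ∧
      ∀ δ ∈ MulAction.stabilizer Gamma v, γ * δ = δ * γ := by
  constructor
  · rintro ⟨x, hx, rfl⟩
    exact ⟨x.2, fun δ hδ => (congrArg Subtype.val (Subgroup.mem_center_iff.1 hx ⟨δ, hδ⟩)).symm⟩
  · rintro ⟨h1, h2⟩
    exact ⟨⟨γ, h1⟩, Subgroup.mem_center_iff.2 fun δ => Subtype.ext (h2 δ δ.2).symm, rfl⟩

theorem stabilizer_le_centralizer (w : ∀ V : GVert, Path (base 0) (vertexBase V)) (v : TreeVert w) :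
    MulAction.stabilizer Gamma v ≤ Subgroup.centralizer ((vertexSystem w).Lam v : Set Gamma) :=
  fun _ hγ => Subgroup.mem_centralizer_iff.2 fun _ hζ => (mem_Lam_iff.1 hζ).2 _ hγ

theorem Lam_le_centralizer (w : ∀ V : GVert, Path (base 0) (vertexBase V)) (v : TreeVert w) :
    (vertexSystem w).Lam v ≤ Subgroup.centralizer ((vertexSystem w).Lam v : Set Gamma) :=
  fun _ hγ => stabilizer_le_centralizer w v (mem_Lam_iff.1 hγ).1

theorem mem_Lam_iff_isTransl {w : ∀ V : GVert, Path (base 0) (vertexBase V)} {v : TreeVert w}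
    {ε : ℝ≥0} {A : Gamma →* (Tree ε (baseWall v.1) ≃ᵢ Tree ε (baseWall v.1))} {α l}
    (M : IsModel A α l) (hs : ∀ γ, γ ∈ MulAction.stabilizer Gamma v ↔ (α γ .nil).InV v.1) (ζ : Gamma) :
    ζ ∈ (vertexSystem w).Lam v ↔ IsTransl v.1 α l ζ := by
  rw [mem_Lam_iff]
  simp only [hs]
  exact ⟨fun h => M.isTransl_of_commute h.1 h.2, fun h =>
    ⟨h.inV, fun δ hδ => M.commute_of_isTransl h hδ⟩⟩

theorem exists_basis_Lam (w : ∀ V : GVert, Path (base 0) (vertexBase V)) (v : TreeVert w) :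
    ∃ ζ : Fin 2 → (vertexSystem w).Lam v, (∀ i j, Commute (ζ i) (ζ j)) ∧
      Function.Bijective fun k : Fin 2 → ℤ => (List.ofFn fun i => ζ i ^ k i).prod := by
  obtain ⟨P₀, α, l, M, -, hs⟩ := Tree.exists_isModel_vertex w v
  exact M.exists_basis (mem_Lam_iff_isTransl M hs)

/-- Both splittings are built from the same `α` and `l`, so their translation vectors coincide. The
translation lengths agree by `barLength_flatSplitting_le` in both directions. -/
theorem exists_flatSplitting (ε : ℝ≥0) (w : ∀ V : GVert, Path (base 0) (vertexBase V))
    (v : TreeVert w) :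
    ∃ (S : FlatSplitting action₀ ((vertexSystem w).Lam v) 2)
      (S' : FlatSplitting (action ε) ((vertexSystem w).Lam v) 2),
      ∀ γ, S.barLength γ = S'.barLength γ ∧ S.vec γ = S'.vec γ := by
  obtain ⟨P₀, α, l, M, M', hs⟩ := Tree.exists_isModel_vertex w v
  have hΛ := mem_Lam_iff_isTransl M hs
  refine ⟨(M.flatSplitting hΛ).ofConj (Tree.develop P₀),
    ((M' ε).flatSplitting hΛ).ofConj (Tree.develop (Tree.markPath ε P₀)), fun γ => ⟨?_, ?_⟩⟩
  · exact le_antisymm ((M' ε).barLength_flatSplitting_le M hΛ γ) (M.barLength_flatSplitting_le (M' ε) hΛ γ)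
  · exact (M.vec_flatSplitting hΛ γ).trans ((M' ε).vec_flatSplitting hΛ γ).symm

/-- The particular splittings are used only to compare the displacement infima. This is enough for
arbitrary splittings by rigidity. -/
theorem groupDispl_eq_groupDispl (ε : ℝ≥0) (w : ∀ V : GVert, Path (base 0) (vertexBase V))
    (v : TreeVert w) (γ : Gamma) (hγ : γ ∈ Subgroup.centralizer ((vertexSystem w).Lam v : Set Gamma)) :
    groupDispl action₀ ((vertexSystem w).Lam v) γ = groupDispl (action ε) ((vertexSystem w).Lam v) γ := by
  obtain ⟨S, S', h⟩ := exists_flatSplitting ε w v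
  have h1 := S.groupDispl_eq (γ := ⟨γ, (vertexSystem w).centralizer_le_normalizer v hγ⟩) hγ
  have h2 := S'.groupDispl_eq (γ := ⟨γ, (vertexSystem w).centralizer_le_normalizer v hγ⟩) hγ
  rw [(h _).1, (h _).2] at h1
  exact h1.trans h2.symm

end TorusComplex

end

theorem proposition8 (ε : ℝ≥0) (hε : 0 < ε)
    (w : ∀ V : TorusComplex.GVert,
      Path (TorusComplex.base 0) (TorusComplex.vertexBase V)) :
    (∃ ζ : ∀ v : (TorusComplex.vertexSystem w).Vert,
        Fin 2 → (TorusComplex.vertexSystem w).Lam v,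
      (TorusComplex.vertexSystem w).IsEquivariantBasis ζ) ∧
    ∀ ζ : ∀ v : (TorusComplex.vertexSystem w).Vert,
        Fin 2 → (TorusComplex.vertexSystem w).Lam v,
      (TorusComplex.vertexSystem w).IsEquivariantBasis ζ →
      (∃ D : GeometricData (TorusComplex.vertexSystem w) 2,
        D.IsDataOf TorusComplex.action₀ ζ) ∧
      (∃ D' : GeometricData (TorusComplex.vertexSystem w) 2,
        D'.IsDataOf (TorusComplex.action ε) ζ) ∧
      ∀ D D' : GeometricData (TorusComplex.vertexSystem w) 2,
        D.IsDataOf TorusComplex.action₀ ζ → D'.IsDataOf (TorusComplex.action ε) ζ →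
          D.Equivalent D' := by
  refine ⟨VertexSystem.exists_isEquivariantBasis _ (TorusComplex.stabilizer_le_centralizer w)
    (TorusComplex.exists_basis_Lam w), fun ζ hζ => ⟨?_, ?_, fun D D' hD hD' => ?_⟩⟩
  · exact GeometricData.exists_isDataOf hζ (TorusComplex.Lam_le_centralizer w) fun v =>
      ⟨(TorusComplex.exists_flatSplitting ε w v).choose⟩
  · exact GeometricData.exists_isDataOf hζ (TorusComplex.Lam_le_centralizer w) fun v =>
      ⟨(TorusComplex.exists_flatSplitting ε w v).choose_spec.choose⟩
  · exact GeometricData.equivalent_of_groupDispl_eq hζ (TorusComplex.stabilizer_le_centralizer w)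
      (TorusComplex.Lam_le_centralizer w) (TorusComplex.groupDispl_eq_groupDispl ε w) hD hD'
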